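/- Let $G>0$, $\nu<\tfrac12$, $s\ge\tfrac12$ be real, let $W\in C^1(\mathbb R)$, and let $\Gamma=\{y=0\}\subset\mathbb R^2$. Write $\hat f(\xi,y)$ for the Fourier transform in $x$ (kernel $e^{-ix\xi}$), in the sense of tempered distributions, and $f^\pm(x)=f(x,0^\pm)$ for the boundary values on $\Gamma$ from $\pm y>0$, in the sense of distributions. Let $\dot\Lambda^{r}_\Gamma(\mathbb R^2)$, $r\geq 1$, be the set of vector fields $\mathbf u=(u_1,u_2)$ on $\mathbb R^2\setminus\Gamma$, with components and traces $u_i^\pm$ that are functions integrable against some negative power of $1+|\cdot|$, such that $(-\partial_{xx})^{\frac{r-m}2}\partial_y^m\mathbf u\in L^2(\mathbb R^2\setminus\Gamma)$ for all integers $0\le m\le r$, and $u_1^+=-u_1^-$, $u_2^+=u_2^-$ on $\Gamma$. Here, for $a>0$, $(-\partial_{xx})^{a/2}f\in L^2$ means that $|\xi|^a\hat f=\hat h$ on $\{\xi\ne0\}$ for some $h\in L^2$. Let $\varepsilon_{ij}=\frac12(\partial_ju_i+\partial_iu_j)$ and $\sigma_{ij}=2G\varepsilon_{ij}+\frac{2\nu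 G}{1-2\nu}(\varepsilon_{11}+\varepsilon_{22})\delta_{ij}$ for $i,j\in\{1,2\}$, with distributional derivatives in $\mathbb R^2\setminus\Gamma$. Suppose that $\mathbf u\in\dot\Lambda^{s+\frac12}_\Gamma(\mathbb R^2)$ satisfies the Euler–Lagrange system, in the sense of distributions, $$\Delta\mathbf u+\tfrac1{1-2\nu}\nabla(\nabla\cdot\mathbf u)=0\ \text{ in }\mathbb R^2\setminus\Gamma,\qquad \sigma_{12}^++\sigma_{12}^-=W'(u_1^+)\ \text{ and }\ \sigma_{22}^+=\sigma_{22}^-\ \text{ on }\Gamma .$$ (i) For almost every $y$, as distributions of $\xi$ on $\mathbb R\setminus\{0\}$, with the sign $\pm$ being that of $y$, $$\hat u_1^\pm(\xi,y)=\hat u_1^\pm(\xi,0^\pm)\Big(1-\frac{|\xi|}{2-2\nu}|y|\Big)e^{-|\xi y|},$$ $$\hat u_2^\pm(\xi,y)=-\frac{\hat u_1^+(\xi,0^+)}{2-2\nu}\Big((1-2\nu)\frac{i\xi}{|\xi|}+i\xi|y|\Big)e^{-|\xi y|}.$$ Suppose in addition that $u_1^+\in\dot H^1(\mathbb R)$,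 that is, $u_1^+$ has a weak derivative $u_1^{+\prime}\in L^2(\mathbb R)$, and that the stress decays at infinity in the weak sense that $\frac1R\iint\sigma_{ij}(x,y)\,\varphi(x/R)\,\eta(y)\,dx\,dy\to0$ as $R\to\infty$ for all $i,j$, $\varphi\in C_c^\infty(\mathbb R)$ and $\eta\in C_c^\infty(\mathbb R\setminus\{0\})$. Then: (ii) the boundary values $\sigma_{12}^\pm,\sigma_{22}^\pm$ are in $L^2(\mathbb R)$, and for almost every $x$ $$\sigma_{12}^+(x)=\sigma_{12}^-(x)=-\frac{G}{(1-\nu)\pi}\,\mathrm{P.V.}\!\int_{-\infty}^{\infty}\frac{u_1^{+\prime}(t)}{x-t}\,dt,\qquad \sigma_{22}^+(x)=\sigma_{22}^-(x)=0,$$ where the principal value exists for almost every $x$; (iii) the stress is a locally integrable function on $\mathbb R^2$ (on $\mathbb R^2\setminus\Gamma$ it is the distribution $\sigma$ above), and $\nabla\cdot\sigma=\mathbf 0$ in $\mathcal D'(\mathbb R^2)$. -/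

import Mathlib

open MeasureTheory Filter Topology Set
open scoped ContDiff SchwartzMap

noncomputable section

namespace PN

/-! Points of the plane are `p = (x, y) : ℝ × ℝ`; the slip plane `Γ` is the line `y = 0`.
A displacement field is `u : Fin 2 → ℝ × ℝ → ℝ`, where `u 0`, `u 1` are the components
`u₁`, `u₂` (their values on the null set `Γ` are irrelevant). -/

/-- A function which is integrable against some negative power of `1 + ‖p‖`; such a function is
locally integrable and defines a tempered distribution. -/
def TemperedFun {E : Type*} [NormedAddCommGroup E] [MeasureSpace E] (f : E → ℝ) : Prop :=
  ∃ N : ℕ, Integrable (fun p => f p / (1 + ‖p‖) ^ N) volume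

/-- `φ ∈ C_c^∞(Ω)`. -/
def IsTest {E : Type*} [NormedAddCommGroup E] [NormedSpace ℝ E] (Ω : Set E) (φ : E → ℝ) : Prop :=
  ContDiff ℝ ∞ φ ∧ HasCompactSupport φ ∧ tsupport φ ⊆ Ω

/-- The open set `ℝ² \ Γ`. -/
def offSlip : Set (ℝ × ℝ) := {p | p.2 ≠ 0}

/-- Coordinate directions: `0` is the `x`-direction, `1` is the `y`-direction. -/
def dir (j : Fin 2) : ℝ × ℝ := if j = 0 then (1, 0) else (0, 1)

/-- The partial derivative `∂_j Φ`. -/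
def pd (j : Fin 2) (Φ : ℝ × ℝ → ℝ) (p : ℝ × ℝ) : ℝ := fderiv ℝ Φ p (dir j)

/-- The Fourier transform `ψ̂(x) = ∫ e^{-i x ξ} ψ(ξ) dξ` (of a test function). The Fourier transform
of a tempered `g` is the distribution `⟨ĝ, ψ⟩ = ∫ g(x) ψ̂(x) dx`. -/
def ft (ψ : ℝ → ℂ) (x : ℝ) : ℂ :=
  ∫ ξ : ℝ, Complex.exp (-(Complex.I * (x : ℂ) * (ξ : ℂ))) * ψ ξ

/-- `(-∂_xx)^{a/2} ∂_y^m f ∈ L²(ℝ² \ Γ)`, for a real `a ≥ 0` and an integer `m ≥ 0`: there is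
`h ∈ L²` with `|ξ|^a ∂_y^m f̂(ξ, y) = ĥ(ξ, y)`, hats being partial Fourier transforms in `x`.
For `a > 0` the symbol `|ξ|^a` is not smooth at `ξ = 0` and, as usual for homogeneous spaces,
the identity is one of distributions on `ξ ≠ 0`. For `a = 0` it says `∂_y^m f = h`. -/
def MemHdot (a : ℝ) (m : ℕ) (f : ℝ × ℝ → ℝ) : Prop :=
  ∃ h : ℝ × ℝ → ℝ, MemLp h 2 volume ∧
    ∀ η : ℝ → ℝ, IsTest {y : ℝ | y ≠ 0} η →
    ∀ ψ : 𝓢(ℝ, ℂ), (0 < a → (0 : ℝ) ∉ tsupport ψ) →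
      ∫ p : ℝ × ℝ, (f p : ℂ) * (((-1) ^ m * iteratedDeriv m η p.2 : ℝ) : ℂ)
          * ft (fun ξ => ((|ξ| ^ a : ℝ) : ℂ) * ψ ξ) p.1
        = ∫ p : ℝ × ℝ, (h p : ℂ) * (η p.2 : ℂ) * ft ψ p.1

/-- Boundary values on `Γ` of a distribution `L` on `ℝ² \ Γ`, given by its pairing with test
functions: `L` has boundary value `T` from above (`κ = 1`) or from below (`κ = -1`) if
`L(φ(x) ε⁻¹ ρ(κ y / ε)) → T(φ) ∫ ρ` as `ε → 0⁺` for all `φ ∈ 𝓢(ℝ)` and `ρ ∈ C_c^∞((0, ∞))`,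
that is, if `L(·, κ ε y) → T` as `ε → 0⁺` in the sense of distributions. -/
def HasBoundaryValue (κ : ℝ) (L : (ℝ × ℝ → ℝ) → ℝ) (T : 𝓢(ℝ, ℝ) → ℝ) : Prop :=
  ∀ φ : 𝓢(ℝ, ℝ), ∀ ρ : ℝ → ℝ, IsTest (Ioi 0) ρ →
    Tendsto (fun ε : ℝ => L (fun p => φ p.1 * (ε⁻¹ * ρ (κ * p.2 / ε)))) (𝓝[>] 0)
      (𝓝 ((∫ y, ρ y) * T φ))

/-- The distribution on the plane given by a function. -/
def pair (f : ℝ × ℝ → ℝ) (Φ : ℝ × ℝ → ℝ) : ℝ := ∫ p, f p * Φ p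

/-- The distribution on the line given by a function. -/
def linePair (g : ℝ → ℝ) (φ : 𝓢(ℝ, ℝ)) : ℝ := ∫ x, g x * φ x

/-- The space `Λ̇^r_Γ(ℝ²)`: tempered functions `u` on `ℝ² \ Γ` such that
`(-∂_xx)^{(r-m)/2} ∂_y^m u ∈ L²(ℝ² \ Γ)` for the integers `0 ≤ m ≤ r`, with traces
`up i = u_i(·, 0⁺)` and `um i = u_i(·, 0⁻)` on `Γ` that satisfy
`u₁(·, 0⁺) = - u₁(·, 0⁻)` and `u₂(·, 0⁺) = u₂(·, 0⁻)`. -/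
structure MemLambda (r : ℝ) (u : Fin 2 → ℝ × ℝ → ℝ) (up um : Fin 2 → ℝ → ℝ) : Prop where
  tempered : ∀ i, TemperedFun (u i)
  hdot : ∀ i, ∀ m : ℕ, (m : ℝ) ≤ r → MemHdot (r - m) m (u i)
  tempered_upper : ∀ i, TemperedFun (up i)
  tempered_lower : ∀ i, TemperedFun (um i)
  trace_upper : ∀ i, HasBoundaryValue 1 (pair (u i)) (linePair (up i))
  trace_lower : ∀ i, HasBoundaryValue (-1) (pair (u i)) (linePair (um i))
  symm_fst : ∀ᵐ x, up 0 x = -um 0 x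
  symm_snd : ∀ᵐ x, up 1 x = um 1 x

/-- The strain `ε_ij = (∂_j u_i + ∂_i u_j) / 2` as a distribution on `ℝ² \ Γ`
(to be paired with test functions supported off `Γ`). -/
def strain (u : Fin 2 → ℝ × ℝ → ℝ) (i j : Fin 2) (Φ : ℝ × ℝ → ℝ) : ℝ :=
  -(1 / 2) * ∫ p, (u i p * pd j Φ p + u j p * pd i Φ p)

/-- The stress `σ_ij = 2G ε_ij + 2νG/(1-2ν) ε_kk δ_ij` as a distribution on `ℝ² \ Γ`. -/
def stress (G ν : ℝ) (u : Fin 2 → ℝ × ℝ → ℝ) (i j : Fin 2) (Φ : ℝ × ℝ → ℝ) : ℝ :=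
  2 * G * strain u i j Φ
    + 2 * ν * G / (1 - 2 * ν) * (if i = j then ∑ k, strain u k k Φ else 0)

/-- `Δu + (1-2ν)⁻¹ ∇(∇·u) = 0` in the sense of distributions in `ℝ² \ Γ`. -/
def SolvesLame (ν : ℝ) (u : Fin 2 → ℝ × ℝ → ℝ) : Prop :=
  ∀ Φ : Fin 2 → ℝ × ℝ → ℝ, (∀ i, IsTest offSlip (Φ i)) →
    ∫ p, ∑ i, u i p * ((∑ j, pd j (pd j (Φ i)) p)
      + 1 / (1 - 2 * ν) * pd i (fun q => ∑ j, pd j (Φ j) q) p) = 0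

/-- The Euler–Lagrange system: the Lamé system in `ℝ² \ Γ`, and, on `Γ`,
`σ₁₂⁺ + σ₁₂⁻ = W'(u₁⁺)` and `σ₂₂⁺ = σ₂₂⁻`. The argument `v` is the trace `u₁⁺`. -/
structure SolvesEulerLagrange (G ν : ℝ) (W : ℝ → ℝ) (u : Fin 2 → ℝ × ℝ → ℝ) (v : ℝ → ℝ) :
    Prop where
  lame : SolvesLame ν u
  shear : ∃ Tp Tm : 𝓢(ℝ, ℝ) → ℝ,
    HasBoundaryValue 1 (stress G ν u 0 1) Tp ∧ HasBoundaryValue (-1) (stress G ν u 0 1) Tm ∧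
    LocallyIntegrable (fun x => deriv W (v x)) volume ∧
    ∀ φ : 𝓢(ℝ, ℝ), HasCompactSupport φ → Tp φ + Tm φ = ∫ x, deriv W (v x) * φ x
  normal : ∃ Tp Tm : 𝓢(ℝ, ℝ) → ℝ,
    HasBoundaryValue 1 (stress G ν u 1 1) Tp ∧ HasBoundaryValue (-1) (stress G ν u 1 1) Tm ∧
    ∀ φ : 𝓢(ℝ, ℝ), Tp φ = Tm φ

/-- The multiplier `(1 - |ξ||y|/(2-2ν)) e^{-|ξy|}`. -/
def mult1 (ν y ξ : ℝ) : ℂ :=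
  (((1 - |ξ| / (2 - 2 * ν) * |y|) * Real.exp (-|ξ * y|) : ℝ) : ℂ)

/-- The multiplier `-(2-2ν)⁻¹ ((1-2ν) iξ/|ξ| + iξ|y|) e^{-|ξy|}`. -/
def mult2 (ν y ξ : ℝ) : ℂ :=
  -(1 / (2 - 2 * (ν : ℂ))) *
    ((1 - 2 * (ν : ℂ)) * (Complex.I * (ξ : ℂ) / ((|ξ| : ℝ) : ℂ))
      + Complex.I * (ξ : ℂ) * ((|y| : ℝ) : ℂ)) * ((Real.exp (-|ξ * y|) : ℝ) : ℂ)

/-- `v ∈ Ḣ¹(ℝ)`, with weak derivative `v' = dv ∈ L²(ℝ)`. -/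
def HasL2Deriv (v dv : ℝ → ℝ) : Prop :=
  MemLp dv 2 volume ∧
    ∀ φ : ℝ → ℝ, IsTest univ φ → ∫ x, v x * deriv φ x = -∫ x, dv x * φ x

/-- The stress decays at infinity in the (weak) sense that its averages over long horizontal
intervals tend to zero: `R⁻¹ ∬ σ_ij(x, y) φ(x/R) η(y) dx dy → 0` as `R → ∞`. -/
def StressDecays (G ν : ℝ) (u : Fin 2 → ℝ × ℝ → ℝ) : Prop :=
  ∀ i j : Fin 2, ∀ φ : ℝ → ℝ, IsTest univ φ → ∀ η : ℝ → ℝ, IsTest {y : ℝ | y ≠ 0} η →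
    Tendsto (fun R : ℝ => stress G ν u i j (fun p => R⁻¹ * φ (p.1 / R) * η p.2)) atTop (𝓝 0)

end PN

end

noncomputable section

namespace PN

/-! ### The Fourier transform on the line -/

lemma ft_eq_fourier (ψ : ℝ → ℂ) (x : ℝ) :
    ft ψ x = FourierTransform.fourier ψ (x / (2 * Real.pi)) := by
  rw [Real.fourier_real_eq_integral_exp_smul, ft]
  refine integral_congr_ae (Eventually.of_forall fun ξ => ?_)
  simp only [smul_eq_mul]
  congr 2
  have : (Real.pi : ℂ) ≠ 0 := by exact_mod_cast Real.pi_ne_zero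
  push_cast
  field_simp

lemma norm_cexp_neg_I_mul (x ξ : ℝ) :
    ‖Complex.exp (-(Complex.I * (x : ℂ) * (ξ : ℂ)))‖ = 1 := by
  rw [show -(Complex.I * (x : ℂ) * (ξ : ℂ)) = ((-(x * ξ) : ℝ) : ℂ) * Complex.I by
    push_cast; ring]
  exact Complex.norm_exp_ofReal_mul_I _

lemma norm_ft_le (ψ : ℝ → ℂ) (x : ℝ) : ‖ft ψ x‖ ≤ ∫ ξ, ‖ψ ξ‖ := by
  refine (norm_integral_le_integral_norm _).trans (le_of_eq ?_)
  refine integral_congr_ae (Eventually.of_forall fun ξ => ?_)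
  simp only [norm_mul, norm_cexp_neg_I_mul, one_mul]

lemma integrable_cexp_mul {ψ : ℝ → ℂ} (hψ : Integrable ψ) (x : ℝ) :
    Integrable fun ξ : ℝ => Complex.exp (-(Complex.I * (x : ℂ) * (ξ : ℂ))) * ψ ξ := by
  refine hψ.bdd_mul (c := 1) (by fun_prop) (Eventually.of_forall fun ξ => ?_)
  rw [norm_cexp_neg_I_mul]

lemma ft_add {f g : ℝ → ℂ} (hf : Integrable f) (hg : Integrable g) (x : ℝ) :
    ft (fun ξ => f ξ + g ξ) x = ft f x + ft g x := by
  simp only [ft, mul_add]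
  exact integral_add (integrable_cexp_mul hf x) (integrable_cexp_mul hg x)

lemma ft_sub {f g : ℝ → ℂ} (hf : Integrable f) (hg : Integrable g) (x : ℝ) :
    ft (fun ξ => f ξ - g ξ) x = ft f x - ft g x := by
  simp only [ft, mul_sub]
  exact integral_sub (integrable_cexp_mul hf x) (integrable_cexp_mul hg x)

lemma ft_const_mul (c : ℂ) (f : ℝ → ℂ) (x : ℝ) :
    ft (fun ξ => c * f ξ) x = c * ft f x := by
  simp only [ft]
  rw [← integral_const_mul]
  congr 1; ext ξ; ring

lemma ft_deriv {f : ℝ → ℂ} (hf : Integrable f) (hd : Differentiable ℝ f)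
    (hf' : Integrable (deriv f)) (x : ℝ) :
    ft (deriv f) x = Complex.I * x * ft f x := by
  rw [ft_eq_fourier, ft_eq_fourier, Real.fourier_deriv hf hd hf']
  have : (Real.pi : ℂ) ≠ 0 := by exact_mod_cast Real.pi_ne_zero
  simp only [smul_eq_mul]
  push_cast
  field_simp

lemma hasDerivAt_ft {f : ℝ → ℂ} (hf : Integrable f) (hf' : Integrable fun ξ : ℝ => (ξ : ℂ) * f ξ)
    (x : ℝ) : HasDerivAt (ft f) (ft (fun ξ => -(Complex.I * ξ) * f ξ) x) x := by
  have h1 := Real.hasDerivAt_fourier (f := f) hf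
    (by simpa only [Complex.real_smul] using hf') (x / (2 * Real.pi))
  have h2 : HasDerivAt (fun x : ℝ => x / (2 * Real.pi)) (1 / (2 * Real.pi)) x :=
    (hasDerivAt_id x).div_const _
  have h3 := h1.scomp x h2
  have hpi : (Real.pi : ℂ) ≠ 0 := by exact_mod_cast Real.pi_ne_zero
  have e : ft f = FourierTransform.fourier f ∘ fun x : ℝ => x / (2 * Real.pi) := by
    ext y; exact ft_eq_fourier f y
  rw [e]
  refine h3.congr_deriv ?_
  rw [← ft_eq_fourier, Complex.real_smul, ← ft_const_mul]
  congr 1; ext ξ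
  simp only [smul_eq_mul]
  push_cast
  field_simp

lemma continuous_ft {f : ℝ → ℂ} (hf : Integrable f) : Continuous (ft f) := by
  refine continuous_of_dominated (bound := fun ξ => ‖f ξ‖) (fun x => ?_) (fun x => ?_) hf.norm ?_
  · exact (integrable_cexp_mul hf x).1
  · refine Eventually.of_forall fun ξ => ?_
    rw [norm_mul, norm_cexp_neg_I_mul, one_mul]
  · exact Eventually.of_forall fun ξ => by fun_prop

lemma schwartz_integrable_mul (ψ : 𝓢(ℝ, ℂ)) : Integrable fun ξ : ℝ => (ξ : ℂ) * ψ ξ := by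
  have h := ψ.integrable_pow_mul volume 1
  refine (integrable_norm_iff ?_).1 (h.congr (Eventually.of_forall fun ξ => by simp))
  exact (by fun_prop : Continuous fun ξ : ℝ => (ξ : ℂ) * ψ ξ).aestronglyMeasurable

/-- Scaling of the line, as a continuous linear equivalence. -/
def scaleEquiv (a : ℝ) (ha : a ≠ 0) : ℝ ≃L[ℝ] ℝ :=
  ContinuousLinearEquiv.smulLeft (Units.mk0 a ha)

lemma scaleEquiv_apply (a : ℝ) (ha : a ≠ 0) (x : ℝ) : scaleEquiv a ha x = a * x := rfl

lemma exists_schwartz_ft (ψ : 𝓢(ℝ, ℂ)) : ∃ φ : 𝓢(ℝ, ℂ), ∀ x, φ x = ft ψ x := by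
  have ha : (1 / (2 * Real.pi)) ≠ 0 := by positivity
  refine ⟨SchwartzMap.compCLMOfContinuousLinearEquiv ℂ (scaleEquiv _ ha)
    (FourierTransform.fourier ψ), fun x => ?_⟩
  rw [ft_eq_fourier, ← SchwartzMap.fourier_coe]
  simp only [SchwartzMap.compCLMOfContinuousLinearEquiv_apply, Function.comp_apply]
  congr 1
  rw [scaleEquiv_apply]
  ring

lemma exists_ft_eq (φ : 𝓢(ℝ, ℂ)) : ∃ ψ : 𝓢(ℝ, ℂ), ∀ x, ft ψ x = φ x := by
  have ha : (2 * Real.pi) ≠ 0 := by positivity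
  refine ⟨FourierTransform.fourierInv
    (SchwartzMap.compCLMOfContinuousLinearEquiv ℂ (scaleEquiv _ ha) φ), fun x => ?_⟩
  rw [ft_eq_fourier, ← SchwartzMap.fourier_coe, FourierTransform.fourier_fourierInv_eq]
  simp only [SchwartzMap.compCLMOfContinuousLinearEquiv_apply, Function.comp_apply]
  congr 1
  rw [scaleEquiv_apply]
  field_simp

lemma ft_inversion (ψ : 𝓢(ℝ, ℂ)) (ξ : ℝ) :
    ∫ x : ℝ, Complex.exp (Complex.I * x * ξ) * ft ψ x = 2 * Real.pi * ψ ξ := by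
  have h : FourierTransform.fourierInv (FourierTransform.fourier ψ) ξ = ψ ξ := by
    rw [FourierTransform.fourierInv_fourier_eq]
  rw [SchwartzMap.fourierInv_coe, SchwartzMap.fourier_coe, Real.fourierInv_eq'] at h
  rw [← h]
  have hs := Measure.integral_comp_div
    (fun v : ℝ => Complex.exp (((2 * Real.pi * (v * ξ) : ℝ) : ℂ) * Complex.I) *
      FourierTransform.fourier (⇑ψ) v) (2 * Real.pi)
  rw [abs_of_pos (by positivity), Complex.real_smul] at hs
  push_cast at hs
  simp only [RCLike.inner_apply, conj_trivial, smul_eq_mul]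
  convert hs using 1
  · refine integral_congr_ae (Eventually.of_forall fun x => ?_)
    simp only [ft_eq_fourier]
    congr 2
    have hpi : (Real.pi : ℂ) ≠ 0 := by exact_mod_cast Real.pi_ne_zero
    field_simp
  · congr 1
    refine integral_congr_ae (Eventually.of_forall fun x => ?_)
    simp only
    congr 2
    push_cast
    ring


/-! ### Complex test functions -/

/-- Complex-valued `C_c^∞(Ω)`. -/
def IsTestC {E : Type*} [NormedAddCommGroup E] [NormedSpace ℝ E] (Ω : Set E) (g : E → ℂ) : Prop :=
  ContDiff ℝ ∞ g ∧ HasCompactSupport g ∧ tsupport g ⊆ Ω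

section IsTestC

variable {E : Type*} [NormedAddCommGroup E] [NormedSpace ℝ E] {Ω Ω' : Set E} {f g : E → ℂ}

lemma IsTestC.mono (hg : IsTestC Ω g) (h : Ω ⊆ Ω') : IsTestC Ω' g :=
  ⟨hg.1, hg.2.1, hg.2.2.trans h⟩

lemma IsTestC.toUniv (hg : IsTestC Ω g) : IsTestC univ g := hg.mono (subset_univ _)

lemma IsTestC.continuous (hg : IsTestC Ω g) : Continuous g := hg.1.continuous

lemma IsTestC.eq_zero (hg : IsTestC Ω g) {p : E} (hp : p ∉ Ω) : g p = 0 :=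
  image_eq_zero_of_notMem_tsupport fun h => hp (hg.2.2 h)

lemma IsTestC.integrable [MeasurableSpace E] [OpensMeasurableSpace E] {μ : Measure E}
    [IsFiniteMeasureOnCompacts μ] (hg : IsTestC Ω g) : Integrable g μ :=
  hg.continuous.integrable_of_hasCompactSupport hg.2.1

lemma IsTestC.add (hf : IsTestC Ω f) (hg : IsTestC Ω g) : IsTestC Ω fun p => f p + g p :=
  ⟨hf.1.add hg.1, hf.2.1.add hg.2.1,
    (tsupport_add f g).trans (union_subset hf.2.2 hg.2.2)⟩

lemma IsTestC.const_mul (c : ℂ) (hg : IsTestC Ω g) : IsTestC Ω fun p => c * g p :=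
  ⟨contDiff_const.mul hg.1, hg.2.1.mul_left,
    (closure_mono (Function.support_mul_subset_right _ _)).trans hg.2.2⟩

lemma IsTestC.neg (hg : IsTestC Ω g) : IsTestC Ω fun p => -g p := by
  simpa using hg.const_mul (-1)

lemma IsTestC.sub (hf : IsTestC Ω f) (hg : IsTestC Ω g) : IsTestC Ω fun p => f p - g p := by
  simpa [sub_eq_add_neg] using hf.add hg.neg

lemma IsTestC.mul_left (hg : IsTestC Ω g) (hΩ : IsOpen Ω) {h : E → ℂ}
    (hh : ContDiffOn ℝ ∞ h Ω) : IsTestC Ω fun p => h p * g p := by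
  refine ⟨contDiff_iff_contDiffAt.2 fun p => ?_, hg.2.1.mul_left,
    (closure_mono (Function.support_mul_subset_right _ _)).trans hg.2.2⟩
  by_cases hp : p ∈ tsupport g
  · exact (hh.contDiffAt (hΩ.mem_nhds (hg.2.2 hp))).mul hg.1.contDiffAt
  · have h0 : (fun q => h q * g q) =ᶠ[𝓝 p] fun _ => 0 := by
      filter_upwards [(isClosed_tsupport g).isOpen_compl.mem_nhds hp] with q hq
      rw [image_eq_zero_of_notMem_tsupport hq, mul_zero]
    exact contDiffAt_const.congr_of_eventuallyEq h0

lemma IsTestC.mul_left' (hg : IsTestC Ω g) {h : E → ℂ} (hh : ContDiff ℝ ∞ h) :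
    IsTestC Ω fun p => h p * g p :=
  ⟨hh.mul hg.1, hg.2.1.mul_left,
    (closure_mono (Function.support_mul_subset_right _ _)).trans hg.2.2⟩

lemma IsTestC.fderiv_apply (hg : IsTestC Ω g) (v : E) : IsTestC Ω fun p => fderiv ℝ g p v := by
  refine ⟨?_, hg.2.1.fderiv_apply ℝ v, ?_⟩
  · exact (hg.1.fderiv_right (m := ∞) (by simp)).clm_apply contDiff_const
  · refine (closure_mono ?_).trans ((tsupport_fderiv_subset ℝ).trans hg.2.2)
    intro p hp h0
    exact hp (by simp [h0])

lemma IsTestC.exists_bound (hg : IsTestC Ω g) : ∃ C : ℝ, ∀ p, ‖g p‖ ≤ C :=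
  hg.2.1.exists_bound_of_continuous hg.continuous

lemma IsTestC.prodMul {E' : Type*} [NormedAddCommGroup E'] [NormedSpace ℝ E'] {Ω₂ : Set E'}
    {η : E' → ℂ} (hg : IsTestC Ω g) (hη : IsTestC Ω₂ η) :
    IsTestC (Ω ×ˢ Ω₂) fun p : E × E' => g p.1 * η p.2 := by
  have hs : tsupport (fun p : E × E' => g p.1 * η p.2) ⊆ tsupport g ×ˢ tsupport η := by
    refine closure_minimal ?_ ((isClosed_tsupport _).prod (isClosed_tsupport _))
    intro p hp
    rw [Function.mem_support] at hp
    exact ⟨subset_tsupport _ (left_ne_zero_of_mul hp), subset_tsupport _ (right_ne_zero_of_mul hp)⟩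
  refine ⟨(hg.1.comp contDiff_fst).mul (hη.1.comp contDiff_snd), ?_,
    hs.trans (prod_mono hg.2.2 hη.2.2)⟩
  exact (hg.2.1.isCompact.prod hη.2.1.isCompact).of_isClosed_subset (isClosed_tsupport _) hs

lemma IsTestC.comp_slice {E' : Type*} [NormedAddCommGroup E'] [NormedSpace ℝ E']
    {Ω₂ : Set (E × E')} {G : E × E' → ℂ} (hG : IsTestC Ω₂ G) (e : E') :
    IsTestC {x | (x, e) ∈ Ω₂} fun x => G (x, e) := by
  have hs : tsupport (fun x => G (x, e)) ⊆ (fun x => (x, e)) ⁻¹' tsupport G :=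
    closure_minimal (fun x hx => subset_tsupport G hx)
      ((isClosed_tsupport G).preimage (by fun_prop))
  refine ⟨hG.1.comp (contDiff_id.prodMk contDiff_const), ?_, hs.trans fun x hx => hG.2.2 hx⟩
  refine HasCompactSupport.intro (hG.2.1.isCompact.image continuous_fst) fun x hx => ?_
  by_contra h0
  exact hx ⟨(x, e), subset_tsupport G h0, rfl⟩

lemma IsTest.ofReal {φ : E → ℝ} (hφ : IsTest Ω φ) : IsTestC Ω fun p => (φ p : ℂ) := by
  have hs : Function.support (fun p => (φ p : ℂ)) = Function.support φ := by
    ext p; simp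
  refine ⟨Complex.ofRealCLM.contDiff.comp hφ.1, ?_, ?_⟩
  · rw [HasCompactSupport, tsupport, hs]; exact hφ.2.1
  · rw [tsupport, hs]; exact hφ.2.2

lemma IsTestC.re (hg : IsTestC Ω g) : IsTest Ω fun p => (g p).re := by
  have hs : Function.support (fun p => (g p).re) ⊆ Function.support g := by
    intro p hp h0; exact hp (by simp [h0])
  exact ⟨Complex.reCLM.contDiff.comp hg.1, hg.2.1.mono hs, (closure_mono hs).trans hg.2.2⟩

lemma IsTestC.im (hg : IsTestC Ω g) : IsTest Ω fun p => (g p).im := by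
  have hs : Function.support (fun p => (g p).im) ⊆ Function.support g := by
    intro p hp h0; exact hp (by simp [h0])
  exact ⟨Complex.imCLM.contDiff.comp hg.1, hg.2.1.mono hs, (closure_mono hs).trans hg.2.2⟩

end IsTestC

lemma IsTestC.deriv {Ω : Set ℝ} {g : ℝ → ℂ} (hg : IsTestC Ω g) : IsTestC Ω (deriv g) := by
  simpa only [fderiv_apply_one_eq_deriv] using hg.fderiv_apply 1

/-! ### Integrals depending on a parameter -/

lemma contDiffOn_integral_param {P : Type*} [NormedAddCommGroup P] [NormedSpace ℝ P] {s : Set P}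
    (hs : IsOpen s) {k : Set ℝ} (hk : IsCompact k) {g : P → ℝ → ℂ}
    (hgs : ∀ p, ∀ x, p ∈ s → x ∉ k → g p x = 0)
    (hg : ContDiffOn ℝ ∞ (fun q : P × ℝ => g q.1 q.2) (s ×ˢ univ)) :
    ContDiffOn ℝ ∞ (fun p => ∫ t, g p t) s := by
  have h := contDiffOn_convolution_right_with_param (𝕜 := ℝ) (μ := (volume : Measure ℝ))
    (f := fun _ : ℝ => (1 : ℝ)) (n := ⊤)
    (ContinuousLinearMap.lsmul ℝ ℝ) hs hk hgs (locallyIntegrable_const 1) hg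
  have h2 := h.comp (f := fun p : P => (p, (0 : ℝ))) (s := s)
    (contDiff_id.prodMk contDiff_const).contDiffOn fun p hp => ⟨hp, mem_univ _⟩
  refine h2.congr fun p _ => ?_
  simp only [Function.comp_apply, convolution, ContinuousLinearMap.lsmul_apply, one_smul, zero_sub]
  exact (integral_neg_eq_self _ volume).symm

lemma contDiff_antideriv {g : ℝ × ℝ → ℂ} {Ω : Set (ℝ × ℝ)} (hg : IsTestC Ω g) :
    ContDiff ℝ ∞ fun p : ℝ × ℝ => ∫ t in Iic p.2, g (p.1, t) := by
  have hk : IsCompact (Prod.snd '' tsupport g) := hg.2.1.isCompact.image continuous_snd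
  have h := contDiffOn_convolution_right_with_param (𝕜 := ℝ) (μ := (volume : Measure ℝ))
    (f := indicator (Ici 0) fun _ : ℝ => (1 : ℝ)) (n := ⊤) (s := univ)
    (g := fun ξ t => g (ξ, t))
    (ContinuousLinearMap.lsmul ℝ ℝ) isOpen_univ hk
    (fun ξ t _ ht => image_eq_zero_of_notMem_tsupport fun h => ht ⟨_, h, rfl⟩)
    ((locallyIntegrable_const 1).indicator measurableSet_Ici) hg.1.contDiffOn
  rw [univ_prod_univ, contDiffOn_univ] at h
  convert h using 1
  ext p
  simp only [convolution, ContinuousLinearMap.lsmul_apply]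
  rw [← integral_indicator measurableSet_Iic,
    ← integral_sub_left_eq_self (fun t => (Iic p.2).indicator (fun t => g (p.1, t)) t) volume p.2]
  refine integral_congr_ae (Eventually.of_forall fun t => ?_)
  simp only [indicator, mem_Ici, mem_Iic, sub_le_self_iff]
  split_ifs <;> simp

/-! ### Partial Fourier transforms of test functions -/

/-- Fourier transform in the first variable. -/
def pft {E : Type*} (g : ℝ × E → ℂ) (p : ℝ × E) : ℂ := ft (fun ξ => g (ξ, p.2)) p.1

section pft

variable {E : Type*} [NormedAddCommGroup E] [NormedSpace ℝ E] {Ω : Set (ℝ × E)} {g : ℝ × E → ℂ}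

lemma IsTestC.slice_integrable (hg : IsTestC Ω g) (e : E) : Integrable fun ξ => g (ξ, e) :=
  (hg.comp_slice e).integrable

lemma contDiff_pft (hg : IsTestC Ω g) : ContDiff ℝ ∞ (pft g) := by
  have hk : IsCompact (Prod.fst '' tsupport g) := hg.2.1.isCompact.image continuous_fst
  have := contDiffOn_integral_param (P := ℝ × E) (s := univ) isOpen_univ hk
    (g := fun p ξ => Complex.exp (-(Complex.I * (p.1 : ℂ) * (ξ : ℂ))) * g (ξ, p.2))
    (fun p ξ _ hξ => by
      rw [image_eq_zero_of_notMem_tsupport (f := g) fun h => hξ ⟨_, h, rfl⟩, mul_zero])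
    (by
      apply ContDiff.contDiffOn
      have h1 : ContDiff ℝ ∞ fun q : (ℝ × E) × ℝ => (q.1.1 : ℂ) :=
        Complex.ofRealCLM.contDiff.comp (contDiff_fst.comp contDiff_fst)
      have h2 : ContDiff ℝ ∞ fun q : (ℝ × E) × ℝ => (q.2 : ℂ) :=
        Complex.ofRealCLM.contDiff.comp contDiff_snd
      have h3 : ContDiff ℝ ∞ fun q : (ℝ × E) × ℝ => g (q.2, q.1.2) :=
        hg.1.comp (contDiff_snd.prodMk (contDiff_snd.comp contDiff_fst))
      exact (((contDiff_const.mul h1).mul h2).neg.cexp).mul h3)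
  rwa [contDiffOn_univ] at this

lemma pft_eq_zero {g : ℝ × E → ℂ} {p : ℝ × E} (hp : p.2 ∉ Prod.snd '' tsupport g) :
    pft g p = 0 := by
  have : (fun ξ => g (ξ, p.2)) = fun _ => 0 := by
    ext ξ
    exact image_eq_zero_of_notMem_tsupport fun h => hp ⟨_, h, rfl⟩
  rw [pft, this]
  simp [ft]

lemma pft_dxi (hg : IsTestC Ω g) (p : ℝ × E) :
    pft (fun q => fderiv ℝ g q (1, 0)) p = Complex.I * p.1 * pft g p := by
  have hs := hg.comp_slice p.2
  have hd : deriv (fun ξ => g (ξ, p.2)) = fun ξ => fderiv ℝ g (ξ, p.2) (1, 0) := by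
    ext ξ
    have h1 : HasFDerivAt g (fderiv ℝ g (ξ, p.2)) (ξ, p.2) :=
      (hg.1.differentiable (by simp) _).hasFDerivAt
    have h2 : HasDerivAt (fun ξ : ℝ => (ξ, p.2)) ((1 : ℝ), (0 : E)) ξ :=
      (hasDerivAt_id ξ).prodMk (hasDerivAt_const ξ p.2)
    exact (h1.comp_hasDerivAt ξ h2).deriv
  rw [pft, pft, ← ft_deriv hs.integrable (hs.1.differentiable (by simp)) hs.deriv.integrable, hd]

lemma pft_pow_decay (N : ℕ) (hg : IsTestC Ω g) :
    ∃ C : ℝ, ∀ p, |p.1| ^ N * ‖pft g p‖ ≤ C := by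
  induction N generalizing g with
  | zero =>
    obtain ⟨B, hB⟩ := hg.exists_bound
    have hk : IsCompact (Prod.fst '' tsupport g) := hg.2.1.isCompact.image continuous_fst
    refine ⟨∫ ξ, (Prod.fst '' tsupport g).indicator (fun _ => B) ξ, fun p => ?_⟩
    rw [pow_zero, one_mul]
    refine (norm_ft_le _ _).trans (integral_mono (hg.slice_integrable p.2).norm ?_ fun ξ => ?_)
    · exact (integrable_indicator_iff hk.measurableSet).2
        (integrableOn_const hk.measure_lt_top.ne)
    · by_cases hξ : ξ ∈ Prod.fst '' tsupport g
      · simp only [indicator_of_mem hξ]; exact hB _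
      · simp only [indicator_of_notMem hξ]
        rw [image_eq_zero_of_notMem_tsupport (f := g) fun h => hξ ⟨_, h, rfl⟩, norm_zero]
  | succ N ih =>
    obtain ⟨C, hC⟩ := ih (hg.fderiv_apply (1, 0))
    refine ⟨C, fun p => le_trans (le_of_eq ?_) (hC p)⟩
    rw [pft_dxi hg, norm_mul, norm_mul, Complex.norm_I, one_mul, Complex.norm_real,
      Real.norm_eq_abs]
    ring

lemma one_add_pow_le (N : ℕ) {a : ℝ} (ha : 0 ≤ a) : (1 + a) ^ N ≤ 2 ^ N * (1 + a ^ N) := by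
  rcases le_total a 1 with h | h
  · calc (1 + a) ^ N ≤ 2 ^ N := by gcongr; linarith
      _ ≤ 2 ^ N * (1 + a ^ N) := le_mul_of_one_le_right (by positivity) (by simp; positivity)
  · calc (1 + a) ^ N ≤ (2 * a) ^ N := by gcongr; linarith
      _ = 2 ^ N * a ^ N := mul_pow _ _ _
      _ ≤ 2 ^ N * (1 + a ^ N) := by gcongr; linarith

lemma pft_decay (N : ℕ) (hg : IsTestC Ω g) :
    ∃ C : ℝ, 0 ≤ C ∧ ∀ p, (1 + |p.1|) ^ N * ‖pft g p‖ ≤ C := by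
  obtain ⟨C0, hC0⟩ := pft_pow_decay 0 hg
  obtain ⟨C1, hC1⟩ := pft_pow_decay N hg
  refine ⟨2 ^ N * (C0 + C1), ?_, fun p => ?_⟩
  · have h0 := (by positivity : (0 : ℝ) ≤ |(0 : ℝ)| ^ 0 * ‖pft g (0, 0)‖).trans (hC0 (0, 0))
    have h1 := (by positivity : (0 : ℝ) ≤ |(0 : ℝ)| ^ N * ‖pft g (0, 0)‖).trans (hC1 (0, 0))
    positivity
  · calc (1 + |p.1|) ^ N * ‖pft g p‖ ≤ 2 ^ N * (1 + |p.1| ^ N) * ‖pft g p‖ := by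
          gcongr; exact one_add_pow_le N (abs_nonneg _)
      _ = 2 ^ N * (|p.1| ^ 0 * ‖pft g p‖ + |p.1| ^ N * ‖pft g p‖) := by ring
      _ ≤ _ := by gcongr; exacts [hC0 p, hC1 p]

lemma pft_add {f : ℝ × E → ℂ} (hf : IsTestC Ω f) (hg : IsTestC Ω g) (p : ℝ × E) :
    pft (fun q => f q + g q) p = pft f p + pft g p :=
  ft_add (hf.slice_integrable _) (hg.slice_integrable _) _

end pft

lemma pft_const_mul {E : Type*} (c : ℂ) (g : ℝ × E → ℂ) (p : ℝ × E) :
    pft (fun q => c * g q) p = c * pft g p :=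
  ft_const_mul _ _ _

section pftPlane

variable {Ω : Set (ℝ × ℝ)} {g : ℝ × ℝ → ℂ}

lemma IsTestC.mul_xi {E : Type*} [NormedAddCommGroup E] [NormedSpace ℝ E] {Ω : Set (ℝ × E)}
    {g : ℝ × E → ℂ} (hg : IsTestC Ω g) : IsTestC Ω fun q => (q.1 : ℂ) * g q :=
  hg.mul_left' (Complex.ofRealCLM.contDiff.comp contDiff_fst)

lemma hasDerivAt_pft_fst (hg : IsTestC Ω g) (p : ℝ × ℝ) :
    HasDerivAt (fun x => pft g (x, p.2)) (pft (fun q => -(Complex.I * q.1) * g q) p) p.1 :=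
  hasDerivAt_ft (hg.slice_integrable p.2) (hg.mul_xi.slice_integrable p.2) p.1

lemma hasDerivAt_pft_snd (hg : IsTestC Ω g) (p : ℝ × ℝ) :
    HasDerivAt (fun y => pft g (p.1, y)) (pft (fun q => fderiv ℝ g q (0, 1)) p) p.2 := by
  have hd := hg.fderiv_apply (0, 1)
  obtain ⟨B, hB⟩ := hd.exists_bound
  have hk : IsCompact (Prod.fst '' tsupport g) := hg.2.1.isCompact.image continuous_fst
  refine (hasDerivAt_integral_of_dominated_loc_of_deriv_le (μ := volume) (s := univ)
    (F := fun y ξ => Complex.exp (-(Complex.I * (p.1 : ℂ) * (ξ : ℂ))) * g (ξ, y))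
    (F' := fun y ξ => Complex.exp (-(Complex.I * (p.1 : ℂ) * (ξ : ℂ))) *
      fderiv ℝ g (ξ, y) (0, 1))
    (bound := (Prod.fst '' tsupport g).indicator fun _ => B) univ_mem
    (Eventually.of_forall fun y => (integrable_cexp_mul (hg.slice_integrable y) _).1)
    (integrable_cexp_mul (hg.slice_integrable p.2) _)
    (integrable_cexp_mul (hd.slice_integrable p.2) _).1 ?_ ?_ ?_).2
  · refine Eventually.of_forall fun ξ y _ => ?_
    rw [norm_mul, norm_cexp_neg_I_mul, one_mul]
    by_cases hξ : ξ ∈ Prod.fst '' tsupport g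
    · simp only [indicator_of_mem hξ]; exact hB (ξ, y)
    · simp only [indicator_of_notMem hξ]
      have : fderiv ℝ g (ξ, y) = 0 := image_eq_zero_of_notMem_tsupport (f := fderiv ℝ g)
        fun h => hξ ⟨_, tsupport_fderiv_subset ℝ h, rfl⟩
      simp [this]
  · exact (integrable_indicator_iff hk.measurableSet).2 (integrableOn_const hk.measure_lt_top.ne)
  · refine Eventually.of_forall fun ξ y _ => ?_
    have h1 : HasFDerivAt g (fderiv ℝ g (ξ, y)) (ξ, y) :=
      (hg.1.differentiable (by simp) _).hasFDerivAt
    have h2 : HasDerivAt (fun y : ℝ => (ξ, y)) ((0 : ℝ), (1 : ℝ)) y :=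
      (hasDerivAt_const y ξ).prodMk (hasDerivAt_id y)
    exact (h1.comp_hasDerivAt y h2).const_mul _

lemma fderiv_pft_fst (hg : IsTestC Ω g) (p : ℝ × ℝ) :
    fderiv ℝ (pft g) p (1, 0) = pft (fun q => -(Complex.I * q.1) * g q) p := by
  have h1 : HasFDerivAt (pft g) (fderiv ℝ (pft g) p) (p.1, p.2) :=
    ((contDiff_pft hg).differentiable (by simp) _).hasFDerivAt
  have h2 : HasDerivAt (fun x : ℝ => (x, p.2)) ((1 : ℝ), (0 : ℝ)) p.1 :=
    (hasDerivAt_id _).prodMk (hasDerivAt_const _ _)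
  have h3 := h1.comp_hasDerivAt p.1 h2
  exact h3.unique (hasDerivAt_pft_fst hg p)

lemma fderiv_pft_snd (hg : IsTestC Ω g) (p : ℝ × ℝ) :
    fderiv ℝ (pft g) p (0, 1) = pft (fun q => fderiv ℝ g q (0, 1)) p := by
  have h1 : HasFDerivAt (pft g) (fderiv ℝ (pft g) p) (p.1, p.2) :=
    ((contDiff_pft hg).differentiable (by simp) _).hasFDerivAt
  have h2 : HasDerivAt (fun y : ℝ => (p.1, y)) ((0 : ℝ), (1 : ℝ)) p.2 :=
    (hasDerivAt_const _ _).prodMk (hasDerivAt_id _)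
  have h3 := h1.comp_hasDerivAt p.2 h2
  exact h3.unique (hasDerivAt_pft_snd hg p)

end pftPlane

/-- `f` is integrable with integral `v`. -/
def HasInt {α : Type*} [MeasurableSpace α] (μ : Measure α) (f : α → ℂ) (v : ℂ) : Prop :=
  Integrable f μ ∧ ∫ a, f a ∂μ = v

lemma HasInt.add {α : Type*} [MeasurableSpace α] {μ : Measure α} {f g : α → ℂ} {v w : ℂ}
    (hf : HasInt μ f v) (hg : HasInt μ g w) : HasInt μ (fun a => f a + g a) (v + w) :=
  ⟨hf.1.add hg.1, by rw [integral_add hf.1 hg.1, hf.2, hg.2]⟩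

lemma HasInt.const_mul {α : Type*} [MeasurableSpace α] {μ : Measure α} {f : α → ℂ} {v : ℂ}
    (hf : HasInt μ f v) (c : ℂ) : HasInt μ (fun a => c * f a) (c * v) :=
  ⟨hf.1.const_mul c, by rw [integral_const_mul, hf.2]⟩

/-! ### Pairing tempered functions with rapidly decreasing functions -/

/-- Decay faster than every power. -/
def Rapid {E F : Type*} [NormedAddCommGroup E] [NormedAddCommGroup F] (h : E → F) : Prop :=
  ∀ N : ℕ, ∃ C : ℝ, ∀ p, (1 + ‖p‖) ^ N * ‖h p‖ ≤ C

section Rapid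

variable {E F : Type*} [NormedAddCommGroup E] [NormedAddCommGroup F]

lemma Rapid.bdd_mul {f g : E → ℂ} (hg : Rapid g) {M : ℝ} (hf : ∀ p, ‖f p‖ ≤ M) :
    Rapid fun p => f p * g p := by
  intro N
  obtain ⟨B, hB⟩ := hg N
  refine ⟨M * B, fun p => ?_⟩
  calc (1 + ‖p‖) ^ N * ‖f p * g p‖ = ‖f p‖ * ((1 + ‖p‖) ^ N * ‖g p‖) := by rw [norm_mul]; ring
    _ ≤ M * B := mul_le_mul (hf p) (hB p) (by positivity) ((norm_nonneg _).trans (hf p))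

lemma TemperedFun.tendsto_integral [MeasureSpace E] [OpensMeasurableSpace E]
    {ι : Type*} {l : Filter ι} [l.IsCountablyGenerated] {f : E → ℝ} (hf : TemperedFun f)
    {h : ι → E → ℂ} {h₀ : E → ℂ} (hm : ∀ᶠ i in l, AEStronglyMeasurable (h i) volume)
    (hb : ∀ N : ℕ, ∃ C : ℝ, ∀ᶠ i in l, ∀ p, (1 + ‖p‖) ^ N * ‖h i p‖ ≤ C)
    (hl : ∀ p, Tendsto (fun i => h i p) l (𝓝 (h₀ p))) :
    Tendsto (fun i => ∫ p, (f p : ℂ) * h i p) l (𝓝 (∫ p, (f p : ℂ) * h₀ p)) := by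
  obtain ⟨N, hN⟩ := hf
  obtain ⟨C, hC⟩ := hb N
  have hpos : ∀ p : E, 0 < (1 + ‖p‖) ^ N := fun p => by positivity
  have hfm : AEStronglyMeasurable f volume := by
    have h1 := hN.1.mul (by fun_prop : Continuous fun p : E =>
      (1 + ‖p‖) ^ N).measurable.aestronglyMeasurable
    refine h1.congr (Eventually.of_forall fun p => ?_)
    have := (hpos p).ne'
    simp only [Pi.mul_apply]
    field_simp
  refine tendsto_integral_filter_of_dominated_convergence
    (fun p => ‖f p / (1 + ‖p‖) ^ N‖ * C) ?_ ?_ (hN.norm.mul_const C) ?_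
  · filter_upwards [hm] with i hi
    exact (Complex.continuous_ofReal.comp_aestronglyMeasurable hfm).mul hi
  · filter_upwards [hC] with i hi
    refine Eventually.of_forall fun p => ?_
    rw [norm_mul, Complex.norm_real, norm_div, Real.norm_of_nonneg (hpos p).le,
      div_mul_eq_mul_div, le_div_iff₀ (hpos p)]
    calc ‖f p‖ * ‖h i p‖ * (1 + ‖p‖) ^ N = ‖f p‖ * ((1 + ‖p‖) ^ N * ‖h i p‖) := by ring
      _ ≤ ‖f p‖ * C := by gcongr; exact hi p
  · exact Eventually.of_forall fun p => (hl p).const_mul _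

lemma TemperedFun.integrable_mul [MeasureSpace E] [OpensMeasurableSpace E]
    {f : E → ℝ} (hf : TemperedFun f)
    {h : E → ℂ} (hm : AEStronglyMeasurable h volume) (hr : Rapid h) :
    Integrable (fun p => (f p : ℂ) * h p) volume := by
  obtain ⟨N, hN⟩ := hf
  obtain ⟨C, hC⟩ := hr N
  have h1 := hN.ofReal (𝕜 := ℂ)
  have h2 := h1.mul_bdd (c := C) (g := fun p => (((1 + ‖p‖) ^ N : ℝ) : ℂ) * h p)
    ((by fun_prop : Continuous fun p : E =>
      (((1 + ‖p‖) ^ N : ℝ) : ℂ)).measurable.aestronglyMeasurable.mul hm)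
    (Eventually.of_forall fun p => by
      rw [norm_mul, Complex.norm_real, Real.norm_of_nonneg (by positivity)]; exact hC p)
  refine h2.congr (Eventually.of_forall fun p => ?_)
  have : (((1 + ‖p‖) ^ N : ℝ) : ℂ) ≠ 0 := by
    have : (0 : ℝ) < (1 + ‖p‖) ^ N := by positivity
    exact_mod_cast this.ne'
  simp only [Complex.coe_algebraMap, Complex.ofReal_div]
  field_simp

end Rapid

lemma SchwartzMap_rapid {E F : Type*} [NormedAddCommGroup E] [NormedSpace ℝ E]
    [NormedAddCommGroup F] [NormedSpace ℝ F] (φ : 𝓢(E, F)) : Rapid φ := by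
  intro N
  obtain ⟨C0, -, hC0⟩ := φ.decay 0 0
  obtain ⟨C1, -, hC1⟩ := φ.decay N 0
  simp only [norm_iteratedFDeriv_zero] at hC0 hC1
  refine ⟨2 ^ N * (C0 + C1), fun p => ?_⟩
  calc (1 + ‖p‖) ^ N * ‖φ p‖ ≤ 2 ^ N * (1 + ‖p‖ ^ N) * ‖φ p‖ := by
        gcongr; exact one_add_pow_le N (norm_nonneg _)
    _ = 2 ^ N * (‖p‖ ^ 0 * ‖φ p‖ + ‖p‖ ^ N * ‖φ p‖) := by ring
    _ ≤ _ := by gcongr; exacts [hC0 p, hC1 p]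

section RapidPft

variable {Ω : Set (ℝ × ℝ)} {g : ℝ × ℝ → ℂ}

lemma prod_norm_le (p : ℝ × ℝ) : 1 + ‖p‖ ≤ (1 + |p.1|) * (1 + |p.2|) := by
  rw [Prod.norm_def, Real.norm_eq_abs, Real.norm_eq_abs]
  rcases max_cases |p.1| |p.2| with h | h <;> rw [h.1] <;>
    nlinarith [abs_nonneg p.1, abs_nonneg p.2, mul_nonneg (abs_nonneg p.1) (abs_nonneg p.2)]

lemma rapid_pft (hg : IsTestC Ω g) : Rapid (pft g) := by
  intro N
  obtain ⟨C, hC0, hC⟩ := pft_decay N hg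
  have hk : IsCompact (Prod.snd '' tsupport g) := hg.2.1.isCompact.image continuous_snd
  obtain ⟨B, hB⟩ := hk.isBounded.exists_norm_le
  refine ⟨C * (1 + |B|) ^ N, fun p => ?_⟩
  by_cases hp : p.2 ∈ Prod.snd '' tsupport g
  · have h2 : |p.2| ≤ |B| := (hB _ hp).trans (le_abs_self _)
    calc (1 + ‖p‖) ^ N * ‖pft g p‖ ≤ ((1 + |p.1|) * (1 + |B|)) ^ N * ‖pft g p‖ := by
          gcongr
          exact (prod_norm_le p).trans (by gcongr)
      _ = (1 + |p.1|) ^ N * ‖pft g p‖ * (1 + |B|) ^ N := by rw [mul_pow]; ring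
      _ ≤ C * (1 + |B|) ^ N := by gcongr; exact hC p
  · rw [pft_eq_zero hp, norm_zero, mul_zero]
    positivity

lemma rapid_ft {Ω : Set ℝ} {ψ : ℝ → ℂ} (hψ : IsTestC Ω ψ) : Rapid (ft ψ) := by
  let S : 𝓢(ℝ, ℂ) := hψ.2.1.toSchwartzMap hψ.1
  obtain ⟨φ, hφ⟩ := exists_schwartz_ft S
  have : ft ψ = φ := by ext x; rw [hφ]; rfl
  rw [this]
  exact SchwartzMap_rapid φ

end RapidPft

/-- Pairing of a tempered function with a partial Fourier transform. -/
def pftPair (u : ℝ × ℝ → ℝ) (g : ℝ × ℝ → ℂ) : ℂ := ∫ p, (u p : ℂ) * pft g p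

section pftPair

variable {u : ℝ × ℝ → ℝ} {Ω Ω' : Set (ℝ × ℝ)} {f g : ℝ × ℝ → ℂ}

lemma pftPair_integrable (hu : TemperedFun u) (hg : IsTestC Ω g) :
    Integrable fun p => (u p : ℂ) * pft g p :=
  hu.integrable_mul (contDiff_pft hg).continuous.aestronglyMeasurable (rapid_pft hg)

lemma pftPair_add (hu : TemperedFun u) (hf : IsTestC Ω f) (hg : IsTestC Ω' g) :
    pftPair u (fun p => f p + g p) = pftPair u f + pftPair u g := by
  rw [pftPair, pftPair, pftPair,
    ← integral_add (pftPair_integrable hu hf) (pftPair_integrable hu hg)]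
  simp only [pft_add hf.toUniv hg.toUniv, mul_add]

lemma pftPair_const_mul (c : ℂ) (g : ℝ × ℝ → ℂ) :
    pftPair u (fun p => c * g p) = c * pftPair u g := by
  rw [pftPair, pftPair, ← integral_const_mul]
  simp only [pft_const_mul, mul_left_comm]

lemma pftPair_neg (g : ℝ × ℝ → ℂ) : pftPair u (fun p => -g p) = -pftPair u g := by
  simpa using pftPair_const_mul (u := u) (-1) g

lemma pftPair_sub (hu : TemperedFun u) (hf : IsTestC Ω f) (hg : IsTestC Ω' g) :
    pftPair u (fun p => f p - g p) = pftPair u f - pftPair u g := by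
  simp only [sub_eq_add_neg]
  rw [pftPair_add hu hf hg.neg, pftPair_neg]

end pftPair

/-! ### The Lamé system tested with partial Fourier transforms -/

/-- `∂_x` on complex functions. -/
def dx (Φ : ℝ × ℝ → ℂ) (p : ℝ × ℝ) : ℂ := fderiv ℝ Φ p (1, 0)

/-- `∂_y` on complex functions. -/
def dy (Φ : ℝ × ℝ → ℂ) (p : ℝ × ℝ) : ℂ := fderiv ℝ Φ p (0, 1)

/-- The Lamé system in the upper half plane, tested with complex functions. -/
def UpperLame (c : ℝ) (u₀ u₁ : ℝ × ℝ → ℝ) : Prop :=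
  ∀ Φ₀ Φ₁ : ℝ × ℝ → ℂ, IsTestC {p | 0 < p.2} Φ₀ → IsTestC {p | 0 < p.2} Φ₁ →
    ∫ p, ((u₀ p : ℂ) * ((1 + c) * dx (dx Φ₀) p + dy (dy Φ₀) p + c * dx (dy Φ₁) p)
      + (u₁ p : ℂ) * (dx (dx Φ₁) p + (1 + c) * dy (dy Φ₁) p + c * dy (dx Φ₀) p)) = 0

section cutoff

lemma exists_cutoff : ∃ χ : ℝ → ℝ, IsTest univ χ ∧ (∀ x, |x| ≤ 1 → χ x = 1) ∧
    (∀ x, 0 ≤ χ x) ∧ (∀ x, χ x ≤ 1) := by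
  let b : ContDiffBump (0 : ℝ) := ⟨1, 2, one_pos, one_lt_two⟩
  refine ⟨b, ⟨b.contDiff, b.hasCompactSupport, subset_univ _⟩, fun x hx => ?_,
    fun x => b.nonneg, fun x => b.le_one⟩
  exact b.one_of_mem_closedBall (by simpa [b, Real.dist_eq] using hx)

variable {Ω : Set (ℝ × ℝ)} {g : ℝ × ℝ → ℂ} {χ : ℝ → ℂ}

lemma dx_pft (hg : IsTestC Ω g) : dx (pft g) = pft fun q => -(Complex.I * q.1) * g q :=
  funext fun p => fderiv_pft_fst hg p

lemma dy_pft (hg : IsTestC Ω g) : dy (pft g) = pft (dy g) :=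
  funext fun p => fderiv_pft_snd hg p

lemma IsTestC.dx (hg : IsTestC Ω g) : IsTestC Ω (dx g) := hg.fderiv_apply (1, 0)

lemma IsTestC.dy (hg : IsTestC Ω g) : IsTestC Ω (dy g) := hg.fderiv_apply (0, 1)

lemma IsTestC.mul_I_xi (hg : IsTestC Ω g) : IsTestC Ω fun q => -(Complex.I * q.1) * g q := by
  simpa only [neg_mul, mul_assoc] using (hg.mul_xi.const_mul Complex.I).neg

lemma dx_add {f g : ℝ × ℝ → ℂ} (hf : ContDiff ℝ ∞ f) (hg : ContDiff ℝ ∞ g) :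
    dx (fun p => f p + g p) = fun p => dx f p + dx g p := by
  ext p
  simp only [dx]
  rw [fderiv_fun_add (hf.differentiable (by simp) _) (hg.differentiable (by simp) _)]
  rfl

lemma dy_add {f g : ℝ × ℝ → ℂ} (hf : ContDiff ℝ ∞ f) (hg : ContDiff ℝ ∞ g) :
    dy (fun p => f p + g p) = fun p => dy f p + dy g p := by
  ext p
  simp only [dy]
  rw [fderiv_fun_add (hf.differentiable (by simp) _) (hg.differentiable (by simp) _)]
  rfl

lemma dy_mul {f g : ℝ × ℝ → ℂ} {p : ℝ × ℝ} (hf : DifferentiableAt ℝ f p)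
    (hg : DifferentiableAt ℝ g p) :
    dy (fun p => f p * g p) p = f p * dy g p + dy f p * g p := by
  simp only [dy]
  rw [fderiv_fun_mul hf hg]
  simp [mul_comm]

lemma dx_mul {f g : ℝ × ℝ → ℂ} {p : ℝ × ℝ} (hf : DifferentiableAt ℝ f p)
    (hg : DifferentiableAt ℝ g p) :
    dx (fun p => f p * g p) p = f p * dx g p + dx f p * g p := by
  simp only [dx]
  rw [fderiv_fun_mul hf hg]
  simp [mul_comm]

lemma contDiff_cut (hχ : ContDiff ℝ ∞ χ) (r : ℝ) :
    ContDiff ℝ ∞ fun p : ℝ × ℝ => χ (r * p.1) :=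
  hχ.comp (contDiff_const.mul contDiff_fst)

lemma dx_cut (hχ : ContDiff ℝ ∞ χ) (r : ℝ) (p : ℝ × ℝ) :
    dx (fun p : ℝ × ℝ => χ (r * p.1)) p = r * deriv χ (r * p.1) := by
  have h1 : HasDerivAt χ (deriv χ (r * p.1)) (r * p.1) :=
    (hχ.differentiable (by simp) _).hasDerivAt
  have h2 : HasFDerivAt (fun p : ℝ × ℝ => r * p.1) (r • ContinuousLinearMap.fst ℝ ℝ ℝ) p :=
    (hasFDerivAt_fst).const_mul r
  have h3 := h1.hasFDerivAt.comp p h2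
  rw [dx, show (fun p : ℝ × ℝ => χ (r * p.1)) = χ ∘ fun p => r * p.1 from rfl, h3.fderiv]
  simp

lemma dy_cut (hχ : ContDiff ℝ ∞ χ) (r : ℝ) (p : ℝ × ℝ) :
    dy (fun p : ℝ × ℝ => χ (r * p.1)) p = 0 := by
  have h1 : HasDerivAt χ (deriv χ (r * p.1)) (r * p.1) :=
    (hχ.differentiable (by simp) _).hasDerivAt
  have h2 : HasFDerivAt (fun p : ℝ × ℝ => r * p.1) (r • ContinuousLinearMap.fst ℝ ℝ ℝ) p :=
    (hasFDerivAt_fst).const_mul r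
  have h3 := h1.hasFDerivAt.comp p h2
  rw [dy, show (fun p : ℝ × ℝ => χ (r * p.1)) = χ ∘ fun p => r * p.1 from rfl, h3.fderiv]
  simp

lemma dx_cut_pft (hχ : ContDiff ℝ ∞ χ) (r : ℝ) (hg : IsTestC Ω g) :
    dx (fun p => χ (r * p.1) * pft g p) = fun p =>
      χ (r * p.1) * pft (fun q => -(Complex.I * q.1) * g q) p
        + r * (deriv χ (r * p.1) * pft g p) := by
  ext p
  rw [dx_mul ((contDiff_cut hχ r).differentiable (by simp) _)
    ((contDiff_pft hg).differentiable (by simp) _), dx_cut hχ, dx_pft hg]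
  ring

lemma dy_cut_pft (hχ : ContDiff ℝ ∞ χ) (r : ℝ) (hg : IsTestC Ω g) :
    dy (fun p => χ (r * p.1) * pft g p) = fun p => χ (r * p.1) * pft (dy g) p := by
  ext p
  rw [dy_mul ((contDiff_cut hχ r).differentiable (by simp) _)
    ((contDiff_pft hg).differentiable (by simp) _), dy_cut hχ, dy_pft hg]
  ring

lemma contDiff_cut_pft (hχ : ContDiff ℝ ∞ χ) (r : ℝ) (hg : IsTestC Ω g) :
    ContDiff ℝ ∞ fun p => χ (r * p.1) * pft g p :=
  (contDiff_cut hχ r).mul (contDiff_pft hg)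

lemma tsupport_pft_subset (g : ℝ × ℝ → ℂ) (hg : HasCompactSupport g) :
    tsupport (pft g) ⊆ Prod.snd ⁻¹' (Prod.snd '' tsupport g) := by
  refine closure_minimal (fun p hp => ?_)
    ((hg.isCompact.image continuous_snd).isClosed.preimage continuous_snd)
  by_contra h
  exact hp (pft_eq_zero h)

lemma isTestC_cut_pft (hχ : IsTestC univ χ) {r : ℝ} (hr : r ≠ 0) {V : Set ℝ}
    (hg : IsTestC {p | p.2 ∈ V} g) :
    IsTestC {p | p.2 ∈ V} fun p => χ (r * p.1) * pft g p := by
  have hs : tsupport (fun p => χ (r * p.1) * pft g p) ⊆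
      ((fun x => r⁻¹ * x) '' tsupport χ) ×ˢ (Prod.snd '' tsupport g) := by
    refine closure_minimal (fun p hp => ?_) (IsClosed.prod ?_ ?_)
    · rw [Function.mem_support] at hp
      refine ⟨⟨r * p.1, subset_tsupport _ (left_ne_zero_of_mul hp), ?_⟩, ?_⟩
      · simp only; field_simp
      · exact tsupport_pft_subset g hg.2.1 (subset_tsupport _ (right_ne_zero_of_mul hp))
    · exact (hχ.2.1.isCompact.image (by fun_prop)).isClosed
    · exact (hg.2.1.isCompact.image continuous_snd).isClosed
  refine ⟨contDiff_cut_pft hχ.1 r hg, ?_, fun p hp => ?_⟩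
  · exact ((hχ.2.1.isCompact.image (by fun_prop)).prod
      (hg.2.1.isCompact.image continuous_snd)).of_isClosed_subset (isClosed_tsupport _) hs
  · obtain ⟨-, q, hq, h⟩ := hs hp
    rw [mem_ofPred_eq, ← h]
    exact hg.2.2 hq

lemma tendsto_cut_pair {u : ℝ × ℝ → ℝ} (hu : TemperedFun u) (hχ : IsTestC univ χ)
    (hg : IsTestC Ω g) :
    Tendsto (fun r : ℝ => ∫ p, (u p : ℂ) * (χ (r * p.1) * pft g p)) (𝓝[>] 0)
      (𝓝 (χ 0 * pftPair u g)) := by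
  have : χ 0 * pftPair u g = ∫ p, (u p : ℂ) * (χ 0 * pft g p) := by
    rw [pftPair, ← integral_const_mul]; congr 1; ext p; ring
  rw [this]
  obtain ⟨M, hM⟩ := hχ.exists_bound
  refine hu.tendsto_integral (Eventually.of_forall fun r =>
    (contDiff_cut_pft hχ.1 r hg).continuous.aestronglyMeasurable) (fun N => ?_) fun p => ?_
  · obtain ⟨B, hB⟩ := rapid_pft hg N
    refine ⟨M * B, Eventually.of_forall fun r p => ?_⟩
    calc (1 + ‖p‖) ^ N * ‖χ (r * p.1) * pft g p‖
        = ‖χ (r * p.1)‖ * ((1 + ‖p‖) ^ N * ‖pft g p‖) := by rw [norm_mul]; ring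
      _ ≤ M * B := mul_le_mul (hM _) (hB p) (by positivity) ((norm_nonneg _).trans (hM 0))
  · refine Tendsto.mul_const _ ?_
    have h1 : Tendsto (fun r : ℝ => r * p.1) (𝓝[>] 0) (𝓝 0) := by
      have : Tendsto (fun r : ℝ => r * p.1) (𝓝 0) (𝓝 (0 * p.1)) := by
        exact (continuous_id.mul continuous_const).tendsto 0
      rw [zero_mul] at this
      exact this.mono_left nhdsWithin_le_nhds
    exact (hχ.continuous.tendsto 0).comp h1

lemma cut_pair_integrable {u : ℝ × ℝ → ℝ} (hu : TemperedFun u) (hχ : IsTestC univ χ)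
    (hg : IsTestC Ω g) (r : ℝ) : Integrable fun p => (u p : ℂ) * (χ (r * p.1) * pft g p) := by
  obtain ⟨M, hM⟩ := hχ.exists_bound
  exact hu.integrable_mul (contDiff_cut_pft hχ.1 r hg).continuous.aestronglyMeasurable
    ((rapid_pft hg).bdd_mul fun p => hM _)

end cutoff

lemma lame_pft {c : ℝ} {u₀ u₁ : ℝ × ℝ → ℝ} (h₀ : TemperedFun u₀) (h₁ : TemperedFun u₁)
    (hL : UpperLame c u₀ u₁) {g₀ g₁ : ℝ × ℝ → ℂ} (hg₀ : IsTestC {p | 0 < p.2} g₀)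
    (hg₁ : IsTestC {p | 0 < p.2} g₁) :
    pftPair u₀ (fun q => (1 + c) * (-(Complex.I * q.1) * (-(Complex.I * q.1) * g₀ q))
        + dy (dy g₀) q + c * (-(Complex.I * q.1) * dy g₁ q))
      + pftPair u₁ (fun q => (-(Complex.I * q.1) * (-(Complex.I * q.1) * g₁ q))
        + (1 + c) * dy (dy g₁) q + c * dy (fun q => -(Complex.I * q.1) * g₀ q) q) = 0 := by
  obtain ⟨χ', hχt, hχ1, -, -⟩ := exists_cutoff
  obtain ⟨χ, hχd⟩ : ∃ χ : ℝ → ℂ, χ = fun x => (χ' x : ℂ) := ⟨_, rfl⟩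
  have hχ : IsTestC univ χ := hχd ▸ hχt.ofReal
  have hχ0 : χ 0 = 1 := by rw [hχd]; simp [hχ1 0 (by simp)]
  have hχ' := hχ.deriv
  have hχ'' := hχ'.deriv
  set X : (ℝ × ℝ → ℂ) → ℝ × ℝ → ℂ := fun g q => -(Complex.I * q.1) * g q with hX
  have tX : ∀ {g}, IsTestC {p : ℝ × ℝ | 0 < p.2} g → IsTestC {p : ℝ × ℝ | 0 < p.2} (X g) :=
    fun hg => hg.mul_I_xi
  set J : ℝ → (ℝ → ℂ) → (ℝ × ℝ → ℝ) → (ℝ × ℝ → ℂ) → ℂ :=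
    fun r ζ u g => ∫ p, (u p : ℂ) * (ζ (r * p.1) * pft g p) with hJ
  have key : ∀ r : ℝ, 0 < r →
      ((1 + c) * (J r χ u₀ (X (X g₀)) + 2 * r * J r (deriv χ) u₀ (X g₀)
          + r ^ 2 * J r (deriv (deriv χ)) u₀ g₀)
        + J r χ u₀ (dy (dy g₀)) + c * (J r χ u₀ (X (dy g₁)) + r * J r (deriv χ) u₀ (dy g₁)))
      + ((J r χ u₁ (X (X g₁)) + 2 * r * J r (deriv χ) u₁ (X g₁)
          + r ^ 2 * J r (deriv (deriv χ)) u₁ g₁)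
        + (1 + c) * J r χ u₁ (dy (dy g₁))
        + c * (J r χ u₁ (dy (X g₀)) + r * J r (deriv χ) u₁ (dy g₀))) = 0 := by
    intro r hr
    have hd := hL (fun p => χ (r * p.1) * pft g₀ p) (fun p => χ (r * p.1) * pft g₁ p)
      (isTestC_cut_pft hχ hr.ne' (V := Ioi 0) hg₀) (isTestC_cut_pft hχ hr.ne' (V := Ioi 0) hg₁)
    have dxx : ∀ {g}, IsTestC {p : ℝ × ℝ | 0 < p.2} g →
        dx (dx fun p => χ (r * p.1) * pft g p) = fun p => (χ (r * p.1) * pft (X (X g)) p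
          + 2 * r * (deriv χ (r * p.1) * pft (X g) p))
          + r ^ 2 * (deriv (deriv χ) (r * p.1) * pft g p) := by
      intro g hg
      rw [dx_cut_pft hχ.1 r hg, dx_add (contDiff_cut_pft hχ.1 r (tX hg))
        (contDiff_const.mul (contDiff_cut_pft hχ'.1 r hg)), dx_cut_pft hχ.1 r (tX hg)]
      ext p
      rw [dx_mul (differentiableAt_const _)
        ((contDiff_cut_pft hχ'.1 r hg).differentiable (by simp) _), dx_cut_pft hχ'.1 r hg]
      simp only [dx, fderiv_fun_const, hX, Pi.zero_apply, zero_apply]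
      ring
    have dyy : ∀ {g}, IsTestC {p : ℝ × ℝ | 0 < p.2} g →
        dy (dy fun p => χ (r * p.1) * pft g p) = fun p => χ (r * p.1) * pft (dy (dy g)) p := by
      intro g hg
      rw [dy_cut_pft hχ.1 r hg, dy_cut_pft hχ.1 r hg.dy]
    have dxy : ∀ {g}, IsTestC {p : ℝ × ℝ | 0 < p.2} g →
        dx (dy fun p => χ (r * p.1) * pft g p) = fun p => χ (r * p.1) * pft (X (dy g)) p
          + r * (deriv χ (r * p.1) * pft (dy g) p) := by
      intro g hg
      rw [dy_cut_pft hχ.1 r hg, dx_cut_pft hχ.1 r hg.dy]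
    have dyx : ∀ {g}, IsTestC {p : ℝ × ℝ | 0 < p.2} g →
        dy (dx fun p => χ (r * p.1) * pft g p) = fun p => χ (r * p.1) * pft (dy (X g)) p
          + r * (deriv χ (r * p.1) * pft (dy g) p) := by
      intro g hg
      rw [dx_cut_pft hχ.1 r hg, dy_add (contDiff_cut_pft hχ.1 r (tX hg))
        (contDiff_const.mul (contDiff_cut_pft hχ'.1 r hg)), dy_cut_pft hχ.1 r (tX hg)]
      ext p
      rw [dy_mul (differentiableAt_const _)
        ((contDiff_cut_pft hχ'.1 r hg).differentiable (by simp) _), dy_cut_pft hχ'.1 r hg]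
      simp only [dy, fderiv_fun_const, Pi.zero_apply, zero_apply, zero_mul,
        add_zero]
    rw [dxx hg₀, dyy hg₀, dxy hg₁, dxx hg₁, dyy hg₁, dyx hg₀] at hd
    have I : ∀ {ζ u g}, IsTestC univ ζ → TemperedFun u → IsTestC {p : ℝ × ℝ | 0 < p.2} g →
        HasInt volume (fun p => (u p : ℂ) * (ζ (r * p.1) * pft g p)) (J r ζ u g) :=
      fun hζ hu hg => ⟨cut_pair_integrable hu hζ hg r, rfl⟩
    have e := (((((((I hχ h₀ (tX (tX hg₀))).add ((I hχ' h₀ (tX hg₀)).const_mul (2 * r))).add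
      ((I hχ'' h₀ hg₀).const_mul (r ^ 2))).const_mul (1 + c)).add (I hχ h₀ hg₀.dy.dy)).add
      (((I hχ h₀ (tX hg₁.dy)).add ((I hχ' h₀ hg₁.dy).const_mul r)).const_mul c)).add
      (((((I hχ h₁ (tX (tX hg₁))).add ((I hχ' h₁ (tX hg₁)).const_mul (2 * r))).add
      ((I hχ'' h₁ hg₁).const_mul (r ^ 2))).add ((I hχ h₁ hg₁.dy.dy).const_mul (1 + c))).add
      (((I hχ h₁ (tX hg₀).dy).add ((I hχ' h₁ hg₀.dy).const_mul r)).const_mul c))).2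
    refine e.symm.trans (Eq.trans (integral_congr_ae (Eventually.of_forall fun p => ?_)) hd)
    simp only
    ring
  have lim : ∀ {ζ : ℝ → ℂ} {u g}, IsTestC univ ζ → TemperedFun u →
      IsTestC {p : ℝ × ℝ | 0 < p.2} g →
      Tendsto (fun r : ℝ => J r ζ u g) (𝓝[>] 0) (𝓝 (ζ 0 * pftPair u g)) :=
    fun hζ hu hg => tendsto_cut_pair hu hζ hg
  have l0 : Tendsto (fun r : ℝ => (r : ℂ)) (𝓝[>] 0) (𝓝 0) := by
    have := Complex.continuous_ofReal.tendsto 0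
    rw [Complex.ofReal_zero] at this
    exact this.mono_left nhdsWithin_le_nhds
  have T := ((((((lim hχ h₀ (tX (tX hg₀))).add ((l0.const_mul 2).mul (lim hχ' h₀ (tX hg₀)))).add
    ((l0.pow 2).mul (lim hχ'' h₀ hg₀))).const_mul (1 + c : ℂ)).add (lim hχ h₀ hg₀.dy.dy)).add
    (((lim hχ h₀ (tX hg₁.dy)).add (l0.mul (lim hχ' h₀ hg₁.dy))).const_mul (c : ℂ))).add
    (((((lim hχ h₁ (tX (tX hg₁))).add ((l0.const_mul 2).mul (lim hχ' h₁ (tX hg₁)))).add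
    ((l0.pow 2).mul (lim hχ'' h₁ hg₁))).add ((lim hχ h₁ hg₁.dy.dy).const_mul (1 + c : ℂ))).add
    (((lim hχ h₁ (tX hg₀).dy).add (l0.mul (lim hχ' h₁ hg₀.dy))).const_mul (c : ℂ)))
  have Z := tendsto_nhds_unique (T.congr' (f₂ := fun _ => (0 : ℂ))
    (by filter_upwards [self_mem_nhdsWithin] with r hr using key r hr)) tendsto_const_nhds
  rw [pftPair_add h₀ (((tX (tX hg₀)).const_mul _).add hg₀.dy.dy) ((tX hg₁.dy).const_mul _),
    pftPair_add h₀ ((tX (tX hg₀)).const_mul _) hg₀.dy.dy,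
    pftPair_add h₁ ((tX (tX hg₁)).add (hg₁.dy.dy.const_mul _)) ((tX hg₀).dy.const_mul _),
    pftPair_add h₁ (tX (tX hg₁)) (hg₁.dy.dy.const_mul _)]
  simp only [pftPair_const_mul]
  rw [← Z, hχ0]
  ring

/-! ### First-order reduction in the upper half plane -/

/-- `|ξ|` as a complex number. -/
def absC (ξ : ℝ) : ℂ := ((|ξ| : ℝ) : ℂ)

/-- `e^{a |ξ| y}`. -/
def expC (a : ℝ) (q : ℝ × ℝ) : ℂ := Complex.exp ((a * |q.1| * q.2 : ℝ) : ℂ)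

/-- Frequencies off zero, arbitrary height. -/
def offFreq : Set (ℝ × ℝ) := {q | q.1 ≠ 0}

/-- Frequencies off zero, positive height. -/
def offFreqUpper : Set (ℝ × ℝ) := {q | q.1 ≠ 0 ∧ 0 < q.2}

lemma isOpen_offFreq : IsOpen offFreq := isOpen_ne.preimage continuous_fst

lemma isOpen_offFreqUpper : IsOpen offFreqUpper :=
  isOpen_offFreq.inter (isOpen_lt continuous_const continuous_snd)

lemma offFreqUpper_subset : offFreqUpper ⊆ offFreq := fun _ h => h.1

lemma contDiffOn_absC : ContDiffOn ℝ ∞ absC {ξ : ℝ | ξ ≠ 0} := fun ξ hξ =>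
  (Complex.ofRealCLM.contDiff.contDiffAt.comp ξ (contDiffAt_abs hξ)).contDiffWithinAt

lemma contDiffOn_absC_fst : ContDiffOn ℝ ∞ (fun q : ℝ × ℝ => absC q.1) offFreq :=
  contDiffOn_absC.comp contDiff_fst.contDiffOn fun _ h => h

lemma contDiffOn_expC (a : ℝ) : ContDiffOn ℝ ∞ (expC a) offFreq := by
  have h : ContDiffOn ℝ ∞ (fun q : ℝ × ℝ => a * absC q.1 * (q.2 : ℂ)) offFreq :=
    (contDiffOn_const.mul contDiffOn_absC_fst).mul
      (Complex.ofRealCLM.contDiff.comp contDiff_snd).contDiffOn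
  refine h.cexp.congr fun q _ => ?_
  simp [expC, absC]

section symbols

variable {Ω : Set (ℝ × ℝ)} {f g : ℝ × ℝ → ℂ}

lemma IsTestC.mul_absC (hg : IsTestC offFreq g) : IsTestC offFreq fun q => absC q.1 * g q :=
  hg.mul_left isOpen_offFreq contDiffOn_absC_fst

lemma IsTestC.mul_expC (hg : IsTestC offFreq g) (a : ℝ) :
    IsTestC offFreq fun q => expC a q * g q :=
  hg.mul_left isOpen_offFreq (contDiffOn_expC a)

lemma IsTestC.upper_mul_absC (hg : IsTestC offFreqUpper g) :
    IsTestC offFreqUpper fun q => absC q.1 * g q :=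
  hg.mul_left isOpen_offFreqUpper (contDiffOn_absC_fst.mono offFreqUpper_subset)

lemma IsTestC.upper_mul_expC (hg : IsTestC offFreqUpper g) (a : ℝ) :
    IsTestC offFreqUpper fun q => expC a q * g q :=
  hg.mul_left isOpen_offFreqUpper ((contDiffOn_expC a).mono offFreqUpper_subset)

lemma IsTestC.upper_toOff (hg : IsTestC offFreqUpper g) : IsTestC offFreq g :=
  hg.mono offFreqUpper_subset

lemma IsTestC.mul_snd (hg : IsTestC Ω g) : IsTestC Ω fun q => (q.2 : ℂ) * g q :=
  hg.mul_left' (Complex.ofRealCLM.contDiff.comp contDiff_snd)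

lemma IsTestC.mul_I_xi' (hg : IsTestC Ω g) : IsTestC Ω fun q => Complex.I * q.1 * g q := by
  simpa only [mul_assoc] using hg.mul_xi.const_mul Complex.I

lemma hasDerivAt_slice (hg : ContDiff ℝ ∞ g) (q : ℝ × ℝ) :
    HasDerivAt (fun y => g (q.1, y)) (dy g q) q.2 := by
  have h1 : HasFDerivAt g (fderiv ℝ g q) (q.1, q.2) :=
    (hg.differentiable (by simp) _).hasFDerivAt
  have h2 : HasDerivAt (fun y : ℝ => (q.1, y)) ((0 : ℝ), (1 : ℝ)) q.2 :=
    (hasDerivAt_const _ _).prodMk (hasDerivAt_id _)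
  exact h1.comp_hasDerivAt q.2 h2

lemma dy_eq_of_hasDerivAt (hg : ContDiff ℝ ∞ g) {q : ℝ × ℝ} {d : ℂ}
    (h : HasDerivAt (fun y => g (q.1, y)) d q.2) : dy g q = d :=
  (hasDerivAt_slice hg q).unique h

lemma dy_fst_mul (h : ℝ → ℂ) (hg : ContDiff ℝ ∞ g)
    (hhg : ContDiff ℝ ∞ fun q : ℝ × ℝ => h q.1 * g q) :
    dy (fun q : ℝ × ℝ => h q.1 * g q) = fun q => h q.1 * dy g q :=
  funext fun q => dy_eq_of_hasDerivAt hhg ((hasDerivAt_slice hg q).const_mul (h q.1))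

lemma dy_absC_mul (hg : IsTestC offFreq g) :
    dy (fun q => absC q.1 * g q) = fun q => absC q.1 * dy g q :=
  dy_fst_mul _ hg.1 hg.mul_absC.1

lemma dy_neg_absC_mul (hg : IsTestC offFreq g) :
    dy (fun q => -(absC q.1 * g q)) = fun q => -(absC q.1 * dy g q) := by
  simp only [← neg_mul]
  refine dy_fst_mul (fun ξ => -absC ξ) hg.1 ?_
  simpa only [neg_mul] using hg.mul_absC.neg.1

lemma dy_I_xi_mul (hg : IsTestC Ω g) :
    dy (fun q => Complex.I * q.1 * g q) = fun q => Complex.I * q.1 * dy g q :=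
  dy_fst_mul (fun ξ : ℝ => Complex.I * ξ) hg.1 hg.mul_I_xi'.1

lemma dy_neg_I_xi_mul (hg : IsTestC Ω g) :
    dy (fun q => -(Complex.I * q.1) * g q) = fun q => -(Complex.I * q.1) * dy g q :=
  dy_fst_mul (fun ξ : ℝ => -(Complex.I * ξ)) hg.1 hg.mul_I_xi.1

lemma dy_sub' (hf : ContDiff ℝ ∞ f) (hg : ContDiff ℝ ∞ g) :
    dy (fun p => f p - g p) = fun p => dy f p - dy g p :=
  funext fun q => dy_eq_of_hasDerivAt (hf.sub hg)
    ((hasDerivAt_slice hf q).sub (hasDerivAt_slice hg q))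

lemma dy_snd_mul (hg : IsTestC Ω g) :
    dy (fun q => (q.2 : ℂ) * g q) = fun q => (q.2 : ℂ) * dy g q + g q := by
  ext q
  refine dy_eq_of_hasDerivAt hg.mul_snd.1 ?_
  have := (Complex.ofRealCLM.hasDerivAt (x := q.2)).mul (hasDerivAt_slice hg.1 q)
  refine this.congr_deriv ?_
  simp [add_comm]

lemma dy_expC_mul (a : ℝ) (hg : IsTestC offFreq g) :
    dy (fun q => expC a q * g q) = fun q => expC a q * (dy g q + a * absC q.1 * g q) := by
  ext q
  refine dy_eq_of_hasDerivAt (hg.mul_expC a).1 ?_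
  have h1 : HasDerivAt (fun y : ℝ => ((a * |q.1| * y : ℝ) : ℂ)) ((a * |q.1| : ℝ) : ℂ) q.2 := by
    simpa using (((hasDerivAt_id q.2).const_mul (a * |q.1|)).ofReal_comp)
  have := h1.cexp.mul (hasDerivAt_slice hg.1 q)
  refine this.congr_deriv ?_
  simp only [expC, absC]
  push_cast
  ring

end symbols

/-- `∂_y - |ξ|`. -/
def opP (g : ℝ × ℝ → ℂ) (q : ℝ × ℝ) : ℂ := dy g q - absC q.1 * g q

/-- `∂_y + |ξ|`. -/
def opQ (g : ℝ × ℝ → ℂ) (q : ℝ × ℝ) : ℂ := dy g q + absC q.1 * g q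

section ops

variable {f g : ℝ × ℝ → ℂ}

lemma IsTestC.opP (hg : IsTestC offFreq g) : IsTestC offFreq (opP g) := hg.dy.sub hg.mul_absC

lemma IsTestC.opQ (hg : IsTestC offFreq g) : IsTestC offFreq (opQ g) := hg.dy.add hg.mul_absC

lemma IsTestC.upper_opP (hg : IsTestC offFreqUpper g) : IsTestC offFreqUpper (PN.opP g) :=
  hg.dy.sub hg.upper_mul_absC

lemma opP_add (hf : IsTestC offFreq f) (hg : IsTestC offFreq g) :
    opP (fun q => f q + g q) = fun q => opP f q + opP g q := by
  ext q; simp only [opP, dy_add hf.1 hg.1]; ring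

lemma opQ_add (hf : IsTestC offFreq f) (hg : IsTestC offFreq g) :
    opQ (fun q => f q + g q) = fun q => opQ f q + opQ g q := by
  ext q; simp only [opQ, dy_add hf.1 hg.1]; ring

lemma dy_opP (hg : IsTestC offFreq g) :
    dy (opP g) = fun q => dy (dy g) q - absC q.1 * dy g q := by
  rw [show dy (opP g) = fun q => dy (dy g) q - dy (fun q => absC q.1 * g q) q from
    dy_sub' hg.dy.1 hg.mul_absC.1, dy_absC_mul hg]

lemma dy_opQ (hg : IsTestC offFreq g) :
    dy (opQ g) = fun q => dy (dy g) q + absC q.1 * dy g q := by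
  rw [show dy (opQ g) = fun q => dy (dy g) q + dy (fun q => absC q.1 * g q) q from
    dy_add hg.dy.1 hg.mul_absC.1, dy_absC_mul hg]

lemma opP_opQ (hg : IsTestC offFreq g) (q : ℝ × ℝ) :
    opP (opQ g) q = dy (dy g) q - absC q.1 * absC q.1 * g q := by
  rw [opP, dy_opQ hg, opQ]; ring

lemma opQ_opP (hg : IsTestC offFreq g) (q : ℝ × ℝ) :
    opQ (opP g) q = dy (dy g) q - absC q.1 * absC q.1 * g q := by
  rw [opQ, dy_opP hg, opP]; ring

lemma opP_opP (hg : IsTestC offFreq g) (q : ℝ × ℝ) :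
    opP (opP g) q = dy (dy g) q - 2 * absC q.1 * dy g q + absC q.1 * absC q.1 * g q := by
  rw [opP, dy_opP hg, opP]; ring

lemma opQ_opQ (hg : IsTestC offFreq g) (q : ℝ × ℝ) :
    opQ (opQ g) q = dy (dy g) q + 2 * absC q.1 * dy g q + absC q.1 * absC q.1 * g q := by
  rw [opQ, dy_opQ hg, opQ]; ring

lemma opP_expC_one (hg : IsTestC offFreq g) :
    opP (fun q => expC 1 q * g q) = fun q => expC 1 q * dy g q := by
  ext q; simp only [opP, dy_expC_mul 1 hg]; push_cast; ring

lemma opQ_expC_neg_one (hg : IsTestC offFreq g) :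
    opQ (fun q => expC (-1) q * g q) = fun q => expC (-1) q * dy g q := by
  ext q; simp only [opQ, dy_expC_mul (-1) hg]; push_cast; ring

lemma expC_mul_expC (q : ℝ × ℝ) : expC 1 q * expC (-1) q = 1 := by
  rw [expC, expC, ← Complex.exp_add, ← Complex.ofReal_add]
  simp

lemma expC_mul_expC' (q : ℝ × ℝ) : expC (-1) q * expC 1 q = 1 := by
  rw [mul_comm, expC_mul_expC]

end ops

/-- Pairing with the isotropic vector `(iξ, -|ξ|)`. -/
def pairA (u₀ u₁ : ℝ × ℝ → ℝ) (g : ℝ × ℝ → ℂ) : ℂ :=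
  pftPair u₀ (fun q => Complex.I * q.1 * g q) - pftPair u₁ (fun q => absC q.1 * g q)

/-- Pairing with the isotropic vector `(-iξ, -|ξ|)`. -/
def pairB (u₀ u₁ : ℝ × ℝ → ℝ) (g : ℝ × ℝ → ℂ) : ℂ :=
  -pftPair u₀ (fun q => Complex.I * q.1 * g q) - pftPair u₁ (fun q => absC q.1 * g q)

section pairAB

variable {u₀ u₁ : ℝ × ℝ → ℝ} {f g : ℝ × ℝ → ℂ}

lemma pairA_add (h₀ : TemperedFun u₀) (h₁ : TemperedFun u₁) (hf : IsTestC offFreq f)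
    (hg : IsTestC offFreq g) :
    pairA u₀ u₁ (fun q => f q + g q) = pairA u₀ u₁ f + pairA u₀ u₁ g := by
  simp only [pairA, mul_add]
  rw [pftPair_add h₀ hf.mul_I_xi' hg.mul_I_xi', pftPair_add h₁ hf.mul_absC hg.mul_absC]
  ring

lemma pairB_add (h₀ : TemperedFun u₀) (h₁ : TemperedFun u₁) (hf : IsTestC offFreq f)
    (hg : IsTestC offFreq g) :
    pairB u₀ u₁ (fun q => f q + g q) = pairB u₀ u₁ f + pairB u₀ u₁ g := by
  simp only [pairB, mul_add]
  rw [pftPair_add h₀ hf.mul_I_xi' hg.mul_I_xi', pftPair_add h₁ hf.mul_absC hg.mul_absC]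
  ring

lemma pairA_const_mul (c : ℂ) (g : ℝ × ℝ → ℂ) :
    pairA u₀ u₁ (fun q => c * g q) = c * pairA u₀ u₁ g := by
  simp only [pairA, mul_left_comm _ c]
  rw [pftPair_const_mul, pftPair_const_mul]
  ring

lemma pairB_const_mul (c : ℂ) (g : ℝ × ℝ → ℂ) :
    pairB u₀ u₁ (fun q => c * g q) = c * pairB u₀ u₁ g := by
  simp only [pairB, mul_left_comm _ c]
  rw [pftPair_const_mul, pftPair_const_mul]
  ring

lemma pairA_add_pairB (h₀ : TemperedFun u₀) (h₁ : TemperedFun u₁) (hf : IsTestC offFreq f)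
    (hg : IsTestC offFreq g) :
    pairA u₀ u₁ f + pairB u₀ u₁ g = pftPair u₀ (fun q => Complex.I * q.1 * (f q - g q))
      + pftPair u₁ (fun q => -(absC q.1 * (f q + g q))) := by
  simp only [pairA, pairB, mul_add, mul_sub]
  rw [pftPair_sub h₀ hf.mul_I_xi' hg.mul_I_xi', pftPair_neg,
    pftPair_add h₁ hf.mul_absC hg.mul_absC]
  ring

lemma absC_sq (ξ : ℝ) : absC ξ * absC ξ = (ξ : ℂ) * ξ := by
  rw [absC, ← Complex.ofReal_mul, abs_mul_abs_self, Complex.ofReal_mul]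

variable {c : ℝ}

lemma lame_pairA (h₀ : TemperedFun u₀) (h₁ : TemperedFun u₁) (hL : UpperLame c u₀ u₁)
    (hg : IsTestC offFreqUpper g) :
    (1 + c / 2) * pairA u₀ u₁ (opP (opQ g)) + c / 2 * pairB u₀ u₁ (opP (opP g)) = 0 := by
  have hg' := hg.upper_toOff
  have hs : offFreqUpper ⊆ {p : ℝ × ℝ | 0 < p.2} := fun _ h => h.2
  have h := lame_pft h₀ h₁ hL (hg.mul_I_xi'.mono hs) (hg.upper_mul_absC.neg.mono hs)
  rw [← pairA_const_mul, ← pairB_const_mul, pairA_add_pairB h₀ h₁ (hg'.opQ.opP.const_mul _)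
    (hg'.opP.opP.const_mul _), ← h]
  rw [dy_neg_I_xi_mul hg.mul_I_xi', dy_I_xi_mul hg, dy_I_xi_mul hg.dy, dy_neg_absC_mul hg',
    dy_neg_absC_mul hg'.dy]
  have hI := Complex.I_mul_I
  congr 2 <;> ext q <;> have hk := absC_sq q.1 <;>
    simp only [opP_opQ hg', opP_opP hg']
  · linear_combination (-(Complex.I * q.1 * g q * (1 + c))) * (hk + q.1 * q.1 * hI)
  · linear_combination (absC q.1 * g q + c * dy g q) * (hk + q.1 * q.1 * hI)

lemma lame_pairB (h₀ : TemperedFun u₀) (h₁ : TemperedFun u₁) (hL : UpperLame c u₀ u₁)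
    (hg : IsTestC offFreqUpper g) :
    c / 2 * pairA u₀ u₁ (opQ (opQ g)) + (1 + c / 2) * pairB u₀ u₁ (opP (opQ g)) = 0 := by
  have hg' := hg.upper_toOff
  have hs : offFreqUpper ⊆ {p : ℝ × ℝ | 0 < p.2} := fun _ h => h.2
  have h := lame_pft h₀ h₁ hL (hg.mul_I_xi.mono hs) (hg.upper_mul_absC.neg.mono hs)
  rw [← pairA_const_mul, ← pairB_const_mul, pairA_add_pairB h₀ h₁ (hg'.opQ.opQ.const_mul _)
    (hg'.opQ.opP.const_mul _), ← h]
  rw [dy_neg_I_xi_mul hg.mul_I_xi, dy_neg_I_xi_mul hg, dy_neg_I_xi_mul hg.dy,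
    dy_neg_absC_mul hg', dy_neg_absC_mul hg'.dy]
  have hI := Complex.I_mul_I
  congr 2 <;> ext q <;> have hk := absC_sq q.1 <;>
    simp only [opP_opQ hg', opQ_opQ hg']
  · linear_combination (Complex.I * q.1 * g q * (1 + c)) * (hk + q.1 * q.1 * hI)
  · linear_combination (absC q.1 * g q - c * dy g q) * (hk + q.1 * q.1 * hI)

end pairAB

/-! ### Antiderivatives in the second variable -/

lemma isTestC_of_subset {E : Type*} [NormedAddCommGroup E] [NormedSpace ℝ E] {Ω K : Set E}
    {g : E → ℂ} (hg : ContDiff ℝ ∞ g) (hK : IsCompact K) (hKΩ : K ⊆ Ω)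
    (h : ∀ q, q ∉ K → g q = 0) : IsTestC Ω g := by
  have hs : tsupport g ⊆ K := closure_minimal
    (fun q hq => by_contra fun hqK => hq (h q hqK)) hK.isClosed
  exact ⟨hg, hK.of_isClosed_subset (isClosed_tsupport _) hs, hs.trans hKΩ⟩

/-- The antiderivative in the second variable which vanishes at `-∞`. -/
def anti (g : ℝ × ℝ → ℂ) (q : ℝ × ℝ) : ℂ := ∫ t in Iic q.2, g (q.1, t)

lemma hasDerivAt_integral_Iic {f : ℝ → ℂ} (hf : Continuous f) (hi : Integrable f) (y : ℝ) :
    HasDerivAt (fun y => ∫ t in Iic y, f t) (f y) y := by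
  have h : (fun y => ∫ t in Iic y, f t) = fun y => (∫ t in Iic 0, f t) + ∫ t in (0 : ℝ)..y, f t := by
    ext y
    rw [← intervalIntegral.integral_Iic_sub_Iic hi.integrableOn hi.integrableOn]
    ring
  rw [h]
  exact (intervalIntegral.integral_hasDerivAt_right (hf.intervalIntegrable _ _)
    hf.aestronglyMeasurable.stronglyMeasurableAtFilter hf.continuousAt).const_add _

section anti

variable {g : ℝ × ℝ → ℂ}

lemma IsTestC.slice_snd {Ω : Set (ℝ × ℝ)} (hg : IsTestC Ω g) (ξ : ℝ) :
    IsTestC {y | (ξ, y) ∈ Ω} fun y => g (ξ, y) := by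
  have hs : tsupport (fun y => g (ξ, y)) ⊆ (fun y => (ξ, y)) ⁻¹' tsupport g :=
    closure_minimal (fun x hx => subset_tsupport g hx)
      ((isClosed_tsupport g).preimage (by fun_prop))
  refine ⟨hg.1.comp (contDiff_const.prodMk contDiff_id), ?_, hs.trans fun x hx => hg.2.2 hx⟩
  refine HasCompactSupport.intro (hg.2.1.isCompact.image continuous_snd) fun x hx => ?_
  by_contra h0
  exact hx ⟨(ξ, x), subset_tsupport g h0, rfl⟩

lemma contDiff_anti {Ω : Set (ℝ × ℝ)} (hg : IsTestC Ω g) : ContDiff ℝ ∞ (anti g) :=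
  contDiff_antideriv hg

lemma dy_anti {Ω : Set (ℝ × ℝ)} (hg : IsTestC Ω g) : dy (anti g) = g :=
  funext fun q => dy_eq_of_hasDerivAt (contDiff_anti hg)
    (hasDerivAt_integral_Iic (hg.slice_snd q.1).continuous (hg.slice_snd q.1).integrable q.2)

lemma IsTestC.exists_box (hg : IsTestC offFreqUpper g) :
    ∃ K : Set ℝ, IsCompact K ∧ K ⊆ {ξ | ξ ≠ 0} ∧ ∃ a b : ℝ, 0 < a ∧
      ∀ q : ℝ × ℝ, g q ≠ 0 → q.1 ∈ K ∧ a ≤ q.2 ∧ q.2 ≤ b := by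
  have hc := hg.2.1.isCompact
  have h2 : IsCompact (Prod.snd '' tsupport g) := hc.image continuous_snd
  obtain ⟨b, hb⟩ := h2.bddAbove
  obtain ⟨a, ha, hab⟩ : ∃ a : ℝ, 0 < a ∧ ∀ y ∈ Prod.snd '' tsupport g, a ≤ y := by
    rcases (Prod.snd '' tsupport g).eq_empty_or_nonempty with h | h
    · exact ⟨1, one_pos, by simp [h]⟩
    · obtain ⟨y, hy, hmin⟩ := h2.exists_isLeast h
      obtain ⟨q, hq, rfl⟩ := hy
      exact ⟨q.2, (hg.2.2 hq).2, fun y hy => hmin hy⟩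
  refine ⟨Prod.fst '' tsupport g, hc.image continuous_fst, ?_, a, b, ha, fun q hq => ?_⟩
  · rintro _ ⟨q, hq, rfl⟩; exact (hg.2.2 hq).1
  · have := subset_tsupport g hq
    exact ⟨⟨q, this, rfl⟩, hab _ ⟨q, this, rfl⟩, hb ⟨q, this, rfl⟩⟩

lemma anti_eq_zero_of_le {a : ℝ} (h : ∀ q : ℝ × ℝ, g q ≠ 0 → a ≤ q.2) {q : ℝ × ℝ} (hq : q.2 < a) :
    anti g q = 0 := by
  refine setIntegral_eq_zero_of_forall_eq_zero fun t ht => ?_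
  by_contra h0
  exact absurd ((h (q.1, t) h0).trans ht) (not_le.2 hq)

lemma anti_eq_zero_of_notMem {K : Set ℝ} (h : ∀ q : ℝ × ℝ, g q ≠ 0 → q.1 ∈ K) {q : ℝ × ℝ}
    (hq : q.1 ∉ K) : anti g q = 0 := by
  refine setIntegral_eq_zero_of_forall_eq_zero fun t ht => ?_
  by_contra h0
  exact hq (h (q.1, t) h0)

lemma anti_eq_integral {b : ℝ} (h : ∀ q : ℝ × ℝ, g q ≠ 0 → q.2 ≤ b) {q : ℝ × ℝ} (hq : b ≤ q.2) :
    anti g q = ∫ t, g (q.1, t) := by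
  refine setIntegral_eq_integral_of_forall_compl_eq_zero fun t ht => ?_
  by_contra h0
  exact ht ((h (q.1, t) h0).trans hq)

lemma isTestC_moment (hg : IsTestC offFreqUpper g) :
    IsTestC {ξ : ℝ | ξ ≠ 0} fun ξ => ∫ t, g (ξ, t) := by
  obtain ⟨K, hK, hK0, a, b, -, h⟩ := hg.exists_box
  have hc := contDiffOn_integral_param (P := ℝ) (s := univ) isOpen_univ (isCompact_Icc (a := a)
    (b := b)) (g := fun ξ t => g (ξ, t))
    (fun ξ t _ ht => by_contra fun h0 => ht ⟨(h _ h0).2.1, (h _ h0).2.2⟩) hg.1.contDiffOn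
  rw [contDiffOn_univ] at hc
  refine isTestC_of_subset hc hK hK0 fun ξ hξ => ?_
  refine integral_eq_zero_of_ae (Eventually.of_forall fun t => ?_)
  by_contra h0
  exact hξ (h _ h0).1

lemma isTestC_anti (hg : IsTestC offFreqUpper g) (h0 : ∀ ξ, ∫ t, g (ξ, t) = 0) :
    IsTestC offFreqUpper (anti g) := by
  obtain ⟨K, hK, hK0, a, b, ha, h⟩ := hg.exists_box
  refine isTestC_of_subset (contDiff_anti hg) (hK.prod (isCompact_Icc (a := a) (b := b)))
    (fun q hq => ⟨hK0 hq.1, ha.trans_le hq.2.1⟩) fun q hq => ?_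
  by_cases h1 : q.1 ∈ K
  · by_cases h2 : a ≤ q.2
    · have h3 : b ≤ q.2 := by
        by_contra h3
        exact hq ⟨h1, h2, (not_le.1 h3).le⟩
      rw [anti_eq_integral (fun q hq => (h q hq).2.2) h3, h0]
    · exact anti_eq_zero_of_le (fun q hq => (h q hq).2.1) (not_le.1 h2)
  · exact anti_eq_zero_of_notMem (fun q hq => (h q hq).1) h1

end anti

/-! ### Exclusion of exponential growth -/

/-- The symbol `ζ(y - R) e^{-|ξ| y} m(ξ)`. -/
def farSymbol (ζ m : ℝ → ℂ) (R : ℝ) (q : ℝ × ℝ) : ℂ := ζ (q.2 - R) * (expC (-1) q * m q.1)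

lemma isTestC_shift {ζ : ℝ → ℂ} (hζ : IsTestC univ ζ) (R : ℝ) :
    IsTestC univ fun y => ζ (y - R) := by
  refine isTestC_of_subset (K := (fun y => y + R) '' tsupport ζ)
    (hζ.1.comp (contDiff_id.sub contDiff_const))
    (hζ.2.1.isCompact.image (by fun_prop)) (subset_univ _) fun y hy => ?_
  exact image_eq_zero_of_notMem_tsupport fun h => hy ⟨y - R, h, by simp⟩

lemma isTestC_farSymbol {ζ m : ℝ → ℂ} (hζ : IsTestC univ ζ) (hm : IsTestC {ξ : ℝ | ξ ≠ 0} m)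
    (R : ℝ) : IsTestC offFreq (farSymbol ζ m R) := by
  have h := ((hm.prodMul (isTestC_shift hζ R)).mono (Ω' := offFreq) fun q hq => hq.1).mul_expC (-1)
  convert h using 2
  simp only [farSymbol]; ring

lemma dy_farSymbol {ζ m : ℝ → ℂ} (hζ : IsTestC univ ζ) (hm : IsTestC {ξ : ℝ | ξ ≠ 0} m) (R : ℝ)
    (q : ℝ × ℝ) :
    dy (farSymbol ζ m R) q = farSymbol (deriv ζ) m R q - absC q.1 * farSymbol ζ m R q := by
  have hs := (hm.prodMul (isTestC_shift hζ R)).mono (Ω' := offFreq) fun q hq => hq.1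
  have e : farSymbol ζ m R = fun q => expC (-1) q * (m q.1 * ζ (q.2 - R)) := by
    ext q; simp only [farSymbol]; ring
  have h1 : dy (fun q : ℝ × ℝ => m q.1 * ζ (q.2 - R)) q = m q.1 * deriv ζ (q.2 - R) := by
    have e : HasDerivAt (fun y => ζ (y - R)) (deriv ζ (q.2 - R)) q.2 :=
      HasDerivAt.comp_sub_const _ _ (hζ.1.differentiable (by simp) _).hasDerivAt
    exact dy_eq_of_hasDerivAt hs.1 (e.const_mul (m q.1))
  rw [e, dy_expC_mul _ hs]
  simp only [h1, farSymbol]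
  push_cast
  ring

lemma IsTestC.exists_gap {m : ℝ → ℂ} (hm : IsTestC {ξ : ℝ | ξ ≠ 0} m) :
    ∃ δ > 0, IsTestC {ξ : ℝ | δ < |ξ|} m := by
  have hc : IsCompact (abs '' tsupport m) := hm.2.1.isCompact.image continuous_abs
  rcases (abs '' tsupport m).eq_empty_or_nonempty with h | h
  · refine ⟨1, one_pos, hm.1, hm.2.1, ?_⟩
    rw [image_eq_empty] at h
    rw [h]; exact empty_subset _
  · obtain ⟨_, ⟨ξ, hξ, rfl⟩, hmin⟩ := hc.exists_isLeast h
    have h0 : 0 < |ξ| := abs_pos.2 (hm.2.2 hξ)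
    exact ⟨|ξ| / 2, half_pos h0, hm.1, hm.2.1, fun x hx =>
      (half_lt_self h0).trans_le (hmin ⟨x, hx, rfl⟩)⟩

/-- `ξ / |ξ|`. -/
def signC (ξ : ℝ) : ℂ := ((ξ / |ξ| : ℝ) : ℂ)

lemma contDiffOn_signC : ContDiffOn ℝ ∞ signC {ξ : ℝ | ξ ≠ 0} := fun ξ hξ =>
  (Complex.ofRealCLM.contDiff.contDiffAt.comp ξ
    (contDiffAt_id.div (contDiffAt_abs hξ) (abs_ne_zero.2 hξ))).contDiffWithinAt

lemma contDiffOn_expC_slice (a y : ℝ) :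
    ContDiffOn ℝ ∞ (fun ξ => expC a (ξ, y)) {ξ : ℝ | ξ ≠ 0} :=
  (contDiffOn_expC a).comp (contDiff_id.prodMk contDiff_const).contDiffOn fun _ h => h

lemma ft_expC_decay {δ : ℝ} (hδ : 0 < δ) (N : ℕ) {m : ℝ → ℂ} (hm : IsTestC {ξ : ℝ | δ < |ξ|} m) :
    ∃ C : ℝ, ∀ y, 0 ≤ y → ∀ x : ℝ,
      |x| ^ N * ‖ft (fun ξ => expC (-1) (ξ, y) * m ξ) x‖ ≤ C * (1 + y) ^ N * Real.exp (-δ * y) := by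
  have hopen : IsOpen {ξ : ℝ | δ < |ξ|} := isOpen_lt continuous_const continuous_abs
  have hsub : {ξ : ℝ | δ < |ξ|} ⊆ {ξ : ℝ | ξ ≠ 0} := fun ξ hξ => abs_pos.1 (hδ.trans hξ)
  induction N generalizing m with
  | zero =>
    refine ⟨∫ ξ, ‖m ξ‖, fun y hy x => ?_⟩
    rw [pow_zero, pow_zero, one_mul, mul_one, mul_comm, ← integral_const_mul]
    refine (norm_ft_le _ _).trans (integral_mono_of_nonneg
      (Eventually.of_forall fun _ => norm_nonneg _) (hm.integrable.norm.const_mul _)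
      (Eventually.of_forall fun ξ => ?_))
    simp only [norm_mul]
    by_cases h0 : m ξ = 0
    · simp [h0]
    · gcongr
      have : δ < |ξ| := hm.2.2 (subset_tsupport _ h0)
      rw [expC, ← Complex.ofReal_exp, Complex.norm_real, Real.norm_of_nonneg (Real.exp_nonneg _)]
      gcongr
      nlinarith
  | succ N ih =>
    obtain ⟨C1, h1⟩ := ih hm.deriv
    have hsm : IsTestC {ξ : ℝ | δ < |ξ|} fun ξ => signC ξ * m ξ :=
      hm.mul_left hopen (contDiffOn_signC.mono hsub)
    obtain ⟨C2, h2⟩ := ih hsm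
    refine ⟨|C1| + |C2|, fun y hy x => ?_⟩
    have hE : ∀ {n : ℝ → ℂ}, IsTestC {ξ : ℝ | δ < |ξ|} n →
        IsTestC {ξ : ℝ | δ < |ξ|} fun ξ => expC (-1) (ξ, y) * n ξ :=
      fun hn => hn.mul_left hopen ((contDiffOn_expC_slice _ _).mono hsub)
    have hd : deriv (fun ξ => expC (-1) (ξ, y) * m ξ) = fun ξ =>
        expC (-1) (ξ, y) * deriv m ξ - y * (expC (-1) (ξ, y) * (signC ξ * m ξ)) := by
      ext ξ
      by_cases hξ : δ < |ξ|
      · have hne : ξ ≠ 0 := hsub hξ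
        have a1 : HasDerivAt (fun ξ : ℝ => ((-1 * |ξ| * y : ℝ) : ℂ)) (-signC ξ * y) ξ := by
          have := (((hasDerivAt_abs hne).const_mul (-1)).mul_const y).ofReal_comp
          refine this.congr_deriv ?_
          have hs : ((SignType.sign ξ : ℝ)) = ξ / |ξ| := by
            rw [eq_div_iff (abs_ne_zero.2 hne)]; exact sign_mul_abs ξ
          rw [hs, signC]; push_cast; ring
        have a2 := a1.cexp.mul (hm.1.differentiable (by simp) ξ).hasDerivAt
        rw [show (fun ξ => expC (-1) (ξ, y) * m ξ) =
          (fun ξ : ℝ => Complex.exp ((-1 * |ξ| * y : ℝ) : ℂ)) * m from rfl, a2.deriv]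
        simp only [expC]
        ring
      · have hn : ξ ∉ tsupport (fun ξ => expC (-1) (ξ, y) * m ξ) := fun h => hξ ((hE hm).2.2 h)
        have d0 := image_eq_zero_of_notMem_tsupport (f := deriv fun ξ => expC (-1) (ξ, y) * m ξ)
          fun h => hn (tsupport_deriv_subset (𝕜 := ℝ) h)
        have d1 : deriv m ξ = 0 := hm.deriv.eq_zero hξ
        rw [d0, d1, hm.eq_zero hξ]; simp
    have h3 := ft_deriv (hE hm).integrable ((hE hm).1.differentiable (by simp))
      (hE hm).deriv.integrable x
    rw [hd, ft_sub (hE hm.deriv).integrable ((hE hsm).integrable.const_mul _), ft_const_mul] at h3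
    have h4 : |x| * ‖ft (fun ξ => expC (-1) (ξ, y) * m ξ) x‖ ≤
        ‖ft (fun ξ => expC (-1) (ξ, y) * deriv m ξ) x‖
          + y * ‖ft (fun ξ => expC (-1) (ξ, y) * (signC ξ * m ξ)) x‖ := by
      calc |x| * ‖ft (fun ξ => expC (-1) (ξ, y) * m ξ) x‖
          = ‖Complex.I * x * ft (fun ξ => expC (-1) (ξ, y) * m ξ) x‖ := by simp
        _ ≤ _ := by
          rw [← h3]
          refine (norm_sub_le _ _).trans (le_of_eq ?_)
          rw [norm_mul, Complex.norm_real, Real.norm_of_nonneg hy]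
    obtain ⟨E, hE0, hEd⟩ : ∃ E : ℝ, 0 ≤ E ∧ (1 + y) ^ N * Real.exp (-δ * y) = E :=
      ⟨_, by positivity, rfl⟩
    have b1 := h1 y hy x
    have b2 := h2 y hy x
    rw [mul_assoc, hEd] at b1 b2
    have c1 := b1.trans (mul_le_mul_of_nonneg_right (le_abs_self C1) hE0)
    have c2 := b2.trans (mul_le_mul_of_nonneg_right (le_abs_self C2) hE0)
    have c3 := mul_le_mul_of_nonneg_left c2 hy
    have c4 := mul_le_mul_of_nonneg_left h4 (by positivity : 0 ≤ |x| ^ N)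
    have c5 : 0 ≤ |C1| * E * y := by positivity
    have c6 : 0 ≤ |C2| * E := by positivity
    rw [pow_succ (1 + y)]
    calc |x| ^ (N + 1) * ‖ft (fun ξ => expC (-1) (ξ, y) * m ξ) x‖
        = |x| ^ N * (|x| * ‖ft (fun ξ => expC (-1) (ξ, y) * m ξ) x‖) := by ring
      _ ≤ (|C1| + |C2|) * E * (1 + y) := by linarith
      _ = _ := by rw [← hEd]; ring

lemma exists_bound_pow_mul_exp {δ : ℝ} (hδ : 0 < δ) (N : ℕ) :
    ∃ C : ℝ, ∀ y : ℝ, 0 ≤ y → (1 + y) ^ N * Real.exp (-δ * y) ≤ C := by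
  refine ⟨N.factorial / δ ^ N * Real.exp δ, fun y hy => ?_⟩
  have h := Real.pow_div_factorial_le_exp (δ * (1 + y)) (by positivity) N
  rw [mul_pow, div_le_iff₀ (by positivity)] at h
  have : Real.exp (δ * (1 + y)) * Real.exp (-δ * y) = Real.exp δ := by
    rw [← Real.exp_add]; ring_nf
  rw [← this]
  have hd : 0 < δ ^ N := by positivity
  calc (1 + y) ^ N * Real.exp (-δ * y)
      = (δ ^ N * (1 + y) ^ N) / δ ^ N * Real.exp (-δ * y) := by field_simp
    _ ≤ (Real.exp (δ * (1 + y)) * N.factorial) / δ ^ N * Real.exp (-δ * y) := by gcongr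
    _ = _ := by ring

lemma tendsto_pftPair_farSymbol {u : ℝ × ℝ → ℝ} (hu : TemperedFun u) {ζ m : ℝ → ℂ}
    (hζ : IsTestC univ ζ) (hm : IsTestC {ξ : ℝ | ξ ≠ 0} m) :
    Tendsto (fun R => pftPair u (farSymbol ζ m R)) atTop (𝓝 0) := by
  obtain ⟨δ, hδ, hm'⟩ := hm.exists_gap
  obtain ⟨B, hB⟩ := hζ.2.1.isCompact.isBounded.exists_norm_le
  obtain ⟨M, hM⟩ := hζ.exists_bound
  have hz : ∀ y, ζ y ≠ 0 → |y| ≤ B := fun y hy => hB y (subset_tsupport _ hy)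
  have hpf : ∀ R p, pft (farSymbol ζ m R) p =
      ζ (p.2 - R) * ft (fun ξ => expC (-1) (ξ, p.2) * m ξ) p.1 := fun R p => by
    rw [pft, ← ft_const_mul]; rfl
  have := hu.tendsto_integral (l := atTop) (h := fun R => pft (farSymbol ζ m R)) (h₀ := fun _ => 0)
    (Eventually.of_forall fun R =>
      (contDiff_pft (isTestC_farSymbol hζ hm R)).continuous.aestronglyMeasurable)
    (fun N => ?_) (fun p => ?_)
  · simpa only [pftPair, mul_zero, integral_zero] using this
  · obtain ⟨C0, h0⟩ := ft_expC_decay hδ 0 hm'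
    obtain ⟨C1, h1⟩ := ft_expC_decay hδ N hm'
    obtain ⟨D, hD⟩ := exists_bound_pow_mul_exp hδ (N + N)
    have hD0 : 0 ≤ D := (by positivity : (0 : ℝ) ≤ (1 + 0) ^ (N + N) * Real.exp (-δ * 0)).trans
      (hD 0 le_rfl)
    have hM0 : 0 ≤ M := (norm_nonneg _).trans (hM 0)
    refine ⟨M * (2 ^ N * ((|C0| + |C1|) * D)), ?_⟩
    filter_upwards [eventually_ge_atTop B] with R hR p
    rw [hpf]
    by_cases hp : ζ (p.2 - R) = 0
    · rw [hp, zero_mul, norm_zero, mul_zero]; positivity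
    have hy : 0 ≤ p.2 := by have := neg_le_of_abs_le (hz _ hp); linarith
    set F := ‖ft (fun ξ => expC (-1) (ξ, p.2) * m ξ) p.1‖ with hF
    have e0 := h0 p.2 hy p.1
    have e1 := h1 p.2 hy p.1
    rw [← hF] at e0 e1
    have hE := Real.exp_nonneg (-δ * p.2)
    have hone : (1 : ℝ) ≤ (1 + p.2) ^ N := one_le_pow₀ (by linarith)
    have f0 : F ≤ |C0| * ((1 + p.2) ^ N * Real.exp (-δ * p.2)) := by
      have : C0 * Real.exp (-δ * p.2) ≤ |C0| * ((1 + p.2) ^ N * Real.exp (-δ * p.2)) :=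
        mul_le_mul (le_abs_self _) (le_mul_of_one_le_left hE hone) hE (abs_nonneg _)
      simp only [pow_zero, one_mul, mul_one] at e0
      linarith
    have f1 : |p.1| ^ N * F ≤ |C1| * ((1 + p.2) ^ N * Real.exp (-δ * p.2)) := by
      have : C1 * ((1 + p.2) ^ N * Real.exp (-δ * p.2)) ≤
          |C1| * ((1 + p.2) ^ N * Real.exp (-δ * p.2)) := by gcongr; exact le_abs_self _
      linarith
    rw [norm_mul]
    calc (1 + ‖p‖) ^ N * (‖ζ (p.2 - R)‖ * F)
        ≤ ((1 + |p.1|) * (1 + p.2)) ^ N * (M * F) := by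
          gcongr
          · have := prod_norm_le p
            rwa [abs_of_nonneg hy] at this
          · exact hM _
      _ = M * ((1 + p.2) ^ N * ((1 + |p.1|) ^ N * F)) := by rw [mul_pow]; ring
      _ ≤ M * ((1 + p.2) ^ N * (2 ^ N * (1 + |p.1| ^ N) * F)) := by
          gcongr; exact one_add_pow_le N (abs_nonneg _)
      _ = M * (2 ^ N * ((1 + p.2) ^ N * (F + |p.1| ^ N * F))) := by ring
      _ ≤ M * (2 ^ N * ((1 + p.2) ^ N * ((|C0| + |C1|) *
            ((1 + p.2) ^ N * Real.exp (-δ * p.2))))) := by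
          gcongr; linarith
      _ = M * (2 ^ N * ((|C0| + |C1|) * ((1 + p.2) ^ (N + N) * Real.exp (-δ * p.2)))) := by
          rw [pow_add]; ring
      _ ≤ _ := by gcongr; exact hD _ hy
  · refine tendsto_const_nhds.congr' ?_
    filter_upwards [eventually_gt_atTop (B + p.2)] with R hR
    rw [hpf, show ζ (p.2 - R) = 0 from ?_, zero_mul]
    by_contra h0
    have := neg_le_of_abs_le (hz _ h0)
    linarith

lemma eq_zero_of_opQ {F : (ℝ × ℝ → ℂ) → ℂ}
    (hadd : ∀ f g, IsTestC offFreq f → IsTestC offFreq g → F (fun q => f q + g q) = F f + F g)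
    (hQ : ∀ g, IsTestC offFreqUpper g → F (opQ g) = 0)
    (hdec : ∀ ζ m, IsTestC univ ζ → IsTestC {ξ : ℝ | ξ ≠ 0} m →
      Tendsto (fun R => F (farSymbol ζ m R)) atTop (𝓝 0))
    {b : ℝ × ℝ → ℂ} (hb : IsTestC offFreqUpper b) : F b = 0 := by
  have hg := hb.upper_mul_expC 1
  set g : ℝ × ℝ → ℂ := fun q => expC 1 q * b q with hgdef
  obtain ⟨K, hK, hK0, y₁, y₂, hy₁, hbox⟩ := hg.exists_box
  have hm := isTestC_moment hg
  set m : ℝ → ℂ := fun ξ => ∫ t, g (ξ, t)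
  obtain ⟨χ, hχ⟩ : ∃ χ : ℝ → ℂ, χ = fun t => ((Real.smoothTransition (-t) : ℝ) : ℂ) := ⟨_, rfl⟩
  have hχc : ContDiff ℝ ∞ χ := by
    rw [hχ]
    exact Complex.ofRealCLM.contDiff.comp (Real.smoothTransition.contDiff.comp contDiff_neg)
  have hχ1 : ∀ t ≤ -1, χ t = 1 := fun t ht => by
    simp [hχ, Real.smoothTransition.one_of_one_le (by linarith : (1 : ℝ) ≤ -t)]
  have hχ0 : ∀ t, 0 ≤ t → χ t = 0 := fun t ht => by
    simp [hχ, Real.smoothTransition.zero_of_nonpos (by linarith : -t ≤ (0 : ℝ))]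
  have hd1 : ∀ t < -1, deriv χ t = 0 := fun t ht => by
    have : χ =ᶠ[𝓝 t] fun _ => 1 := by
      filter_upwards [Iio_mem_nhds ht] with s hs using hχ1 s (le_of_lt hs)
    rw [this.deriv_eq]; simp
  have hd0 : ∀ t > 0, deriv χ t = 0 := fun t ht => by
    have : χ =ᶠ[𝓝 t] fun _ => 0 := by
      filter_upwards [Ioi_mem_nhds ht] with s hs using hχ0 s (le_of_lt hs)
    rw [this.deriv_eq]; simp
  have hζ : IsTestC univ (deriv χ) := by
    refine isTestC_of_subset (K := Icc (-1) 0) ((contDiff_infty_iff_deriv.1 hχc).2)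
      isCompact_Icc (subset_univ _) fun t ht => ?_
    by_cases h : t < -1
    · exact hd1 t h
    · exact hd0 t (by by_contra h2; exact ht ⟨not_lt.1 h, not_lt.1 h2⟩)
  have key : ∀ R, y₂ + 1 < R → F b + F (farSymbol (deriv χ) m R) = 0 := by
    intro R hR
    have hB : IsTestC offFreqUpper fun q => χ (q.2 - R) * anti g q := by
      refine isTestC_of_subset (K := K ×ˢ Icc y₁ R) ?_ (hK.prod isCompact_Icc)
        (fun q hq => ⟨hK0 hq.1, hy₁.trans_le hq.2.1⟩) fun q hq => ?_
      · exact (hχc.comp (contDiff_snd.sub contDiff_const)).mul (contDiff_anti hg)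
      · by_cases h1 : q.1 ∈ K
        · by_cases h2 : y₁ ≤ q.2
          · rw [hχ0 _, zero_mul]
            by_contra h3
            exact hq ⟨h1, h2, by linarith [not_le.1 h3]⟩
          · rw [anti_eq_zero_of_le (fun q hq => (hbox q hq).2.1) (not_le.1 h2), mul_zero]
        · rw [anti_eq_zero_of_notMem (fun q hq => (hbox q hq).1) h1, mul_zero]
    have h := hQ _ (hB.upper_mul_expC (-1))
    rw [opQ_expC_neg_one hB.upper_toOff] at h
    rw [← hadd _ _ hb.upper_toOff (isTestC_farSymbol hζ hm R), ← h]
    congr 1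
    ext q
    have hdB : dy (fun q => χ (q.2 - R) * anti g q) q
        = deriv χ (q.2 - R) * anti g q + χ (q.2 - R) * g q := by
      refine dy_eq_of_hasDerivAt hB.1 ?_
      have e1 : HasDerivAt (fun y => χ (y - R)) (deriv χ (q.2 - R)) q.2 :=
        HasDerivAt.comp_sub_const _ _ (hχc.differentiable (by simp) _).hasDerivAt
      have e2 := hasDerivAt_slice (contDiff_anti hg) q
      rw [dy_anti hg] at e2
      exact e1.mul e2
    have e1 : χ (q.2 - R) * g q = g q := by
      by_cases h0 : g q = 0
      · rw [h0, mul_zero]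
      · rw [hχ1 _ (by have := (hbox q h0).2.2; linarith), one_mul]
    have e2 : deriv χ (q.2 - R) * anti g q = deriv χ (q.2 - R) * m q.1 := by
      by_cases h0 : q.2 - R < -1
      · rw [hd1 _ h0, zero_mul, zero_mul]
      · rw [anti_eq_integral (fun q hq => (hbox q hq).2.2) (by linarith [not_lt.1 h0])]
    rw [hdB, e1, e2]
    simp only [farSymbol, hgdef]
    linear_combination (-b q) * expC_mul_expC q
  have hlim := (hdec _ _ hζ hm).const_add (F b)
  rw [add_zero] at hlim
  refine tendsto_nhds_unique (hlim.congr' (f₂ := fun _ => (0 : ℂ)) ?_) tendsto_const_nhds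
  filter_upwards [eventually_gt_atTop (y₂ + 1)] with R hR using key R hR

section reduction

variable {u₀ u₁ : ℝ × ℝ → ℝ} {c : ℝ}

lemma tendsto_pairA_farSymbol (h₀ : TemperedFun u₀) (h₁ : TemperedFun u₁) {ζ m : ℝ → ℂ}
    (hζ : IsTestC univ ζ) (hm : IsTestC {ξ : ℝ | ξ ≠ 0} m) :
    Tendsto (fun R => pairA u₀ u₁ (farSymbol ζ m R)) atTop (𝓝 0) := by
  have a := tendsto_pftPair_farSymbol h₀ hζ (m := fun ξ => Complex.I * ξ * m ξ)
    (hm.mul_left' (contDiff_const.mul Complex.ofRealCLM.contDiff))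
  have b := tendsto_pftPair_farSymbol h₁ hζ (m := fun ξ => absC ξ * m ξ)
    (hm.mul_left isOpen_ne contDiffOn_absC)
  have := a.sub b
  rw [sub_zero] at this
  refine this.congr fun R => ?_
  simp only [pairA]
  congr 2 <;> ext q <;> simp only [farSymbol] <;> ring

lemma tendsto_pairB_farSymbol (h₀ : TemperedFun u₀) (h₁ : TemperedFun u₁) {ζ m : ℝ → ℂ}
    (hζ : IsTestC univ ζ) (hm : IsTestC {ξ : ℝ | ξ ≠ 0} m) :
    Tendsto (fun R => pairB u₀ u₁ (farSymbol ζ m R)) atTop (𝓝 0) := by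
  have a := tendsto_pftPair_farSymbol h₀ hζ (m := fun ξ => Complex.I * ξ * m ξ)
    (hm.mul_left' (contDiff_const.mul Complex.ofRealCLM.contDiff))
  have b := tendsto_pftPair_farSymbol h₁ hζ (m := fun ξ => absC ξ * m ξ)
    (hm.mul_left isOpen_ne contDiffOn_absC)
  have := a.neg.sub b
  rw [sub_zero, neg_zero] at this
  refine this.congr fun R => ?_
  simp only [pairB]
  congr 2 <;> [congr 1; skip] <;> ext q <;> simp only [farSymbol] <;> ring

lemma opQ_farSymbol {ζ m : ℝ → ℂ} (hζ : IsTestC univ ζ) (hm : IsTestC {ξ : ℝ | ξ ≠ 0} m) (R : ℝ) :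
    opQ (farSymbol ζ m R) = farSymbol (deriv ζ) m R := by
  ext q; rw [opQ, dy_farSymbol hζ hm]; ring

lemma opP_farSymbol {ζ m : ℝ → ℂ} (hζ : IsTestC univ ζ) (hm : IsTestC {ξ : ℝ | ξ ≠ 0} m) (R : ℝ) :
    opP (farSymbol ζ m R) = fun q => farSymbol (deriv ζ) m R q
      + farSymbol ζ (fun ξ => -2 * (absC ξ * m ξ)) R q := by
  ext q; rw [opP, dy_farSymbol hζ hm]; simp only [farSymbol]; ring

lemma pairAB_opQ_opP (h₀ : TemperedFun u₀) (h₁ : TemperedFun u₁) (hL : UpperLame c u₀ u₁)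
    {b : ℝ × ℝ → ℂ} (hb : IsTestC offFreqUpper b) :
    c / 2 * pairA u₀ u₁ (opQ b) + (1 + c / 2) * pairB u₀ u₁ (opP b) = 0 := by
  refine eq_zero_of_opQ (F := fun b => c / 2 * pairA u₀ u₁ (opQ b)
    + (1 + c / 2) * pairB u₀ u₁ (opP b)) (fun f g hf hg => ?_)
    (fun g hg => lame_pairB h₀ h₁ hL hg) (fun ζ m hζ hm => ?_) hb
  · simp only [opQ_add hf hg, opP_add hf hg, pairA_add h₀ h₁ hf.opQ hg.opQ,
      pairB_add h₀ h₁ hf.opP hg.opP]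
    ring
  · have hm2 := (hm.mul_left isOpen_ne contDiffOn_absC).const_mul (-2)
    have h1 := ((tendsto_pairA_farSymbol h₀ h₁ hζ.deriv hm).const_mul (c / 2 : ℂ)).add
      (((tendsto_pairB_farSymbol h₀ h₁ hζ.deriv hm).add
        (tendsto_pairB_farSymbol h₀ h₁ hζ hm2)).const_mul (1 + c / 2 : ℂ))
    simp only [add_zero, mul_zero] at h1
    refine h1.congr fun R => ?_
    rw [opQ_farSymbol hζ hm, opP_farSymbol hζ hm, pairB_add h₀ h₁
      (isTestC_farSymbol hζ.deriv hm R) (isTestC_farSymbol hζ hm2 R)]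

lemma pairA_opP (h₀ : TemperedFun u₀) (h₁ : TemperedFun u₁) (hL : UpperLame c u₀ u₁) (hc : 0 < c)
    {b : ℝ × ℝ → ℂ} (hb : IsTestC offFreqUpper b) : pairA u₀ u₁ (opP b) = 0 := by
  refine eq_zero_of_opQ (F := fun b => pairA u₀ u₁ (opP b)) (fun f g hf hg => ?_)
    (fun g hg => ?_) (fun ζ m hζ hm => ?_) hb
  · simp only [opP_add hf hg, pairA_add h₀ h₁ hf.opP hg.opP]
  · have e1 := lame_pairA h₀ h₁ hL hg
    have e2 := pairAB_opQ_opP h₀ h₁ hL hg.upper_opP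
    rw [show opQ (opP g) = opP (opQ g) from funext fun q => by
      rw [opQ_opP hg.upper_toOff, opP_opQ hg.upper_toOff]] at e2
    have hc1 : (1 + c : ℂ) ≠ 0 := by
      have : (1 + c : ℝ) ≠ 0 := by linarith
      exact_mod_cast this
    have : (1 + c : ℂ) * pairA u₀ u₁ (opP (opQ g)) = 0 := by
      linear_combination (1 + c / 2 : ℂ) * e1 - (c / 2 : ℂ) * e2
    exact (mul_eq_zero.1 this).resolve_left hc1
  · have hm2 := (hm.mul_left isOpen_ne contDiffOn_absC).const_mul (-2)
    have h1 := (tendsto_pairA_farSymbol h₀ h₁ hζ.deriv hm).add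
        (tendsto_pairA_farSymbol h₀ h₁ hζ hm2)
    simp only [add_zero] at h1
    refine h1.congr fun R => ?_
    rw [opP_farSymbol hζ hm, pairA_add h₀ h₁
      (isTestC_farSymbol hζ.deriv hm R) (isTestC_farSymbol hζ hm2 R)]

/-- The combination of `pairB` and `pairA` which is annihilated by `∂_y - |ξ|`. -/
def pairC (γ : ℝ) (u₀ u₁ : ℝ × ℝ → ℝ) (g : ℝ × ℝ → ℂ) : ℂ :=
  pairB u₀ u₁ g - 2 * γ * pairA u₀ u₁ (fun q => absC q.1 * (q.2 * g q))

lemma pairC_opP (h₀ : TemperedFun u₀) (h₁ : TemperedFun u₁) (hL : UpperLame c u₀ u₁) (hc : 0 < c)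
    {γ : ℝ} (hγ : γ * (2 + c) = c) {b : ℝ × ℝ → ℂ} (hb : IsTestC offFreqUpper b) :
    pairC γ u₀ u₁ (opP b) = 0 := by
  have hb' := hb.upper_toOff
  have e1 := pairAB_opQ_opP h₀ h₁ hL hb
  have e2 := pairA_opP h₀ h₁ hL hc hb
  have e3 := pairA_opP h₀ h₁ hL hc hb.mul_snd.upper_mul_absC
  have f1 : opQ b = fun q => opP b q + 2 * (absC q.1 * b q) := by
    ext q; simp only [opQ, opP]; ring
  have f2 : opP (fun q => absC q.1 * (q.2 * b q)) = fun q => absC q.1 * (q.2 * opP b q)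
      + absC q.1 * b q := by
    ext q
    rw [opP, dy_absC_mul hb'.mul_snd, dy_snd_mul hb']
    simp only [opP]; ring
  rw [f1, pairA_add h₀ h₁ hb'.opP (hb'.mul_absC.const_mul 2), pairA_const_mul, e2] at e1
  rw [f2, pairA_add h₀ h₁ hb'.opP.mul_snd.mul_absC hb'.mul_absC] at e3
  have hγ' : (γ : ℂ) * (2 + c) = c := by exact_mod_cast hγ
  have hc2 : (2 + c : ℂ) ≠ 0 := by
    have : (2 + c : ℝ) ≠ 0 := by linarith
    exact_mod_cast this
  refine (mul_eq_zero.1 (?_ : (2 + c : ℂ) * pairC γ u₀ u₁ (opP b) = 0)).resolve_left hc2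
  rw [pairC]
  linear_combination 2 * e1 - 2 * c * e3 -
    2 * pairA u₀ u₁ (fun q => absC q.1 * (q.2 * opP b q)) * hγ'

end reduction

/-! ### Representation by boundary values -/

/-- The exponential moment `∫ e^{-s t} η(t) dt`. -/
def expMoment (η : ℝ → ℂ) (s : ℝ) : ℂ := ∫ t : ℝ, Complex.exp (-((s : ℂ) * t)) * η t

/-- The product symbol `ψ(ξ) η(y)`. -/
def tensor (ψ η : ℝ → ℂ) (q : ℝ × ℝ) : ℂ := ψ q.1 * η q.2

/-- `ε⁻¹ ρ(y / ε)`. -/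
def scaled (ρ : ℝ → ℝ) (ε : ℝ) (y : ℝ) : ℂ := ((ε⁻¹ * ρ (y / ε) : ℝ) : ℂ)

/-- Pairing of a tempered function on the line with a Fourier transform. -/
def ftPair (v : ℝ → ℝ) (ψ : ℝ → ℂ) : ℂ := ∫ x, (v x : ℂ) * ft ψ x

section ftPair

variable {v : ℝ → ℝ} {f g : ℝ → ℂ} {Ω Ω' : Set ℝ}

lemma ftPair_integrable (hv : TemperedFun v) (hg : IsTestC Ω g) :
    Integrable fun x => (v x : ℂ) * ft g x :=
  hv.integrable_mul (continuous_ft hg.integrable).aestronglyMeasurable (rapid_ft hg)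

lemma ftPair_add (hv : TemperedFun v) (hf : IsTestC Ω f) (hg : IsTestC Ω' g) :
    ftPair v (fun ξ => f ξ + g ξ) = ftPair v f + ftPair v g := by
  rw [ftPair, ftPair, ftPair, ← integral_add (ftPair_integrable hv hf) (ftPair_integrable hv hg)]
  simp only [ft_add hf.integrable hg.integrable, mul_add]

lemma ftPair_const_mul (c : ℂ) (g : ℝ → ℂ) : ftPair v (fun ξ => c * g ξ) = c * ftPair v g := by
  rw [ftPair, ftPair, ← integral_const_mul]
  simp only [ft_const_mul, mul_left_comm]

lemma ftPair_neg (g : ℝ → ℂ) : ftPair v (fun ξ => -g ξ) = -ftPair v g := by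
  simpa using ftPair_const_mul (v := v) (-1) g

lemma ftPair_sub (hv : TemperedFun v) (hf : IsTestC Ω f) (hg : IsTestC Ω' g) :
    ftPair v (fun ξ => f ξ - g ξ) = ftPair v f - ftPair v g := by
  simp only [sub_eq_add_neg]
  rw [ftPair_add hv hf hg.neg, ftPair_neg]

end ftPair

lemma contDiff_expMoment {Ω : Set ℝ} {η : ℝ → ℂ} (hη : IsTestC Ω η) :
    ContDiff ℝ ∞ (expMoment η) := by
  have h := contDiffOn_integral_param (P := ℝ) (s := univ) isOpen_univ hη.2.1.isCompact
    (g := fun s t => Complex.exp (-((s : ℂ) * t)) * η t)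
    (fun s t _ ht => by rw [image_eq_zero_of_notMem_tsupport ht, mul_zero]) (by
      apply ContDiff.contDiffOn
      have h1 : ContDiff ℝ ∞ fun q : ℝ × ℝ => (q.1 : ℂ) :=
        Complex.ofRealCLM.contDiff.comp contDiff_fst
      have h2 : ContDiff ℝ ∞ fun q : ℝ × ℝ => (q.2 : ℂ) :=
        Complex.ofRealCLM.contDiff.comp contDiff_snd
      exact (h1.mul h2).neg.cexp.mul (hη.1.comp contDiff_snd))
  rwa [contDiffOn_univ] at h

lemma contDiffOn_expMoment_abs {Ω : Set ℝ} {η : ℝ → ℂ} (hη : IsTestC Ω η) :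
    ContDiffOn ℝ ∞ (fun ξ => expMoment η |ξ|) {ξ : ℝ | ξ ≠ 0} :=
  (contDiff_expMoment hη).comp_contDiffOn fun _ hξ => (contDiffAt_abs hξ).contDiffWithinAt

lemma expMoment_scaled (ρ : ℝ → ℝ) {ε : ℝ} (hε : 0 < ε) (s : ℝ) :
    expMoment (scaled ρ ε) s = expMoment (fun t => (ρ t : ℂ)) (ε * s) := by
  have h := Measure.integral_comp_div
    (fun t : ℝ => Complex.exp (-(((ε * s : ℝ) : ℂ) * t)) * (ρ t : ℂ)) ε
  rw [abs_of_pos hε] at h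
  have hε' : (ε : ℂ) ≠ 0 := by exact_mod_cast hε.ne'
  have e : expMoment (fun t => (ρ t : ℂ)) (ε * s) = (ε : ℂ)⁻¹ * ((ε : ℂ) *
      expMoment (fun t => (ρ t : ℂ)) (ε * s)) := by field_simp
  rw [e, expMoment, expMoment, ← Complex.real_smul, ← h, ← integral_const_mul]
  refine integral_congr_ae (Eventually.of_forall fun t => ?_)
  simp only [scaled]
  push_cast
  rw [show ((ε : ℂ) * s * (t / ε)) = (s : ℂ) * t by field_simp]
  ring

lemma expMoment_zero (η : ℝ → ℂ) : expMoment η 0 = ∫ t, η t := by simp [expMoment]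

lemma isTest_scaled {ρ : ℝ → ℝ} (hρ : IsTest (Ioi 0) ρ) {ε : ℝ} (hε : 0 < ε) :
    IsTestC (Ioi 0) (scaled ρ ε) := by
  refine isTestC_of_subset (K := (fun y => ε * y) '' tsupport ρ) ?_
    (hρ.2.1.isCompact.image (by fun_prop)) ?_ fun y hy => ?_
  · exact Complex.ofRealCLM.contDiff.comp
      (contDiff_const.mul (hρ.1.comp (contDiff_id.div_const ε)))
  · rintro _ ⟨y, hy, rfl⟩
    exact mul_pos hε (hρ.2.2 hy)
  · rw [scaled, image_eq_zero_of_notMem_tsupport (f := ρ) fun h => hy ⟨y / ε, h, ?_⟩]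
    · simp
    · field_simp

lemma IsTestC.tensor_upper {ψ η : ℝ → ℂ} (hψ : IsTestC {ξ : ℝ | ξ ≠ 0} ψ)
    (hη : IsTestC (Ioi 0) η) : IsTestC offFreqUpper (tensor ψ η) :=
  hψ.prodMul hη

lemma pftPair_tendsto_slice {u : ℝ × ℝ → ℝ} (hu : TemperedFun u) {Ω : Set (ℝ × (ℝ × ℝ))}
    {G : ℝ × (ℝ × ℝ) → ℂ} (hG : IsTestC Ω G) :
    Tendsto (fun ε => pftPair u fun q => G (q.1, (q.2, ε))) (𝓝 0)
      (𝓝 (pftPair u fun q => G (q.1, (q.2, 0)))) := by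
  have hp : ∀ (ε : ℝ) (p : ℝ × ℝ),
      pft (fun q => G (q.1, (q.2, ε))) p = pft G (p.1, (p.2, ε)) := fun ε p => rfl
  have hc : Continuous (pft G) := (contDiff_pft hG).continuous
  refine hu.tendsto_integral (Eventually.of_forall fun ε => ?_) (fun N => ?_) fun p => ?_
  · exact (hc.comp (by fun_prop :
      Continuous fun p : ℝ × ℝ => (p.1, (p.2, ε)))).aestronglyMeasurable
  · obtain ⟨C, hC0, hC⟩ := pft_decay N hG
    have hk : IsCompact ((fun e : ℝ × (ℝ × ℝ) => e.2.1) '' tsupport G) :=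
      hG.2.1.isCompact.image (by fun_prop)
    obtain ⟨B, hB⟩ := hk.isBounded.exists_norm_le
    refine ⟨C * (1 + |B|) ^ N, Eventually.of_forall fun ε p => ?_⟩
    rw [hp]
    by_cases h : (p.2, ε) ∈ Prod.snd '' tsupport G
    · obtain ⟨e, he, h2⟩ := h
      have h3 : |p.2| ≤ |B| :=
        (hB _ ⟨e, he, congrArg Prod.fst h2⟩).trans (le_abs_self _)
      calc (1 + ‖p‖) ^ N * ‖pft G (p.1, (p.2, ε))‖
          ≤ ((1 + |p.1|) * (1 + |B|)) ^ N * ‖pft G (p.1, (p.2, ε))‖ := by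
            gcongr
            exact (prod_norm_le p).trans (by gcongr)
        _ = (1 + |p.1|) ^ N * ‖pft G (p.1, (p.2, ε))‖ * (1 + |B|) ^ N := by rw [mul_pow]; ring
        _ ≤ C * (1 + |B|) ^ N := by gcongr; exact hC (p.1, (p.2, ε))
    · rw [pft_eq_zero (p := (p.1, (p.2, ε))) h, norm_zero, mul_zero]
      positivity
  · exact (hc.comp (by fun_prop : Continuous fun ε : ℝ => (p.1, (p.2, ε)))).tendsto 0

lemma ftPair_tendsto_slice {v : ℝ → ℝ} (hv : TemperedFun v) {Ω : Set (ℝ × ℝ)}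
    {G : ℝ × ℝ → ℂ} (hG : IsTestC Ω G) :
    Tendsto (fun ε => ftPair v fun ξ => G (ξ, ε)) (𝓝 0) (𝓝 (ftPair v fun ξ => G (ξ, 0))) := by
  have hp : ∀ (ε : ℝ) (x : ℝ), ft (fun ξ => G (ξ, ε)) x = pft G (x, ε) := fun ε p => rfl
  have hc : Continuous (pft G) := (contDiff_pft hG).continuous
  refine hv.tendsto_integral (Eventually.of_forall fun ε => ?_) (fun N => ?_) fun x => ?_
  · exact (hc.comp (by fun_prop : Continuous fun x : ℝ => (x, ε))).aestronglyMeasurable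
  · obtain ⟨C, hC0, hC⟩ := pft_decay N hG
    exact ⟨C, Eventually.of_forall fun ε x => hC (x, ε)⟩
  · exact (hc.comp (by fun_prop : Continuous fun ε : ℝ => (x, ε))).tendsto 0

lemma eq_zero_of_moment {F : (ℝ × ℝ → ℂ) → ℂ}
    (hP : ∀ b, IsTestC offFreqUpper b → F (opP b) = 0) {g : ℝ × ℝ → ℂ}
    (hg : IsTestC offFreqUpper g) (h0 : ∀ ξ, ∫ y : ℝ, expC (-1) (ξ, y) * g (ξ, y) = 0) : F g = 0 := by
  have h1 := hg.upper_mul_expC (-1)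
  have h2 := isTestC_anti h1 h0
  have h3 := hP _ (h2.upper_mul_expC 1)
  rw [opP_expC_one h2.upper_toOff, dy_anti h1] at h3
  rw [← h3]
  congr 1; ext q
  rw [← mul_assoc, expC_mul_expC, one_mul]

lemma integral_expC_neg_one (η : ℝ → ℂ) (ξ : ℝ) :
    ∫ y : ℝ, expC (-1) (ξ, y) * η y = expMoment η |ξ| := by
  rw [expMoment]
  congr 1; ext y
  rw [expC]
  congr 2; push_cast; ring

lemma tensor_eq_transport {F : (ℝ × ℝ → ℂ) → ℂ}
    (hsub : ∀ f g, IsTestC offFreqUpper f → IsTestC offFreqUpper g →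
      F (fun q => f q - g q) = F f - F g)
    (hP : ∀ b, IsTestC offFreqUpper b → F (opP b) = 0) {ψ η ρ : ℝ → ℂ}
    (hψ : IsTestC {ξ : ℝ | ξ ≠ 0} ψ) (hη : IsTestC (Ioi 0) η) (hρ : IsTestC (Ioi 0) ρ)
    (hρ1 : ∫ y, ρ y = 1) :
    F (tensor ψ η) = F fun q => expC 1 q * tensor (fun ξ => expMoment η |ξ| * ψ ξ) ρ q := by
  have hm := hψ.mul_left isOpen_ne (contDiffOn_expMoment_abs hη)
  have h2 := (hm.tensor_upper hρ).upper_mul_expC 1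
  rw [← sub_eq_zero, ← hsub _ _ (hψ.tensor_upper hη) h2]
  refine eq_zero_of_moment hP ((hψ.tensor_upper hη).sub h2) fun ξ => ?_
  have e : ∀ y, expC (-1) (ξ, y) * (tensor ψ η (ξ, y) -
      expC 1 (ξ, y) * tensor (fun ξ => expMoment η |ξ| * ψ ξ) ρ (ξ, y)) =
      ψ ξ * (expC (-1) (ξ, y) * η y) - expMoment η |ξ| * ψ ξ * ρ y := fun y => by
    simp only [tensor]
    linear_combination (-(expMoment η |ξ| * ψ ξ * ρ y)) * expC_mul_expC' (ξ, y)
  have hi : Integrable fun y => expC (-1) (ξ, y) * η y :=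
    (hη.mul_left' (h := fun y : ℝ => expC (-1) (ξ, y)) (by
      have : ContDiff ℝ ∞ fun y : ℝ => ((-1 * |ξ| * y : ℝ) : ℂ) :=
        Complex.ofRealCLM.contDiff.comp (contDiff_const.mul contDiff_id)
      exact this.cexp)).integrable
  simp only [e]
  rw [integral_sub (hi.const_mul _) (hρ.integrable.const_mul _), integral_const_mul,
    integral_const_mul, hρ1, integral_expC_neg_one]
  ring

/-- A linear functional on symbols given by two tempered functions and two multipliers. -/
def symbolPair (u₀ u₁ : ℝ × ℝ → ℝ) (h₀ h₁ g : ℝ × ℝ → ℂ) : ℂ :=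
  pftPair u₀ (fun q => h₀ q * g q) + pftPair u₁ (fun q => h₁ q * g q)

lemma symbolPair_tensor {u₀ u₁ : ℝ × ℝ → ℝ} (hu₀ : TemperedFun u₀) (hu₁ : TemperedFun u₁)
    {h₀ h₁ : ℝ × ℝ → ℂ} (hh₀ : ContDiffOn ℝ ∞ h₀ offFreq) (hh₁ : ContDiffOn ℝ ∞ h₁ offFreq)
    (hP : ∀ b, IsTestC offFreqUpper b → symbolPair u₀ u₁ h₀ h₁ (opP b) = 0)
    {ρ : ℝ → ℝ} (hρ : IsTest (Ioi 0) ρ) (hρ1 : ∫ y, ρ y = 1) {B : (ℝ → ℂ) → ℂ}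
    (hB : ∀ ψ, IsTestC {ξ : ℝ | ξ ≠ 0} ψ → Tendsto
      (fun ε => symbolPair u₀ u₁ h₀ h₁ (tensor ψ (scaled ρ ε))) (𝓝[>] 0) (𝓝 (B ψ)))
    {ψ η : ℝ → ℂ} (hψ : IsTestC {ξ : ℝ | ξ ≠ 0} ψ) (hη : IsTestC (Ioi 0) η) :
    symbolPair u₀ u₁ h₀ h₁ (tensor ψ η) = B fun ξ => expMoment η |ξ| * ψ ξ := by
  have hρC := hρ.ofReal
  have hρ1' : ∫ y : ℝ, (ρ y : ℂ) = 1 := by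
    have := integral_ofReal (𝕜 := ℂ) (f := ρ) (μ := volume)
    rw [hρ1] at this
    exact_mod_cast this
  have hsub : ∀ f g, IsTestC offFreqUpper f → IsTestC offFreqUpper g →
      symbolPair u₀ u₁ h₀ h₁ (fun q => f q - g q)
        = symbolPair u₀ u₁ h₀ h₁ f - symbolPair u₀ u₁ h₀ h₁ g := by
    intro f g hf hg
    have m : ∀ {f h}, IsTestC offFreqUpper f → ContDiffOn ℝ ∞ h offFreq →
        IsTestC offFreqUpper fun q => h q * f q := fun hf hh =>
      hf.mul_left isOpen_offFreqUpper (hh.mono offFreqUpper_subset)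
    simp only [symbolPair, mul_sub]
    rw [pftPair_sub hu₀ (m hf hh₀) (m hg hh₀), pftPair_sub hu₁ (m hf hh₁) (m hg hh₁)]
    ring
  have key : ∀ ψ, IsTestC {ξ : ℝ | ξ ≠ 0} ψ →
      symbolPair u₀ u₁ h₀ h₁ (fun q => expC 1 q * tensor ψ (fun y => (ρ y : ℂ)) q) = B ψ := by
    intro ψ hψ
    obtain ⟨χ, hχ, hχ1, -, -⟩ := exists_cutoff
    have hΩ : IsOpen {p : ℝ × (ℝ × ℝ) | p.1 ≠ 0} := isOpen_ne.preimage continuous_fst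
    have hproj : ContDiff ℝ ∞ fun p : ℝ × (ℝ × ℝ) => (p.1, p.2.1) :=
      contDiff_fst.prodMk (contDiff_fst.comp contDiff_snd)
    have hG0 : IsTestC {p : ℝ × (ℝ × ℝ) | p.1 ≠ 0}
        fun p => ψ p.1 * ((ρ p.2.1 : ℂ) * (χ p.2.2 : ℂ)) :=
      (hψ.prodMul (hρC.prodMul hχ.ofReal)).mono fun p hp => hp.1
    have hμ : ContDiffOn ℝ ∞ (fun p : ℝ × (ℝ × ℝ) => expMoment (fun t => (ρ t : ℂ))
        (p.2.2 * |p.1|)) {p | p.1 ≠ 0} := by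
      refine (contDiff_expMoment hρC).comp_contDiffOn ?_
      refine (contDiff_snd.comp contDiff_snd).contDiffOn.mul fun p hp => ?_
      exact ((contDiffAt_abs (n := ⊤) hp).comp p contDiffAt_fst).contDiffWithinAt
    have hG : ∀ {h}, ContDiffOn ℝ ∞ h offFreq → IsTestC {p : ℝ × (ℝ × ℝ) | p.1 ≠ 0}
        fun p => h (p.1, p.2.1) * (expC 1 (p.1, p.2.1) * (expMoment (fun t => (ρ t : ℂ))
        (p.2.2 * |p.1|) * (ψ p.1 * ((ρ p.2.1 : ℂ) * (χ p.2.2 : ℂ))))) := fun hh =>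
      ((hG0.mul_left hΩ hμ).mul_left hΩ
        ((contDiffOn_expC 1).comp hproj.contDiffOn fun p hp => hp)).mul_left hΩ
        (hh.comp hproj.contDiffOn fun p hp => hp)
    have T := (pftPair_tendsto_slice hu₀ (hG hh₀)).add (pftPair_tendsto_slice hu₁ (hG hh₁))
    have T2 := tendsto_nhds_unique ((T.mono_left nhdsWithin_le_nhds).congr' ?_) (hB ψ hψ)
    · rw [← T2, symbolPair]
      simp only [zero_mul, expMoment_zero, hρ1', one_mul, hχ1 0 (by simp), tensor,
        Complex.ofReal_one, mul_one]
    · filter_upwards [Ioo_mem_nhdsGT (zero_lt_one' ℝ)] with ε hε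
      rw [tensor_eq_transport hsub hP hψ (isTest_scaled hρ hε.1) hρC hρ1']
      have : χ ε = 1 := hχ1 _ (by rw [abs_of_pos hε.1]; exact hε.2.le)
      simp only [symbolPair, this, tensor, expMoment_scaled ρ hε.1, Complex.ofReal_one, mul_one,
        mul_assoc]
  rw [tensor_eq_transport hsub hP hψ hη hρC hρ1',
    key _ (hψ.mul_left isOpen_ne (contDiffOn_expMoment_abs hη))]

/-! ### Boundary values of complex test functions -/

lemma integral_ofReal_mul {α : Type*} [MeasurableSpace α] {μ : Measure α} {f : α → ℝ} {φ : α → ℂ}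
    (h : Integrable (fun a => (f a : ℂ) * φ a) μ) :
    ∫ a, (f a : ℂ) * φ a ∂μ = ((∫ a, f a * (φ a).re ∂μ : ℝ) : ℂ)
      + ((∫ a, f a * (φ a).im ∂μ : ℝ) : ℂ) * Complex.I := by
  rw [← integral_re_add_im h]
  simp

/-- The real part of a Schwartz function. -/
def schwartzRe (φ : 𝓢(ℝ, ℂ)) : 𝓢(ℝ, ℝ) := SchwartzMap.postcompCLM (𝕜 := ℝ) Complex.reCLM φ

/-- The imaginary part of a Schwartz function. -/
def schwartzIm (φ : 𝓢(ℝ, ℂ)) : 𝓢(ℝ, ℝ) := SchwartzMap.postcompCLM (𝕜 := ℝ) Complex.imCLM φ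

lemma schwartzRe_apply (φ : 𝓢(ℝ, ℂ)) (x : ℝ) : schwartzRe φ x = (φ x).re := rfl

lemma schwartzIm_apply (φ : 𝓢(ℝ, ℂ)) (x : ℝ) : schwartzIm φ x = (φ x).im := rfl

lemma HasBoundaryValue.tendsto_pftPair {f : ℝ × ℝ → ℝ} {g : ℝ → ℝ} (hf : TemperedFun f)
    (hg : TemperedFun g) (h : HasBoundaryValue 1 (pair f) (linePair g)) {ψ : ℝ → ℂ} {Ω : Set ℝ}
    (hψ : IsTestC Ω ψ) {ρ : ℝ → ℝ} (hρ : IsTest (Ioi 0) ρ) :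
    Tendsto (fun ε => pftPair f (tensor ψ (scaled ρ ε))) (𝓝[>] 0)
      (𝓝 (((∫ y, ρ y : ℝ) : ℂ) * ftPair g ψ)) := by
  obtain ⟨φ, hφ⟩ := exists_schwartz_ft (hψ.2.1.toSchwartzMap hψ.1)
  have hφ' : ∀ x, ft ψ x = φ x := fun x => (hφ x).symm
  have e1 := (Complex.continuous_ofReal.tendsto _).comp (h (schwartzRe φ) ρ hρ)
  have e2 := (Complex.continuous_ofReal.tendsto _).comp (h (schwartzIm φ) ρ hρ)
  have e3 := e1.add (e2.mul_const Complex.I)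
  have hR : ((∫ y, ρ y : ℝ) : ℂ) * ftPair g ψ =
      (((∫ y, ρ y) * linePair g (schwartzRe φ) : ℝ) : ℂ)
      + (((∫ y, ρ y) * linePair g (schwartzIm φ) : ℝ) : ℂ) * Complex.I := by
    rw [ftPair, integral_ofReal_mul (ftPair_integrable hg hψ)]
    simp only [hφ', linePair]
    push_cast
    simp only [schwartzRe_apply, schwartzIm_apply]
    ring
  rw [hR]
  refine e3.congr' ?_
  filter_upwards [self_mem_nhdsWithin] with ε hε
  have ht : IsTestC (univ ×ˢ Ioi 0) (tensor ψ (scaled ρ ε)) :=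
    hψ.toUniv.prodMul (isTest_scaled hρ hε)
  have hp : ∀ p, pft (tensor ψ (scaled ρ ε)) p = φ p.1 * scaled ρ ε p.2 := fun p => by
    have := ft_const_mul (scaled ρ ε p.2) ψ p.1
    rw [hφ'] at this
    rw [pft, mul_comm (φ p.1), ← this]
    simp only [tensor, mul_comm]
  rw [pftPair, integral_ofReal_mul (pftPair_integrable hf ht)]
  simp only [hp, Function.comp_apply, pair, scaled, one_mul, Complex.re_mul_ofReal,
    Complex.im_mul_ofReal, schwartzRe_apply, schwartzIm_apply]

/-! ### The solution in the upper half plane in terms of its boundary values -/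

lemma exists_isTest_integral_one : ∃ ρ : ℝ → ℝ, IsTest (Ioi 0) ρ ∧ ∫ y, ρ y = 1 := by
  let b : ContDiffBump (2 : ℝ) := ⟨1 / 2, 1, by norm_num, by norm_num⟩
  refine ⟨b.normed volume, ⟨b.contDiff_normed, b.hasCompactSupport_normed, ?_⟩,
    b.integral_normed⟩
  rw [b.tsupport_normed_eq]
  intro y hy
  have := (abs_le.1 (Real.dist_eq y 2 ▸ Metric.mem_closedBall.1 hy)).1
  simp only [mem_Ioi, b] at this ⊢
  linarith

lemma IsTest.id_mul {Ω : Set ℝ} {ρ : ℝ → ℝ} (hρ : IsTest Ω ρ) : IsTest Ω fun t => t * ρ t :=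
  ⟨contDiff_id.mul hρ.1, hρ.2.1.mul_left,
    (closure_mono (Function.support_mul_subset_right _ _)).trans hρ.2.2⟩

lemma IsTestC.id_mul {Ω : Set ℝ} {η : ℝ → ℂ} (hη : IsTestC Ω η) :
    IsTestC Ω fun t => (t : ℂ) * η t := hη.mul_left' Complex.ofRealCLM.contDiff

lemma IsTestC.I_mul {Ω : Set ℝ} {η : ℝ → ℂ} (hη : IsTestC Ω η) :
    IsTestC Ω fun t => Complex.I * t * η t :=
  hη.mul_left' (contDiff_const.mul Complex.ofRealCLM.contDiff)

lemma IsTestC.absC_mul {ψ : ℝ → ℂ} (hψ : IsTestC {ξ : ℝ | ξ ≠ 0} ψ) :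
    IsTestC {ξ : ℝ | ξ ≠ 0} fun ξ => absC ξ * ψ ξ := hψ.mul_left isOpen_ne contDiffOn_absC

lemma IsTestC.expMoment_mul {Ω : Set ℝ} {ψ η : ℝ → ℂ} (hψ : IsTestC {ξ : ℝ | ξ ≠ 0} ψ)
    (hη : IsTestC Ω η) : IsTestC {ξ : ℝ | ξ ≠ 0} fun ξ => expMoment η |ξ| * ψ ξ :=
  hψ.mul_left isOpen_ne (contDiffOn_expMoment_abs hη)

lemma snd_mul_scaled (ρ : ℝ → ℝ) {ε : ℝ} (hε : ε ≠ 0) (y : ℝ) :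
    (y : ℂ) * scaled ρ ε y = ε * scaled (fun t => t * ρ t) ε y := by
  have : (ε : ℂ) ≠ 0 := by exact_mod_cast hε
  simp only [scaled]
  push_cast
  field_simp

/-- Tempered solutions of the Lamé system in the upper half plane, with tempered boundary
values. -/
structure UpperSolution (c : ℝ) (u₀ u₁ : ℝ × ℝ → ℝ) (v₀ v₁ : ℝ → ℝ) : Prop where
  temp₀ : TemperedFun u₀
  temp₁ : TemperedFun u₁
  tempb₀ : TemperedFun v₀
  tempb₁ : TemperedFun v₁
  trace₀ : HasBoundaryValue 1 (pair u₀) (linePair v₀)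
  trace₁ : HasBoundaryValue 1 (pair u₁) (linePair v₁)
  lame : UpperLame c u₀ u₁

section upper

variable {c : ℝ} {u₀ u₁ : ℝ × ℝ → ℝ} {v₀ v₁ : ℝ → ℝ} {ψ η : ℝ → ℂ}

lemma pairA_tensor_eq (ψ η : ℝ → ℂ) : pairA u₀ u₁ (tensor ψ η)
    = pftPair u₀ (tensor (fun ξ => Complex.I * ξ * ψ ξ) η)
      - pftPair u₁ (tensor (fun ξ => absC ξ * ψ ξ) η) := by
  simp only [pairA]
  congr 2 <;> ext q <;> simp only [tensor] <;> ring

lemma pairB_tensor_eq (ψ η : ℝ → ℂ) : pairB u₀ u₁ (tensor ψ η)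
    = -pftPair u₀ (tensor (fun ξ => Complex.I * ξ * ψ ξ) η)
      - pftPair u₁ (tensor (fun ξ => absC ξ * ψ ξ) η) := by
  simp only [pairB]
  congr 2
  · congr 2; ext q; simp only [tensor]; ring
  · ext q; simp only [tensor]; ring

lemma UpperSolution.tendsto_pairA (h : UpperSolution c u₀ u₁ v₀ v₁)
    (hψ : IsTestC {ξ : ℝ | ξ ≠ 0} ψ) {ρ : ℝ → ℝ} (hρ : IsTest (Ioi 0) ρ) :
    Tendsto (fun ε => pairA u₀ u₁ (tensor ψ (scaled ρ ε))) (𝓝[>] 0)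
      (𝓝 (((∫ y, ρ y : ℝ) : ℂ) * (ftPair v₀ (fun ξ => Complex.I * ξ * ψ ξ)
        - ftPair v₁ (fun ξ => absC ξ * ψ ξ)))) := by
  simp only [pairA_tensor_eq, mul_sub]
  exact (h.trace₀.tendsto_pftPair h.temp₀ h.tempb₀ hψ.I_mul hρ).sub
    (h.trace₁.tendsto_pftPair h.temp₁ h.tempb₁ hψ.absC_mul hρ)

lemma UpperSolution.tendsto_pairB (h : UpperSolution c u₀ u₁ v₀ v₁)
    (hψ : IsTestC {ξ : ℝ | ξ ≠ 0} ψ) {ρ : ℝ → ℝ} (hρ : IsTest (Ioi 0) ρ) :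
    Tendsto (fun ε => pairB u₀ u₁ (tensor ψ (scaled ρ ε))) (𝓝[>] 0)
      (𝓝 (((∫ y, ρ y : ℝ) : ℂ) * (-ftPair v₀ (fun ξ => Complex.I * ξ * ψ ξ)
        - ftPair v₁ (fun ξ => absC ξ * ψ ξ)))) := by
  simp only [pairB_tensor_eq, mul_sub, mul_neg]
  exact (h.trace₀.tendsto_pftPair h.temp₀ h.tempb₀ hψ.I_mul hρ).neg.sub
    (h.trace₁.tendsto_pftPair h.temp₁ h.tempb₁ hψ.absC_mul hρ)

lemma UpperSolution.pairA_tensor (h : UpperSolution c u₀ u₁ v₀ v₁) (hc : 0 < c)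
    (hψ : IsTestC {ξ : ℝ | ξ ≠ 0} ψ) (hη : IsTestC (Ioi 0) η) :
    pairA u₀ u₁ (tensor ψ η) = ftPair v₀ (fun ξ => Complex.I * ξ * (expMoment η |ξ| * ψ ξ))
      - ftPair v₁ (fun ξ => absC ξ * (expMoment η |ξ| * ψ ξ)) := by
  obtain ⟨ρ, hρ, hρ1⟩ := exists_isTest_integral_one
  have e : ∀ g, symbolPair u₀ u₁ (fun q => Complex.I * q.1) (fun q => -absC q.1) g
      = pairA u₀ u₁ g := fun g => by
    simp only [symbolPair, pairA, neg_mul, pftPair_neg, sub_eq_add_neg]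
  rw [← e]
  refine symbolPair_tensor h.temp₀ h.temp₁ (B := fun ψ => ftPair v₀ (fun ξ => Complex.I * ξ * ψ ξ)
      - ftPair v₁ (fun ξ => absC ξ * ψ ξ)) ?_ contDiffOn_absC_fst.neg (fun b hb => ?_) hρ hρ1
      (fun ψ hψ => ?_) hψ hη
  · exact (contDiff_const.mul (Complex.ofRealCLM.contDiff.comp contDiff_fst)).contDiffOn
  · rw [e, pairA_opP h.temp₀ h.temp₁ h.lame hc hb]
  · simp only [e]
    simpa [hρ1] using h.tendsto_pairA hψ hρ

lemma pairC_tensor_eq (γ : ℝ) (ψ η : ℝ → ℂ) : pairC γ u₀ u₁ (tensor ψ η)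
    = pairB u₀ u₁ (tensor ψ η)
      - 2 * γ * pairA u₀ u₁ (tensor (fun ξ => absC ξ * ψ ξ) fun t => (t : ℂ) * η t) := by
  simp only [pairC]
  congr 3
  ext q; simp only [tensor]; ring

lemma UpperSolution.pairC_tensor (h : UpperSolution c u₀ u₁ v₀ v₁) (hc : 0 < c) {γ : ℝ}
    (hγ : γ * (2 + c) = c) (hψ : IsTestC {ξ : ℝ | ξ ≠ 0} ψ) (hη : IsTestC (Ioi 0) η) :
    pairC γ u₀ u₁ (tensor ψ η)
      = -ftPair v₀ (fun ξ => Complex.I * ξ * (expMoment η |ξ| * ψ ξ))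
      - ftPair v₁ (fun ξ => absC ξ * (expMoment η |ξ| * ψ ξ)) := by
  obtain ⟨ρ, hρ, hρ1⟩ := exists_isTest_integral_one
  have hξ : ContDiff ℝ ∞ fun q : ℝ × ℝ => Complex.I * q.1 :=
    contDiff_const.mul (Complex.ofRealCLM.contDiff.comp contDiff_fst)
  have hy : ContDiff ℝ ∞ fun q : ℝ × ℝ => (q.2 : ℂ) :=
    Complex.ofRealCLM.contDiff.comp contDiff_snd
  have e : ∀ g, IsTestC offFreqUpper g →
      symbolPair u₀ u₁ (fun q => -(Complex.I * q.1) - 2 * γ * (Complex.I * q.1 * (absC q.1 * q.2)))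
        (fun q => -absC q.1 + 2 * γ * (absC q.1 * (absC q.1 * q.2))) g = pairC γ u₀ u₁ g := by
    intro g hg
    have hg' := hg.upper_toOff
    have e0 : (fun q : ℝ × ℝ => (-(Complex.I * q.1) -
        2 * γ * (Complex.I * q.1 * (absC q.1 * q.2))) * g q) = fun q => -(Complex.I * q.1 * g q)
        - 2 * γ * (Complex.I * q.1 * (absC q.1 * (q.2 * g q))) := by ext q; ring
    have e1 : (fun q : ℝ × ℝ => (-absC q.1 + 2 * γ * (absC q.1 * (absC q.1 * q.2))) * g q)
        = fun q => -(absC q.1 * g q) + 2 * γ * (absC q.1 * (absC q.1 * (q.2 * g q))) := by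
      ext q; ring
    rw [symbolPair, e0, e1, pftPair_sub h.temp₀ hg'.mul_I_xi'.neg
      (hg'.mul_snd.mul_absC.mul_I_xi'.const_mul _), pftPair_add h.temp₁ hg'.mul_absC.neg
      (hg'.mul_snd.mul_absC.mul_absC.const_mul _), pairC, pairA, pairB, pftPair_neg, pftPair_neg,
      pftPair_const_mul, pftPair_const_mul]
    ring
  rw [← e _ (hψ.tensor_upper hη)]
  refine symbolPair_tensor h.temp₀ h.temp₁ (B := fun ψ =>
      -ftPair v₀ (fun ξ => Complex.I * ξ * ψ ξ) - ftPair v₁ (fun ξ => absC ξ * ψ ξ)) ?_ ?_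
      (fun b hb => ?_) hρ hρ1 (fun ψ hψ => ?_) hψ hη
  · exact hξ.neg.contDiffOn.sub (contDiffOn_const.mul
      (hξ.contDiffOn.mul (contDiffOn_absC_fst.mul hy.contDiffOn)))
  · exact contDiffOn_absC_fst.neg.add (contDiffOn_const.mul
      (contDiffOn_absC_fst.mul (contDiffOn_absC_fst.mul hy.contDiffOn)))
  · rw [e _ hb.upper_opP, pairC_opP h.temp₀ h.temp₁ h.lame hc hγ hb]
  · have l1 := h.tendsto_pairB hψ hρ
    have l2 := h.tendsto_pairA hψ.absC_mul hρ.id_mul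
    have l3 : Tendsto (fun ε : ℝ => (ε : ℂ)) (𝓝[>] 0) (𝓝 0) :=
      (Complex.continuous_ofReal.tendsto' 0 0 Complex.ofReal_zero).mono_left nhdsWithin_le_nhds
    have l4 := l1.sub ((l3.mul l2).const_mul (2 * γ : ℂ))
    simp only [hρ1, zero_mul, mul_zero, sub_zero, Complex.ofReal_one, one_mul] at l4
    refine l4.congr' ?_
    filter_upwards [self_mem_nhdsWithin] with ε hε
    rw [e _ (hψ.tensor_upper (isTest_scaled hρ hε)), pairC_tensor_eq, ← pairA_const_mul]
    congr 3
    ext q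
    simp only [tensor]
    rw [snd_mul_scaled ρ (ne_of_gt hε)]
    ring

lemma I_mul_ne_zero {ξ : ℝ} (hξ : ξ ≠ 0) : Complex.I * (ξ : ℂ) ≠ 0 :=
  mul_ne_zero Complex.I_ne_zero (by exact_mod_cast hξ)

lemma absC_ne_zero {ξ : ℝ} (hξ : ξ ≠ 0) : absC ξ ≠ 0 := by
  rw [absC]; exact_mod_cast abs_ne_zero.2 hξ

lemma IsTestC.exists_eq_I_mul (hψ : IsTestC {ξ : ℝ | ξ ≠ 0} ψ) :
    ∃ θ, IsTestC {ξ : ℝ | ξ ≠ 0} θ ∧ ψ = fun ξ => Complex.I * ξ * θ ξ := by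
  refine ⟨fun ξ => (Complex.I * ξ)⁻¹ * ψ ξ, hψ.mul_left isOpen_ne ?_, ?_⟩
  · exact (contDiff_const.mul Complex.ofRealCLM.contDiff).contDiffOn.inv
      fun ξ hξ => I_mul_ne_zero hξ
  · ext ξ
    by_cases h : ξ = 0
    · simp [hψ.eq_zero (p := ξ) (by simpa using h)]
    · rw [mul_inv_cancel_left₀ (I_mul_ne_zero h)]

lemma IsTestC.exists_eq_absC_mul (hψ : IsTestC {ξ : ℝ | ξ ≠ 0} ψ) :
    ∃ θ, IsTestC {ξ : ℝ | ξ ≠ 0} θ ∧ ψ = fun ξ => absC ξ * θ ξ := by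
  refine ⟨fun ξ => (absC ξ)⁻¹ * ψ ξ, hψ.mul_left isOpen_ne ?_, ?_⟩
  · exact contDiffOn_absC.inv fun ξ hξ => absC_ne_zero hξ
  · ext ξ
    by_cases h : ξ = 0
    · simp [hψ.eq_zero (p := ξ) (by simpa using h)]
    · rw [mul_inv_cancel_left₀ (absC_ne_zero h)]

lemma UpperSolution.pftPair_fst (h : UpperSolution c u₀ u₁ v₀ v₁) (hc : 0 < c) {γ : ℝ}
    (hγ : γ * (2 + c) = c) (hψ : IsTestC {ξ : ℝ | ξ ≠ 0} ψ) (hη : IsTestC (Ioi 0) η) :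
    pftPair u₀ (tensor ψ η)
      = ftPair v₀ (fun ξ => (expMoment η |ξ| - γ * absC ξ * expMoment (fun t => t * η t) |ξ|) * ψ ξ)
      - ftPair v₁ (fun ξ => γ * (Complex.I * ξ) * expMoment (fun t => t * η t) |ξ| * ψ ξ) := by
  obtain ⟨θ, hθ, rfl⟩ := hψ.exists_eq_I_mul
  have a1 := h.pairA_tensor hc hθ hη
  have a2 := h.pairA_tensor hc hθ.absC_mul hη.id_mul
  have b1 := h.pairC_tensor hc hγ hθ hη
  rw [pairA_tensor_eq] at a1
  rw [pairC_tensor_eq, a2, pairB_tensor_eq] at b1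
  have m0 := hθ.expMoment_mul hη
  have m1 := hθ.expMoment_mul hη.id_mul
  have f0 : (fun ξ : ℝ => (expMoment η |ξ| - γ * absC ξ * expMoment (fun t => t * η t) |ξ|)
      * (Complex.I * ξ * θ ξ)) = fun ξ => Complex.I * ξ * (expMoment η |ξ| * θ ξ)
      - γ * (Complex.I * ξ * (expMoment (fun t => t * η t) |ξ| * (absC ξ * θ ξ))) := by
    ext ξ; ring
  have f1 : (fun ξ : ℝ => γ * (Complex.I * ξ) * expMoment (fun t => t * η t) |ξ|
      * (Complex.I * ξ * θ ξ)) = fun ξ => -γ * (absC ξ * (expMoment (fun t => t * η t) |ξ|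
      * (absC ξ * θ ξ))) := by
    ext ξ
    linear_combination (γ * expMoment (fun t => t * η t) |ξ| * θ ξ) *
      (absC_sq ξ + ξ * ξ * Complex.I_mul_I)
  rw [f0, f1, ftPair_const_mul, ftPair_sub h.tempb₀ m0.I_mul
    ((hθ.absC_mul.expMoment_mul hη.id_mul).I_mul.const_mul _), ftPair_const_mul]
  linear_combination (a1 - b1) / 2

lemma UpperSolution.pftPair_snd (h : UpperSolution c u₀ u₁ v₀ v₁) (hc : 0 < c) {γ : ℝ}
    (hγ : γ * (2 + c) = c) (hψ : IsTestC {ξ : ℝ | ξ ≠ 0} ψ) (hη : IsTestC (Ioi 0) η) :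
    pftPair u₁ (tensor ψ η)
      = ftPair v₁ (fun ξ => (expMoment η |ξ| + γ * absC ξ * expMoment (fun t => t * η t) |ξ|) * ψ ξ)
      - ftPair v₀ (fun ξ => γ * (Complex.I * ξ) * expMoment (fun t => t * η t) |ξ| * ψ ξ) := by
  obtain ⟨θ, hθ, rfl⟩ := hψ.exists_eq_absC_mul
  have a1 := h.pairA_tensor hc hθ hη
  have a2 := h.pairA_tensor hc hθ.absC_mul hη.id_mul
  have b1 := h.pairC_tensor hc hγ hθ hη
  rw [pairA_tensor_eq] at a1
  rw [pairC_tensor_eq, a2, pairB_tensor_eq] at b1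
  have m0 := hθ.expMoment_mul hη
  have f0 : (fun ξ : ℝ => (expMoment η |ξ| + γ * absC ξ * expMoment (fun t => t * η t) |ξ|)
      * (absC ξ * θ ξ)) = fun ξ => absC ξ * (expMoment η |ξ| * θ ξ)
      + γ * (absC ξ * (expMoment (fun t => t * η t) |ξ| * (absC ξ * θ ξ))) := by
    ext ξ; ring
  have f1 : (fun ξ : ℝ => γ * (Complex.I * ξ) * expMoment (fun t => t * η t) |ξ|
      * (absC ξ * θ ξ)) = fun ξ => γ * (Complex.I * ξ * (expMoment (fun t => t * η t) |ξ|
      * (absC ξ * θ ξ))) := by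
    ext ξ; ring
  rw [f0, f1, ftPair_const_mul, ftPair_add h.tempb₁ m0.absC_mul
    ((hθ.absC_mul.expMoment_mul hη.id_mul).absC_mul.const_mul _), ftPair_const_mul]
  linear_combination -(a1 + b1) / 2

end upper

/-! ### Reflection -/

/-- The map `(x, y) ↦ (x, κ y)`; for `κ = -1` the reflection in the slip plane. -/
def flip (κ : ℝ) (p : ℝ × ℝ) : ℝ × ℝ := (p.1, κ * p.2)

section flip

variable {κ : ℝ}

lemma flip_flip (hκ : κ * κ = 1) (p : ℝ × ℝ) : flip κ (flip κ p) = p := by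
  simp [flip, ← mul_assoc, hκ]

lemma contDiff_flip (κ : ℝ) : ContDiff ℝ ∞ (flip κ) :=
  contDiff_fst.prodMk (contDiff_const.mul contDiff_snd)

lemma norm_flip (hκ : κ * κ = 1) (p : ℝ × ℝ) : ‖flip κ p‖ = ‖p‖ := by
  have : |κ| = 1 := by
    have h := abs_mul_abs_self κ
    rw [hκ] at h
    nlinarith [abs_nonneg κ]
  simp [flip, Prod.norm_def, this]

/-- `flip κ` as a homeomorphism. -/
def flipHomeo (hκ : κ * κ = 1) : (ℝ × ℝ) ≃ₜ (ℝ × ℝ) where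
  toFun := flip κ
  invFun := flip κ
  left_inv := flip_flip hκ
  right_inv := flip_flip hκ
  continuous_toFun := (contDiff_flip κ).continuous
  continuous_invFun := (contDiff_flip κ).continuous

lemma measurePreserving_flip (hκ : κ * κ = 1) : MeasurePreserving (flip κ) volume volume := by
  rcases mul_self_eq_one_iff.1 hκ with rfl | rfl
  · have : flip 1 = id := by ext p <;> simp [flip]
    rw [this]
    exact MeasurePreserving.id _
  · have : flip (-1) = Prod.map id (fun y : ℝ => -y) := by ext p <;> simp [flip]
    rw [this]
    exact (MeasurePreserving.id volume).prod (Measure.measurePreserving_neg volume)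

lemma measurableEmbedding_flip (hκ : κ * κ = 1) : MeasurableEmbedding (flip κ) :=
  (flipHomeo hκ).measurableEmbedding

lemma integral_flip {F : Type*} [NormedAddCommGroup F] [NormedSpace ℝ F] (hκ : κ * κ = 1)
    (f : ℝ × ℝ → F) : ∫ p, f (flip κ p) = ∫ p, f p :=
  (measurePreserving_flip hκ).integral_comp (measurableEmbedding_flip hκ) f

lemma TemperedFun.comp_flip {f : ℝ × ℝ → ℝ} (hf : TemperedFun f) (hκ : κ * κ = 1) :
    TemperedFun fun p => f (flip κ p) := by
  obtain ⟨N, hN⟩ := hf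
  refine ⟨N, ?_⟩
  have := (measurePreserving_flip hκ).integrable_comp_emb (measurableEmbedding_flip hκ) |>.2 hN
  refine this.congr (Eventually.of_forall fun p => ?_)
  simp [norm_flip hκ]

lemma TemperedFun.const_mul {E : Type*} [NormedAddCommGroup E] [MeasureSpace E] {f : E → ℝ}
    (hf : TemperedFun f) (c : ℝ) : TemperedFun fun p => c * f p := by
  obtain ⟨N, hN⟩ := hf
  exact ⟨N, by simpa only [mul_div_assoc] using hN.const_mul c⟩

lemma IsTestC.comp_flip (hκ : κ * κ = 1) {Ω : Set (ℝ × ℝ)} {Φ : ℝ × ℝ → ℂ} (h : IsTestC Ω Φ) :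
    IsTestC (flip κ ⁻¹' Ω) fun p => Φ (flip κ p) := by
  refine ⟨h.1.comp (contDiff_flip κ), h.2.1.comp_homeomorph (flipHomeo hκ), ?_⟩
  exact (tsupport_comp_subset_preimage Φ (contDiff_flip κ).continuous).trans
    (preimage_mono h.2.2)

lemma hasFDerivAt_comp_flip {Φ : ℝ × ℝ → ℂ} (h : Differentiable ℝ Φ) (p : ℝ × ℝ) :
    HasFDerivAt (fun p => Φ (flip κ p)) ((fderiv ℝ Φ (flip κ p)).comp
      ((ContinuousLinearMap.fst ℝ ℝ ℝ).prod (κ • ContinuousLinearMap.snd ℝ ℝ ℝ))) p :=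
  (h _).hasFDerivAt.comp p (hasFDerivAt_fst.prodMk (hasFDerivAt_snd.const_mul κ))

lemma dx_comp_flip {Φ : ℝ × ℝ → ℂ} (h : Differentiable ℝ Φ) :
    dx (fun p => Φ (flip κ p)) = fun p => dx Φ (flip κ p) := by
  ext p; simp [dx, (hasFDerivAt_comp_flip h p).fderiv]

lemma dy_comp_flip {Φ : ℝ × ℝ → ℂ} (h : Differentiable ℝ Φ) :
    dy (fun p => Φ (flip κ p)) = fun p => κ * dy Φ (flip κ p) := by
  ext p
  have : ((0, κ) : ℝ × ℝ) = κ • (0, 1) := by simp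
  simp only [dy, (hasFDerivAt_comp_flip h p).fderiv]
  rw [← Complex.real_smul, ← map_smul, ← this]
  simp

end flip

section realPart

variable {Φ : ℝ × ℝ → ℂ}

lemma pd_re (h : Differentiable ℝ Φ) (j : Fin 2) :
    pd j (fun p => (Φ p).re) = fun p => (fderiv ℝ Φ p (dir j)).re := by
  ext p
  have : HasFDerivAt (fun p => (Φ p).re) (Complex.reCLM.comp (fderiv ℝ Φ p)) p :=
    Complex.reCLM.hasFDerivAt.comp p (h p).hasFDerivAt
  simp [pd, this.fderiv]

lemma pd_im (h : Differentiable ℝ Φ) (j : Fin 2) :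
    pd j (fun p => (Φ p).im) = fun p => (fderiv ℝ Φ p (dir j)).im := by
  ext p
  have : HasFDerivAt (fun p => (Φ p).im) (Complex.imCLM.comp (fderiv ℝ Φ p)) p :=
    Complex.imCLM.hasFDerivAt.comp p (h p).hasFDerivAt
  simp [pd, this.fderiv]

lemma pd_zero_re (h : Differentiable ℝ Φ) :
    pd 0 (fun p => (Φ p).re) = fun p => (dx Φ p).re := pd_re h 0

lemma pd_one_re (h : Differentiable ℝ Φ) :
    pd 1 (fun p => (Φ p).re) = fun p => (dy Φ p).re := pd_re h 1

lemma pd_zero_im (h : Differentiable ℝ Φ) :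
    pd 0 (fun p => (Φ p).im) = fun p => (dx Φ p).im := pd_im h 0

lemma pd_one_im (h : Differentiable ℝ Φ) :
    pd 1 (fun p => (Φ p).im) = fun p => (dy Φ p).im := pd_im h 1

lemma pd_add {f g : ℝ × ℝ → ℝ} (hf : Differentiable ℝ f) (hg : Differentiable ℝ g) (j : Fin 2) :
    pd j (fun p => f p + g p) = fun p => pd j f p + pd j g p := by
  ext p
  have : HasFDerivAt (fun p => f p + g p) (fderiv ℝ f p + fderiv ℝ g p) p :=
    (hf p).hasFDerivAt.add (hg p).hasFDerivAt
  simp [pd, this.fderiv]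

end realPart

/-- The complex form of the Lamé system. -/
lemma SolvesLame.complex {ν : ℝ} {u : Fin 2 → ℝ × ℝ → ℝ} (h : SolvesLame ν u) {Φ₀ Φ₁ : ℝ × ℝ → ℂ}
    (h₀ : IsTestC offSlip Φ₀) (h₁ : IsTestC offSlip Φ₁) :
    ∫ p, ((u 0 p : ℂ) * ((1 + (1 / (1 - 2 * ν) : ℝ)) * dx (dx Φ₀) p + dy (dy Φ₀) p
        + (1 / (1 - 2 * ν) : ℝ) * dx (dy Φ₁) p)
      + (u 1 p : ℂ) * (dx (dx Φ₁) p + (1 + (1 / (1 - 2 * ν) : ℝ)) * dy (dy Φ₁) p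
        + (1 / (1 - 2 * ν) : ℝ) * dy (dx Φ₀) p)) = 0 := by
  have d : ∀ {Ω : Set (ℝ × ℝ)} {Φ}, IsTestC Ω Φ → Differentiable ℝ Φ := fun h =>
    h.1.differentiable (by simp)
  have dr : ∀ {Ω : Set (ℝ × ℝ)} {Φ}, IsTestC Ω Φ → Differentiable ℝ fun p => (Φ p).re := fun h =>
    h.re.1.differentiable (by simp)
  have di : ∀ {Ω : Set (ℝ × ℝ)} {Φ}, IsTestC Ω Φ → Differentiable ℝ fun p => (Φ p).im := fun h =>
    h.im.1.differentiable (by simp)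
  by_cases hi : Integrable fun p => ((u 0 p : ℂ) * ((1 + (1 / (1 - 2 * ν) : ℝ)) * dx (dx Φ₀) p
        + dy (dy Φ₀) p + (1 / (1 - 2 * ν) : ℝ) * dx (dy Φ₁) p)
      + (u 1 p : ℂ) * (dx (dx Φ₁) p + (1 + (1 / (1 - 2 * ν) : ℝ)) * dy (dy Φ₁) p
        + (1 / (1 - 2 * ν) : ℝ) * dy (dx Φ₀) p))
  swap
  · exact integral_undef hi
  have e1 := h ![fun p => (Φ₀ p).re, fun p => (Φ₁ p).re]
    (fun i => by fin_cases i; exacts [h₀.re, h₁.re])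
  have e2 := h ![fun p => (Φ₀ p).im, fun p => (Φ₁ p).im]
    (fun i => by fin_cases i; exacts [h₀.im, h₁.im])
  simp only [Fin.sum_univ_two, Matrix.cons_val_zero, Matrix.cons_val_one, pd_zero_re (d h₀),
    pd_zero_re (d h₀.dx), pd_one_re (d h₀), pd_one_re (d h₀.dy), pd_zero_re (d h₁),
    pd_zero_re (d h₁.dx), pd_one_re (d h₁), pd_one_re (d h₁.dy), pd_add (dr h₀.dx) (dr h₁.dy),
    pd_one_re (d h₀.dx), pd_zero_re (d h₁.dy)] at e1
  simp only [Fin.sum_univ_two, Matrix.cons_val_zero, Matrix.cons_val_one, pd_zero_im (d h₀),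
    pd_zero_im (d h₀.dx), pd_one_im (d h₀), pd_one_im (d h₀.dy), pd_zero_im (d h₁),
    pd_zero_im (d h₁.dx), pd_one_im (d h₁), pd_one_im (d h₁.dy), pd_add (di h₀.dx) (di h₁.dy),
    pd_one_im (d h₀.dx), pd_zero_im (d h₁.dy)] at e2
  have hz : ∀ {f g : ℝ × ℝ → ℝ}, ∫ p, g p = 0 → (∀ p, f p = g p) → ∫ p, f p = 0 :=
    fun h0 h => (integral_congr_ae (Eventually.of_forall h)).trans h0
  rw [← integral_re_add_im hi]
  simp only [RCLike.re_eq_complex_re, RCLike.im_eq_complex_im]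
  rw [hz e1 fun p => ?_, hz e2 fun p => ?_]
  · simp
  · simp only [Complex.add_im, Complex.im_ofReal_mul, add_mul, one_mul]
    ring
  · simp only [Complex.add_re, Complex.re_ofReal_mul, add_mul, one_mul]
    ring

lemma HasBoundaryValue.comp_flip {κ : ℝ} (hκ : κ * κ = 1) {f : ℝ × ℝ → ℝ} {g : ℝ → ℝ}
    (h : HasBoundaryValue κ (pair f) (linePair g)) (c : ℝ) :
    HasBoundaryValue 1 (pair fun p => c * f (flip κ p)) (linePair fun x => c * g x) := by
  intro φ ρ hρ
  have := (h φ ρ hρ).const_mul c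
  have e : (∫ y, ρ y) * linePair (fun x => c * g x) φ = c * ((∫ y, ρ y) * linePair g φ) := by
    simp only [linePair, mul_assoc, integral_const_mul]; ring
  rw [e]
  refine this.congr fun ε => ?_
  simp only [pair, mul_assoc, integral_const_mul]
  rw [← integral_flip hκ]
  simp only [flip, ← mul_assoc, hκ, one_mul]

lemma UpperLame.flip {κ : ℝ} (hκ : κ * κ = 1) {ν : ℝ} {u : Fin 2 → ℝ × ℝ → ℝ}
    (h : SolvesLame ν u) : UpperLame (1 / (1 - 2 * ν)) (fun p => 1 * u 0 (PN.flip κ p))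
      (fun p => κ * u 1 (PN.flip κ p)) := by
  intro Φ₀ Φ₁ h₀ h₁
  have hs : PN.flip κ ⁻¹' {p : ℝ × ℝ | 0 < p.2} ⊆ offSlip := by
    intro p (hp : 0 < κ * p.2) h0
    rw [h0, mul_zero] at hp
    exact hp.ne rfl
  have d : ∀ {Φ}, IsTestC {p : ℝ × ℝ | 0 < p.2} Φ → Differentiable ℝ Φ := fun h =>
    h.1.differentiable (by simp)
  have d' : ∀ {Φ}, IsTestC {p : ℝ × ℝ | 0 < p.2} Φ →
    Differentiable ℝ fun p => Φ (PN.flip κ p) := fun h => (d h).comp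
      ((contDiff_flip κ).differentiable (by simp))
  have e := h.complex ((h₀.comp_flip hκ).mono hs) (((h₁.comp_flip hκ).mono hs).const_mul κ)
  rw [← integral_flip hκ] at e
  have c1 : ∀ {Φ : ℝ × ℝ → ℂ}, IsTestC {p : ℝ × ℝ | 0 < p.2} Φ →
      dx (fun p => κ * Φ (PN.flip κ p)) = fun p => κ * dx Φ (PN.flip κ p) := by
    intro Φ hΦ
    ext p
    rw [← congrFun (dx_comp_flip (κ := κ) (d hΦ)) p]
    exact congrArg (· (1, 0)) (((d' hΦ) p).hasFDerivAt.const_mul (κ : ℂ)).fderiv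
  have c2 : ∀ {Φ : ℝ × ℝ → ℂ}, IsTestC {p : ℝ × ℝ | 0 < p.2} Φ →
      dy (fun p => κ * Φ (PN.flip κ p)) = fun p => dy Φ (PN.flip κ p) := by
    intro Φ hΦ
    have : ∀ p, dy (fun p => κ * Φ (PN.flip κ p)) p = κ * (κ * dy Φ (PN.flip κ p)) := fun p => by
      rw [← congrFun (dy_comp_flip (d hΦ)) p]
      exact congrArg (· (0, 1)) (((d' hΦ) p).hasFDerivAt.const_mul (κ : ℂ)).fderiv
    ext p
    rw [this, ← mul_assoc, ← Complex.ofReal_mul, hκ, Complex.ofReal_one, one_mul]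
  simp only [dx_comp_flip (d h₀), dx_comp_flip (d h₀.dx), dy_comp_flip (d h₀), c2 h₀.dy,
    c2 h₁, dx_comp_flip (d h₁.dy), c1 h₁, c1 h₁.dx, dy_comp_flip (d h₁.dy),
    dy_comp_flip (d h₀.dx), flip_flip hκ] at e
  rw [← e]
  refine integral_congr_ae (Eventually.of_forall fun p => ?_)
  push_cast
  ring

lemma upperSolution_flip {κ : ℝ} (hκ : κ * κ = 1) {ν : ℝ} {u : Fin 2 → ℝ × ℝ → ℝ}
    {w : Fin 2 → ℝ → ℝ} (hu : ∀ i, TemperedFun (u i)) (hw : ∀ i, TemperedFun (w i))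
    (hb : ∀ i, HasBoundaryValue κ (pair (u i)) (linePair (w i))) (h : SolvesLame ν u) :
    UpperSolution (1 / (1 - 2 * ν)) (fun p => 1 * u 0 (flip κ p)) (fun p => κ * u 1 (flip κ p))
      (fun x => 1 * w 0 x) (fun x => κ * w 1 x) where
  temp₀ := ((hu 0).comp_flip hκ).const_mul 1
  temp₁ := ((hu 1).comp_flip hκ).const_mul κ
  tempb₀ := (hw 0).const_mul 1
  tempb₁ := (hw 1).const_mul κ
  trace₀ := (hb 0).comp_flip hκ 1
  trace₁ := (hb 1).comp_flip hκ κ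
  lame := .flip hκ h

/-! ### Both half planes -/

lemma pft_tensor (ψ η : ℝ → ℂ) (p : ℝ × ℝ) : pft (tensor ψ η) p = η p.2 * ft ψ p.1 := by
  rw [← ft_const_mul]
  simp only [pft, tensor, mul_comm]

/-- The half line `κ y > 0`. -/
def halfLine (κ : ℝ) : Set ℝ := {y | 0 < κ * y}

lemma IsTestC.comp_mul {κ : ℝ} (hκ : κ * κ = 1) {η : ℝ → ℂ} (hη : IsTestC (halfLine κ) η) :
    IsTestC (Ioi 0) fun t => η (κ * t) := by
  have h0 : κ ≠ 0 := by rintro rfl; simp at hκ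
  have hc : ContDiff ℝ ∞ fun t : ℝ => κ * t := contDiff_const.mul contDiff_id
  refine ⟨hη.1.comp hc, hη.2.1.comp_homeomorph (Homeomorph.mulLeft₀ κ h0), ?_⟩
  refine (tsupport_comp_subset_preimage η hc.continuous).trans fun t ht => ?_
  have : 0 < κ * (κ * t) := hη.2.2 ht
  rwa [← mul_assoc, hκ, one_mul] at this

lemma pftPair_tensor_comp {κ : ℝ} (hκ : κ * κ = 1) (c : ℝ) (u : ℝ × ℝ → ℝ) (ψ η : ℝ → ℂ) :
    pftPair (fun p => c * u (flip κ p)) (tensor ψ fun t => η (κ * t))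
      = c * pftPair u (tensor ψ η) := by
  rw [pftPair, pftPair, ← integral_const_mul, ← integral_flip hκ]
  simp only [pft_tensor, flip, ← mul_assoc, hκ, one_mul, Complex.ofReal_mul]

section moments

variable {Ω : Set ℝ} {η : ℝ → ℂ}

lemma integrable_exp_mul (hη : IsTestC Ω η) (s : ℝ) :
    Integrable fun t : ℝ => Complex.exp (-((s : ℂ) * t)) * η t :=
  (hη.mul_left' (h := fun t : ℝ => Complex.exp (-((s : ℂ) * t)))
    (contDiff_const.mul Complex.ofRealCLM.contDiff).neg.cexp).integrable

lemma expMoment_add {η' : ℝ → ℂ} {Ω' : Set ℝ} (hη : IsTestC Ω η) (hη' : IsTestC Ω' η') (s : ℝ) :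
    expMoment (fun t => η t + η' t) s = expMoment η s + expMoment η' s := by
  simp only [expMoment, mul_add]
  exact integral_add (integrable_exp_mul hη s) (integrable_exp_mul hη' s)

lemma expMoment_const_mul (c : ℂ) (s : ℝ) :
    expMoment (fun t => c * η t) s = c * expMoment η s := by
  simp only [expMoment, mul_left_comm _ c, integral_const_mul]

lemma expMoment_deriv (hη : IsTestC Ω η) (s : ℝ) :
    expMoment (deriv η) s = s * expMoment η s := by
  have hd : ∀ t : ℝ, HasDerivAt (fun t : ℝ => Complex.exp (-((s : ℂ) * t)))
      (-s * Complex.exp (-((s : ℂ) * t))) t := fun t => by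
    have h1 : HasDerivAt (fun t : ℝ => -((s : ℂ) * t)) (-((s : ℂ) * 1)) t :=
      (Complex.ofRealCLM.hasDerivAt.const_mul (s : ℂ)).neg
    convert h1.cexp using 1
    ring
  have := integral_mul_deriv_eq_deriv_mul_of_integrable (fun t _ => hd t)
    (fun t _ => (hη.1.differentiable (by simp) t).hasDerivAt) (integrable_exp_mul hη.deriv s)
    (((integrable_exp_mul hη s).const_mul (-s : ℂ)).congr
      (Eventually.of_forall fun t => (mul_assoc _ _ _).symm))
    (integrable_exp_mul hη s)
  rw [expMoment, this, expMoment, ← integral_const_mul, ← integral_neg]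
  congr 1; ext t; ring

lemma deriv_id_mul (hη : IsTestC Ω η) :
    deriv (fun t : ℝ => (t : ℂ) * η t) = fun t => η t + t * deriv η t := by
  ext t
  have h := (Complex.ofRealCLM.hasDerivAt (x := t)).mul
    (hη.1.differentiable (by simp) t).hasDerivAt
  simpa using (show HasDerivAt (fun t : ℝ => (t : ℂ) * η t) _ t from h).deriv

lemma expMoment_id_mul_deriv (hη : IsTestC Ω η) (s : ℝ) :
    expMoment (fun t => t * deriv η t) s
      = -expMoment η s + s * expMoment (fun t => t * η t) s := by
  rw [← expMoment_deriv hη.id_mul, deriv_id_mul hη, expMoment_add hη hη.deriv.id_mul]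
  ring

/-- `∫ e^{-s|y|} η(y) dy` for `η` supported in the half line of sign `κ`. -/
def moment₀ (κ : ℝ) (η : ℝ → ℂ) (s : ℝ) : ℂ := expMoment (fun t => η (κ * t)) s

/-- `∫ |y| e^{-s|y|} η(y) dy` for `η` supported in the half line of sign `κ`. -/
def moment₁ (κ : ℝ) (η : ℝ → ℂ) (s : ℝ) : ℂ := expMoment (fun t => t * η (κ * t)) s

lemma deriv_comp_mul_eq {κ : ℝ} (hκ : κ * κ = 1) (η : ℝ → ℂ) :
    (fun t => deriv η (κ * t)) = fun t => κ * deriv (fun t => η (κ * t)) t := by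
  ext t
  rw [deriv_comp_mul_left κ η t, Complex.real_smul, ← mul_assoc, ← Complex.ofReal_mul, hκ,
    Complex.ofReal_one, one_mul]

lemma moment₀_deriv {κ : ℝ} (hκ : κ * κ = 1) (hη : IsTestC (halfLine κ) η) (s : ℝ) :
    moment₀ κ (deriv η) s = κ * (s * moment₀ κ η s) := by
  rw [moment₀, deriv_comp_mul_eq hκ, expMoment_const_mul, expMoment_deriv (hη.comp_mul hκ), moment₀]

lemma moment₁_deriv {κ : ℝ} (hκ : κ * κ = 1) (hη : IsTestC (halfLine κ) η) (s : ℝ) :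
    moment₁ κ (deriv η) s = κ * (-moment₀ κ η s + s * moment₁ κ η s) := by
  have : (fun t : ℝ => (t : ℂ) * deriv η (κ * t))
      = fun t => κ * (t * deriv (fun t => η (κ * t)) t) := by
    ext t
    rw [congrFun (deriv_comp_mul_eq hκ η) t]
    ring
  rw [moment₁, this, expMoment_const_mul, expMoment_id_mul_deriv (hη.comp_mul hκ), moment₀, moment₁]

lemma IsTestC.moment₀_mul {κ : ℝ} (hκ : κ * κ = 1) (hη : IsTestC (halfLine κ) η) {ψ : ℝ → ℂ}
    (hψ : IsTestC {ξ : ℝ | ξ ≠ 0} ψ) : IsTestC {ξ : ℝ | ξ ≠ 0} fun ξ => moment₀ κ η |ξ| * ψ ξ :=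
  hψ.expMoment_mul (hη.comp_mul hκ)

lemma IsTestC.moment₁_mul {κ : ℝ} (hκ : κ * κ = 1) (hη : IsTestC (halfLine κ) η) {ψ : ℝ → ℂ}
    (hψ : IsTestC {ξ : ℝ | ξ ≠ 0} ψ) : IsTestC {ξ : ℝ | ξ ≠ 0} fun ξ => moment₁ κ η |ξ| * ψ ξ :=
  hψ.expMoment_mul (hη.comp_mul hκ).id_mul

end moments

lemma ftPair_congr_mul {v w : ℝ → ℝ} {a : ℝ} (h : ∀ᵐ x, w x = a * v x) (ψ : ℝ → ℂ) :
    ftPair w ψ = a * ftPair v ψ := by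
  rw [ftPair, ftPair, ← integral_const_mul]
  refine integral_congr_ae ?_
  filter_upwards [h] with x hx
  rw [hx]; push_cast; ring

section half

variable {κ ν γ : ℝ} {u : Fin 2 → ℝ × ℝ → ℝ} {v w : Fin 2 → ℝ → ℝ} {ψ η : ℝ → ℂ}

/-- A solution in the half plane `κ y > 0` whose traces are `κ v₁`, `v₂`. -/
structure HalfSolution (κ ν : ℝ) (u : Fin 2 → ℝ × ℝ → ℝ) (v w : Fin 2 → ℝ → ℝ) : Prop where
  sq : κ * κ = 1
  lt : ν < 1 / 2
  temp : ∀ i, TemperedFun (u i)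
  tempv : ∀ i, TemperedFun (v i)
  tempw : ∀ i, TemperedFun (w i)
  trace : ∀ i, HasBoundaryValue κ (pair (u i)) (linePair (w i))
  fst : ∀ᵐ x, w 0 x = κ * v 0 x
  snd : ∀ᵐ x, w 1 x = v 1 x
  lame : SolvesLame ν u

lemma HalfSolution.pftPair_fst (h : HalfSolution κ ν u v w) (hγ : γ * (3 - 4 * ν) = 1)
    (hψ : IsTestC {ξ : ℝ | ξ ≠ 0} ψ) (hη : IsTestC (halfLine κ) η) :
    pftPair (u 0) (tensor ψ η) = κ * (
      ftPair (v 0) (fun ξ => (moment₀ κ η |ξ| - γ * absC ξ * moment₁ κ η |ξ|) * ψ ξ)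
      - ftPair (v 1) (fun ξ => γ * (Complex.I * ξ) * moment₁ κ η |ξ| * ψ ξ)) := by
  have hν : 0 < 1 - 2 * ν := by linarith [h.lt]
  have hγ' : γ * (2 + 1 / (1 - 2 * ν)) = 1 / (1 - 2 * ν) := by
    field_simp; linear_combination hγ
  have e := (upperSolution_flip h.sq h.temp h.tempw h.trace h.lame).pftPair_fst
    (by positivity) hγ' hψ (hη.comp_mul h.sq)
  rw [pftPair_tensor_comp h.sq, ftPair_congr_mul (a := κ) (v := v 0) (w := fun x => 1 * w 0 x)
    (h.fst.mono fun x hx => by rw [hx, one_mul]),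
    ftPair_congr_mul (a := κ) (v := v 1) (w := fun x => κ * w 1 x) (h.snd.mono fun x hx => by rw [hx])] at e
  rw [Complex.ofReal_one, one_mul] at e
  rw [e, ← mul_sub]
  rfl

lemma HalfSolution.pftPair_snd (h : HalfSolution κ ν u v w) (hγ : γ * (3 - 4 * ν) = 1)
    (hψ : IsTestC {ξ : ℝ | ξ ≠ 0} ψ) (hη : IsTestC (halfLine κ) η) :
    pftPair (u 1) (tensor ψ η) =
      ftPair (v 1) (fun ξ => (moment₀ κ η |ξ| + γ * absC ξ * moment₁ κ η |ξ|) * ψ ξ)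
      - ftPair (v 0) (fun ξ => γ * (Complex.I * ξ) * moment₁ κ η |ξ| * ψ ξ) := by
  have hν : 0 < 1 - 2 * ν := by linarith [h.lt]
  have hγ' : γ * (2 + 1 / (1 - 2 * ν)) = 1 / (1 - 2 * ν) := by
    field_simp; linear_combination hγ
  have e := (upperSolution_flip h.sq h.temp h.tempw h.trace h.lame).pftPair_snd
    (by positivity) hγ' hψ (hη.comp_mul h.sq)
  rw [pftPair_tensor_comp h.sq, ftPair_congr_mul (a := κ) (v := v 0) (w := fun x => 1 * w 0 x)
    (h.fst.mono fun x hx => by rw [hx, one_mul]),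
    ftPair_congr_mul (a := κ) (v := v 1) (w := fun x => κ * w 1 x) (h.snd.mono fun x hx => by rw [hx])] at e
  have hκ : (κ : ℂ) ≠ 0 := by
    have : κ ≠ 0 := by rintro rfl; simpa using h.sq
    exact_mod_cast this
  rw [← mul_sub] at e
  exact mul_left_cancel₀ hκ e

end half

/-! ### The stress as a functional -/

/-- The first Lamé parameter. -/
def lameOne (G ν : ℝ) : ℝ := 2 * ν * G / (1 - 2 * ν)

/-- The factor of `∂₁Φ` in `σ_ij(Φ)`. -/
def fluxX (G ν : ℝ) (u : Fin 2 → ℝ × ℝ → ℝ) (i j : Fin 2) : ℝ × ℝ → ℝ :=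
  if i = j then fun p => (if i = 0 then -(2 * G + lameOne G ν) else -lameOne G ν) * u 0 p
  else fun p => -G * u 1 p

/-- The factor of `∂₂Φ` in `σ_ij(Φ)`. -/
def fluxY (G ν : ℝ) (u : Fin 2 → ℝ × ℝ → ℝ) (i j : Fin 2) : ℝ × ℝ → ℝ :=
  if i = j then fun p => (if i = 0 then -lameOne G ν else -(2 * G + lameOne G ν)) * u 1 p
  else fun p => -G * u 0 p

section stress

variable {G ν : ℝ} {u : Fin 2 → ℝ × ℝ → ℝ}

lemma temperedFun_fluxX (hu : ∀ i, TemperedFun (u i)) (i j : Fin 2) :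
    TemperedFun (fluxX G ν u i j) := by
  rw [fluxX]
  split_ifs <;> exact (hu _).const_mul _

lemma temperedFun_fluxY (hu : ∀ i, TemperedFun (u i)) (i j : Fin 2) :
    TemperedFun (fluxY G ν u i j) := by
  rw [fluxY]
  split_ifs <;> exact (hu _).const_mul _

lemma pair_const_mul (a : ℝ) (f Φ : ℝ × ℝ → ℝ) : pair (fun p => a * f p) Φ = a * pair f Φ := by
  simp only [pair, mul_assoc, integral_const_mul]

lemma pftPair_const_mul_left (a : ℝ) (f : ℝ × ℝ → ℝ) (g : ℝ × ℝ → ℂ) :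
    pftPair (fun p => a * f p) g = a * pftPair f g := by
  simp only [pftPair, Complex.ofReal_mul, mul_assoc, integral_const_mul]

lemma pair_fluxX (i j : Fin 2) (Φ : ℝ × ℝ → ℝ) : pair (fluxX G ν u i j) Φ = if i = j then
    (if i = 0 then -(2 * G + lameOne G ν) else -lameOne G ν) * pair (u 0) Φ
      else -G * pair (u 1) Φ := by
  rw [fluxX]
  split_ifs <;> exact pair_const_mul _ _ _

lemma pair_fluxY (i j : Fin 2) (Φ : ℝ × ℝ → ℝ) : pair (fluxY G ν u i j) Φ = if i = j then
    (if i = 0 then -lameOne G ν else -(2 * G + lameOne G ν)) * pair (u 1) Φ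
      else -G * pair (u 0) Φ := by
  rw [fluxY]
  split_ifs <;> exact pair_const_mul _ _ _

lemma stress_eq_flux (i j : Fin 2) {Φ : ℝ × ℝ → ℝ}
    (hi : ∀ i j, Integrable fun p => u i p * pd j Φ p) :
    stress G ν u i j Φ = pair (fluxX G ν u i j) (pd 0 Φ) + pair (fluxY G ν u i j) (pd 1 Φ) := by
  have e : ∀ i j, strain u i j Φ = -(1 / 2) * (pair (u i) (pd j Φ) + pair (u j) (pd i Φ)) :=
    fun i j => by rw [strain, integral_add (hi i j) (hi j i)]; rfl
  simp only [stress, e, Fin.sum_univ_two, pair_fluxX, pair_fluxY]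
  fin_cases i <;> fin_cases j <;> simp [lameOne] <;> ring

/-- The pairing of the stress with the partial Fourier transform of a symbol. -/
def stressPair (G ν : ℝ) (u : Fin 2 → ℝ × ℝ → ℝ) (i j : Fin 2) (g : ℝ × ℝ → ℂ) : ℂ :=
  pftPair (fluxX G ν u i j) (fun q => -(Complex.I * q.1) * g q)
    + pftPair (fluxY G ν u i j) (dy g)

lemma integrable_mul_re_im {f : ℝ × ℝ → ℝ} (hf : TemperedFun f) {Ω : Set (ℝ × ℝ)}
    {g : ℝ × ℝ → ℂ} (hg : IsTestC Ω g) : (Integrable fun p => f p * (pft g p).re) ∧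
      Integrable fun p => f p * (pft g p).im := by
  have h := pftPair_integrable hf hg
  exact ⟨h.re.congr (Eventually.of_forall fun p => Complex.re_ofReal_mul _ _),
    h.im.congr (Eventually.of_forall fun p => Complex.im_ofReal_mul _ _)⟩

lemma stress_pft (hu : ∀ i, TemperedFun (u i)) (i j : Fin 2) {Ω : Set (ℝ × ℝ)} {g : ℝ × ℝ → ℂ}
    (hg : IsTestC Ω g) : stressPair G ν u i j g = (stress G ν u i j (fun p => (pft g p).re) : ℂ)
      + (stress G ν u i j (fun p => (pft g p).im) : ℂ) * Complex.I := by
  have hd : Differentiable ℝ (pft g) := (contDiff_pft hg).differentiable (by simp)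
  have r0 := pd_zero_re hd
  have r1 := pd_one_re hd
  have i0 := pd_zero_im hd
  have i1 := pd_one_im hd
  rw [dx_pft hg] at r0 i0
  rw [dy_pft hg] at r1 i1
  rw [stress_eq_flux, stress_eq_flux, r0, r1, i0, i1, stressPair, pftPair, pftPair,
    integral_ofReal_mul (pftPair_integrable (temperedFun_fluxX hu i j) hg.mul_I_xi),
    integral_ofReal_mul (pftPair_integrable (temperedFun_fluxY hu i j) hg.dy)]
  · simp only [pair]
    push_cast
    ring
  · intro i j
    fin_cases j
    · simpa [i0] using (integrable_mul_re_im (hu i) hg.mul_I_xi).2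
    · simpa [i1] using (integrable_mul_re_im (hu i) hg.dy).2
  · intro i j
    fin_cases j
    · simpa [r0] using (integrable_mul_re_im (hu i) hg.mul_I_xi).1
    · simpa [r1] using (integrable_mul_re_im (hu i) hg.dy).1

lemma dy_tensor {Ω Ω' : Set ℝ} {ψ η : ℝ → ℂ} (hψ : IsTestC Ω ψ) (hη : IsTestC Ω' η) :
    dy (tensor ψ η) = tensor ψ (deriv η) := by
  ext q
  refine dy_eq_of_hasDerivAt (hψ.prodMul hη).1 ?_
  exact ((hη.1.differentiable (by simp) q.2).hasDerivAt).const_mul (ψ q.1)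

lemma stressPair_tensor {Ω Ω' : Set ℝ} {ψ η : ℝ → ℂ} (hψ : IsTestC Ω ψ) (hη : IsTestC Ω' η)
    (i j : Fin 2) : stressPair G ν u i j (tensor ψ η)
      = pftPair (fluxX G ν u i j) (tensor (fun ξ => -(Complex.I * ξ) * ψ ξ) η)
        + pftPair (fluxY G ν u i j) (tensor ψ (deriv η)) := by
  rw [stressPair, dy_tensor hψ hη]
  congr 2
  ext q
  simp only [tensor, mul_assoc]

end stress

/-! ### Elimination of the normal trace -/

lemma IsTestC.comp_mul_halfLine {κ : ℝ} (hκ : κ * κ = 1) {η : ℝ → ℂ} (hη : IsTestC (Ioi 0) η) :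
    IsTestC (halfLine κ) fun t => η (κ * t) := by
  have h0 : κ ≠ 0 := by rintro rfl; simp at hκ
  have hc : ContDiff ℝ ∞ fun t : ℝ => κ * t := contDiff_const.mul contDiff_id
  refine ⟨hη.1.comp hc, hη.2.1.comp_homeomorph (Homeomorph.mulLeft₀ κ h0), ?_⟩
  exact (tsupport_comp_subset_preimage η hc.continuous).trans (preimage_mono hη.2.2)

lemma HasBoundaryValue.tendsto_complex {κ : ℝ} (hκ : κ * κ = 1) {L : (ℝ × ℝ → ℝ) → ℝ}
    {T : 𝓢(ℝ, ℝ) → ℝ} (h : HasBoundaryValue κ L T) {Λ : (ℝ × ℝ → ℂ) → ℂ}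
    (hΛ : ∀ g, IsTestC univ g → Λ g = (L (fun p => (pft g p).re) : ℂ)
      + (L (fun p => (pft g p).im) : ℂ) * Complex.I)
    {ψ : ℝ → ℂ} (hψ : IsTestC univ ψ) {φ : 𝓢(ℝ, ℂ)} (hφ : ∀ x, φ x = ft ψ x) {ρ : ℝ → ℝ}
    (hρ : IsTest (Ioi 0) ρ) :
    Tendsto (fun ε => Λ (tensor ψ fun y => scaled ρ ε (κ * y))) (𝓝[>] 0)
      (𝓝 (((∫ y, ρ y : ℝ) : ℂ) * ((T (schwartzRe φ) : ℂ) + T (schwartzIm φ) * Complex.I))) := by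
  have e1 := (Complex.continuous_ofReal.tendsto _).comp (h (schwartzRe φ) ρ hρ)
  have e2 := (Complex.continuous_ofReal.tendsto _).comp (h (schwartzIm φ) ρ hρ)
  have e3 := e1.add (e2.mul_const Complex.I)
  rw [mul_add, ← mul_assoc]
  simp only [Complex.ofReal_mul] at e3
  refine e3.congr' ?_
  filter_upwards [self_mem_nhdsWithin] with ε hε
  have ht : IsTestC univ (tensor ψ fun y => scaled ρ ε (κ * y)) :=
    (hψ.prodMul ((isTest_scaled hρ hε).comp_mul_halfLine hκ)).toUniv
  rw [hΛ _ ht]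
  simp only [pft_tensor, ← hφ, Function.comp_apply, scaled, Complex.re_ofReal_mul,
    Complex.im_ofReal_mul, schwartzRe_apply, schwartzIm_apply, mul_comm]

lemma tendsto_expMoment_scaled {v : ℝ → ℝ} (hv : TemperedFun v) {ψ : ℝ → ℂ}
    (hψ : IsTestC {ξ : ℝ | ξ ≠ 0} ψ) {ρ : ℝ → ℝ} (hρ : IsTest (Ioi 0) ρ) :
    Tendsto (fun ε => ftPair v fun ξ => expMoment (scaled ρ ε) |ξ| * ψ ξ) (𝓝[>] 0)
      (𝓝 (((∫ y, ρ y : ℝ) : ℂ) * ftPair v ψ)) := by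
  obtain ⟨χ, hχ, hχ1, -, -⟩ := exists_cutoff
  have hρC := hρ.ofReal
  have hΩ : IsOpen {p : ℝ × ℝ | p.1 ≠ 0} := isOpen_ne.preimage continuous_fst
  have hμ : ContDiffOn ℝ ∞ (fun p : ℝ × ℝ => expMoment (fun t => (ρ t : ℂ))
      (p.2 * |p.1|)) {p | p.1 ≠ 0} := by
    refine (contDiff_expMoment hρC).comp_contDiffOn ?_
    refine contDiff_snd.contDiffOn.mul fun p hp => ?_
    exact ((contDiffAt_abs (n := ⊤) hp).comp p contDiffAt_fst).contDiffWithinAt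
  have hG : IsTestC {p : ℝ × ℝ | p.1 ≠ 0} fun p => expMoment (fun t => (ρ t : ℂ))
      (p.2 * |p.1|) * (ψ p.1 * (χ p.2 : ℂ)) :=
    ((hψ.prodMul hχ.ofReal).mono fun p hp => hp.1).mul_left hΩ hμ
  have hl : ((∫ y, ρ y : ℝ) : ℂ) = ∫ y : ℝ, (ρ y : ℂ) := integral_ofReal.symm
  have T := (ftPair_tendsto_slice hv hG).mono_left (nhdsWithin_le_nhds (s := Ioi 0))
  simp only [zero_mul, expMoment_zero, hχ1 0 (by simp), Complex.ofReal_one, mul_one, ← hl] at T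
  rw [ftPair_const_mul] at T
  refine T.congr' ?_
  filter_upwards [Ioo_mem_nhdsGT (zero_lt_one' ℝ)] with ε hε
  have : χ ε = 1 := hχ1 _ (by rw [abs_of_pos hε.1]; exact hε.2.le)
  simp only [this, expMoment_scaled ρ hε.1, Complex.ofReal_one, mul_one]

lemma tendsto_expMoment_id_mul_scaled {v : ℝ → ℝ} (hv : TemperedFun v) {ψ : ℝ → ℂ}
    (hψ : IsTestC {ξ : ℝ | ξ ≠ 0} ψ) {ρ : ℝ → ℝ} (hρ : IsTest (Ioi 0) ρ) :
    Tendsto (fun ε => ftPair v fun ξ => expMoment (fun t => t * scaled ρ ε t) |ξ| * ψ ξ) (𝓝[>] 0)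
      (𝓝 0) := by
  have l3 : Tendsto (fun ε : ℝ => (ε : ℂ)) (𝓝[>] 0) (𝓝 0) :=
    (Complex.continuous_ofReal.tendsto' 0 0 Complex.ofReal_zero).mono_left nhdsWithin_le_nhds
  have l := l3.mul (tendsto_expMoment_scaled hv hψ hρ.id_mul)
  rw [zero_mul] at l
  refine l.congr' ?_
  filter_upwards [self_mem_nhdsWithin] with ε hε
  rw [← ftPair_const_mul]
  congr 1; ext ξ
  rw [← mul_assoc, ← expMoment_const_mul]
  congr 2; ext t
  rw [snd_mul_scaled ρ (ne_of_gt hε)]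

section half

variable {κ G ν γ : ℝ} {u : Fin 2 → ℝ × ℝ → ℝ} {v w : Fin 2 → ℝ → ℝ} {ψ η : ℝ → ℂ}

lemma pftPair_fluxX (i j : Fin 2) (g : ℝ × ℝ → ℂ) : pftPair (fluxX G ν u i j) g = if i = j then
    (((if i = 0 then -(2 * G + lameOne G ν) else -lameOne G ν : ℝ)) : ℂ) * pftPair (u 0) g
      else -G * pftPair (u 1) g := by
  rw [fluxX]
  split_ifs <;> rw [pftPair_const_mul_left]
  rw [Complex.ofReal_neg]

lemma pftPair_fluxY (i j : Fin 2) (g : ℝ × ℝ → ℂ) : pftPair (fluxY G ν u i j) g = if i = j then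
    (((if i = 0 then -lameOne G ν else -(2 * G + lameOne G ν) : ℝ)) : ℂ) * pftPair (u 1) g
      else -G * pftPair (u 0) g := by
  rw [fluxY]
  split_ifs <;> rw [pftPair_const_mul_left]
  rw [Complex.ofReal_neg]

lemma IsTestC.neg_I_mul {Ω : Set ℝ} {η : ℝ → ℂ} (hη : IsTestC Ω η) :
    IsTestC Ω fun t => -(Complex.I * t) * η t :=
  hη.mul_left' (contDiff_const.mul Complex.ofRealCLM.contDiff).neg

lemma HalfSolution.stressPair_normal (h : HalfSolution κ ν u v w) (hγ : γ * (3 - 4 * ν) = 1)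
    (hψ : IsTestC {ξ : ℝ | ξ ≠ 0} ψ) (hη : IsTestC (halfLine κ) η) :
    stressPair G ν u 1 1 (tensor ψ η) = κ * (lameOne G ν *
      (ftPair (v 0) (fun ξ => moment₀ κ η |ξ| * (Complex.I * ξ * ψ ξ))
        - γ * ftPair (v 0) (fun ξ => moment₁ κ η |ξ| * (absC ξ * (Complex.I * ξ * ψ ξ)))
        + γ * ftPair (v 1) (fun ξ => moment₁ κ η |ξ| * (absC ξ * (absC ξ * ψ ξ))))
      - (2 * G + lameOne G ν) *
      ((1 - γ) * ftPair (v 1) (fun ξ => moment₀ κ η |ξ| * (absC ξ * ψ ξ))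
        + γ * ftPair (v 1) (fun ξ => moment₁ κ η |ξ| * (absC ξ * (absC ξ * ψ ξ)))
        + γ * ftPair (v 0) (fun ξ => moment₀ κ η |ξ| * (Complex.I * ξ * ψ ξ))
        - γ * ftPair (v 0) (fun ξ => moment₁ κ η |ξ| * (absC ξ * (Complex.I * ξ * ψ ξ))))) := by
  have t0 : ∀ {θ}, IsTestC {ξ : ℝ | ξ ≠ 0} θ → IsTestC {ξ : ℝ | ξ ≠ 0}
    fun ξ => moment₀ κ η |ξ| * θ ξ := fun hθ => hη.moment₀_mul h.sq hθ
  have t1 : ∀ {θ}, IsTestC {ξ : ℝ | ξ ≠ 0} θ → IsTestC {ξ : ℝ | ξ ≠ 0}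
    fun ξ => moment₁ κ η |ξ| * θ ξ := fun hθ => hη.moment₁_mul h.sq hθ
  rw [stressPair_tensor hψ hη, pftPair_fluxX, pftPair_fluxY, h.pftPair_fst hγ hψ.neg_I_mul hη,
    h.pftPair_snd hγ hψ hη.deriv]
  have f1 : (fun ξ : ℝ => (moment₀ κ η |ξ| - γ * absC ξ * moment₁ κ η |ξ|)
      * (-(Complex.I * ξ) * ψ ξ)) = fun ξ => (-1) * (moment₀ κ η |ξ| * (Complex.I * ξ * ψ ξ))
      + γ * (moment₁ κ η |ξ| * (absC ξ * (Complex.I * ξ * ψ ξ))) := by ext ξ; ring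
  have f2 : (fun ξ : ℝ => γ * (Complex.I * ξ) * moment₁ κ η |ξ| * (-(Complex.I * ξ) * ψ ξ))
      = fun ξ => γ * (moment₁ κ η |ξ| * (absC ξ * (absC ξ * ψ ξ))) := by
    ext ξ
    linear_combination (-γ * moment₁ κ η |ξ| * ψ ξ) * (absC_sq ξ + ξ * ξ * Complex.I_mul_I)
  have f3 : (fun ξ : ℝ => (moment₀ κ (deriv η) |ξ| + γ * absC ξ * moment₁ κ (deriv η) |ξ|) * ψ ξ)
      = fun ξ => κ * (1 - γ) * (moment₀ κ η |ξ| * (absC ξ * ψ ξ))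
      + κ * γ * (moment₁ κ η |ξ| * (absC ξ * (absC ξ * ψ ξ))) := by
    ext ξ
    rw [moment₀_deriv h.sq hη, moment₁_deriv h.sq hη]
    simp only [absC]; ring
  have f4 : (fun ξ : ℝ => γ * (Complex.I * ξ) * moment₁ κ (deriv η) |ξ| * ψ ξ)
      = fun ξ => (-κ * γ) * (moment₀ κ η |ξ| * (Complex.I * ξ * ψ ξ))
      + κ * γ * (moment₁ κ η |ξ| * (absC ξ * (Complex.I * ξ * ψ ξ))) := by
    ext ξ
    rw [moment₁_deriv h.sq hη]
    simp only [absC]; ring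
  rw [f1, f2, f3, f4, ftPair_add (h.tempv 0) ((t0 hψ.I_mul).const_mul _)
    ((t1 hψ.I_mul.absC_mul).const_mul _), ftPair_add (h.tempv 1) ((t0 hψ.absC_mul).const_mul _)
    ((t1 hψ.absC_mul.absC_mul).const_mul _), ftPair_add (h.tempv 0) ((t0 hψ.I_mul).const_mul _)
    ((t1 hψ.I_mul.absC_mul).const_mul _)]
  simp only [ftPair_const_mul]
  simp
  ring

lemma HalfSolution.tendsto_stressPair_normal (h : HalfSolution κ ν u v w)
    (hγ : γ * (3 - 4 * ν) = 1) (hψ : IsTestC {ξ : ℝ | ξ ≠ 0} ψ) {ρ : ℝ → ℝ}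
    (hρ : IsTest (Ioi 0) ρ) (hρ1 : ∫ y, ρ y = 1) :
    Tendsto (fun ε => stressPair G ν u 1 1 (tensor ψ fun y => scaled ρ ε (κ * y))) (𝓝[>] 0)
      (𝓝 (κ * (lameOne G ν * ftPair (v 0) (fun ξ => Complex.I * ξ * ψ ξ)
        - (2 * G + lameOne G ν) * ((1 - γ) * ftPair (v 1) (fun ξ => absC ξ * ψ ξ)
          + γ * ftPair (v 0) (fun ξ => Complex.I * ξ * ψ ξ))))) := by
  have m0 : ∀ ε s, moment₀ κ (fun y => scaled ρ ε (κ * y)) s = expMoment (scaled ρ ε) s :=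
    fun ε s => by simp only [moment₀, ← mul_assoc, h.sq, one_mul]
  have m1 : ∀ ε s, moment₁ κ (fun y => scaled ρ ε (κ * y)) s
      = expMoment (fun t => t * scaled ρ ε t) s :=
    fun ε s => by simp only [moment₁, ← mul_assoc, h.sq, one_mul]
  have a := fun (i : Fin 2) {θ : ℝ → ℂ} (hθ : IsTestC {ξ : ℝ | ξ ≠ 0} θ) =>
    tendsto_expMoment_scaled (h.tempv i) hθ hρ
  have b := fun (i : Fin 2) {θ : ℝ → ℂ} (hθ : IsTestC {ξ : ℝ | ξ ≠ 0} θ) =>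
    tendsto_expMoment_id_mul_scaled (h.tempv i) hθ hρ
  have l := (((((a 0 hψ.I_mul).sub ((b 0 hψ.I_mul.absC_mul).const_mul (γ : ℂ))).add
    ((b 1 hψ.absC_mul.absC_mul).const_mul (γ : ℂ))).const_mul (lameOne G ν : ℂ)).sub
    ((((((a 1 hψ.absC_mul).const_mul (1 - γ : ℂ)).add
    ((b 1 hψ.absC_mul.absC_mul).const_mul (γ : ℂ))).add ((a 0 hψ.I_mul).const_mul (γ : ℂ))).sub
    ((b 0 hψ.I_mul.absC_mul).const_mul (γ : ℂ))).const_mul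
    (2 * G + lameOne G ν : ℂ))).const_mul (κ : ℂ)
  simp only [hρ1, Complex.ofReal_one, one_mul, mul_zero, sub_zero, add_zero] at l
  refine l.congr' ?_
  filter_upwards [self_mem_nhdsWithin] with ε hε
  rw [h.stressPair_normal hγ hψ ((isTest_scaled hρ hε).comp_mul_halfLine h.sq)]
  simp only [m0, m1]

end half

/-- The hypotheses on a solution which matter for its representation. -/
structure SlipSolution (G ν : ℝ) (u : Fin 2 → ℝ × ℝ → ℝ) (v w : Fin 2 → ℝ → ℝ) : Prop where
  pos : 0 < G
  upper : HalfSolution 1 ν u v v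
  lower : HalfSolution (-1) ν u v w
  normal : ∃ Tp Tm : 𝓢(ℝ, ℝ) → ℝ,
    HasBoundaryValue 1 (stress G ν u 1 1) Tp ∧ HasBoundaryValue (-1) (stress G ν u 1 1) Tm ∧
    ∀ φ : 𝓢(ℝ, ℝ), Tp φ = Tm φ

section slip

variable {κ G ν β : ℝ} {u : Fin 2 → ℝ × ℝ → ℝ} {v w : Fin 2 → ℝ → ℝ} {ψ η : ℝ → ℂ}

lemma SlipSolution.normal_trace (h : SlipSolution G ν u v w) (hβ : β * (2 - 2 * ν) = 1)
    (hψ : IsTestC {ξ : ℝ | ξ ≠ 0} ψ) : ftPair (v 1) (fun ξ => absC ξ * ψ ξ)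
      = -((1 - 2 * ν) * β) * ftPair (v 0) (fun ξ => Complex.I * ξ * ψ ξ) := by
  obtain ⟨ρ, hρ, hρ1⟩ := exists_isTest_integral_one
  obtain ⟨Tp, Tm, hp, hm, hT⟩ := h.normal
  have hν := h.upper.lt
  have h3 : 0 < 3 - 4 * ν := by linarith
  obtain ⟨γ, hγd⟩ : ∃ γ, γ = 1 / (3 - 4 * ν) := ⟨_, rfl⟩
  have hγ : γ * (3 - 4 * ν) = 1 := by rw [hγd]; field_simp
  obtain ⟨φ, hφ⟩ := exists_schwartz_ft (hψ.2.1.toSchwartzMap hψ.1)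
  have hΛ : ∀ g, IsTestC univ g → stressPair G ν u 1 1 g =
      (stress G ν u 1 1 (fun p => (pft g p).re) : ℂ)
      + (stress G ν u 1 1 (fun p => (pft g p).im) : ℂ) * Complex.I :=
    fun g hg => stress_pft h.upper.temp 1 1 hg
  have e1 := tendsto_nhds_unique (hp.tendsto_complex h.upper.sq hΛ hψ.toUniv hφ hρ)
    (h.upper.tendsto_stressPair_normal (G := G) hγ hψ hρ hρ1)
  have e2 := tendsto_nhds_unique (hm.tendsto_complex h.lower.sq hΛ hψ.toUniv hφ hρ)
    (h.lower.tendsto_stressPair_normal (G := G) hγ hψ hρ hρ1)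
  rw [← hT, ← hT, e1] at e2
  set X := ftPair (v 0) fun ξ => Complex.I * ξ * ψ ξ
  set Y := ftPair (v 1) fun ξ => absC ξ * ψ ξ
  have e3 : (lameOne G ν : ℂ) * X - (2 * G + lameOne G ν) * ((1 - γ) * Y + γ * X) = 0 := by
    push_cast at e2
    linear_combination e2 / 2
  have r1 : lameOne G ν * (1 - 2 * ν) = 2 * ν * G := by
    rw [lameOne]; field_simp [show (1 - 2 * ν) ≠ 0 by linarith]
  have c1 : (lameOne G ν : ℂ) * (1 - 2 * ν) = 2 * ν * G := by exact_mod_cast r1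
  have c2 : (γ : ℂ) * (3 - 4 * ν) = 1 := by exact_mod_cast hγ
  have c3 : (β : ℂ) * (2 - 2 * ν) = 1 := by exact_mod_cast hβ
  have e4 : (4 * G * (1 - ν) : ℂ) * Y = -(2 * G * (1 - 2 * ν)) * X := by
    have hn : (1 - 2 * ν : ℂ) ≠ 0 := by
      have : (1 - 2 * ν : ℝ) ≠ 0 := by linarith
      exact_mod_cast this
    apply mul_left_cancel₀ hn
    linear_combination (-(1 - 2 * ν : ℂ) * (3 - 4 * ν)) * e3
      + ((3 - 4 * ν) * (X - ((1 - γ) * Y + γ * X))) * c1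
      + (2 * G * (1 - ν) * (Y - X)) * c2
  have hG : (2 * G : ℂ) ≠ 0 := by
    have : (2 * G : ℝ) ≠ 0 := by linarith [h.pos]
    exact_mod_cast this
  apply mul_left_cancel₀ hG
  linear_combination β * e4 - (2 * G * Y) * c3

lemma signC_mul_absC (ξ : ℝ) : signC ξ * absC ξ = ξ := by
  by_cases h : ξ = 0
  · simp [h, absC]
  · rw [signC, absC, ← Complex.ofReal_mul, div_mul_cancel₀ _ (abs_ne_zero.2 h)]

lemma IsTestC.signC_mul (hψ : IsTestC {ξ : ℝ | ξ ≠ 0} ψ) :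
    IsTestC {ξ : ℝ | ξ ≠ 0} fun ξ => signC ξ * ψ ξ := hψ.mul_left isOpen_ne contDiffOn_signC

lemma SlipSolution.ftPair_snd (h : SlipSolution G ν u v w) (hβ : β * (2 - 2 * ν) = 1)
    (hψ : IsTestC {ξ : ℝ | ξ ≠ 0} ψ) : ftPair (v 1) ψ
      = ftPair (v 0) (fun ξ => -((1 - 2 * ν) * β) * (Complex.I * (signC ξ * ψ ξ))) := by
  obtain ⟨θ, hθ, rfl⟩ := hψ.exists_eq_absC_mul
  rw [h.normal_trace hβ hθ, ftPair_const_mul]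
  congr 2; ext ξ
  rw [← mul_assoc (signC ξ), signC_mul_absC]
  ring

/-- One of the two halves of a solution. -/
lemma SlipSolution.half (h : SlipSolution G ν u v w) (hκ : κ * κ = 1) :
    ∃ w', HalfSolution κ ν u v w' := by
  rcases mul_self_eq_one_iff.1 hκ with rfl | rfl
  exacts [⟨_, h.upper⟩, ⟨_, h.lower⟩]

lemma SlipSolution.pftPair_fst (h : SlipSolution G ν u v w) (hβ : β * (2 - 2 * ν) = 1)
    (hκ : κ * κ = 1) (hψ : IsTestC {ξ : ℝ | ξ ≠ 0} ψ) (hη : IsTestC (halfLine κ) η) :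
    pftPair (u 0) (tensor ψ η) = ftPair (v 0)
      (fun ξ => κ * (moment₀ κ η |ξ| - β * absC ξ * moment₁ κ η |ξ|) * ψ ξ) := by
  obtain ⟨w', h'⟩ := h.half hκ
  have h3 : 0 < 3 - 4 * ν := by linarith [h'.lt]
  obtain ⟨γ, hγd⟩ : ∃ γ, γ = 1 / (3 - 4 * ν) := ⟨_, rfl⟩
  have hγ : γ * (3 - 4 * ν) = 1 := by rw [hγd]; field_simp
  have t0 := hη.moment₀_mul hκ hψ
  have t1 := hη.moment₁_mul hκ hψ
  rw [h'.pftPair_fst hγ hψ hη]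
  have f0 : (fun ξ : ℝ => (moment₀ κ η |ξ| - γ * absC ξ * moment₁ κ η |ξ|) * ψ ξ)
      = fun ξ => moment₀ κ η |ξ| * ψ ξ - γ * (absC ξ * (moment₁ κ η |ξ| * ψ ξ)) := by
    ext ξ; ring
  have f1 : (fun ξ : ℝ => γ * (Complex.I * ξ) * moment₁ κ η |ξ| * ψ ξ)
      = fun ξ => γ * (Complex.I * ξ * (moment₁ κ η |ξ| * ψ ξ)) := by ext ξ; ring
  have f2 : (fun ξ : ℝ => κ * (moment₀ κ η |ξ| - β * absC ξ * moment₁ κ η |ξ|) * ψ ξ)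
      = fun ξ => κ * (moment₀ κ η |ξ| * ψ ξ - β * (absC ξ * (moment₁ κ η |ξ| * ψ ξ))) := by
    ext ξ; ring
  have f3 : (fun ξ : ℝ => -((1 - 2 * ν) * β : ℂ) * (Complex.I * (signC ξ *
      (Complex.I * ξ * (moment₁ κ η |ξ| * ψ ξ))))) = fun ξ => (1 - 2 * ν) * β *
      (absC ξ * (moment₁ κ η |ξ| * ψ ξ)) := by
    ext ξ
    have : signC ξ * ξ = absC ξ := by
      by_cases h : ξ = 0
      · simp [h, absC]
      · rw [← mul_right_inj' (absC_ne_zero h), absC_sq, ← mul_assoc, mul_comm (absC ξ),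
          signC_mul_absC]
    linear_combination (-((1 - 2 * ν) * β * (moment₁ κ η |ξ| * ψ ξ))) *
      (Complex.I * Complex.I * this + absC ξ * Complex.I_mul_I)
  have c2 : (γ : ℂ) * (3 - 4 * ν) = 1 := by exact_mod_cast hγ
  have c3 : (β : ℂ) * (2 - 2 * ν) = 1 := by exact_mod_cast hβ
  rw [f0, f1, f2, ftPair_const_mul, ftPair_const_mul, ftPair_sub (h'.tempv 0) t0
    (t1.absC_mul.const_mul _), ftPair_sub (h'.tempv 0) t0 (t1.absC_mul.const_mul _),
    h.ftPair_snd hβ t1.I_mul, f3, ftPair_const_mul, ftPair_const_mul, ftPair_const_mul]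
  linear_combination (κ * ftPair (v 0) (fun ξ => absC ξ * (moment₁ κ η |ξ| * ψ ξ))) *
    (γ * c3 - β * c2)

lemma SlipSolution.pftPair_snd (h : SlipSolution G ν u v w) (hβ : β * (2 - 2 * ν) = 1)
    (hκ : κ * κ = 1) (hψ : IsTestC {ξ : ℝ | ξ ≠ 0} ψ) (hη : IsTestC (halfLine κ) η) :
    pftPair (u 1) (tensor ψ η) = ftPair (v 0)
      (fun ξ => -β * (Complex.I * ((1 - 2 * ν) * signC ξ * moment₀ κ η |ξ|
        + ξ * moment₁ κ η |ξ|)) * ψ ξ) := by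
  obtain ⟨w', h'⟩ := h.half hκ
  have h3 : 0 < 3 - 4 * ν := by linarith [h'.lt]
  obtain ⟨γ, hγd⟩ : ∃ γ, γ = 1 / (3 - 4 * ν) := ⟨_, rfl⟩
  have hγ : γ * (3 - 4 * ν) = 1 := by rw [hγd]; field_simp
  have t0 := hη.moment₀_mul hκ hψ
  have t1 := hη.moment₁_mul hκ hψ
  rw [h'.pftPair_snd hγ hψ hη]
  have f0 : (fun ξ : ℝ => (moment₀ κ η |ξ| + γ * absC ξ * moment₁ κ η |ξ|) * ψ ξ)
      = fun ξ => moment₀ κ η |ξ| * ψ ξ + γ * (absC ξ * (moment₁ κ η |ξ| * ψ ξ)) := by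
    ext ξ; ring
  have f1 : (fun ξ : ℝ => γ * (Complex.I * ξ) * moment₁ κ η |ξ| * ψ ξ)
      = fun ξ => γ * (Complex.I * ξ * (moment₁ κ η |ξ| * ψ ξ)) := by ext ξ; ring
  have f2 : (fun ξ : ℝ => -β * (Complex.I * ((1 - 2 * ν) * signC ξ * moment₀ κ η |ξ|
        + ξ * moment₁ κ η |ξ|)) * ψ ξ)
      = fun ξ => -((1 - 2 * ν) * β : ℂ) * (Complex.I * (signC ξ * (moment₀ κ η |ξ| * ψ ξ)))
        + -(β : ℂ) * (Complex.I * ξ * (moment₁ κ η |ξ| * ψ ξ)) := by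
    ext ξ; ring
  have s0 : IsTestC {ξ : ℝ | ξ ≠ 0} fun ξ => -((1 - 2 * ν) * β : ℂ) *
    (Complex.I * (signC ξ * (moment₀ κ η |ξ| * ψ ξ))) := (t0.signC_mul.const_mul _).const_mul _
  have c2 : (γ : ℂ) * (3 - 4 * ν) = 1 := by exact_mod_cast hγ
  have c3 : (β : ℂ) * (2 - 2 * ν) = 1 := by exact_mod_cast hβ
  rw [f0, f1, f2, ftPair_add (h'.tempv 0) s0 (t1.I_mul.const_mul _), ftPair_add (h'.tempv 1) t0
    (t1.absC_mul.const_mul _), ftPair_const_mul _ (fun ξ => absC ξ * _), h.normal_trace hβ t1,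
    h.ftPair_snd hβ t0, ftPair_const_mul _ (fun ξ => Complex.I * _ * _),
    ftPair_const_mul _ (fun ξ : ℝ => Complex.I * _ * _)]
  linear_combination (ftPair (v 0) (fun ξ => Complex.I * ξ * (moment₁ κ η |ξ| * ψ ξ))) *
    (γ * c3 - β * c2)

end slip

/-! ### Frequency cut-offs -/

lemma deriv_cut_mul {Ω : Set ℝ} {θ : ℝ → ℂ} (hθ : IsTestC Ω θ) (ψ : 𝓢(ℝ, ℂ)) (s : ℝ) :
    deriv (fun ξ => θ (s * ξ) * ψ ξ) = fun ξ => s * (deriv θ (s * ξ) * ψ ξ)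
      + θ (s * ξ) * SchwartzMap.derivCLM ℂ ℂ ψ ξ := by
  ext ξ
  have h1 : HasDerivAt (fun ξ => θ (s * ξ)) (s • deriv θ (s * ξ)) ξ := by
    have h2 := (hθ.1.differentiable (by simp) (s * ξ)).hasDerivAt
    have h3 : HasDerivAt (fun ξ => s * ξ) s ξ := by simpa using (hasDerivAt_id ξ).const_mul s
    exact h2.scomp ξ h3
  have h2 : HasDerivAt (fun ξ => θ (s * ξ) * ψ ξ) _ ξ := h1.mul (ψ.differentiable ξ).hasDerivAt
  rw [h2.deriv, SchwartzMap.derivCLM_apply, Complex.real_smul]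
  ring

lemma integrable_cut_mul {Ω : Set ℝ} {θ : ℝ → ℂ} (hθ : IsTestC Ω θ) (ψ : 𝓢(ℝ, ℂ)) (s : ℝ) :
    Integrable fun ξ => θ (s * ξ) * ψ ξ := by
  obtain ⟨C, hC⟩ := hθ.exists_bound
  exact ψ.integrable.bdd_mul (c := C) (hθ.continuous.comp (by fun_prop)).aestronglyMeasurable
    (Eventually.of_forall fun ξ => hC _)

lemma ft_cut_pow_decay (N : ℕ) {θ : ℝ → ℂ} (hθ : IsTestC univ θ) (ψ : 𝓢(ℝ, ℂ)) :
    ∃ C : ℝ, ∀ s : ℝ, 0 ≤ s → ∀ x, |x| ^ N * ‖ft (fun ξ => θ (s * ξ) * ψ ξ) x‖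
      ≤ C * (1 + s) ^ N := by
  induction N generalizing θ ψ with
  | zero =>
    obtain ⟨C, hC⟩ := hθ.exists_bound
    refine ⟨∫ ξ, C * ‖ψ ξ‖, fun s _ x => ?_⟩
    simp only [pow_zero, one_mul, mul_one]
    refine (norm_integral_le_integral_norm _).trans (integral_mono_of_nonneg
      (Eventually.of_forall fun ξ => norm_nonneg _) (ψ.integrable.norm.const_mul C)
      (Eventually.of_forall fun ξ => ?_))
    simp only [norm_mul, norm_cexp_neg_I_mul, one_mul]
    gcongr
    exact hC _
  | succ N ih =>
    obtain ⟨C1, h1⟩ := ih hθ.deriv ψ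
    obtain ⟨C2, h2⟩ := ih hθ (SchwartzMap.derivCLM ℂ ℂ ψ)
    refine ⟨C1 + |C2|, fun s hs x => ?_⟩
    have i1 := (integrable_cut_mul hθ.deriv ψ s).const_mul (s : ℂ)
    have i2 := integrable_cut_mul hθ (SchwartzMap.derivCLM ℂ ℂ ψ) s
    have hd : Differentiable ℝ fun ξ => θ (s * ξ) * ψ ξ :=
      ((hθ.1.differentiable (by simp)).comp (differentiable_id.const_mul s)).mul ψ.differentiable
    have e := ft_deriv (integrable_cut_mul hθ ψ s) hd (by
      rw [deriv_cut_mul hθ]; exact i1.add i2) x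
    rw [deriv_cut_mul hθ, ft_add i1 i2, ft_const_mul] at e
    have e2 : |x| ^ (N + 1) * ‖ft (fun ξ => θ (s * ξ) * ψ ξ) x‖
        = |x| ^ N * ‖Complex.I * x * ft (fun ξ => θ (s * ξ) * ψ ξ) x‖ := by
      rw [norm_mul, norm_mul, Complex.norm_I, Complex.norm_real, Real.norm_eq_abs]; ring
    rw [e2, ← e]
    have hs1 : 1 ≤ 1 + s := by linarith
    calc |x| ^ N * ‖s * ft (fun ξ => deriv θ (s * ξ) * ψ ξ) x
          + ft (fun ξ => θ (s * ξ) * SchwartzMap.derivCLM ℂ ℂ ψ ξ) x‖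
        ≤ |x| ^ N * (s * ‖ft (fun ξ => deriv θ (s * ξ) * ψ ξ) x‖
          + ‖ft (fun ξ => θ (s * ξ) * SchwartzMap.derivCLM ℂ ℂ ψ ξ) x‖) := by
          gcongr
          refine (norm_add_le _ _).trans ?_
          rw [norm_mul, Complex.norm_real, Real.norm_of_nonneg hs]
      _ = s * (|x| ^ N * ‖ft (fun ξ => deriv θ (s * ξ) * ψ ξ) x‖)
          + |x| ^ N * ‖ft (fun ξ => θ (s * ξ) * SchwartzMap.derivCLM ℂ ℂ ψ ξ) x‖ := by ring
      _ ≤ s * (C1 * (1 + s) ^ N) + C2 * (1 + s) ^ N := by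
          exact add_le_add (mul_le_mul_of_nonneg_left (h1 s hs x) hs) (h2 s hs x)
      _ ≤ (C1 + |C2|) * (1 + s) ^ (N + 1) := by
          have hC1 : 0 ≤ C1 := by
            have := (by positivity : (0 : ℝ) ≤ _).trans (h1 0 le_rfl 0)
            simpa using this
          have hp : 0 ≤ (1 + s) ^ N := by positivity
          rw [pow_succ]
          nlinarith [le_abs_self C2, mul_nonneg hC1 hp, mul_nonneg (abs_nonneg C2) hp,
            mul_nonneg (mul_nonneg (abs_nonneg C2) hp) hs,
            mul_le_mul_of_nonneg_right (le_abs_self C2) hp]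

lemma ft_cut_decay (N : ℕ) {θ : ℝ → ℂ} (hθ : IsTestC univ θ) (ψ : 𝓢(ℝ, ℂ)) :
    ∃ C : ℝ, ∀ s : ℝ, 0 ≤ s → ∀ x, (1 + ‖x‖) ^ N * ‖ft (fun ξ => θ (s * ξ) * ψ ξ) x‖
      ≤ C * (1 + s) ^ N := by
  obtain ⟨C0, h0⟩ := ft_cut_pow_decay 0 hθ ψ
  obtain ⟨C1, h1⟩ := ft_cut_pow_decay N hθ ψ
  refine ⟨2 ^ N * (|C0| + C1), fun s hs x => ?_⟩
  have h0' := h0 s hs x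
  simp only [pow_zero, one_mul, mul_one] at h0'
  have hs1 : 1 ≤ (1 + s) ^ N := one_le_pow₀ (by linarith)
  calc (1 + ‖x‖) ^ N * ‖ft (fun ξ => θ (s * ξ) * ψ ξ) x‖
      ≤ 2 ^ N * (1 + ‖x‖ ^ N) * ‖ft (fun ξ => θ (s * ξ) * ψ ξ) x‖ := by
        gcongr; exact one_add_pow_le N (norm_nonneg _)
    _ = 2 ^ N * (‖ft (fun ξ => θ (s * ξ) * ψ ξ) x‖
        + |x| ^ N * ‖ft (fun ξ => θ (s * ξ) * ψ ξ) x‖) := by rw [Real.norm_eq_abs]; ring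
    _ ≤ 2 ^ N * (|C0| * (1 + s) ^ N + C1 * (1 + s) ^ N) := by
        refine mul_le_mul_of_nonneg_left (add_le_add ?_ (h1 s hs x)) (by positivity)
        exact (h0'.trans (le_abs_self _)).trans (le_mul_of_one_le_right (abs_nonneg _) hs1)
    _ = _ := by ring

lemma tendsto_ft_cut {θ : ℝ → ℂ} (hθ : IsTestC univ θ) (h1 : θ 0 = 1) (ψ : 𝓢(ℝ, ℂ)) (x : ℝ) :
    Tendsto (fun s : ℝ => ft (fun ξ => θ (s * ξ) * ψ ξ) x) (𝓝[>] 0) (𝓝 (ft ψ x)) := by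
  obtain ⟨C, hC⟩ := hθ.exists_bound
  refine tendsto_integral_filter_of_dominated_convergence (fun ξ => C * ‖ψ ξ‖)
    (Eventually.of_forall fun s => (integrable_cexp_mul (integrable_cut_mul hθ ψ s) x).1)
    (Eventually.of_forall fun s => Eventually.of_forall fun ξ => ?_)
    (ψ.integrable.norm.const_mul C) (Eventually.of_forall fun ξ => ?_)
  · rw [norm_mul, norm_cexp_neg_I_mul, one_mul, norm_mul]
    gcongr
    exact hC _
  · refine Tendsto.const_mul _ ?_
    have h2 : Tendsto (fun s : ℝ => θ (s * ξ)) (𝓝 0) (𝓝 1) := by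
      exact (hθ.continuous.comp (by fun_prop : Continuous fun s : ℝ => s * ξ)).tendsto' 0 1
        (by simpa using h1)
    simpa using (h2.mono_left nhdsWithin_le_nhds).mul_const (ψ ξ)

lemma TemperedFun.tendsto_ft_cut {v : ℝ → ℝ} (hv : TemperedFun v) {θ : ℝ → ℂ}
    (hθ : IsTestC univ θ) (h1 : θ 0 = 1) (ψ : 𝓢(ℝ, ℂ)) :
    Tendsto (fun s : ℝ => ftPair v fun ξ => θ (s * ξ) * ψ ξ) (𝓝[>] 0) (𝓝 (ftPair v ψ)) := by
  refine hv.tendsto_integral (Eventually.of_forall fun s =>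
    (continuous_ft (integrable_cut_mul hθ ψ s)).aestronglyMeasurable) (fun N => ?_)
    fun x => PN.tendsto_ft_cut hθ h1 ψ x
  obtain ⟨C, hC⟩ := ft_cut_decay N hθ ψ
  refine ⟨|C| * 2 ^ N, ?_⟩
  filter_upwards [Ioo_mem_nhdsGT (zero_lt_one' ℝ)] with s hs x
  refine (hC s hs.1.le x).trans ?_
  have : 0 ≤ 1 + s := by linarith [hs.1]
  gcongr
  · exact le_abs_self C
  · linarith [hs.2]

/-! ### A Liouville argument on the line -/

/-- A functional of order one on the line. -/
def orderOne (F₀ F₁ : ℝ → ℝ) (φ : ℝ → ℂ) : ℂ :=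
  (∫ x, (F₀ x : ℂ) * φ x) + ∫ x, (F₁ x : ℂ) * deriv φ x

section orderOne

variable {F₀ F₁ : ℝ → ℝ}

/-- Multiplication of a Schwartz function by a power. -/
def powMul (a : ℂ) (n : ℕ) (ψ : 𝓢(ℝ, ℂ)) : 𝓢(ℝ, ℂ) :=
  SchwartzMap.smulLeftCLM ℂ (fun ξ : ℝ => (a * ξ) ^ n) ψ

lemma hasTemperateGrowth_mul_pow (a : ℂ) (n : ℕ) :
    Function.HasTemperateGrowth fun ξ : ℝ => (a * ξ) ^ n := by
  have h : Function.HasTemperateGrowth fun ξ : ℝ => a * (ξ : ℂ) :=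
    (Function.HasTemperateGrowth.const a).mul Complex.ofRealCLM.hasTemperateGrowth
  exact h.pow n

lemma powMul_apply (a : ℂ) (n : ℕ) (ψ : 𝓢(ℝ, ℂ)) (ξ : ℝ) :
    powMul a n ψ ξ = (a * ξ) ^ n * ψ ξ := by
  rw [powMul, SchwartzMap.smulLeftCLM_apply_apply (hasTemperateGrowth_mul_pow a n), smul_eq_mul]

lemma deriv_ft_schwartz (ψ : 𝓢(ℝ, ℂ)) : deriv (ft ψ) = ft (powMul (-Complex.I) 1 ψ) := by
  ext x
  rw [(hasDerivAt_ft ψ.integrable (schwartz_integrable_mul ψ) x).deriv]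
  congr 1; ext ξ
  rw [powMul_apply, pow_one]
  ring

lemma iteratedDeriv_ft_schwartz (k : ℕ) (ψ : 𝓢(ℝ, ℂ)) :
    iteratedDeriv k (ft ψ) = ft (powMul (-Complex.I) k ψ) := by
  induction k with
  | zero =>
    rw [iteratedDeriv_zero]
    congr 1; ext ξ; simp [powMul_apply]
  | succ k ih =>
    rw [iteratedDeriv_succ, ih, deriv_ft_schwartz]
    congr 1; ext ξ
    rw [powMul_apply, powMul_apply, powMul_apply]
    ring

lemma orderOne_ft (ψ : 𝓢(ℝ, ℂ)) :
    orderOne F₀ F₁ (ft ψ) = ftPair F₀ ψ + ftPair F₁ (powMul (-Complex.I) 1 ψ) := by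
  rw [orderOne, deriv_ft_schwartz]; rfl

lemma rapid_ft_schwartz (ψ : 𝓢(ℝ, ℂ)) : Rapid (ft ψ) := by
  obtain ⟨φ, hφ⟩ := exists_schwartz_ft ψ
  rw [show ft ψ = φ from funext fun x => (hφ x).symm]
  exact SchwartzMap_rapid φ

lemma ftPair_integrable_schwartz {v : ℝ → ℝ} (hv : TemperedFun v) (ψ : 𝓢(ℝ, ℂ)) :
    Integrable fun x => (v x : ℂ) * ft ψ x :=
  hv.integrable_mul (continuous_ft ψ.integrable).aestronglyMeasurable (rapid_ft_schwartz ψ)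

lemma ftPair_sub_schwartz {v : ℝ → ℝ} (hv : TemperedFun v) (φ ψ : 𝓢(ℝ, ℂ)) :
    ftPair v (φ - ψ : 𝓢(ℝ, ℂ)) = ftPair v φ - ftPair v ψ := by
  rw [ftPair, ftPair, ftPair, ← integral_sub (ftPair_integrable_schwartz hv φ)
    (ftPair_integrable_schwartz hv ψ)]
  congr 1; ext x
  rw [← mul_sub, ← ft_sub φ.integrable ψ.integrable]
  rfl

lemma TemperedFun.exists_norm_ftPair_cut_le {v : ℝ → ℝ} (hv : TemperedFun v) : ∃ N₀ : ℕ,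
    ∀ N, N₀ ≤ N → ∀ {θ : ℝ → ℂ} (_ : IsTestC univ θ) (ψ : 𝓢(ℝ, ℂ)), ∃ C : ℝ, ∀ s : ℝ, 0 ≤ s →
      ‖ftPair v fun ξ => θ (s * ξ) * ψ ξ‖ ≤ C * (1 + s) ^ N := by
  obtain ⟨N₀, h⟩ := hv
  refine ⟨N₀, fun N hN θ hθ ψ => ?_⟩
  obtain ⟨C, hC⟩ := ft_cut_decay N₀ hθ ψ
  refine ⟨(∫ x, ‖v x / (1 + ‖x‖) ^ N₀‖) * |C|, fun s hs => ?_⟩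
  rw [ftPair, mul_assoc, ← integral_mul_const]
  refine (norm_integral_le_integral_norm _).trans (integral_mono_of_nonneg
      (Eventually.of_forall fun ξ => norm_nonneg _) (h.norm.mul_const _)
      (Eventually.of_forall fun x => ?_))
  have hp : 0 < (1 + ‖x‖) ^ N₀ := by positivity
  simp only
  rw [norm_mul, Complex.norm_real, norm_div, Real.norm_of_nonneg hp.le, div_mul_eq_mul_div,
    le_div_iff₀ hp]
  calc ‖v x‖ * ‖ft (fun ξ => θ (s * ξ) * ψ ξ) x‖ * (1 + ‖x‖) ^ N₀
      = ‖v x‖ * ((1 + ‖x‖) ^ N₀ * ‖ft (fun ξ => θ (s * ξ) * ψ ξ) x‖) := by ring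
    _ ≤ ‖v x‖ * (|C| * (1 + s) ^ N) := by
        refine mul_le_mul_of_nonneg_left ((hC s hs x).trans ?_) (norm_nonneg _)
        refine mul_le_mul (le_abs_self C) (pow_le_pow_right₀ (by linarith) hN) (by positivity)
          (abs_nonneg C)

/-- The Schwartz function `θ(s ξ) ψ(ξ)`. -/
def cutSchwartz {θ : ℝ → ℂ} (hθ : IsTestC univ θ) {s : ℝ} (hs : s ≠ 0) (ψ : 𝓢(ℝ, ℂ)) : 𝓢(ℝ, ℂ) :=
  HasCompactSupport.toSchwartzMap (f := fun ξ => θ (s * ξ) * ψ ξ)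
    ((hθ.2.1.comp_homeomorph (Homeomorph.mulLeft₀ s hs)).mul_right)
    ((hθ.1.comp (contDiff_const.mul contDiff_id)).mul (ψ.smooth ⊤))

lemma cutSchwartz_apply {θ : ℝ → ℂ} (hθ : IsTestC univ θ) {s : ℝ} (hs : s ≠ 0) (ψ : 𝓢(ℝ, ℂ))
    (ξ : ℝ) : cutSchwartz hθ hs ψ ξ = θ (s * ξ) * ψ ξ := rfl

lemma isTestC_cutSchwartz {θ : ℝ → ℂ} (hθ : IsTestC univ θ) {s : ℝ} (hs : s ≠ 0) {ψ : 𝓢(ℝ, ℂ)}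
    (h0 : (0 : ℝ) ∉ tsupport ψ) : IsTestC {ξ : ℝ | ξ ≠ 0} fun ξ => θ (s * ξ) * ψ ξ := by
  refine ⟨(cutSchwartz hθ hs ψ).smooth ⊤,
    (hθ.2.1.comp_homeomorph (Homeomorph.mulLeft₀ s hs)).mul_right, fun ξ hξ h => ?_⟩
  have h' : ξ = 0 := h
  exact h0 (h' ▸ closure_mono (Function.support_mul_subset_right _ _) hξ)

lemma orderOne_ft_of_notMem (hF₀ : TemperedFun F₀) (hF₁ : TemperedFun F₁)
    (h : ∀ ψ, IsTestC {ξ : ℝ | ξ ≠ 0} ψ → orderOne F₀ F₁ (ft ψ) = 0) {ψ : 𝓢(ℝ, ℂ)}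
    (h0 : (0 : ℝ) ∉ tsupport ψ) : orderOne F₀ F₁ (ft ψ) = 0 := by
  obtain ⟨χ, hχ, hχ1, -, -⟩ := exists_cutoff
  have hθ := hχ.ofReal
  have hθ0 : ((χ 0 : ℝ) : ℂ) = 1 := by rw [hχ1 0 (by simp)]; simp
  have l := (hF₀.tendsto_ft_cut hθ hθ0 ψ).add
    (hF₁.tendsto_ft_cut hθ hθ0 (powMul (-Complex.I) 1 ψ))
  rw [orderOne_ft]
  refine tendsto_nhds_unique l (tendsto_const_nhds.congr' ?_)
  filter_upwards [self_mem_nhdsWithin] with s hs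
  have hs' : s ≠ 0 := ne_of_gt hs
  rw [← h _ (isTestC_cutSchwartz hθ hs' h0)]
  have := orderOne_ft (F₀ := F₀) (F₁ := F₁) (cutSchwartz hθ hs' ψ)
  refine this.trans ?_
  congr 2; ext ξ
  rw [powMul_apply, powMul_apply, cutSchwartz_apply]
  ring

lemma exists_orderOne_iteratedDeriv (hF₀ : TemperedFun F₀) (hF₁ : TemperedFun F₁)
    (h : ∀ ψ, IsTestC {ξ : ℝ | ξ ≠ 0} ψ → orderOne F₀ F₁ (ft ψ) = 0) :
    ∃ n : ℕ, ∀ ψ : 𝓢(ℝ, ℂ), orderOne F₀ F₁ (iteratedDeriv n (ft ψ)) = 0 := by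
  obtain ⟨χ, hχ, hχ1, -, -⟩ := exists_cutoff
  obtain ⟨N₀, h₀⟩ := hF₀.exists_norm_ftPair_cut_le
  obtain ⟨N₁, h₁⟩ := hF₁.exists_norm_ftPair_cut_le
  set N := max N₀ N₁
  refine ⟨N + 1, fun ψ => ?_⟩
  rw [iteratedDeriv_ft_schwartz]
  have hθ : IsTestC univ fun ξ : ℝ => (-Complex.I * ξ) ^ (N + 1) * (χ ξ : ℂ) :=
    hχ.ofReal.mul_left' ((contDiff_const.mul Complex.ofRealCLM.contDiff).pow _)
  obtain ⟨C₀, hC₀⟩ := h₀ N (le_max_left _ _) hθ ψ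
  obtain ⟨C₁, hC₁⟩ := h₁ N (le_max_right _ _) hθ (powMul (-Complex.I) 1 ψ)
  set A := orderOne F₀ F₁ (ft (powMul (-Complex.I) (N + 1) ψ))
  have key : ∀ M : ℝ, 1 ≤ M → M * ‖A‖ ≤ (|C₀| + |C₁|) * 2 ^ N := by
    intro M hM
    have hM0 : (0 : ℝ) < M := by linarith
    set g := cutSchwartz hθ hM0.ne' ψ with hg
    have hMC : (M : ℂ) ≠ 0 := by exact_mod_cast hM0.ne'
    set f : 𝓢(ℝ, ℂ) := powMul (-Complex.I) (N + 1) ψ - ((M : ℂ) ^ (N + 1))⁻¹ • g with hf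
    have hf0 : (0 : ℝ) ∉ tsupport f := by
      rw [notMem_tsupport_iff_eventuallyEq]
      have : Ioo (-M⁻¹) M⁻¹ ∈ 𝓝 (0 : ℝ) := Ioo_mem_nhds (by simpa using hM0) (by positivity)
      filter_upwards [this] with ξ hξ
      have hx : |M * ξ| ≤ 1 := by
        rw [abs_mul, abs_of_pos hM0]
        have : |ξ| ≤ M⁻¹ := (abs_lt.2 hξ).le
        calc M * |ξ| ≤ M * M⁻¹ := by gcongr
          _ = 1 := mul_inv_cancel₀ hM0.ne'
      simp only [hf, sub_apply, smul_apply, powMul_apply, hg,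
        cutSchwartz_apply, hχ1 _ hx, smul_eq_mul, Pi.zero_apply]
      push_cast
      field_simp
      ring
    have e := orderOne_ft_of_notMem hF₀ hF₁ h hf0
    have e2 : A = ((M : ℂ) ^ (N + 1))⁻¹ * orderOne F₀ F₁ (ft g) := by
      rw [orderOne_ft] at e
      have s1 : powMul (-Complex.I) 1 f = powMul (-Complex.I) 1 (powMul (-Complex.I) (N + 1) ψ)
          - ((M : ℂ) ^ (N + 1))⁻¹ • powMul (-Complex.I) 1 g := by
        ext ξ
        simp only [hf, powMul_apply, sub_apply, smul_apply, smul_eq_mul]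
        ring
      have s2 : ∀ (v : ℝ → ℝ) (g : 𝓢(ℝ, ℂ)) (a : ℂ), ftPair v (a • g : 𝓢(ℝ, ℂ)) = a * ftPair v g :=
        fun v g a => ftPair_const_mul a g
      rw [s1, hf, ftPair_sub_schwartz hF₀, ftPair_sub_schwartz hF₁, s2, s2] at e
      simp only [A, orderOne_ft]
      linear_combination e
    have e3 : ‖orderOne F₀ F₁ (ft g)‖ ≤ (|C₀| + |C₁|) * (1 + M) ^ N := by
      rw [orderOne_ft, add_mul]
      refine (norm_add_le _ _).trans (add_le_add ?_ ?_)
      · exact (hC₀ M hM0.le).trans (mul_le_mul_of_nonneg_right (le_abs_self _) (by positivity))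
      · have : (powMul (-Complex.I) 1 g : ℝ → ℂ) = fun ξ => (-Complex.I * ((M * ξ : ℝ) : ℂ)) ^ (N + 1)
            * (χ (M * ξ) : ℂ) * powMul (-Complex.I) 1 ψ ξ := by
          ext ξ
          rw [powMul_apply, powMul_apply, hg, cutSchwartz_apply]
          ring
        rw [this]
        exact (hC₁ M hM0.le).trans (mul_le_mul_of_nonneg_right (le_abs_self _) (by positivity))
    rw [e2, norm_mul, norm_inv, norm_pow, Complex.norm_real, Real.norm_of_nonneg hM0.le]
    calc M * ((M ^ (N + 1))⁻¹ * ‖orderOne F₀ F₁ (ft g)‖)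
        = (M ^ N)⁻¹ * ‖orderOne F₀ F₁ (ft g)‖ := by rw [pow_succ]; field_simp
      _ ≤ (M ^ N)⁻¹ * ((|C₀| + |C₁|) * (2 * M) ^ N) := by
          refine mul_le_mul_of_nonneg_left (e3.trans ?_) (by positivity)
          have : 1 + M ≤ 2 * M := by linarith
          gcongr
      _ = (|C₀| + |C₁|) * 2 ^ N := by rw [mul_pow]; field_simp
  by_contra hA
  have hA' : 0 < ‖A‖ := norm_pos_iff.2 hA
  set D := (|C₀| + |C₁|) * 2 ^ N
  have hD : 0 ≤ D := by positivity
  have := key (D / ‖A‖ + 1) (by have : 0 ≤ D / ‖A‖ := by positivity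
                                linarith)
  rw [add_mul, div_mul_cancel₀ _ hA'.ne', one_mul] at this
  linarith

end orderOne

section descend

variable {F₀ F₁ : ℝ → ℝ} {Ω Ω' : Set ℝ}

lemma IsTestC.rapid {f : ℝ → ℂ} (hf : IsTestC Ω f) : Rapid f :=
  SchwartzMap_rapid (hf.2.1.toSchwartzMap hf.1)

lemma TemperedFun.integrable_mul_test {F : ℝ → ℝ} (hF : TemperedFun F) {f : ℝ → ℂ}
    (hf : IsTestC Ω f) : Integrable fun x => (F x : ℂ) * f x :=
  hF.integrable_mul hf.continuous.aestronglyMeasurable hf.rapid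

lemma orderOne_sub (hF₀ : TemperedFun F₀) (hF₁ : TemperedFun F₁) {f g : ℝ → ℂ}
    (hf : IsTestC Ω f) (hg : IsTestC Ω' g) :
    orderOne F₀ F₁ (fun x => f x - g x) = orderOne F₀ F₁ f - orderOne F₀ F₁ g := by
  have hd : deriv (fun x => f x - g x) = fun x => deriv f x - deriv g x := by
    ext x
    exact deriv_fun_sub (hf.1.differentiable (by simp) x) (hg.1.differentiable (by simp) x)
  simp only [orderOne, hd, mul_sub]
  rw [integral_sub (hF₀.integrable_mul_test hf) (hF₀.integrable_mul_test hg),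
    integral_sub (hF₁.integrable_mul_test hf.deriv) (hF₁.integrable_mul_test hg.deriv)]
  ring

lemma orderOne_const_mul (c : ℂ) (f : ℝ → ℂ) :
    orderOne F₀ F₁ (fun x => c * f x) = c * orderOne F₀ F₁ f := by
  simp only [orderOne, deriv_const_mul_field, mul_left_comm _ c, integral_const_mul]
  ring

lemma IsTestC.iteratedDeriv {f : ℝ → ℂ} (hf : IsTestC Ω f) (k : ℕ) :
    IsTestC Ω (iteratedDeriv k f) := by
  induction k with
  | zero => simpa using hf
  | succ k ih => rw [iteratedDeriv_succ]; exact ih.deriv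

lemma IsTestC.exists_deriv_eq {f : ℝ → ℂ} (hf : IsTestC univ f) (h0 : ∫ x, f x = 0) :
    ∃ g, IsTestC univ g ∧ _root_.deriv g = f := by
  have hd := hasDerivAt_integral_Iic hf.continuous hf.integrable
  have hg : _root_.deriv (fun y => ∫ t in Iic y, f t) = f := funext fun y => (hd y).deriv
  refine ⟨fun y => ∫ t in Iic y, f t, ?_, hg⟩
  obtain ⟨B, hB⟩ := hf.2.1.isCompact.isBounded.exists_norm_le
  have hz : ∀ t, |B| < |t| → f t = 0 := fun t ht => image_eq_zero_of_notMem_tsupport fun h =>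
    absurd ((hB t h).trans (le_abs_self B)) (not_le.2 ht)
  refine isTestC_of_subset (K := Icc (-|B|) |B|) ?_ isCompact_Icc (subset_univ _) fun y hy => ?_
  · refine contDiff_infty_iff_deriv.2 ⟨fun y => (hd y).differentiableAt, ?_⟩
    rw [hg]; exact hf.1
  · rw [mem_Icc, not_and_or, not_le, not_le] at hy
    rcases hy with hy | hy
    · refine setIntegral_eq_zero_of_forall_eq_zero fun t ht => hz t ?_
      rw [lt_abs]; right; linarith [mem_Iic.1 ht]
    · rw [← h0]
      refine setIntegral_eq_integral_of_forall_compl_eq_zero fun t ht => hz t ?_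
      rw [lt_abs]; left; linarith [not_le.1 (show ¬ t ≤ y from ht)]

lemma iteratedDeriv_sub_test {f g : ℝ → ℂ} (hf : IsTestC Ω f) (hg : IsTestC Ω' g) (k : ℕ) :
    iteratedDeriv k (fun x => f x - g x) = fun x => iteratedDeriv k f x - iteratedDeriv k g x := by
  ext x
  exact iteratedDeriv_fun_sub (hf.1.contDiffAt.of_le (by exact_mod_cast le_top))
    (hg.1.contDiffAt.of_le (by exact_mod_cast le_top))

/-- The decay of averages over long intervals. -/
def AveragesDecay (F₀ F₁ : ℝ → ℝ) : Prop :=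
  ∀ φ : ℝ → ℂ, IsTestC univ φ →
    Tendsto (fun R : ℝ => (R : ℂ)⁻¹ * orderOne F₀ F₁ fun x => φ (x / R)) atTop (𝓝 0)

lemma iteratedDeriv_comp_div {f : ℝ → ℂ} (hf : ContDiff ℝ ∞ f) (k : ℕ) (R : ℝ) :
    iteratedDeriv k (fun x => f (x / R)) = fun x => (R : ℂ)⁻¹ ^ k * iteratedDeriv k f (x / R) := by
  have := iteratedDeriv_comp_const_smul (n := k) (hf.of_le (by exact_mod_cast le_top)) R⁻¹
  simp only [inv_mul_eq_div] at this
  rw [this]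
  ext x
  rw [Complex.real_smul]
  push_cast
  rfl

lemma orderOne_iteratedDeriv_descend (hF₀ : TemperedFun F₀) (hF₁ : TemperedFun F₁)
    (hd : AveragesDecay F₀ F₁) (k : ℕ)
    (h : ∀ φ, IsTestC univ φ → orderOne F₀ F₁ (iteratedDeriv (k + 1) φ) = 0) {φ : ℝ → ℂ}
    (hφ : IsTestC univ φ) : orderOne F₀ F₁ (iteratedDeriv k φ) = 0 := by
  obtain ⟨ρ', hρ', hρ1'⟩ := exists_isTest_integral_one
  obtain ⟨ρ, hρd⟩ : ∃ ρ : ℝ → ℂ, ρ = fun x => (ρ' x : ℂ) := ⟨_, rfl⟩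
  have hρ : IsTestC univ ρ := hρd ▸ hρ'.ofReal.toUniv
  have hρ1 : ∫ x, ρ x = 1 := by
    have := integral_ofReal (𝕜 := ℂ) (f := ρ') (μ := volume)
    rw [hρ1'] at this
    simp only [hρd]
    exact_mod_cast this
  have e1 : ∀ φ, IsTestC univ φ → orderOne F₀ F₁ (iteratedDeriv k φ)
      = (∫ x, φ x) * orderOne F₀ F₁ (iteratedDeriv k ρ) := by
    intro φ hφ
    obtain ⟨g, hg, hgd⟩ := (hφ.sub (hρ.const_mul (∫ x, φ x))).exists_deriv_eq (by
      rw [integral_sub hφ.integrable (hρ.integrable.const_mul _), integral_const_mul, hρ1, mul_one,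
        sub_self])
    have e := h g hg
    have e3 : iteratedDeriv k (fun x => (∫ x, φ x) * ρ x)
        = fun x => (∫ x, φ x) * iteratedDeriv k ρ x := funext fun x =>
      iteratedDeriv_const_mul _ (hρ.1.contDiffAt.of_le (by exact_mod_cast le_top))
    rw [iteratedDeriv_succ', hgd, iteratedDeriv_sub_test hφ (hρ.const_mul _),
      orderOne_sub hF₀ hF₁ (hφ.iteratedDeriv k) ((hρ.const_mul _).iteratedDeriv k), e3,
      orderOne_const_mul] at e
    linear_combination e
  have e2 : orderOne F₀ F₁ (iteratedDeriv k ρ) = 0 := by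
    have l := (hd _ (hρ.iteratedDeriv k)).norm
    rw [norm_zero] at l
    refine norm_eq_zero.1 (le_antisymm (ge_of_tendsto l ?_) (norm_nonneg _))
    filter_upwards [eventually_ge_atTop 1] with R hR
    have hR0 : 0 < R := by linarith
    have hRC : (R : ℂ) ≠ 0 := by exact_mod_cast hR0.ne'
    have hc : ContDiff ℝ ∞ fun x : ℝ => x / R := contDiff_id.div_const R
    have ht : IsTestC univ fun x => ρ (x / R) := by
      refine ⟨hρ.1.comp hc, ?_, subset_univ _⟩
      have := hρ.2.1.comp_homeomorph (Homeomorph.mulRight₀ R⁻¹ (inv_ne_zero hR0.ne'))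
      exact this
    have e := e1 _ ht
    rw [iteratedDeriv_comp_div hρ.1, orderOne_const_mul, Measure.integral_comp_div, hρ1,
      abs_of_pos hR0, Complex.real_smul, mul_one] at e
    have e' : (R : ℂ)⁻¹ * orderOne F₀ F₁ (fun x => iteratedDeriv k ρ (x / R))
        = (R : ℂ) ^ k * orderOne F₀ F₁ (iteratedDeriv k ρ) := by
      have : orderOne F₀ F₁ (fun x => iteratedDeriv k ρ (x / R))
          = (R : ℂ) ^ k * (R * orderOne F₀ F₁ (iteratedDeriv k ρ)) := by
        rw [← e, ← mul_assoc, ← mul_pow, mul_inv_cancel₀ hRC, one_pow, one_mul]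
      rw [this]; field_simp
    rw [e', norm_mul, norm_pow, Complex.norm_real, Real.norm_of_nonneg hR0.le]
    exact le_mul_of_one_le_left (norm_nonneg _) (one_le_pow₀ hR)
  rw [e1 φ hφ, e2, mul_zero]

lemma tendsto_orderOne_cut (hF₀ : TemperedFun F₀) (hF₁ : TemperedFun F₁) (φ : 𝓢(ℝ, ℂ))
    {χ : ℝ → ℂ} (hχ : IsTestC univ χ) (h1 : χ 0 = 1) :
    Tendsto (fun s : ℝ => orderOne F₀ F₁ fun x => χ (s * x) * φ x) (𝓝[>] 0)
      (𝓝 (orderOne F₀ F₁ φ)) := by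
  obtain ⟨A, hA⟩ := hχ.exists_bound
  obtain ⟨B, hB⟩ := hχ.deriv.exists_bound
  have hA0 : 0 ≤ A := (norm_nonneg _).trans (hA 0)
  have hB0 : 0 ≤ B := (norm_nonneg _).trans (hB 0)
  have hs : ∀ x, Tendsto (fun s : ℝ => s * x) (𝓝[>] 0) (𝓝 0) := fun x =>
    ((by fun_prop : Continuous fun s : ℝ => s * x).tendsto' 0 0 (by simp)).mono_left
      nhdsWithin_le_nhds
  have hl : ∀ x, Tendsto (fun s : ℝ => χ (s * x)) (𝓝[>] 0) (𝓝 1) := fun x => by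
    rw [← h1]; exact (hχ.continuous.tendsto 0).comp (hs x)
  simp only [orderOne, deriv_cut_mul hχ]
  refine Tendsto.add (hF₀.tendsto_integral (Eventually.of_forall fun s => ?_) (fun N => ?_)
    fun x => ?_) (hF₁.tendsto_integral (Eventually.of_forall fun s => ?_) (fun N => ?_) fun x => ?_)
  · exact ((hχ.continuous.comp (by fun_prop)).mul φ.continuous).aestronglyMeasurable
  · obtain ⟨C, hC⟩ := SchwartzMap_rapid φ N
    refine ⟨A * C, Eventually.of_forall fun s x => ?_⟩
    rw [norm_mul, mul_left_comm]
    exact mul_le_mul (hA _) (hC x) (by positivity) hA0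
  · simpa using (hl x).mul_const (φ x)
  · exact ((((hχ.deriv.continuous.comp (by fun_prop : Continuous fun x : ℝ => s * x)).mul
      φ.continuous).const_mul (s : ℂ)).add ((hχ.continuous.comp (by fun_prop)).mul
      (SchwartzMap.derivCLM ℂ ℂ φ).continuous)).aestronglyMeasurable
  · obtain ⟨C, hC⟩ := SchwartzMap_rapid φ N
    obtain ⟨D, hD⟩ := SchwartzMap_rapid (SchwartzMap.derivCLM ℂ ℂ φ) N
    refine ⟨B * C + A * D, ?_⟩
    filter_upwards [Ioo_mem_nhdsGT (zero_lt_one' ℝ)] with s hs x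
    have hs' : ‖(s : ℂ)‖ ≤ 1 := by
      rw [Complex.norm_real, Real.norm_of_nonneg hs.1.le]; exact hs.2.le
    calc (1 + ‖x‖) ^ N * ‖s * (deriv χ (s * x) * φ x)
          + χ (s * x) * SchwartzMap.derivCLM ℂ ℂ φ x‖
        ≤ (1 + ‖x‖) ^ N * (1 * (‖deriv χ (s * x)‖ * ‖φ x‖)
          + ‖χ (s * x)‖ * ‖SchwartzMap.derivCLM ℂ ℂ φ x‖) := by
          gcongr
          refine (norm_add_le _ _).trans ?_
          simp only [norm_mul]
          gcongr
      _ = ‖deriv χ (s * x)‖ * ((1 + ‖x‖) ^ N * ‖φ x‖)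
          + ‖χ (s * x)‖ * ((1 + ‖x‖) ^ N * ‖SchwartzMap.derivCLM ℂ ℂ φ x‖) := by ring
      _ ≤ B * C + A * D := add_le_add (mul_le_mul (hB _) (hC x) (by positivity) hB0)
          (mul_le_mul (hA _) (hD x) (by positivity) hA0)
  · have h2 : Tendsto (fun s : ℝ => (s : ℂ) * (deriv χ (s * x) * φ x)) (𝓝[>] 0) (𝓝 0) := by
      have h3 : Tendsto (fun s : ℝ => (s : ℂ)) (𝓝[>] 0) (𝓝 0) :=
        (Complex.continuous_ofReal.tendsto' 0 0 Complex.ofReal_zero).mono_left nhdsWithin_le_nhds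
      have h4 := ((hχ.deriv.continuous.tendsto 0).comp (hs x)).mul_const (φ x)
      simpa using h3.mul h4
    simpa [SchwartzMap.derivCLM_apply] using
      h2.add ((hl x).mul_const (SchwartzMap.derivCLM ℂ ℂ φ x))

theorem orderOne_eq_zero (hF₀ : TemperedFun F₀) (hF₁ : TemperedFun F₁)
    (hd : AveragesDecay F₀ F₁)
    (h : ∀ ψ, IsTestC {ξ : ℝ | ξ ≠ 0} ψ → orderOne F₀ F₁ (ft ψ) = 0) (φ : 𝓢(ℝ, ℂ)) :
    orderOne F₀ F₁ φ = 0 := by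
  obtain ⟨n, hn⟩ := exists_orderOne_iteratedDeriv hF₀ hF₁ h
  have hn' : ∀ φ, IsTestC univ φ → orderOne F₀ F₁ (iteratedDeriv n φ) = 0 := fun φ hφ => by
    obtain ⟨ψ, hψ⟩ := exists_ft_eq (hφ.2.1.toSchwartzMap hφ.1)
    rw [show φ = ft ψ from funext fun x => (hψ x).symm]
    exact hn ψ
  have h0 : ∀ φ, IsTestC univ φ → orderOne F₀ F₁ φ = 0 := by
    clear hn
    induction n with
    | zero => simpa using hn'
    | succ n ih => exact ih fun φ hφ => orderOne_iteratedDeriv_descend hF₀ hF₁ hd n hn' hφ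
  obtain ⟨χ, hχ, hχ1, -, -⟩ := exists_cutoff
  have l := tendsto_orderOne_cut hF₀ hF₁ φ hχ.ofReal (by rw [hχ1 0 (by simp)]; simp)
  refine tendsto_nhds_unique l (tendsto_const_nhds.congr' ?_)
  filter_upwards [self_mem_nhdsWithin] with s hs
  exact (h0 _ ⟨(cutSchwartz hχ.ofReal (ne_of_gt hs) φ).smooth ⊤,
    (hχ.ofReal.2.1.comp_homeomorph (Homeomorph.mulLeft₀ s (ne_of_gt hs))).mul_right,
    subset_univ _⟩).symm

end descend

/-! ### The stress in terms of the derivative of the trace -/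

lemma MemLp.temperedFun {f : ℝ → ℝ} (hf : MemLp f 2 volume) : TemperedFun f := by
  refine ⟨1, ?_⟩
  have hc : Continuous fun x : ℝ => (1 + ‖x‖)⁻¹ :=
    (by fun_prop : Continuous fun x : ℝ => 1 + ‖x‖).inv₀ fun x => by positivity
  have hg : MemLp (fun x : ℝ => (1 + ‖x‖)⁻¹) 2 volume := by
    rw [memLp_two_iff_integrable_sq hc.aestronglyMeasurable]
    refine (integrable_one_add_norm (E := ℝ) (r := 2) (by simp)).congr
      (Eventually.of_forall fun x => ?_)
    simp only
    rw [Real.rpow_neg (by positivity), inv_pow]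
    norm_cast
  refine (hf.integrable_mul hg).congr (Eventually.of_forall fun x => ?_)
  simp [div_eq_mul_inv]

lemma HasL2Deriv.tempered {v dv : ℝ → ℝ} (h : HasL2Deriv v dv) : TemperedFun dv :=
  MemLp.temperedFun h.1

lemma HasL2Deriv.orderOne_eq_zero {v dv : ℝ → ℝ} (h : HasL2Deriv v dv) (hv : TemperedFun v)
    (φ : 𝓢(ℝ, ℂ)) : orderOne dv v φ = 0 := by
  have h0 : ∀ φ, IsTestC univ φ → orderOne dv v φ = 0 := by
    intro φ hφ
    have hd := hφ.1.differentiable (by simp)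
    have r : ∀ x, deriv (fun x => (φ x).re) x = (deriv φ x).re := fun x =>
      (Complex.reCLM.hasFDerivAt.comp_hasDerivAt x (hd x).hasDerivAt).deriv
    have i : ∀ x, deriv (fun x => (φ x).im) x = (deriv φ x).im := fun x =>
      (Complex.imCLM.hasFDerivAt.comp_hasDerivAt x (hd x).hasDerivAt).deriv
    have e1 := h.2 _ hφ.re
    have e2 := h.2 _ hφ.im
    simp only [r, i] at e1 e2
    rw [orderOne, integral_ofReal_mul (h.tempered.integrable_mul_test hφ),
      integral_ofReal_mul (hv.integrable_mul_test hφ.deriv), e1, e2]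
    push_cast
    ring
  obtain ⟨χ, hχ, hχ1, -, -⟩ := exists_cutoff
  have l := tendsto_orderOne_cut h.tempered hv φ hχ.ofReal (by rw [hχ1 0 (by simp)]; simp)
  refine tendsto_nhds_unique l (tendsto_const_nhds.congr' ?_)
  filter_upwards [self_mem_nhdsWithin] with s hs
  exact (h0 _ ⟨(cutSchwartz hχ.ofReal (ne_of_gt hs) φ).smooth ⊤,
    (hχ.ofReal.2.1.comp_homeomorph (Homeomorph.mulLeft₀ s (ne_of_gt hs))).mul_right,
    subset_univ _⟩).symm

lemma HasL2Deriv.ftPair_eq {v dv : ℝ → ℝ} (h : HasL2Deriv v dv) (hv : TemperedFun v) {Ω : Set ℝ}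
    {ψ : ℝ → ℂ} (hψ : IsTestC Ω ψ) : ftPair dv ψ = ftPair v fun ξ => Complex.I * ξ * ψ ξ := by
  obtain ⟨φ, hφ⟩ := exists_schwartz_ft (hψ.2.1.toSchwartzMap hψ.1)
  have e := h.orderOne_eq_zero hv φ
  rw [show (φ : ℝ → ℂ) = ft (hψ.2.1.toSchwartzMap hψ.1) from funext hφ, orderOne_ft] at e
  have e2 : ftPair v (powMul (-Complex.I) 1 (hψ.2.1.toSchwartzMap hψ.1))
      = -ftPair v fun ξ => Complex.I * ξ * ψ ξ := by
    rw [← ftPair_neg]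
    congr 1; ext ξ
    rw [powMul_apply, pow_one, ← neg_mul, ← neg_mul]
    rfl
  rw [e2] at e
  exact add_neg_eq_zero.1 e

/-- The symbol of the stress is `(stressA + stressB |ξ y|) e^{-|ξ y|}`. -/
def stressA (C κ : ℝ) (i j : Fin 2) (ξ : ℝ) : ℂ :=
  if i = j then (if i = 0 then 2 * (C * κ) else 0) else C * (Complex.I * signC ξ)

/-- The symbol of the stress is `(stressA + stressB |ξ y|) e^{-|ξ y|}`. -/
def stressB (C κ : ℝ) (i j : Fin 2) (ξ : ℝ) : ℂ :=
  if i = j then (if i = 0 then -(C * κ) else C * κ) else -(C * (Complex.I * signC ξ))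

section slip

variable {κ G ν β : ℝ} {u : Fin 2 → ℝ × ℝ → ℝ} {v w : Fin 2 → ℝ → ℝ} {ψ η : ℝ → ℂ}

lemma ftPair_lin {Ω Ω' : Set ℝ} {v : ℝ → ℝ} (hv : TemperedFun v) {f g : ℝ → ℂ} (hf : IsTestC Ω f)
    (hg : IsTestC Ω' g) (a b : ℂ) :
    a * ftPair v f + b * ftPair v g = ftPair v fun ξ => a * f ξ + b * g ξ := by
  rw [ftPair_add hv (hf.const_mul a) (hg.const_mul b), ftPair_const_mul, ftPair_const_mul]

lemma signC_mul_self (ξ : ℝ) : signC ξ * ξ = absC ξ := by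
  by_cases h : ξ = 0
  · simp [h, absC]
  · rw [← mul_right_inj' (absC_ne_zero h), absC_sq, ← mul_assoc, mul_comm (absC ξ), signC_mul_absC]

lemma SlipSolution.isTestC_fst (hκ : κ * κ = 1) (hψ : IsTestC {ξ : ℝ | ξ ≠ 0} ψ)
    (hη : IsTestC (halfLine κ) η) : IsTestC {ξ : ℝ | ξ ≠ 0}
      fun ξ => κ * (moment₀ κ η |ξ| - β * absC ξ * moment₁ κ η |ξ|) * ψ ξ := by
  have h := ((hη.moment₀_mul hκ hψ).sub
    (((hη.moment₁_mul hκ hψ).absC_mul).const_mul (β : ℂ))).const_mul (κ : ℂ)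
  convert h using 2
  ring

lemma SlipSolution.isTestC_snd (hκ : κ * κ = 1) (hψ : IsTestC {ξ : ℝ | ξ ≠ 0} ψ)
    (hη : IsTestC (halfLine κ) η) : IsTestC {ξ : ℝ | ξ ≠ 0}
      fun ξ => -β * (Complex.I * ((1 - 2 * ν) * signC ξ * moment₀ κ η |ξ|
        + ξ * moment₁ κ η |ξ|)) * ψ ξ := by
  have h := (((hη.moment₀_mul hκ hψ).signC_mul.const_mul (1 - 2 * ν : ℂ)).add
    (hη.moment₁_mul hκ hψ).id_mul).const_mul (-β * Complex.I)
  convert h using 2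
  ring

lemma isTestC_stress (C : ℝ) (hκ : κ * κ = 1) (hψ : IsTestC {ξ : ℝ | ξ ≠ 0} ψ)
    (hη : IsTestC (halfLine κ) η) (i j : Fin 2) : IsTestC {ξ : ℝ | ξ ≠ 0}
      fun ξ => (stressA C κ i j ξ * moment₀ κ η |ξ|
        + stressB C κ i j ξ * absC ξ * moment₁ κ η |ξ|) * ψ ξ := by
  have t0 := hη.moment₀_mul hκ hψ
  have t1 := (hη.moment₁_mul hκ hψ).absC_mul
  have : IsTestC {ξ : ℝ | ξ ≠ 0} fun ξ => stressA C κ i j ξ * (moment₀ κ η |ξ| * ψ ξ)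
      + stressB C κ i j ξ * (absC ξ * (moment₁ κ η |ξ| * ψ ξ)) := by
    simp only [stressA, stressB]
    split_ifs
    · exact (t0.const_mul _).add (t1.const_mul _)
    · exact (t0.const_mul _).add (t1.const_mul _)
    · simp only [← neg_mul_eq_neg_mul, mul_assoc]
      exact ((t0.signC_mul.const_mul _).const_mul _).add
        ((t1.signC_mul.const_mul _).const_mul _).neg
  convert this using 2
  ring

lemma SlipSolution.stressPair_tensor (h : SlipSolution G ν u v w) (hβ : β * (2 - 2 * ν) = 1)
    (hκ : κ * κ = 1) {dv : ℝ → ℝ} (hdv : HasL2Deriv (v 0) dv)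
    (hψ : IsTestC {ξ : ℝ | ξ ≠ 0} ψ) (hη : IsTestC (halfLine κ) η) (i j : Fin 2) :
    stressPair G ν u i j (tensor ψ η) = ftPair dv fun ξ =>
      (stressA (2 * G * β) κ i j ξ * moment₀ κ η |ξ|
        + stressB (2 * G * β) κ i j ξ * absC ξ * moment₁ κ η |ξ|) * ψ ξ := by
  have hν := h.upper.lt
  have hv0 := h.upper.tempv 0
  have hm := isTestC_stress (2 * G * β) hκ hψ hη i j
  rw [hdv.ftPair_eq hv0 hm, PN.stressPair_tensor hψ hη, pftPair_fluxX, pftPair_fluxY,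
    h.pftPair_fst hβ hκ hψ.neg_I_mul hη, h.pftPair_fst hβ hκ hψ hη.deriv,
    h.pftPair_snd hβ hκ hψ.neg_I_mul hη, h.pftPair_snd hβ hκ hψ hη.deriv]
  have a1 := isTestC_fst (β := β) hκ hψ.neg_I_mul hη
  have a2 := isTestC_fst (β := β) hκ hψ hη.deriv
  have a3 := isTestC_snd (β := β) (ν := ν) hκ hψ.neg_I_mul hη
  have a4 := isTestC_snd (β := β) (ν := ν) hκ hψ hη.deriv
  have r1 : lameOne G ν * (1 - 2 * ν) = 2 * ν * G := by
    rw [lameOne]; field_simp [show (1 - 2 * ν) ≠ 0 by linarith]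
  have c1 : (lameOne G ν : ℂ) * (1 - 2 * ν) = 2 * ν * G := by exact_mod_cast r1
  have c3 : (β : ℂ) * (2 - 2 * ν) = 1 := by exact_mod_cast hβ
  have c4 : (κ : ℂ) * κ = 1 := by exact_mod_cast hκ
  have l1 : (lameOne G ν : ℂ) = 2 * ν * β * (2 * G + lameOne G ν) := by
    linear_combination (2 * β) * c1 - lameOne G ν * c3
  have l2 : (2 * G + lameOne G ν : ℂ) = 2 * ν * β * lameOne G ν + 4 * G * β := by
    linear_combination (2 * β) * c1 - (lameOne G ν + 2 * G) * c3
  have hI := Complex.I_mul_I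
  have ak : ∀ ξ : ℝ, ((|ξ| : ℝ) : ℂ) = absC ξ := fun _ => rfl
  fin_cases i <;> fin_cases j <;> simp only [Fin.zero_eta, Fin.mk_one, Fin.isValue, if_true, if_false,
    zero_ne_one, one_ne_zero, stressA, stressB]
  · rw [ftPair_lin hv0 a1 a4]
    congr 1; ext ξ
    have s1 := signC_mul_absC ξ
    simp only [moment₀_deriv hκ hη, moment₁_deriv hκ hη, ak]
    push_cast
    linear_combination (lameOne G ν * β * Complex.I * κ * (1 - 2 * ν) * moment₀ κ η |ξ| * ψ ξ) * s1
      + (κ * Complex.I * ξ * moment₀ κ η |ξ| * ψ ξ) * l2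
  · rw [ftPair_lin hv0 a3 a2]
    congr 1; ext ξ
    have s1 := signC_mul_self ξ
    have s2 := absC_sq ξ
    simp only [moment₀_deriv hκ hη, moment₁_deriv hκ hη, ak]
    push_cast
    linear_combination ((-G * β * ξ * ((1 - 2 * ν) * signC ξ * moment₀ κ η |ξ| + ξ * moment₁ κ η |ξ|)
        - 2 * G * β * ξ * signC ξ * (moment₀ κ η |ξ| - absC ξ * moment₁ κ η |ξ|)) * ψ ξ) * hI
      - (G * (absC ξ * moment₀ κ η |ξ| + β * absC ξ * moment₀ κ η |ξ|
        - β * absC ξ * absC ξ * moment₁ κ η |ξ|) * ψ ξ) * c4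
      + ((G * β * (1 - 2 * ν) * moment₀ κ η |ξ| + 2 * G * β * (moment₀ κ η |ξ|
        - absC ξ * moment₁ κ η |ξ|)) * ψ ξ) * s1
      - (G * β * moment₁ κ η |ξ| * ψ ξ) * s2 + (G * absC ξ * moment₀ κ η |ξ| * ψ ξ) * c3
  · rw [ftPair_lin hv0 a3 a2]
    congr 1; ext ξ
    have s1 := signC_mul_self ξ
    have s2 := absC_sq ξ
    simp only [moment₀_deriv hκ hη, moment₁_deriv hκ hη, ak]
    push_cast
    linear_combination ((-G * β * ξ * ((1 - 2 * ν) * signC ξ * moment₀ κ η |ξ| + ξ * moment₁ κ η |ξ|)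
        - 2 * G * β * ξ * signC ξ * (moment₀ κ η |ξ| - absC ξ * moment₁ κ η |ξ|)) * ψ ξ) * hI
      - (G * (absC ξ * moment₀ κ η |ξ| + β * absC ξ * moment₀ κ η |ξ|
        - β * absC ξ * absC ξ * moment₁ κ η |ξ|) * ψ ξ) * c4
      + ((G * β * (1 - 2 * ν) * moment₀ κ η |ξ| + 2 * G * β * (moment₀ κ η |ξ|
        - absC ξ * moment₁ κ η |ξ|)) * ψ ξ) * s1
      - (G * β * moment₁ κ η |ξ| * ψ ξ) * s2 + (G * absC ξ * moment₀ κ η |ξ| * ψ ξ) * c3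
  · rw [ftPair_lin hv0 a1 a4]
    congr 1; ext ξ
    have s1 := signC_mul_absC ξ
    simp only [moment₀_deriv hκ hη, moment₁_deriv hκ hη, ak]
    push_cast
    linear_combination ((2 * G + lameOne G ν) * β * Complex.I * κ * (1 - 2 * ν) * moment₀ κ η |ξ|
      * ψ ξ) * s1 + (κ * Complex.I * ξ * moment₀ κ η |ξ| * ψ ξ) * l1

end slip

/-! ### Duality for the Fourier transform on `L²` -/

lemma quasiMeasurePreserving_mul {c : ℝ} (hc : c ≠ 0) :
    Measure.QuasiMeasurePreserving (fun x : ℝ => c * x) volume volume :=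
  ⟨measurable_const_mul c, by
    rw [Real.map_volume_mul_left hc]; exact Measure.smul_absolutelyContinuous⟩

lemma memLp_comp_mul {f : ℝ → ℂ} (hf : MemLp f 2 volume) {c : ℝ} (hc : c ≠ 0) :
    MemLp (fun x => f (c * x)) 2 volume := by
  refine (memLp_two_iff_integrable_sq_norm
    (hf.1.comp_quasiMeasurePreserving (quasiMeasurePreserving_mul hc))).2 ?_
  exact ((memLp_two_iff_integrable_sq_norm hf.1).1 hf).comp_mul_left' hc

open FourierTransform in
lemma integral_fourier_lp_mul_schwartz (F : Lp ℂ 2 (volume : Measure ℝ)) (ψ : 𝓢(ℝ, ℂ)) :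
    ∫ x, (𝓕 F : Lp ℂ 2 (volume : Measure ℝ)) x * ψ x = ∫ x, F x * 𝓕 (ψ : ℝ → ℂ) x := by
  have h := congrArg (fun T : 𝓢'(ℝ, ℂ) => T ψ) (Lp.fourier_toTemperedDistribution_eq F)
  simp only [TemperedDistribution.fourier_apply, Lp.toTemperedDistribution_apply, smul_eq_mul] at h
  simp only [mul_comm _ (ψ _), ← h, SchwartzMap.fourier_coe, mul_comm (F _)]

open FourierTransform in
lemma fourier_toLp_ae_eq {g : ℝ → ℂ} (h1 : Integrable g) (h2 : MemLp g 2 volume) :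
    (𝓕 (h2.toLp g) : Lp ℂ 2 (volume : Measure ℝ)) =ᵐ[volume] 𝓕 g := by
  have hc : Continuous (𝓕 g) := VectorFourier.fourierIntegral_continuous
    Real.continuous_fourierChar (by exact continuous_inner) h1
  refine ae_eq_of_integral_contDiff_smul_eq
    ((Lp.memLp _).locallyIntegrable (by norm_num)) hc.locallyIntegrable fun φ hφ hs => ?_
  have hC : ContDiff ℝ ∞ fun x => (φ x : ℂ) := Complex.ofRealCLM.contDiff.comp hφ
  have hs' : HasCompactSupport fun x => (φ x : ℂ) := hs.comp_left (g := Complex.ofReal) rfl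
  have e := integral_fourier_lp_mul_schwartz (h2.toLp g) (hs'.toSchwartzMap hC)
  have e2 := VectorFourier.integral_fourierIntegral_smul_eq_flip (L := innerₗ ℝ) (f := g)
    (g := fun x => (φ x : ℂ)) (μ := volume) (ν := volume) Real.continuous_fourierChar
    (by exact continuous_inner) h1 (hC.continuous.integrable_of_hasCompactSupport hs')
  have e3 : ∫ x, (h2.toLp g) x * 𝓕 (hs'.toSchwartzMap hC : ℝ → ℂ) x
      = ∫ x, g x * 𝓕 (fun x => (φ x : ℂ)) x := by
    refine integral_congr_ae ?_
    filter_upwards [h2.coeFn_toLp] with x hx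
    rw [hx]; rfl
  simp only [Complex.real_smul, mul_comm (φ _ : ℂ)]
  refine (e.trans e3).trans ?_
  refine Eq.trans ?_ e2.symm
  simp only [flip_innerₗ, smul_eq_mul]
  rfl

lemma continuous_integral_lp_mul (F : Lp ℂ 2 (volume : Measure ℝ)) :
    Continuous fun G : Lp ℂ 2 (volume : Measure ℝ) => ∫ x, F x * G x := by
  have : (fun G : Lp ℂ 2 (volume : Measure ℝ) => ∫ x, F x * G x)
      = fun G => inner ℂ (star F) G := by
    ext G
    rw [L2.inner_def]
    refine integral_congr_ae ?_
    filter_upwards [Lp.coeFn_star F] with x hx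
    rw [hx]
    simp [mul_comm]
  rw [this]
  fun_prop

open FourierTransform in
lemma integral_fourier_lp_mul (F G : Lp ℂ 2 (volume : Measure ℝ)) :
    ∫ x, (𝓕 F : Lp ℂ 2 (volume : Measure ℝ)) x * G x
      = ∫ x, F x * (𝓕 G : Lp ℂ 2 (volume : Measure ℝ)) x := by
  refine DenseRange.induction_on (p := fun G : Lp ℂ 2 (volume : Measure ℝ) =>
    ∫ x, (𝓕 F : Lp ℂ 2 (volume : Measure ℝ)) x * G x
      = ∫ x, F x * (𝓕 G : Lp ℂ 2 (volume : Measure ℝ)) x)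
    (SchwartzMap.denseRange_toLpCLM (p := 2) ENNReal.ofNat_ne_top) G ?_ fun ψ => ?_
  · exact isClosed_eq (continuous_integral_lp_mul _)
      ((continuous_integral_lp_mul F).comp (Lp.fourierTransformₗᵢ ℝ ℂ).continuous)
  · have e := integral_fourier_lp_mul_schwartz F ψ
    simp only [SchwartzMap.toLpCLM_apply]
    rw [SchwartzMap.toLp_fourier_eq]
    refine Eq.trans (integral_congr_ae ?_) (e.trans (integral_congr_ae ?_))
    · filter_upwards [ψ.coeFn_toLp 2] with x hx
      rw [hx]
    · filter_upwards [(𝓕 ψ).coeFn_toLp 2] with x hx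
      rw [hx, SchwartzMap.fourier_coe]

open FourierTransform in
lemma integral_fourier_lp_mul_fun (F : Lp ℂ 2 (volume : Measure ℝ)) {g : ℝ → ℂ}
    (h1 : Integrable g) (h2 : MemLp g 2 volume) :
    ∫ x, (𝓕 F : Lp ℂ 2 (volume : Measure ℝ)) x * g x
      = ∫ x, F x * ft g (2 * Real.pi * x) := by
  have hpi := Real.pi_pos
  refine Eq.trans (integral_congr_ae ?_) ((integral_fourier_lp_mul F (h2.toLp g)).trans
    (integral_congr_ae ?_))
  · filter_upwards [h2.coeFn_toLp] with x hx
    rw [hx]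
  · filter_upwards [fourier_toLp_ae_eq h1 h2] with x hx
    rw [hx, ft_eq_fourier, mul_div_cancel_left₀ x (by positivity)]

/-- `D` is the transpose of the Fourier transform of `f`, tested against `L¹ ∩ L²`. -/
def FtDual (f D : ℝ → ℂ) : Prop :=
  MemLp f 2 volume ∧ MemLp D 2 volume ∧
    ∀ g : ℝ → ℂ, Integrable g → MemLp g 2 volume → ∫ x, f x * ft g x = ∫ x, D x * g x

open FourierTransform in
lemma exists_ftDual {f : ℝ → ℂ} (hf : MemLp f 2 volume) : ∃ D, FtDual f D := by
  have hpi : 2 * Real.pi ≠ 0 := by positivity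
  have hF := memLp_comp_mul hf hpi
  set F := hF.toLp
  refine ⟨fun x => (2 * Real.pi : ℂ) * (𝓕 F : Lp ℂ 2 (volume : Measure ℝ)) x, hf,
    (Lp.memLp _).const_mul _, fun g h1 h2 => ?_⟩
  simp only [mul_assoc (2 * Real.pi : ℂ)]
  rw [integral_const_mul, integral_fourier_lp_mul_fun F h1 h2]
  have e : ∫ x, F x * ft g (2 * Real.pi * x)
      = ∫ x, f (2 * Real.pi * x) * ft g (2 * Real.pi * x) := by
    refine integral_congr_ae ?_
    filter_upwards [hF.coeFn_toLp] with x hx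
    rw [hx]
  rw [e, Measure.integral_comp_mul_left (fun x => f x * ft g x), abs_inv,
    abs_of_pos (by positivity), Complex.real_smul]
  push_cast
  rw [mul_inv_cancel_left₀ (by exact_mod_cast hpi)]

open FourierTransform in
lemma exists_ftDual_of_right {D : ℝ → ℂ} (hD : MemLp D 2 volume) : ∃ f, FtDual f D := by
  have hpi : 2 * Real.pi ≠ 0 := by positivity
  set E : Lp ℂ 2 (volume : Measure ℝ) := 𝓕⁻ (hD.toLp D) with hE
  refine ⟨fun x => (2 * Real.pi : ℂ)⁻¹ * E ((2 * Real.pi)⁻¹ * x),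
    (memLp_comp_mul (Lp.memLp E) (inv_ne_zero hpi)).const_mul _, hD, fun g h1 h2 => ?_⟩
  have e := integral_fourier_lp_mul_fun E h1 h2
  have e1 : ∫ x, (𝓕 E : Lp ℂ 2 (volume : Measure ℝ)) x * g x = ∫ x, D x * g x := by
    rw [hE, FourierTransform.fourier_fourierInv_eq]
    refine integral_congr_ae ?_
    filter_upwards [hD.coeFn_toLp] with x hx
    rw [hx]
  rw [← e1, e]
  have e2 := Measure.integral_comp_mul_left
    (fun x => E ((2 * Real.pi)⁻¹ * x) * ft g x) (2 * Real.pi)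
  simp only [inv_mul_cancel_left₀ hpi] at e2
  rw [e2, abs_inv, abs_of_pos (by positivity), Complex.real_smul]
  simp only [mul_assoc (2 * Real.pi : ℂ)⁻¹]
  rw [integral_const_mul]
  push_cast
  rfl

/-! ### The stress field -/

/-- The Fourier symbol of the stress at height `y`. -/
def stressSymbol (C : ℝ) (i j : Fin 2) (y ξ : ℝ) : ℂ :=
  (stressA C (y / |y|) i j ξ + stressB C (y / |y|) i j ξ * ((|ξ| * |y| : ℝ) : ℂ))
    * ((Real.exp (-(|ξ| * |y|)) : ℝ) : ℂ)

/-- A weight in `L²(ℝ)`. -/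
def freqWeight (ξ : ℝ) : ℝ := (1 + |ξ|) ^ (-(3 / 4) : ℝ)

/-- A locally integrable function of the height. -/
def heightWeight (y : ℝ) : ℝ := 1 + |y| ^ (-(3 / 4) : ℝ)

lemma norm_signC_le (ξ : ℝ) : ‖signC ξ‖ ≤ 1 := by
  rw [signC, Complex.norm_real, Real.norm_eq_abs, abs_div, abs_abs]
  exact div_self_le_one _

lemma abs_div_abs_le (y : ℝ) : abs (y / |y|) ≤ 1 := by
  rw [abs_div, abs_abs]
  exact div_self_le_one _

lemma norm_stressA_le (C y : ℝ) (i j : Fin 2) (ξ : ℝ) :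
    ‖stressA C (y / |y|) i j ξ‖ ≤ 2 * |C| := by
  have h1 := norm_signC_le ξ
  have h2 := abs_div_abs_le y
  have hC := abs_nonneg C
  rw [stressA]
  split_ifs
  · rw [norm_mul, ← Complex.ofReal_mul, Complex.norm_real, Real.norm_eq_abs, abs_mul]
    norm_num
    nlinarith
  · simp
  · rw [norm_mul, norm_mul, Complex.norm_real, Complex.norm_I, Real.norm_eq_abs]
    nlinarith

lemma norm_stressB_le (C y : ℝ) (i j : Fin 2) (ξ : ℝ) :
    ‖stressB C (y / |y|) i j ξ‖ ≤ |C| := by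
  have h1 := norm_signC_le ξ
  have h2 := abs_div_abs_le y
  have hC := abs_nonneg C
  rw [stressB]
  split_ifs
  · rw [norm_neg, ← Complex.ofReal_mul, Complex.norm_real, Real.norm_eq_abs, abs_mul]
    nlinarith
  · rw [← Complex.ofReal_mul, Complex.norm_real, Real.norm_eq_abs, abs_mul]
    nlinarith
  · rw [norm_neg, norm_mul, norm_mul, Complex.norm_real, Complex.norm_I, Real.norm_eq_abs]
    nlinarith

lemma norm_stressSymbol_le (C : ℝ) (i j : Fin 2) (y ξ : ℝ) : ‖stressSymbol C i j y ξ‖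
    ≤ 2 * |C| * ((1 + |ξ| * |y|) * Real.exp (-(|ξ| * |y|))) := by
  have ht : 0 ≤ |ξ| * |y| := by positivity
  rw [stressSymbol, norm_mul, Complex.norm_real, Real.norm_of_nonneg (Real.exp_pos _).le,
    ← mul_assoc]
  refine mul_le_mul_of_nonneg_right ((norm_add_le _ _).trans ?_) (Real.exp_pos _).le
  rw [norm_mul, Complex.norm_real, Real.norm_of_nonneg ht]
  have h1 := norm_stressA_le C y i j ξ
  have h2 := mul_le_mul_of_nonneg_right (norm_stressB_le C y i j ξ) ht
  nlinarith [mul_nonneg (abs_nonneg C) ht]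

lemma norm_stressSymbol_le_const (C : ℝ) (i j : Fin 2) (y ξ : ℝ) :
    ‖stressSymbol C i j y ξ‖ ≤ 2 * |C| := by
  refine (norm_stressSymbol_le C i j y ξ).trans (mul_le_of_le_one_right (by positivity) ?_)
  rw [Real.exp_neg, ← div_eq_mul_inv]
  exact div_le_one_of_le₀ (by linarith [Real.add_one_le_exp (|ξ| * |y|)]) (Real.exp_pos _).le

lemma one_add_mul_exp_neg_le {t : ℝ} (ht : 0 ≤ t) : (1 + t) ^ 2 * Real.exp (-t) ≤ 4 := by
  have h := Real.add_one_le_exp (t / 2)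
  have h2 : (1 + t) ≤ 2 * Real.exp (t / 2) := by linarith
  have h3 : (1 + t) ^ 2 ≤ (2 * Real.exp (t / 2)) ^ 2 := pow_le_pow_left₀ (by linarith) h2 2
  have h4 : Real.exp (t / 2) ^ 2 = Real.exp t := by rw [← Real.exp_nat_mul]; congr 1; push_cast; ring
  rw [mul_pow, h4] at h3
  have h5 : Real.exp t * Real.exp (-t) = 1 := by rw [← Real.exp_add]; simp
  nlinarith [Real.exp_pos (-t)]

lemma norm_stressSymbol_le_weight (C : ℝ) (i j : Fin 2) {y : ℝ} (hy : y ≠ 0) (ξ : ℝ) :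
    ‖stressSymbol C i j y ξ‖ ≤ 8 * |C| * (freqWeight ξ * heightWeight y) := by
  refine (norm_stressSymbol_le C i j y ξ).trans ?_
  set t := |ξ| * |y| with ht'
  have ht : 0 ≤ t := by positivity
  have hy' : 0 < |y| := abs_pos.2 hy
  have hx : 0 ≤ |ξ| := abs_nonneg ξ
  have h1 := one_add_mul_exp_neg_le ht
  have h4 : (1 + t) * Real.exp (-t) ≤ 4 := by
    nlinarith [mul_nonneg (mul_nonneg ht (by linarith : 0 ≤ 1 + t)) (Real.exp_pos (-t)).le]
  have key : (1 + t) * Real.exp (-t) ≤ 4 * (freqWeight ξ * heightWeight y) := by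
    have hw : 0 < (1 + |ξ|) ^ (3 / 4 : ℝ) := Real.rpow_pos_of_pos (by linarith) _
    have e0 : freqWeight ξ = ((1 + |ξ|) ^ (3 / 4 : ℝ))⁻¹ := by
      rw [freqWeight, Real.rpow_neg (by linarith)]
    have e1 : (1 + |ξ|) ^ (3 / 4 : ℝ) ≤ 1 + |ξ| ^ (3 / 4 : ℝ) := by
      simpa using Real.rpow_add_le_add_rpow (zero_le_one (α := ℝ)) hx
        (by norm_num : (0 : ℝ) ≤ 3 / 4) (by norm_num)
    have e2 : |ξ| ^ (3 / 4 : ℝ) = |y| ^ (-(3 / 4) : ℝ) * t ^ (3 / 4 : ℝ) := by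
      rw [ht', Real.mul_rpow hx hy'.le, mul_comm (|ξ| ^ _), ← mul_assoc, ← Real.rpow_add hy']
      simp
    have e3 : t ^ (3 / 4 : ℝ) ≤ 1 + t := by
      calc t ^ (3 / 4 : ℝ) ≤ (1 + t) ^ (3 / 4 : ℝ) :=
            Real.rpow_le_rpow ht (by linarith) (by norm_num)
        _ ≤ (1 + t) ^ (1 : ℝ) := Real.rpow_le_rpow_of_exponent_le (by linarith) (by norm_num)
        _ = 1 + t := Real.rpow_one _
    have hY : 0 < |y| ^ (-(3 / 4) : ℝ) := Real.rpow_pos_of_pos hy' _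
    have hE := Real.exp_pos (-t)
    have e4 : 4 * (freqWeight ξ * heightWeight y)
        = 4 * (1 + |y| ^ (-(3 / 4) : ℝ)) / (1 + |ξ|) ^ (3 / 4 : ℝ) := by
      rw [e0, heightWeight]; ring
    rw [e4, le_div_iff₀ hw]
    have e5 : (1 + |ξ|) ^ (3 / 4 : ℝ) ≤ 1 + |y| ^ (-(3 / 4) : ℝ) * (1 + t) := by
      rw [e2] at e1
      exact e1.trans (by gcongr)
    calc (1 + t) * Real.exp (-t) * (1 + |ξ|) ^ (3 / 4 : ℝ)
        ≤ (1 + t) * Real.exp (-t) * (1 + |y| ^ (-(3 / 4) : ℝ) * (1 + t)) := by gcongr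
      _ = (1 + t) * Real.exp (-t) + |y| ^ (-(3 / 4) : ℝ) * ((1 + t) ^ 2 * Real.exp (-t)) := by ring
      _ ≤ 4 + |y| ^ (-(3 / 4) : ℝ) * 4 := by gcongr
      _ = _ := by ring
  nlinarith [abs_nonneg C]

lemma measurable_stressSymbol (C : ℝ) (i j : Fin 2) :
    Measurable fun q : ℝ × ℝ => stressSymbol C i j q.1 q.2 := by
  have hs : Measurable signC :=
    Complex.measurable_ofReal.comp (measurable_id.div continuous_abs.measurable)
  have hd : Measurable fun q : ℝ × ℝ => q.1 / |q.1| :=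
    measurable_fst.div (continuous_abs.measurable.comp measurable_fst)
  have ha : Measurable fun q : ℝ × ℝ => |q.2| * |q.1| := by fun_prop
  simp only [stressSymbol, stressA, stressB]
  split_ifs <;> fun_prop

lemma memLp_freqWeight : MemLp freqWeight 2 volume := by
  have hc : Continuous freqWeight := Continuous.rpow_const (by fun_prop)
    fun x => Or.inl (by positivity)
  rw [memLp_two_iff_integrable_sq hc.aestronglyMeasurable]
  refine (integrable_one_add_norm (E := ℝ) (r := 3 / 2) (by norm_num)).congr
    (Eventually.of_forall fun x => ?_)
  simp only [freqWeight, Real.norm_eq_abs]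
  rw [← Real.rpow_natCast, ← Real.rpow_mul (by positivity)]
  norm_num

lemma locallyIntegrable_heightWeight : LocallyIntegrable heightWeight volume := by
  have h : LocallyIntegrable (fun y : ℝ => |y| ^ (-(3 / 4) : ℝ)) volume := by
    refine locallyIntegrable_of_norm_le_rpow (C := 1) (α := 3 / 4) (by simp) (by norm_num)
      (Eventually.of_forall fun x => ?_)
      (continuous_abs.measurable.pow_const _).aestronglyMeasurable
    rw [one_mul, Real.norm_of_nonneg (by positivity), Real.norm_eq_abs]
  exact (locallyIntegrable_const 1).add h

lemma heightWeight_nonneg (y : ℝ) : 0 ≤ heightWeight y := by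
  rw [heightWeight]; positivity

section field

variable {C : ℝ} {D : ℝ → ℂ} {i j : Fin 2}

/-- The product of the density and the symbol. -/
def freqStress (C : ℝ) (D : ℝ → ℂ) (i j : Fin 2) (y ξ : ℝ) : ℂ := D ξ * stressSymbol C i j y ξ

/-- The stress field with boundary density `D` (in Fourier variables). -/
def stressField (C : ℝ) (D : ℝ → ℂ) (i j : Fin 2) (p : ℝ × ℝ) : ℂ :=
  (2 * Real.pi : ℂ)⁻¹ * ft (freqStress C D i j p.2) (-p.1)

/-- An integrable majorant. -/
def freqBound (C : ℝ) (D : ℝ → ℂ) (ξ : ℝ) : ℝ := 8 * |C| * (freqWeight ξ * ‖D ξ‖)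

lemma integrable_freqBound (hD : MemLp D 2 volume) : Integrable (freqBound C D) :=
  ((memLp_freqWeight.integrable_mul hD.norm)).const_mul _

lemma norm_freqStress_le {y : ℝ} (hy : y ≠ 0) (ξ : ℝ) :
    ‖freqStress C D i j y ξ‖ ≤ freqBound C D ξ * heightWeight y := by
  rw [freqStress, norm_mul, freqBound]
  refine (mul_le_mul_of_nonneg_left (norm_stressSymbol_le_weight C i j hy ξ)
    (norm_nonneg _)).trans (le_of_eq (by ring))

lemma aestronglyMeasurable_freqStress (hD : MemLp D 2 volume) (y : ℝ) :
    AEStronglyMeasurable (freqStress C D i j y) volume :=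
  hD.1.mul ((measurable_stressSymbol C i j).comp
    (measurable_const.prodMk measurable_id)).aestronglyMeasurable

lemma integrable_freqStress (hD : MemLp D 2 volume) {y : ℝ} (hy : y ≠ 0) :
    Integrable (freqStress C D i j y) :=
  ((integrable_freqBound (C := C) hD).mul_const (heightWeight y)).mono'
    (aestronglyMeasurable_freqStress hD y) (Eventually.of_forall (norm_freqStress_le hy))

/-- The bound for the stress field. -/
def fieldBound (C : ℝ) (D : ℝ → ℂ) : ℝ := (2 * Real.pi)⁻¹ * ∫ ξ, freqBound C D ξ

lemma norm_stressField_le (hD : MemLp D 2 volume) {p : ℝ × ℝ} (hp : p.2 ≠ 0) :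
    ‖stressField C D i j p‖ ≤ fieldBound C D * heightWeight p.2 := by
  have hpi := Real.pi_pos
  rw [stressField, norm_mul, norm_inv, norm_mul, Complex.norm_real, Complex.norm_ofNat,
    Real.norm_of_nonneg hpi.le, fieldBound, mul_assoc]
  gcongr
  refine (norm_ft_le _ _).trans ?_
  rw [← integral_mul_const]
  exact integral_mono (integrable_freqStress hD hp).norm
    ((integrable_freqBound hD).mul_const _) (norm_freqStress_le hp)

lemma tendsto_stressField (y : ℝ) :
    Tendsto (fun x => stressField C D i j (x, y)) (cocompact ℝ) (𝓝 0) := by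
  have h := Real.zero_at_infty_fourier (freqStress C D i j y)
  have hc : Tendsto (fun x : ℝ => -x / (2 * Real.pi)) (cocompact ℝ) (cocompact ℝ) := by
    have : (2 * Real.pi) ≠ 0 := by positivity
    exact ((Homeomorph.neg ℝ).trans
      (Homeomorph.mulRight₀ _ (inv_ne_zero this))).isClosedEmbedding.tendsto_cocompact
  have := (h.comp hc).const_mul (2 * Real.pi : ℂ)⁻¹
  rw [mul_zero] at this
  refine this.congr fun x => ?_
  simp only [stressField, ft_eq_fourier, Function.comp_apply]

lemma integrable_exp_mul_stressSymbol (hD : MemLp D 2 volume) {Φ : ℝ × ℝ → ℂ}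
    (hΦ : Integrable fun p : ℝ × ℝ => heightWeight p.2 * ‖Φ p‖)
    (hm : AEStronglyMeasurable Φ volume) :
    Integrable (fun q : ℝ × (ℝ × ℝ) => D q.1 * (stressSymbol C i j q.2.2 q.1
        * Complex.exp (-(Complex.I * ((-q.2.1 : ℝ) : ℂ) * q.1)) * Φ q.2))
      ((volume : Measure ℝ).prod (volume : Measure (ℝ × ℝ))) := by
  refine ((integrable_freqBound (C := C) hD).mul_prod hΦ).mono' ?_ ?_
  · refine hD.1.comp_fst.mul (AEStronglyMeasurable.mul (AEStronglyMeasurable.mul ?_ ?_) hm.comp_snd)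
    · exact ((measurable_stressSymbol C i j).comp
        (measurable_snd.snd.prodMk measurable_fst)).aestronglyMeasurable
    · exact (Continuous.aestronglyMeasurable (by fun_prop))
  · have h0 : ∀ᵐ p : ℝ × ℝ, p.2 ≠ 0 := by
      have : ∀ᵐ y : ℝ, y ≠ 0 := Measure.ae_ne volume 0
      exact Measure.quasiMeasurePreserving_snd.ae this
    filter_upwards [Measure.quasiMeasurePreserving_snd.ae h0] with q hq
    have h := norm_freqStress_le (C := C) (D := D) (i := i) (j := j) hq q.1
    rw [freqStress, norm_mul] at h
    simp only [norm_mul, norm_cexp_neg_I_mul, mul_one]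
    rw [← mul_assoc, ← mul_assoc]
    exact mul_le_mul_of_nonneg_right h (norm_nonneg _)

lemma integral_stressField_mul (hD : MemLp D 2 volume) {Φ : ℝ × ℝ → ℂ}
    (hΦ : Integrable fun p : ℝ × ℝ => heightWeight p.2 * ‖Φ p‖)
    (hm : AEStronglyMeasurable Φ volume) :
    ∫ p, stressField C D i j p * Φ p = (2 * Real.pi : ℂ)⁻¹ * ∫ ξ, D ξ * ∫ p : ℝ × ℝ,
      stressSymbol C i j p.2 ξ * Complex.exp (-(Complex.I * ((-p.1 : ℝ) : ℂ) * ξ)) * Φ p := by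
  have h := integral_integral_swap (f := fun ξ p => D ξ * (stressSymbol C i j p.2 ξ
    * Complex.exp (-(Complex.I * ((-p.1 : ℝ) : ℂ) * ξ)) * Φ p))
    (integrable_exp_mul_stressSymbol (C := C) (i := i) (j := j) hD hΦ hm)
  simp only [integral_const_mul] at h
  rw [h, ← integral_const_mul]
  refine integral_congr_ae (Eventually.of_forall fun p => ?_)
  simp only [stressField, ft, freqStress]
  rw [mul_assoc, ← integral_mul_const]
  congr 1
  refine integral_congr_ae (Eventually.of_forall fun ξ => ?_)
  simp only
  ring

end field


/-! ### The stress field is real and has the right Fourier transform -/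

lemma integrable_exp_neg_abs {a : ℝ} (ha : 0 < a) :
    Integrable fun ξ : ℝ => Real.exp (-(|ξ| * a)) := by
  have h1 : IntegrableOn (fun ξ : ℝ => Real.exp (-(|ξ| * a))) (Ioi 0) :=
    (exp_neg_integrableOn_Ioi 0 ha).congr_fun (fun ξ (hξ : 0 < ξ) => by
      simp only [abs_of_pos hξ]; ring_nf) measurableSet_Ioi
  have h2 : IntegrableOn (fun ξ : ℝ => Real.exp (-(|ξ| * a))) (Iic 0) := by
    refine (integrableOn_exp_mul_Iic ha 0).congr_fun (fun ξ (hξ : ξ ≤ 0) => ?_) measurableSet_Iic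
    simp only [abs_of_nonpos hξ]
    ring_nf
  rw [← integrableOn_univ, ← Iic_union_Ioi (a := (0 : ℝ))]
  exact h2.union h1

lemma memLp_exp_neg_abs {a : ℝ} (ha : 0 < a) :
    MemLp (fun ξ : ℝ => Real.exp (-(|ξ| * a))) 2 volume := by
  rw [memLp_two_iff_integrable_sq (Continuous.aestronglyMeasurable (by fun_prop))]
  refine (integrable_exp_neg_abs (a := 2 * a) (by positivity)).congr
    (Eventually.of_forall fun ξ => ?_)
  simp only [← Real.exp_nat_mul]
  congr 1; push_cast; ring

lemma norm_stressSymbol_le_exp (C : ℝ) (i j : Fin 2) (y ξ : ℝ) :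
    ‖stressSymbol C i j y ξ‖ ≤ 4 * |C| * Real.exp (-(|ξ| * (|y| / 2))) := by
  refine (norm_stressSymbol_le C i j y ξ).trans ?_
  set t := |ξ| * |y| with ht'
  have h := Real.add_one_le_exp (t / 2)
  have ht : 0 ≤ t := by positivity
  have e : Real.exp (-t) = Real.exp (-(|ξ| * (|y| / 2))) * Real.exp (-(|ξ| * (|y| / 2))) := by
    rw [← Real.exp_add]; congr 1; rw [ht']; ring
  have e2 : Real.exp (t / 2) * Real.exp (-(|ξ| * (|y| / 2))) = 1 := by
    rw [← Real.exp_add, ht', ← Real.exp_zero]; congr 1; ring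
  have hE := Real.exp_pos (-(|ξ| * (|y| / 2)))
  have : (1 + t) * Real.exp (-t) ≤ 2 * Real.exp (-(|ξ| * (|y| / 2))) := by
    rw [e, ← mul_assoc]
    refine mul_le_mul_of_nonneg_right ?_ hE.le
    nlinarith
  nlinarith [abs_nonneg C]

/-- `g(-ξ) = conj g(ξ)`. -/
def Hermitian (g : ℝ → ℂ) : Prop := ∀ ξ, g (-ξ) = starRingEnd ℂ (g ξ)

lemma Hermitian.ft_real {g : ℝ → ℂ} (hg : Hermitian g) (x : ℝ) :
    (((ft g x).re : ℝ) : ℂ) = ft g x := by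
  rw [← Complex.conj_eq_iff_re, ft, ← integral_conj, ← integral_neg_eq_self]
  refine integral_congr_ae (Eventually.of_forall fun ξ => ?_)
  simp only [hg ξ, map_mul, Complex.conj_conj, ← Complex.exp_conj, map_neg, Complex.conj_I,
    Complex.conj_ofReal]
  push_cast
  ring_nf

lemma Hermitian.mul {f g : ℝ → ℂ} (hf : Hermitian f) (hg : Hermitian g) :
    Hermitian fun ξ => f ξ * g ξ := fun ξ => by simp only [hf ξ, hg ξ, map_mul]

lemma hermitian_stressSymbol (C : ℝ) (i j : Fin 2) (y : ℝ) : Hermitian (stressSymbol C i j y) := by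
  intro ξ
  have hs : signC (-ξ) = -signC ξ := by simp [signC, neg_div]
  have hc : starRingEnd ℂ (signC ξ) = signC ξ := Complex.conj_ofReal _
  simp only [stressSymbol, stressA, stressB, abs_neg, hs]
  split_ifs <;> simp only [map_mul, map_add, map_neg, Complex.conj_ofReal, Complex.conj_I, hc,
    map_zero, map_ofNat]
  all_goals ring

lemma hermitian_exp (x : ℝ) :
    Hermitian fun ξ : ℝ => Complex.exp (-(Complex.I * (x : ℂ) * (ξ : ℂ))) := by
  intro ξ
  simp only [← Complex.exp_conj, map_neg, map_mul, Complex.conj_I, Complex.conj_ofReal]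
  push_cast
  ring_nf

/-- `∫ f ft g = ∫ D g` for real `f` and hermitian `g` is real. -/
lemma FtDual.integral_real {f : ℝ → ℝ} {D : ℝ → ℂ} (h : FtDual (fun x => (f x : ℂ)) D) {g : ℝ → ℂ}
    (h1 : Integrable g) (h2 : MemLp g 2 volume) (hg : Hermitian g) :
    (((∫ ξ, D ξ * g ξ).re : ℝ) : ℂ) = ∫ ξ, D ξ * g ξ := by
  rw [← Complex.conj_eq_iff_re, ← h.2.2 g h1 h2, ← integral_conj]
  refine integral_congr_ae (Eventually.of_forall fun x => ?_)
  simp only [map_mul, Complex.conj_ofReal, Complex.conj_eq_iff_re.2 (hg.ft_real x)]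

section field

variable {C : ℝ} {D : ℝ → ℂ} {i j : Fin 2}

lemma aestronglyMeasurable_stressSymbol (y : ℝ) :
    AEStronglyMeasurable (stressSymbol C i j y) volume :=
  ((measurable_stressSymbol C i j).comp
    (measurable_const.prodMk measurable_id)).aestronglyMeasurable

lemma integrable_stressSymbol {y : ℝ} (hy : y ≠ 0) : Integrable (stressSymbol C i j y) :=
  ((integrable_exp_neg_abs (by positivity : 0 < |y| / 2)).const_mul (4 * |C|)).mono'
    (aestronglyMeasurable_stressSymbol y)
    (Eventually.of_forall (norm_stressSymbol_le_exp C i j y))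

lemma memLp_stressSymbol {y : ℝ} (hy : y ≠ 0) : MemLp (stressSymbol C i j y) 2 volume :=
  ((memLp_exp_neg_abs (by positivity : 0 < |y| / 2)).const_mul (4 * |C|)).of_le
    (aestronglyMeasurable_stressSymbol y)
    (Eventually.of_forall fun ξ => (norm_stressSymbol_le_exp C i j y ξ).trans (le_abs_self _))

/-- The stress field as a real function. -/
def stressReal (C : ℝ) (D : ℝ → ℂ) (i j : Fin 2) (p : ℝ × ℝ) : ℝ := (stressField C D i j p).re

lemma ofReal_stressReal {f : ℝ → ℝ} (h : FtDual (fun x => (f x : ℂ)) D) {p : ℝ × ℝ}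
    (hp : p.2 ≠ 0) : (stressReal C D i j p : ℂ) = stressField C D i j p := by
  have e : stressField C D i j p = (2 * Real.pi : ℂ)⁻¹ * ∫ ξ, D ξ * (Complex.exp (-(Complex.I *
      ((-p.1 : ℝ) : ℂ) * (ξ : ℂ))) * stressSymbol C i j p.2 ξ) := by
    rw [stressField, ft]
    congr 2; ext ξ; rw [freqStress]; ring
  have hm : MemLp (fun ξ : ℝ => Complex.exp (-(Complex.I *
      ((-p.1 : ℝ) : ℂ) * (ξ : ℂ))) * stressSymbol C i j p.2 ξ) 2 volume := by
    refine (memLp_stressSymbol (C := C) (i := i) (j := j) hp).of_le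
      ((Continuous.aestronglyMeasurable (by fun_prop)).mul (aestronglyMeasurable_stressSymbol _))
      (Eventually.of_forall fun ξ => ?_)
    rw [norm_mul, norm_cexp_neg_I_mul, one_mul]
  have := h.integral_real (integrable_cexp_mul (integrable_stressSymbol (C := C) (i := i) (j := j)
    hp) (-p.1)) hm ((hermitian_exp _).mul (hermitian_stressSymbol C i j p.2))
  rw [stressReal, e, ← this, show (2 * Real.pi : ℂ)⁻¹ = (((2 * Real.pi)⁻¹ : ℝ) : ℂ) by push_cast; rfl,
    ← Complex.ofReal_mul, Complex.ofReal_re]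

lemma aestronglyMeasurable_stressField (hD : MemLp D 2 volume) :
    AEStronglyMeasurable (stressField C D i j) volume := by
  have h : AEStronglyMeasurable (fun q : (ℝ × ℝ) × ℝ =>
      Complex.exp (-(Complex.I * ((-q.1.1 : ℝ) : ℂ) * (q.2 : ℂ))) * freqStress C D i j q.1.2 q.2)
      ((volume : Measure (ℝ × ℝ)).prod (volume : Measure ℝ)) := by
    refine AEStronglyMeasurable.mul (Continuous.aestronglyMeasurable (by fun_prop))
      (hD.1.comp_snd.mul ?_)
    exact ((measurable_stressSymbol C i j).comp
      (measurable_fst.snd.prodMk measurable_snd)).aestronglyMeasurable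
  exact h.integral_prod_right'.const_mul _

lemma ae_snd_ne_zero : ∀ᵐ p : ℝ × ℝ, p.2 ≠ 0 :=
  Measure.quasiMeasurePreserving_snd.ae (Measure.ae_ne volume (0 : ℝ))

lemma locallyIntegrable_heightWeight_snd :
    LocallyIntegrable (fun p : ℝ × ℝ => heightWeight p.2) volume := by
  rw [locallyIntegrable_iff]
  intro K hK
  have h1 : IntegrableOn (fun _ : ℝ => (1 : ℝ)) (Prod.fst '' K) volume :=
    integrableOn_const (hK.image continuous_fst).measure_lt_top.ne
  have h2 := locallyIntegrable_heightWeight.integrableOn_isCompact (hK.image continuous_snd)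
  have h3 := Integrable.mul_prod h1 h2
  rw [Measure.prod_restrict] at h3
  refine IntegrableOn.mono_set (h3.congr (Eventually.of_forall fun p => by simp)) subset_prod

lemma integrable_heightWeight_mul {E : Type*} [NormedAddCommGroup E] {Φ : ℝ × ℝ → E}
    (hc : Continuous Φ) (hs : HasCompactSupport Φ) :
    Integrable fun p : ℝ × ℝ => heightWeight p.2 * ‖Φ p‖ :=
  locallyIntegrable_heightWeight_snd.integrable_smul_right_of_hasCompactSupport hc.norm hs.norm

lemma locallyIntegrable_stressReal (hD : MemLp D 2 volume) :
    LocallyIntegrable (stressReal C D i j) volume := by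
  refine (locallyIntegrable_heightWeight_snd.smul (fieldBound C D)).mono
    (aestronglyMeasurable_stressField hD).re ?_
  filter_upwards [ae_snd_ne_zero] with p hp
  exact ((Complex.abs_re_le_norm _).trans (norm_stressField_le hD hp)).trans (le_abs_self _)

lemma integral_comp_sign_mul {κ : ℝ} (hκ : κ * κ = 1) (f : ℝ → ℂ) :
    ∫ t, f (κ * t) = ∫ t, f t := by
  have : |κ⁻¹| = 1 := by
    rw [inv_eq_of_mul_eq_one_right hκ, ← abs_one, ← sq_eq_sq_iff_abs_eq_abs, sq, hκ, one_pow]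
  rw [Measure.integral_comp_mul_left, this, one_smul]

lemma integral_stressSymbol_mul {κ : ℝ} (hκ : κ * κ = 1) {η : ℝ → ℂ}
    (hη : IsTestC (halfLine κ) η) (ξ : ℝ) :
    ∫ y, stressSymbol C i j y ξ * η y = stressA C κ i j ξ * moment₀ κ η |ξ|
      + stressB C κ i j ξ * absC ξ * moment₁ κ η |ξ| := by
  have hc := hη.comp_mul hκ
  rw [← integral_comp_sign_mul hκ, moment₀, moment₁, expMoment, expMoment, ← integral_const_mul,
    ← integral_const_mul, ← integral_add ((integrable_exp_mul hc _).const_mul _)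
      ((integrable_exp_mul hc.id_mul _).const_mul _)]
  refine integral_congr_ae (Eventually.of_forall fun t => ?_)
  simp only
  by_cases h0 : η (κ * t) = 0
  · simp [h0]
  have ht : 0 < t := by
    have h1 : κ * t ∈ halfLine κ := hη.2.2 (subset_tsupport _ h0)
    have h2 : 0 < κ * (κ * t) := h1
    rwa [← mul_assoc, hκ, one_mul] at h2
  have ha : |κ| = 1 := by
    rw [← abs_one, ← sq_eq_sq_iff_abs_eq_abs, sq, hκ, one_pow]
  have e1 : |κ * t| = t := by rw [abs_mul, ha, one_mul, abs_of_pos ht]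
  rw [stressSymbol, e1, mul_div_assoc, div_self ht.ne', mul_one, absC]
  push_cast
  ring

lemma integral_stressField_mul_tensor (hD : MemLp D 2 volume) (ψ : 𝓢(ℝ, ℂ)) {η : ℝ → ℂ}
    (hη : IsTestC univ η) :
    ∫ p : ℝ × ℝ, stressField C D i j p * (ft ψ p.1 * η p.2)
      = ∫ ξ, D ξ * (ψ ξ * ∫ y, stressSymbol C i j y ξ * η y) := by
  obtain ⟨φ, hφ⟩ := exists_schwartz_ft ψ
  have hf : Continuous (ft ψ) := continuous_ft ψ.integrable
  have hi : Integrable (ft ψ) := φ.integrable.congr (Eventually.of_forall hφ)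
  have hw : Integrable fun y => heightWeight y * ‖η y‖ :=
    locallyIntegrable_heightWeight.integrable_smul_right_of_hasCompactSupport
      hη.continuous.norm hη.2.1.norm
  have hΦ : Integrable fun p : ℝ × ℝ => heightWeight p.2 * ‖ft ψ p.1 * η p.2‖ := by
    refine (hi.norm.mul_prod hw).congr (Eventually.of_forall fun p => ?_)
    simp only [norm_mul]; ring
  have hηc := hη.continuous
  rw [integral_stressField_mul hD hΦ (Continuous.aestronglyMeasurable (by fun_prop)),
    ← integral_const_mul]
  refine integral_congr_ae (Eventually.of_forall fun ξ => ?_)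
  have e : ∫ p : ℝ × ℝ, stressSymbol C i j p.2 ξ * Complex.exp (-(Complex.I *
      ((-p.1 : ℝ) : ℂ) * ξ)) * (ft ψ p.1 * η p.2)
      = (∫ x : ℝ, Complex.exp (Complex.I * x * ξ) * ft ψ x) * ∫ y, stressSymbol C i j y ξ * η y := by
    rw [← integral_prod_mul]
    refine integral_congr_ae (Eventually.of_forall fun p => ?_)
    simp only
    push_cast
    rw [show -(Complex.I * -(p.1 : ℂ) * ξ) = Complex.I * p.1 * ξ by ring]
    ring
  simp only [e, ft_inversion]
  have : (Real.pi : ℂ) ≠ 0 := by exact_mod_cast Real.pi_ne_zero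
  field_simp

end field

/-! ### The stress is given by the stress field on products -/

lemma Rapid.prod {φ η : ℝ → ℂ} (hφ : Rapid φ) (hη : Rapid η) :
    Rapid fun p : ℝ × ℝ => φ p.1 * η p.2 := by
  intro N
  obtain ⟨A, hA⟩ := hφ N
  obtain ⟨B, hB⟩ := hη N
  refine ⟨A * B, fun p => ?_⟩
  calc (1 + ‖p‖) ^ N * ‖φ p.1 * η p.2‖
      ≤ ((1 + |p.1|) * (1 + |p.2|)) ^ N * (‖φ p.1‖ * ‖η p.2‖) := by
        rw [norm_mul]
        gcongr
        exact prod_norm_le p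
    _ = ((1 + ‖p.1‖) ^ N * ‖φ p.1‖) * ((1 + ‖p.2‖) ^ N * ‖η p.2‖) := by
        rw [mul_pow, Real.norm_eq_abs, Real.norm_eq_abs]; ring
    _ ≤ A * B := mul_le_mul (hA _) (hB _) (by positivity)
        (le_trans (by positivity) (hA p.1))

/-- Integration in the second variable against a test function. -/
def sliceInt (f : ℝ × ℝ → ℝ) (η : ℝ → ℝ) (x : ℝ) : ℝ := ∫ y, f (x, y) * η y

section slice

variable {f : ℝ × ℝ → ℝ} {η : ℝ → ℝ} {Ω : Set ℝ}

lemma TemperedFun.sliceInt (hf : TemperedFun f) (hη : IsTest Ω η) :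
    TemperedFun (sliceInt f η) := by
  obtain ⟨N, hN⟩ := hf
  obtain ⟨B, hB⟩ := hη.ofReal.rapid N
  have hηc := hη.1.continuous
  have h1 : Integrable (fun p : ℝ × ℝ => (f p / (1 + ‖p‖) ^ N) *
      ((1 + ‖p‖) ^ N / (1 + ‖p.1‖) ^ N * η p.2)) := by
    refine hN.mul_bdd (c := B) (Continuous.aestronglyMeasurable ?_)
      (Eventually.of_forall fun p => ?_)
    · refine ((by fun_prop : Continuous fun p : ℝ × ℝ => (1 + ‖p‖) ^ N).div₀ (by fun_prop)
        fun p => by positivity).mul (by fun_prop)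
    · rw [norm_mul, Real.norm_of_nonneg (by positivity)]
      refine le_trans ?_ (hB p.2)
      rw [Complex.norm_real]
      gcongr
      rw [← div_pow]
      gcongr
      rw [div_le_iff₀ (by positivity), mul_comm]
      exact prod_norm_le p
  refine ⟨N, (h1.integral_prod_left).congr (Eventually.of_forall fun x => ?_)⟩
  simp only [PN.sliceInt]
  rw [← integral_div]
  congr 1; ext y
  have : (1 + ‖(x, y)‖) ^ N ≠ 0 := by positivity
  field_simp

lemma integrable_mul_tensor (hf : TemperedFun f) (hη : IsTest Ω η) {φ : ℝ → ℂ}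
    (hm : AEStronglyMeasurable φ volume) (hφ : Rapid φ) :
    Integrable fun p : ℝ × ℝ => (f p : ℂ) * (φ p.1 * (η p.2 : ℂ)) :=
  hf.integrable_mul (hm.comp_fst.mul hη.ofReal.continuous.aestronglyMeasurable.comp_snd)
    (hφ.prod hη.ofReal.rapid)

lemma integral_sliceInt_mul (hf : TemperedFun f) (hη : IsTest Ω η) {φ : ℝ → ℂ}
    (hm : AEStronglyMeasurable φ volume) (hφ : Rapid φ) :
    ∫ p : ℝ × ℝ, (f p : ℂ) * (φ p.1 * (η p.2 : ℂ)) = ∫ x, (sliceInt f η x : ℂ) * φ x := by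
  have h := integrable_mul_tensor hf hη hm hφ
  rw [Measure.volume_eq_prod, integral_prod _ h]
  refine integral_congr_ae (Eventually.of_forall fun x => ?_)
  simp only [PN.sliceInt]
  rw [← integral_complex_ofReal, ← integral_mul_const]
  congr 1; ext y
  push_cast
  ring

lemma integral_sliceInt_mul_real (hf : TemperedFun f) (hη : IsTest Ω η) {φ : ℝ → ℝ}
    (hm : AEStronglyMeasurable φ volume) (hφ : Rapid fun x => (φ x : ℂ)) :
    ∫ p : ℝ × ℝ, f p * (φ p.1 * η p.2) = ∫ x, sliceInt f η x * φ x := by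
  have h := integral_sliceInt_mul hf hη (Complex.continuous_ofReal.comp_aestronglyMeasurable hm) hφ
  apply Complex.ofReal_injective
  rw [← integral_complex_ofReal, ← integral_complex_ofReal]
  push_cast
  exact h

lemma pd_zero_tensor {φ : ℝ → ℝ} (hφ : Differentiable ℝ φ) (hη : Differentiable ℝ η) :
    pd 0 (fun p : ℝ × ℝ => φ p.1 * η p.2) = fun p => deriv φ p.1 * η p.2 := by
  ext p
  have h1 : HasFDerivAt (fun p : ℝ × ℝ => p.1) (ContinuousLinearMap.fst ℝ ℝ ℝ) p := hasFDerivAt_fst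
  have h2 : HasFDerivAt (fun p : ℝ × ℝ => p.2) (ContinuousLinearMap.snd ℝ ℝ ℝ) p := hasFDerivAt_snd
  have h := ((hφ p.1).hasDerivAt.comp_hasFDerivAt p h1).mul
    ((hη p.2).hasDerivAt.comp_hasFDerivAt p h2)
  have h' : HasFDerivAt (fun p : ℝ × ℝ => φ p.1 * η p.2) _ p := h
  rw [pd, h'.fderiv]
  simp [dir, mul_comm]

lemma pd_one_tensor {φ : ℝ → ℝ} (hφ : Differentiable ℝ φ) (hη : Differentiable ℝ η) :
    pd 1 (fun p : ℝ × ℝ => φ p.1 * η p.2) = fun p => φ p.1 * deriv η p.2 := by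
  ext p
  have h1 : HasFDerivAt (fun p : ℝ × ℝ => p.1) (ContinuousLinearMap.fst ℝ ℝ ℝ) p := hasFDerivAt_fst
  have h2 : HasFDerivAt (fun p : ℝ × ℝ => p.2) (ContinuousLinearMap.snd ℝ ℝ ℝ) p := hasFDerivAt_snd
  have h := ((hφ p.1).hasDerivAt.comp_hasFDerivAt p h1).mul
    ((hη p.2).hasDerivAt.comp_hasFDerivAt p h2)
  have h' : HasFDerivAt (fun p : ℝ × ℝ => φ p.1 * η p.2) _ p := h
  rw [pd, h'.fderiv]
  simp [dir]

lemma IsTest.deriv (hη : IsTest Ω η) : IsTest Ω (deriv η) :=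
  ⟨(contDiff_infty_iff_deriv.1 hη.1).2, hη.2.1.deriv,
    tsupport_deriv_subset.trans hη.2.2⟩

lemma rapid_schwartz_ofReal (φ : 𝓢(ℝ, ℝ)) : Rapid fun x => (φ x : ℂ) := by
  intro N
  obtain ⟨A, hA⟩ := SchwartzMap_rapid φ N
  exact ⟨A, fun x => by simpa using hA x⟩

end slice

section stress

variable {G ν β κ : ℝ} {u : Fin 2 → ℝ × ℝ → ℝ} {v w : Fin 2 → ℝ → ℝ} {i j : Fin 2} {η : ℝ → ℝ}
  {Ω : Set ℝ}

lemma stress_tensor (hu : ∀ i, TemperedFun (u i)) (φ : 𝓢(ℝ, ℝ)) (hη : IsTest Ω η) :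
    stress G ν u i j (fun p => φ p.1 * η p.2)
      = (∫ x, sliceInt (fluxX G ν u i j) η x * deriv φ x)
        + ∫ x, sliceInt (fluxY G ν u i j) (deriv η) x * φ x := by
  have hφd := φ.differentiable
  have hηd := hη.1.differentiable (by simp)
  have e0 := pd_zero_tensor hφd hηd
  have e1 := pd_one_tensor hφd hηd
  have hr := rapid_schwartz_ofReal φ
  have hr' : Rapid fun x => ((deriv φ x : ℝ) : ℂ) :=
    rapid_schwartz_ofReal (SchwartzMap.derivCLM ℝ ℝ φ)
  have hm := φ.continuous.aestronglyMeasurable (μ := volume)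
  have hm' : AEStronglyMeasurable (deriv φ) volume :=
    (SchwartzMap.derivCLM ℝ ℝ φ).continuous.aestronglyMeasurable
  rw [stress_eq_flux, e0, e1, pair, pair,
    integral_sliceInt_mul_real (temperedFun_fluxX hu i j) hη hm' hr',
    integral_sliceInt_mul_real (temperedFun_fluxY hu i j) hη.deriv hm hr]
  · intro a b
    have h0 := (integrable_mul_tensor (hu a) hη
      (Complex.continuous_ofReal.comp_aestronglyMeasurable hm') hr').re
    have h1 := (integrable_mul_tensor (hu a) hη.deriv
      (Complex.continuous_ofReal.comp_aestronglyMeasurable hm) hr).re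
    fin_cases b
    · simp only [Fin.zero_eta, e0]
      refine h0.congr (Eventually.of_forall fun p => ?_)
      simp only [← Complex.ofReal_mul]
      rfl
    · simp only [Fin.mk_one, e1]
      refine h1.congr (Eventually.of_forall fun p => ?_)
      simp only [← Complex.ofReal_mul]
      rfl

variable {C : ℝ} {D : ℝ → ℂ}

lemma temperedFun_stressReal (hD : MemLp D 2 volume) : TemperedFun (stressReal C D i j) := by
  have h1 : Integrable fun y : ℝ => heightWeight y * (1 + |y|) ^ (-2 : ℝ) := by
    have a : Integrable ((Icc (-1 : ℝ) 1).indicator heightWeight) :=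
      (locallyIntegrable_heightWeight.integrableOn_isCompact isCompact_Icc).integrable_indicator
        measurableSet_Icc
    have b : Integrable fun y : ℝ => (1 + ‖y‖) ^ (-2 : ℝ) := integrable_one_add_norm (by simp)
    refine (a.add (b.const_mul 2)).mono' ?_ (Eventually.of_forall fun y => ?_)
    · exact locallyIntegrable_heightWeight.aestronglyMeasurable.mul b.aestronglyMeasurable
    · have hy := abs_nonneg y
      have hw := heightWeight_nonneg y
      have hp : 0 ≤ (1 + |y|) ^ (-2 : ℝ) := by positivity
      rw [norm_mul, Real.norm_of_nonneg hw, Real.norm_of_nonneg hp, Pi.add_apply]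
      by_cases hm : y ∈ Icc (-1 : ℝ) 1
      · rw [indicator_of_mem hm]
        have : (1 + |y|) ^ (-2 : ℝ) ≤ 1 :=
          Real.rpow_le_one_of_one_le_of_nonpos (by linarith) (by norm_num)
        have h3 := mul_le_of_le_one_right hw this
        simp only [Real.norm_eq_abs]
        linarith
      · rw [indicator_of_notMem hm, zero_add, Real.norm_eq_abs]
        have h1 : 1 ≤ |y| := by
          by_contra h
          exact hm (abs_le.1 (not_le.1 h).le)
        have : |y| ^ (-(3 / 4) : ℝ) ≤ 1 :=
          Real.rpow_le_one_of_one_le_of_nonpos h1 (by norm_num)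
        refine mul_le_mul_of_nonneg_right ?_ hp
        rw [heightWeight]; linarith
  have h2 : Integrable fun x : ℝ => (1 + ‖x‖) ^ (-2 : ℝ) := integrable_one_add_norm (by simp)
  refine ⟨4, (((h2.mul_prod h1).const_mul (fieldBound C D)).mono' ?_ ?_)⟩
  · refine (aestronglyMeasurable_stressField hD).re.mul (Continuous.aestronglyMeasurable ?_)
    exact (by fun_prop : Continuous fun p : ℝ × ℝ => (1 + ‖p‖) ^ 4).inv₀ fun p => by positivity
  · filter_upwards [ae_snd_ne_zero] with p hp
    have hb : ‖stressReal C D i j p‖ ≤ fieldBound C D * heightWeight p.2 :=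
      (Complex.abs_re_le_norm _).trans (norm_stressField_le hD hp)
    have e : ∀ x : ℝ, (1 + |x|) ^ (-2 : ℝ) = ((1 + |x|) ^ 2)⁻¹ := fun x => by
      rw [Real.rpow_neg (by positivity)]; norm_cast
    have hle : ((1 + |p.1|) ^ 2) * ((1 + |p.2|) ^ 2) ≤ (1 + ‖p‖) ^ 4 := by
      have a1 : |p.1| ≤ ‖p‖ := norm_fst_le p
      have a2 : |p.2| ≤ ‖p‖ := norm_snd_le p
      calc ((1 + |p.1|) ^ 2) * ((1 + |p.2|) ^ 2) ≤ (1 + ‖p‖) ^ 2 * (1 + ‖p‖) ^ 2 := by gcongr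
        _ = _ := by ring
    rw [norm_div, Real.norm_eq_abs ((1 + ‖p‖) ^ 4), abs_of_pos (by positivity),
      div_eq_mul_inv, Real.norm_eq_abs p.1, e, e]
    calc ‖stressReal C D i j p‖ * ((1 + ‖p‖) ^ 4)⁻¹
        ≤ (fieldBound C D * heightWeight p.2) * (((1 + |p.1|) ^ 2) * ((1 + |p.2|) ^ 2))⁻¹ := by
          gcongr
          exact (norm_nonneg _).trans hb
      _ = _ := by rw [mul_inv]; ring

/-- The difference of the stress and the stress field on products, as functional of order one. -/
lemma orderOne_stress_sub (hu : ∀ i, TemperedFun (u i)) (hD : MemLp D 2 volume)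
    (hη : IsTest Ω η) (φ : 𝓢(ℝ, ℝ)) :
    orderOne (fun x => sliceInt (fluxY G ν u i j) (deriv η) x - sliceInt (stressReal C D i j) η x)
      (sliceInt (fluxX G ν u i j) η) (fun x => (φ x : ℂ))
      = ((stress G ν u i j (fun p => φ p.1 * η p.2)
        - ∫ p : ℝ × ℝ, stressReal C D i j p * (φ p.1 * η p.2) : ℝ) : ℂ) := by
  have hr := rapid_schwartz_ofReal φ
  have hm := φ.continuous.aestronglyMeasurable (μ := volume)
  have hY := (temperedFun_fluxY (G := G) (ν := ν) hu i j).sliceInt hη.deriv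
  have hS := (temperedFun_stressReal (C := C) (i := i) (j := j) hD).sliceInt hη
  have hmC := Complex.continuous_ofReal.comp_aestronglyMeasurable hm
  have hd : deriv (fun x => (φ x : ℂ)) = fun x => ((deriv φ x : ℝ) : ℂ) :=
    funext fun x => ((φ.differentiable x).hasDerivAt.ofReal_comp).deriv
  rw [stress_tensor hu φ hη, integral_sliceInt_mul_real (temperedFun_stressReal hD) hη hm hr,
    orderOne, hd]
  simp only [Complex.ofReal_sub, Complex.ofReal_add, ← integral_complex_ofReal, Complex.ofReal_mul,
    sub_mul]
  rw [integral_sub (hY.integrable_mul hmC hr) (hS.integrable_mul hmC hr)]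
  ring

end stress

/-! ### Identification of the stress on products -/

section

variable {G ν β κ C : ℝ} {u : Fin 2 → ℝ × ℝ → ℝ} {v w : Fin 2 → ℝ → ℝ} {i j : Fin 2} {η : ℝ → ℝ}
  {Ω : Set ℝ} {D : ℝ → ℂ}

lemma integrable_heightWeight_test (hη : IsTest Ω η) :
    Integrable fun y => heightWeight y * ‖η y‖ :=
  locallyIntegrable_heightWeight.integrable_smul_right_of_hasCompactSupport
    hη.1.continuous.norm hη.2.1.norm

lemma norm_stressReal_mul_le (hD : MemLp D 2 volume) (η : ℝ → ℝ) (x : ℝ) :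
    ∀ᵐ y, ‖stressReal C D i j (x, y) * η y‖ ≤ fieldBound C D * (heightWeight y * ‖η y‖) := by
  filter_upwards [Measure.ae_ne volume (0 : ℝ)] with y hy
  rw [norm_mul, ← mul_assoc]
  exact mul_le_mul_of_nonneg_right ((Complex.abs_re_le_norm _).trans
    (norm_stressField_le (p := (x, y)) hD hy)) (norm_nonneg _)

lemma norm_sliceInt_stressReal_le (hD : MemLp D 2 volume) (hη : IsTest Ω η) (x : ℝ) :
    ‖sliceInt (stressReal C D i j) η x‖ ≤ ∫ y, fieldBound C D * (heightWeight y * ‖η y‖) :=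
  norm_integral_le_of_norm_le ((integrable_heightWeight_test hη).const_mul _)
    (norm_stressReal_mul_le hD η x)

lemma aestronglyMeasurable_stressReal_slice (hD : MemLp D 2 volume) (x : ℝ) :
    AEStronglyMeasurable (fun y => stressReal C D i j (x, y)) volume := by
  have h : AEStronglyMeasurable (fun q : ℝ × ℝ =>
      Complex.exp (-(Complex.I * ((-x : ℝ) : ℂ) * (q.2 : ℂ))) * freqStress C D i j q.1 q.2)
      ((volume : Measure ℝ).prod (volume : Measure ℝ)) :=
    AEStronglyMeasurable.mul (Continuous.aestronglyMeasurable (by fun_prop))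
      (hD.1.comp_snd.mul (measurable_stressSymbol C i j).aestronglyMeasurable)
  exact (h.integral_prod_right'.const_mul _).re

lemma tendsto_sliceInt_stressReal (hD : MemLp D 2 volume) (hη : IsTest Ω η) :
    Tendsto (sliceInt (stressReal C D i j) η) (cocompact ℝ) (𝓝 0) := by
  have : (cocompact ℝ).IsCountablyGenerated := by
    rw [← Metric.cobounded_eq_cocompact, ← comap_norm_atTop]; infer_instance
  have h := tendsto_integral_filter_of_dominated_convergence
    (F := fun x y => stressReal C D i j (x, y) * η y) (f := fun _ => (0 : ℝ)) (l := cocompact ℝ)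
    (μ := volume) (fun y => fieldBound C D * (heightWeight y * ‖η y‖))
    (Eventually.of_forall fun x => (aestronglyMeasurable_stressReal_slice hD x).mul
      hη.1.continuous.aestronglyMeasurable)
    (Eventually.of_forall fun x => norm_stressReal_mul_le hD η x)
    ((integrable_heightWeight_test hη).const_mul _)
    (Eventually.of_forall fun y => by
      have := ((Complex.continuous_re.tendsto _).comp
        (tendsto_stressField (C := C) (D := D) (i := i) (j := j) y)).mul_const (η y)
      rwa [Complex.zero_re, zero_mul] at this)
  rwa [integral_zero] at h

lemma tendsto_average_of_tendsto_zero {F : ℝ → ℝ} (hm : AEStronglyMeasurable F volume) {K : ℝ}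
    (hb : ∀ x, ‖F x‖ ≤ K) (hl : Tendsto F (cocompact ℝ) (𝓝 0)) {φ : ℝ → ℝ} (hφ : IsTest univ φ) :
    Tendsto (fun R : ℝ => ∫ x, F x * (R⁻¹ * φ (x / R))) atTop (𝓝 0) := by
  have hφi : Integrable φ := hφ.1.continuous.integrable_of_hasCompactSupport hφ.2.1
  have h := tendsto_integral_filter_of_dominated_convergence
    (F := fun (R t : ℝ) => F (R * t) * φ t) (f := fun _ => (0 : ℝ)) (l := atTop)
    (μ := volume) (fun t => K * ‖φ t‖)
    (by
      filter_upwards [eventually_gt_atTop 0] with R hR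
      exact (hm.comp_quasiMeasurePreserving (quasiMeasurePreserving_mul hR.ne')).mul
        hφ.1.continuous.aestronglyMeasurable)
    (Eventually.of_forall fun R => Eventually.of_forall fun t => by
      rw [norm_mul]
      exact mul_le_mul_of_nonneg_right (hb _) (norm_nonneg _))
    (hφi.norm.const_mul K)
    (by
      filter_upwards [Measure.ae_ne volume (0 : ℝ)] with t ht
      have : Tendsto (fun R : ℝ => R * t) atTop (cocompact ℝ) := by
        rw [← Metric.cobounded_eq_cocompact, ← tendsto_norm_atTop_iff_cobounded]
        simp only [norm_mul]
        exact tendsto_norm_atTop_atTop.atTop_mul_const (norm_pos_iff.2 ht)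
      simpa using (hl.comp this).mul_const (φ t))
  simp only [integral_zero] at h
  refine h.congr' ?_
  filter_upwards [eventually_gt_atTop 0] with R hR
  have e := Measure.integral_comp_mul_left (fun x => F x * (R⁻¹ * φ (x / R))) R
  rw [abs_inv, abs_of_pos hR, smul_eq_mul, eq_inv_mul_iff_mul_eq₀ hR.ne', ← integral_const_mul] at e
  rw [← e]
  refine integral_congr_ae (Eventually.of_forall fun t => ?_)
  simp only [mul_div_cancel_left₀ t hR.ne']
  field_simp

/-- A real test function as a Schwartz function. -/
def IsTest.schwartz {φ : ℝ → ℝ} (hφ : IsTest Ω φ) : 𝓢(ℝ, ℝ) := hφ.2.1.toSchwartzMap hφ.1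

lemma IsTest.scale {φ : ℝ → ℝ} (hφ : IsTest univ φ) {R : ℝ} (hR : 0 < R) :
    IsTest univ fun x => R⁻¹ * φ (x / R) := by
  refine ⟨contDiff_const.mul (hφ.1.comp (contDiff_id.div_const R)), ?_, subset_univ _⟩
  have h := hφ.2.1.comp_homeomorph (Homeomorph.mulRight₀ R⁻¹ (inv_ne_zero hR.ne'))
  exact HasCompactSupport.mul_left (f := fun _ => R⁻¹) (by exact h)

lemma TemperedFun.sub {f g : ℝ → ℝ} (hf : TemperedFun f) (hg : TemperedFun g) :
    TemperedFun fun x => f x - g x := by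
  obtain ⟨N, hN⟩ := hf
  obtain ⟨M, hM⟩ := hg
  have key : ∀ (f : ℝ → ℝ) (N M : ℕ), Integrable (fun p => f p / (1 + ‖p‖) ^ N) volume →
      Integrable (fun p => f p / (1 + ‖p‖) ^ (N + M)) volume := by
    intro f N M h
    refine (h.mul_bdd (c := 1) (g := fun p => ((1 + ‖p‖) ^ M)⁻¹) (Continuous.aestronglyMeasurable
      ((by fun_prop : Continuous fun p : ℝ => (1 + ‖p‖) ^ M).inv₀ fun p => by positivity))
      (Eventually.of_forall fun p => ?_)).congr (Eventually.of_forall fun p => ?_)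
    · rw [norm_inv, Real.norm_of_nonneg (by positivity)]
      exact inv_le_one_of_one_le₀ (one_le_pow₀ (by linarith [norm_nonneg p]))
    · simp only [pow_add]
      rw [div_mul_eq_div_div, div_eq_mul_inv (_ / _)]
  have h2 := key g M N hM
  rw [add_comm] at h2
  refine ⟨N + M, ((key f N M hN).sub h2).congr (Eventually.of_forall fun p => ?_)⟩
  simp only [Pi.sub_apply, sub_div]

lemma averagesDecay_stress (hu : ∀ i, TemperedFun (u i)) (hs : StressDecays G ν u)
    (hD : MemLp D 2 volume) (hη : IsTest {y : ℝ | y ≠ 0} η) :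
    AveragesDecay
      (fun x => sliceInt (fluxY G ν u i j) (deriv η) x - sliceInt (stressReal C D i j) η x)
      (sliceInt (fluxX G ν u i j) η) := by
  have hS := temperedFun_stressReal (C := C) (i := i) (j := j) hD
  have hY := (temperedFun_fluxY (G := G) (ν := ν) hu i j).sliceInt hη.deriv
  have hX := (temperedFun_fluxX (G := G) (ν := ν) hu i j).sliceInt hη
  have hF₀ : TemperedFun fun x =>
    sliceInt (fluxY G ν u i j) (deriv η) x - sliceInt (stressReal C D i j) η x := hY.sub (hS.sliceInt hη)
  have key : ∀ φ : ℝ → ℝ, IsTest univ φ → Tendsto (fun R : ℝ => orderOne (fun x =>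
      sliceInt (fluxY G ν u i j) (deriv η) x - sliceInt (stressReal C D i j) η x)
      (sliceInt (fluxX G ν u i j) η) (fun x => ((R⁻¹ * φ (x / R) : ℝ) : ℂ))) atTop (𝓝 0) := by
    intro φ hφ
    have h1 := hs i j φ hφ η hη
    have hm : AEStronglyMeasurable (sliceInt (stressReal C D i j) η) volume :=
      (((aestronglyMeasurable_stressField hD).re).mul
        hη.1.continuous.aestronglyMeasurable.comp_snd).integral_prod_right'
    have h2 := tendsto_average_of_tendsto_zero hm
      (norm_sliceInt_stressReal_le (C := C) (i := i) (j := j) hD hη)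
      (tendsto_sliceInt_stressReal hD hη) hφ
    have h3 := (Complex.continuous_ofReal.tendsto _).comp (h1.sub h2)
    rw [sub_zero, Complex.ofReal_zero] at h3
    refine h3.congr' ?_
    filter_upwards [eventually_gt_atTop 0] with R hR
    have ht := hφ.scale hR
    have e := orderOne_stress_sub (G := G) (ν := ν) (C := C) (i := i) (j := j) hu hD hη ht.schwartz
    have e2 := integral_sliceInt_mul_real hS hη (φ := fun x => R⁻¹ * φ (x / R))
      ht.1.continuous.aestronglyMeasurable (rapid_schwartz_ofReal ht.schwartz)
    refine Eq.trans ?_ e.symm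
    simp only [Function.comp_apply]
    rw [← e2]
    rfl
  intro φ hφ
  have h := (key _ hφ.re).sub ((key _ hφ.im).const_mul (-Complex.I))
  rw [mul_zero, sub_zero] at h
  refine h.congr' ?_
  filter_upwards [eventually_gt_atTop 0] with R hR
  rw [← orderOne_const_mul, ← orderOne_const_mul, ← orderOne_sub hF₀ hX (hφ.re.scale hR).ofReal ((hφ.im.scale hR).ofReal.const_mul _)]
  congr 1; ext x
  conv_rhs => rw [← Complex.re_add_im (φ (x / R))]
  push_cast
  ring

lemma SlipSolution.orderOne_stress_ft (h : SlipSolution G ν u v w) (hβ : β * (2 - 2 * ν) = 1)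
    (hκ : κ * κ = 1) {dv : ℝ → ℝ} (hdv : HasL2Deriv (v 0) dv)
    (hD : FtDual (fun x => (dv x : ℂ)) D) (hη : IsTest (halfLine κ) η) {ψ : ℝ → ℂ}
    (hψ : IsTestC {ξ : ℝ | ξ ≠ 0} ψ) :
    orderOne (fun x => sliceInt (fluxY G ν u i j) (deriv η) x
        - sliceInt (stressReal (2 * G * β) D i j) η x)
      (sliceInt (fluxX G ν u i j) η) (ft ψ) = 0 := by
  have hu := h.upper.temp
  have hd : deriv (fun x => (η x : ℂ)) = fun x => ((deriv η x : ℝ) : ℂ) :=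
    funext fun x => ((hη.1.differentiable (by simp) x).hasDerivAt.ofReal_comp).deriv
  have e := h.stressPair_tensor hβ hκ hdv hψ hη.ofReal i j
  have hm := isTestC_stress (2 * G * β) hκ hψ hη.ofReal i j
  rw [PN.stressPair_tensor hψ hη.ofReal, hd, ftPair,
    hD.2.2 _ hm.integrable (hm.continuous.memLp_of_hasCompactSupport hm.2.1)] at e
  have hS := temperedFun_stressReal (C := 2 * G * β) (i := i) (j := j) hD.2.1
  set ψ' : 𝓢(ℝ, ℂ) := hψ.2.1.toSchwartzMap hψ.1
  have hψ' : ft ψ = ft ψ' := rfl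
  have e2 : ∫ x, (sliceInt (stressReal (2 * G * β) D i j) η x : ℂ) * ft ψ x
      = ∫ ξ, D ξ * ((stressA (2 * G * β) κ i j ξ * moment₀ κ (fun x => (η x : ℂ)) |ξ|
        + stressB (2 * G * β) κ i j ξ * absC ξ * moment₁ κ (fun x => (η x : ℂ)) |ξ|) * ψ ξ) := by
    rw [hψ', ← integral_sliceInt_mul hS hη (continuous_ft ψ'.integrable).aestronglyMeasurable
      (rapid_ft_schwartz ψ')]
    have := integral_stressField_mul_tensor (C := 2 * G * β) (i := i) (j := j) hD.2.1 ψ'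
      (hη.ofReal.mono (subset_univ _))
    simp only [integral_stressSymbol_mul hκ hη.ofReal] at this
    refine Eq.trans (integral_congr_ae ?_) (this.trans (integral_congr_ae ?_))
    · filter_upwards [ae_snd_ne_zero] with p hp
      rw [ofReal_stressReal hD hp]
    · refine Eventually.of_forall fun ξ => ?_
      simp only [mul_comm (ψ' ξ)]
      rfl
  have e3 : ∀ (f : ℝ × ℝ → ℝ), TemperedFun f → ∀ (χ : ℝ → ℂ), IsTestC {ξ : ℝ | ξ ≠ 0} χ →
      ∀ (ρ : ℝ → ℝ), IsTest (halfLine κ) ρ →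
      pftPair f (tensor χ fun y => (ρ y : ℂ)) = ∫ x, (sliceInt f ρ x : ℂ) * ft χ x := by
    intro f hf χ hχ ρ hρ
    rw [← integral_sliceInt_mul hf hρ (continuous_ft hχ.integrable).aestronglyMeasurable
      (rapid_ft hχ), pftPair]
    simp only [pft_tensor, mul_comm (ft χ _)]
  have hX := temperedFun_fluxX (G := G) (ν := ν) hu i j
  have hY := temperedFun_fluxY (G := G) (ν := ν) hu i j
  rw [e3 _ hX _ hψ.neg_I_mul _ hη, e3 _ hY _ hψ _ hη.deriv] at e
  have hd2 : deriv (ft ψ) = ft fun ξ => -(Complex.I * ξ) * ψ ξ := by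
    rw [hψ', deriv_ft_schwartz]
    congr 1; ext ξ
    rw [powMul_apply, pow_one, ← neg_mul]
    rfl
  have hr := rapid_ft hψ
  have hm := (continuous_ft hψ.integrable).aestronglyMeasurable (μ := volume)
  rw [orderOne, hd2]
  simp only [Complex.ofReal_sub, sub_mul]
  rw [integral_sub ((hY.sliceInt hη.deriv).integrable_mul hm hr)
    ((hS.sliceInt hη).integrable_mul hm hr), e2, ← e]
  ring

/-- The stress is the stress field, on products. -/
theorem SlipSolution.stress_tensor_eq (h : SlipSolution G ν u v w) (hβ : β * (2 - 2 * ν) = 1)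
    (hκ : κ * κ = 1) {dv : ℝ → ℝ} (hdv : HasL2Deriv (v 0) dv) (hs : StressDecays G ν u)
    (hD : FtDual (fun x => (dv x : ℂ)) D) (hη : IsTest (halfLine κ) η) (φ : 𝓢(ℝ, ℝ)) :
    stress G ν u i j (fun p => φ p.1 * η p.2)
      = ∫ p : ℝ × ℝ, stressReal (2 * G * β) D i j p * (φ p.1 * η p.2) := by
  have hu := h.upper.temp
  have hS := temperedFun_stressReal (C := 2 * G * β) (i := i) (j := j) hD.2.1
  have hη' : IsTest {y : ℝ | y ≠ 0} η := ⟨hη.1, hη.2.1, hη.2.2.trans fun y hy h0 => by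
    have hy' : 0 < κ * y := hy
    simp only [h0, mul_zero, lt_irrefl] at hy'⟩
  have e := orderOne_eq_zero
    (((temperedFun_fluxY (G := G) (ν := ν) hu i j).sliceInt hη.deriv).sub (hS.sliceInt hη))
    ((temperedFun_fluxX (G := G) (ν := ν) hu i j).sliceInt hη)
    (averagesDecay_stress hu hs hD.2.1 hη')
    (fun ψ hψ => h.orderOne_stress_ft hβ hκ hdv hD hη hψ)
    (SchwartzMap.postcompCLM (𝕜 := ℝ) Complex.ofRealCLM φ)
  have e2 := orderOne_stress_sub (G := G) (ν := ν) (C := 2 * G * β) (i := i) (j := j) hu hD.2.1 hη φ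
  rw [show (fun x => (φ x : ℂ)) = SchwartzMap.postcompCLM (𝕜 := ℝ) Complex.ofRealCLM φ from rfl,
    e] at e2
  exact sub_eq_zero.1 (Complex.ofReal_eq_zero.1 e2.symm)

end

/-! ### From products to general test functions -/

lemma exists_mollifier {δ : ℝ} (hδ : 0 < δ) : ∃ ρ : ℝ → ℝ, IsTest univ ρ ∧ (∀ x, 0 ≤ ρ x) ∧
    ∫ x, ρ x = 1 ∧ ∀ x, δ ≤ |x| → ρ x = 0 := by
  let b : ContDiffBump (0 : ℝ) := ⟨δ / 2, δ, by positivity, by linarith⟩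
  refine ⟨b.normed volume, ⟨b.contDiff_normed, b.hasCompactSupport_normed, subset_univ _⟩,
    fun x => b.nonneg_normed x, b.integral_normed, fun x hx => ?_⟩
  by_contra h
  have hm : x ∈ Function.support (b.normed volume) := h
  rw [b.support_normed_eq, Metric.mem_ball, Real.dist_eq, sub_zero] at hm
  exact absurd hm (not_lt.2 hx)

section moll

variable {Φ : ℝ × ℝ → ℝ} {ρ : ℝ → ℝ}

lemma integral_shift_mul (h1 : ∫ x, ρ x = 1) (p : ℝ × ℝ) :
    ∫ q : ℝ × ℝ, ρ (p.1 - q.1) * ρ (p.2 - q.2) = 1 := by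
  rw [Measure.volume_eq_prod, integral_prod_mul (fun x => ρ (p.1 - x)) (fun y => ρ (p.2 - y)),
    integral_sub_left_eq_self, integral_sub_left_eq_self, h1, one_mul]

lemma integrable_shift_mul {f g : ℝ → ℝ} (hf : Integrable f) (hg : Integrable g) (p : ℝ × ℝ) :
    Integrable fun q : ℝ × ℝ => f (p.1 - q.1) * g (p.2 - q.2) :=
  (hf.comp_sub_left p.1).mul_prod (hg.comp_sub_left p.2)

lemma IsTest.integrable {Ω : Set ℝ} (hρ : IsTest Ω ρ) : Integrable ρ :=
  hρ.1.continuous.integrable_of_hasCompactSupport hρ.2.1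

lemma mollify_close (hc : Continuous Φ) (hs : HasCompactSupport Φ) {ε : ℝ} (hε : 0 < ε) :
    ∃ δ₀ > 0, ∀ δ ≤ δ₀, ∀ ρ : ℝ → ℝ, IsTest univ ρ → (∀ x, 0 ≤ ρ x) → ∫ x, ρ x = 1 →
      (∀ x, δ ≤ |x| → ρ x = 0) →
      ∀ p : ℝ × ℝ, |(∫ q : ℝ × ℝ, Φ q * (ρ (p.1 - q.1) * ρ (p.2 - q.2))) - Φ p| ≤ ε := by
  have hu := hs.uniformContinuous_of_continuous hc
  obtain ⟨δ₀, hδ₀, hd⟩ := Metric.uniformContinuous_iff.1 hu ε hε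
  refine ⟨δ₀, hδ₀, fun δ hδ ρ hρ h0 h1 hz p => ?_⟩
  obtain ⟨M, hM⟩ := hs.exists_bound_of_continuous hc
  have hk := integrable_shift_mul hρ.integrable hρ.integrable p
  have hi : Integrable fun q : ℝ × ℝ => Φ q * (ρ (p.1 - q.1) * ρ (p.2 - q.2)) :=
    hk.bdd_mul hc.aestronglyMeasurable (Eventually.of_forall hM)
  have e : (∫ q : ℝ × ℝ, Φ q * (ρ (p.1 - q.1) * ρ (p.2 - q.2))) - Φ p
      = ∫ q : ℝ × ℝ, (Φ q - Φ p) * (ρ (p.1 - q.1) * ρ (p.2 - q.2)) := by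
    simp only [sub_mul]
    rw [integral_sub hi (hk.const_mul _), integral_const_mul, integral_shift_mul h1, mul_one]
  rw [e, ← Real.norm_eq_abs]
  refine (norm_integral_le_of_norm_le (hk.const_mul ε) (Eventually.of_forall fun q => ?_)).trans
    (le_of_eq ?_)
  · have hp : 0 ≤ ρ (p.1 - q.1) * ρ (p.2 - q.2) := mul_nonneg (h0 _) (h0 _)
    rw [norm_mul, Real.norm_of_nonneg hp]
    by_cases hq : dist q p < δ
    · exact mul_le_mul_of_nonneg_right (hd (hq.trans_le hδ)).le hp
    · have : ρ (p.1 - q.1) * ρ (p.2 - q.2) = 0 := by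
        rw [dist_comm, Prod.dist_eq, max_lt_iff, not_and_or, not_lt, not_lt, Real.dist_eq,
          Real.dist_eq] at hq
        rcases hq with hq | hq
        · rw [hz _ hq, zero_mul]
        · rw [hz _ hq, mul_zero]
      simp [this]
  · rw [integral_const_mul, integral_shift_mul h1, mul_one]

lemma pd_shift_zero {f g : ℝ → ℝ} (hf : Differentiable ℝ f) (hg : Differentiable ℝ g)
    (q : ℝ × ℝ) : pd 0 (fun p : ℝ × ℝ => f (p.1 - q.1) * g (p.2 - q.2))
      = fun p => deriv f (p.1 - q.1) * g (p.2 - q.2) := by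
  have := pd_zero_tensor (φ := fun x => f (x - q.1)) (η := fun y => g (y - q.2))
    (by fun_prop) (by fun_prop)
  rw [this]
  ext p
  rw [deriv_comp_sub_const]

lemma pd_shift_one {f g : ℝ → ℝ} (hf : Differentiable ℝ f) (hg : Differentiable ℝ g)
    (q : ℝ × ℝ) : pd 1 (fun p : ℝ × ℝ => f (p.1 - q.1) * g (p.2 - q.2))
      = fun p => f (p.1 - q.1) * deriv g (p.2 - q.2) := by
  have := pd_one_tensor (φ := fun x => f (x - q.1)) (η := fun y => g (y - q.2))
    (by fun_prop) (by fun_prop)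
  rw [this]
  ext p
  rw [deriv_comp_sub_const]

lemma integral_mul_shift_parts (hΦ : IsTest univ Φ) (hρ : IsTest univ ρ) (p : ℝ × ℝ) :
    (∫ q : ℝ × ℝ, Φ q * (deriv ρ (p.1 - q.1) * ρ (p.2 - q.2))
        = ∫ q : ℝ × ℝ, pd 0 Φ q * (ρ (p.1 - q.1) * ρ (p.2 - q.2))) ∧
      ∫ q : ℝ × ℝ, Φ q * (ρ (p.1 - q.1) * deriv ρ (p.2 - q.2))
        = ∫ q : ℝ × ℝ, pd 1 Φ q * (ρ (p.1 - q.1) * ρ (p.2 - q.2)) := by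
  have hρd := hρ.1.differentiable (by simp)
  have hΦd := hΦ.1.differentiable (by simp)
  have hk : Differentiable ℝ fun q : ℝ × ℝ => ρ (p.1 - q.1) * ρ (p.2 - q.2) := by fun_prop
  have e0 : pd 0 (fun q : ℝ × ℝ => ρ (p.1 - q.1) * ρ (p.2 - q.2))
      = fun q => -(deriv ρ (p.1 - q.1) * ρ (p.2 - q.2)) := by
    rw [pd_zero_tensor (φ := fun x => ρ (p.1 - x)) (η := fun y => ρ (p.2 - y))
      (by fun_prop) (by fun_prop)]
    ext q
    rw [deriv_comp_const_sub, neg_mul]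
  have e1 : pd 1 (fun q : ℝ × ℝ => ρ (p.1 - q.1) * ρ (p.2 - q.2))
      = fun q => -(ρ (p.1 - q.1) * deriv ρ (p.2 - q.2)) := by
    rw [pd_one_tensor (φ := fun x => ρ (p.1 - x)) (η := fun y => ρ (p.2 - y))
      (by fun_prop) (by fun_prop)]
    ext q
    rw [deriv_comp_const_sub, mul_neg]
  have hΦb := hΦ.2.1.exists_bound_of_continuous hΦ.1.continuous
  obtain ⟨M, hM⟩ := hΦb
  have hkb : ∃ B, ∀ q : ℝ × ℝ, ‖ρ (p.1 - q.1) * ρ (p.2 - q.2)‖ ≤ B := by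
    obtain ⟨B, hB⟩ := hρ.2.1.exists_bound_of_continuous hρ.1.continuous
    exact ⟨B * B, fun q => by
      rw [norm_mul]
      exact mul_le_mul (hB _) (hB _) (norm_nonneg _) ((norm_nonneg _).trans (hB 0))⟩
  obtain ⟨B, hB⟩ := hkb
  have hdc : ∀ j, Continuous (pd j Φ) := fun j =>
    (hΦ.1.continuous_fderiv (by simp)).clm_apply continuous_const
  have hds : ∀ j, HasCompactSupport (pd j Φ) := fun j =>
    (hΦ.2.1.fderiv ℝ).comp_left (g := fun L : ℝ × ℝ →L[ℝ] ℝ => L (dir j)) rfl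
  have key : ∀ j : Fin 2, Integrable (pd j fun q : ℝ × ℝ => ρ (p.1 - q.1) * ρ (p.2 - q.2)) →
      ∫ q : ℝ × ℝ, Φ q * pd j (fun q : ℝ × ℝ => ρ (p.1 - q.1) * ρ (p.2 - q.2)) q
        = -∫ q : ℝ × ℝ, pd j Φ q * (ρ (p.1 - q.1) * ρ (p.2 - q.2)) := by
    intro j hj
    have hkc := hk.continuous
    refine integral_mul_fderiv_eq_neg_fderiv_mul_of_integrable (μ := volume) ?_ ?_ ?_
      (fun x _ => hΦd x) (fun x _ => hk x)
    · exact ((hdc j).integrable_of_hasCompactSupport (hds j)).mul_bdd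
        hkc.aestronglyMeasurable (Eventually.of_forall hB)
    · exact hj.bdd_mul hΦ.1.continuous.aestronglyMeasurable (Eventually.of_forall hM)
    · exact (hΦ.1.continuous.integrable_of_hasCompactSupport hΦ.2.1).mul_bdd
        hkc.aestronglyMeasurable (Eventually.of_forall hB)
  have k0 := key 0 (by
    rw [e0]; exact (integrable_shift_mul hρ.deriv.integrable hρ.integrable p).neg)
  have k1 := key 1 (by
    rw [e1]; exact (integrable_shift_mul hρ.integrable hρ.deriv.integrable p).neg)
  simp only [e0, e1, mul_neg, integral_neg, neg_inj] at k0 k1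
  exact ⟨k0, k1⟩

lemma mollify_fubini {A : ℝ × ℝ → ℝ} (hA : LocallyIntegrable A volume) (hΦ : IsTest univ Φ)
    {f g : ℝ → ℝ} (hf : IsTest univ f) (hg : IsTest univ g) {δ : ℝ}
    (hfz : ∀ x, δ ≤ |x| → f x = 0) (hgz : ∀ x, δ ≤ |x| → g x = 0) :
    Integrable (fun q => Φ q * ∫ p : ℝ × ℝ, A p * (f (p.1 - q.1) * g (p.2 - q.2))) ∧
    Integrable (fun p => A p * ∫ q : ℝ × ℝ, Φ q * (f (p.1 - q.1) * g (p.2 - q.2))) ∧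
    ∫ q, Φ q * ∫ p : ℝ × ℝ, A p * (f (p.1 - q.1) * g (p.2 - q.2))
      = ∫ p : ℝ × ℝ, A p * ∫ q : ℝ × ℝ, Φ q * (f (p.1 - q.1) * g (p.2 - q.2)) := by
  obtain ⟨a, ha⟩ := hf.2.1.exists_bound_of_continuous hf.1.continuous
  obtain ⟨b, hb⟩ := hg.2.1.exists_bound_of_continuous hg.1.continuous
  set K := Metric.cthickening δ (tsupport Φ)
  have hK : IsCompact K := hΦ.2.1.isCompact.cthickening
  have hAK : Integrable (K.indicator A) := (hA.integrableOn_isCompact hK).integrable_indicator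
    hK.isClosed.measurableSet
  have hfc := hf.1.continuous
  have hgc := hg.1.continuous
  have hi : Integrable (fun z : (ℝ × ℝ) × (ℝ × ℝ) =>
      Φ z.1 * (A z.2 * (f (z.2.1 - z.1.1) * g (z.2.2 - z.1.2))))
      ((volume : Measure (ℝ × ℝ)).prod (volume : Measure (ℝ × ℝ))) := by
    refine (((hΦ.1.continuous.integrable_of_hasCompactSupport hΦ.2.1).norm.mul_prod
      hAK.norm).const_mul (a * b)).mono' ?_ (Eventually.of_forall fun z => ?_)
    · exact hΦ.1.continuous.aestronglyMeasurable.comp_fst.mul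
        (hA.aestronglyMeasurable.comp_snd.mul (Continuous.aestronglyMeasurable (by fun_prop)))
    · by_cases h0 : Φ z.1 * (A z.2 * (f (z.2.1 - z.1.1) * g (z.2.2 - z.1.2))) = 0
      · rw [h0, norm_zero]
        exact mul_nonneg (mul_nonneg ((norm_nonneg _).trans (ha 0))
          ((norm_nonneg _).trans (hb 0))) (by positivity)
      · have hm : z.2 ∈ K := by
          have h1 : z.1 ∈ tsupport Φ := subset_tsupport _ (left_ne_zero_of_mul h0)
          have h2 := right_ne_zero_of_mul (right_ne_zero_of_mul h0)
          refine Metric.mem_cthickening_of_dist_le _ _ _ _ h1 ?_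
          rw [Prod.dist_eq, max_le_iff, Real.dist_eq, Real.dist_eq]
          constructor
          · by_contra h
            exact left_ne_zero_of_mul h2 (hfz _ (not_le.1 h).le)
          · by_contra h
            exact right_ne_zero_of_mul h2 (hgz _ (not_le.1 h).le)
        rw [indicator_of_mem hm, norm_mul, norm_mul, norm_mul]
        calc ‖Φ z.1‖ * (‖A z.2‖ * (‖f (z.2.1 - z.1.1)‖ * ‖g (z.2.2 - z.1.2)‖))
            ≤ ‖Φ z.1‖ * (‖A z.2‖ * (a * b)) := by
              gcongr
              · exact (norm_nonneg _).trans (ha 0)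
              · exact ha _
              · exact hb _
          _ = _ := by ring
  refine ⟨?_, ?_, ?_⟩
  · refine hi.integral_prod_left.congr (Eventually.of_forall fun q => ?_)
    simp only [integral_const_mul]
  · refine hi.integral_prod_right.congr (Eventually.of_forall fun p => ?_)
    simp only
    rw [← integral_const_mul]
    congr 1; ext q; ring
  · have := integral_integral_swap (f := fun q p : ℝ × ℝ =>
      Φ q * (A p * (f (p.1 - q.1) * g (p.2 - q.2)))) hi
    simp only [integral_const_mul] at this
    rw [this]
    refine integral_congr_ae (Eventually.of_forall fun p => ?_)
    simp only
    rw [← integral_const_mul]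
    congr 1; ext q; ring

lemma IsTest.pd {Ω : Set (ℝ × ℝ)} (hΦ : IsTest Ω Φ) (j : Fin 2) : IsTest Ω (pd j Φ) :=
  ⟨(hΦ.1.fderiv_right (m := ∞) (by simp)).clm_apply contDiff_const,
    (hΦ.2.1.fderiv ℝ).comp_left (g := fun L : ℝ × ℝ →L[ℝ] ℝ => L (dir j)) rfl,
    (closure_mono fun p hp => by
      intro h0; exact hp (by simp [PN.pd, h0])).trans ((tsupport_fderiv_subset ℝ).trans hΦ.2.2)⟩

lemma tsupport_pd_subset (j : Fin 2) : tsupport (PN.pd j Φ) ⊆ tsupport Φ :=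
  (closure_mono fun p hp => by
      intro h0; exact hp (by simp [PN.pd, h0])).trans (tsupport_fderiv_subset ℝ)

lemma mollify_pair {A : ℝ × ℝ → ℝ} (hA : LocallyIntegrable A volume) {K₀ : Set (ℝ × ℝ)}
    (hK₀ : IsCompact K₀) (hΦ : IsTest univ Φ) (hs : tsupport Φ ⊆ K₀) (hρ : IsTest univ ρ)
    (hz : ∀ x, 1 ≤ |x| → ρ x = 0) {ε : ℝ}
    (hε : ∀ p : ℝ × ℝ, |(∫ q : ℝ × ℝ, Φ q * (ρ (p.1 - q.1) * ρ (p.2 - q.2))) - Φ p| ≤ ε) :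
    |(∫ p : ℝ × ℝ, A p * ∫ q : ℝ × ℝ, Φ q * (ρ (p.1 - q.1) * ρ (p.2 - q.2))) - pair A Φ|
      ≤ ε * ∫ p in Metric.cthickening 1 K₀, ‖A p‖ := by
  have hK : IsCompact (Metric.cthickening 1 K₀) := hK₀.cthickening
  have hi := (mollify_fubini hA hΦ hρ hρ hz hz).2.1
  have hi2 : Integrable fun p => A p * Φ p :=
    hA.integrable_smul_right_of_hasCompactSupport hΦ.1.continuous hΦ.2.1
  have hAK : Integrable ((Metric.cthickening 1 K₀).indicator fun p => ‖A p‖) :=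
    IntegrableOn.integrable_indicator (hA.integrableOn_isCompact hK).norm hK.isClosed.measurableSet
  rw [pair, ← integral_sub hi hi2, ← integral_indicator hK.isClosed.measurableSet,
    ← integral_const_mul, ← Real.norm_eq_abs]
  refine norm_integral_le_of_norm_le (hAK.const_mul ε) (Eventually.of_forall fun p => ?_)
  rw [← mul_sub, norm_mul]
  by_cases hp : p ∈ Metric.cthickening 1 K₀
  · rw [indicator_of_mem hp, mul_comm]
    exact mul_le_mul_of_nonneg_right (hε p) (norm_nonneg _)
  · have hq : ∀ q ∈ tsupport Φ, 1 < dist p q := fun q hq => by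
      by_contra h
      exact hp (Metric.mem_cthickening_of_dist_le _ _ _ _ (hs hq) (not_lt.1 h))
    have h1 : Φ p = 0 := by
      by_contra h
      have := hq p (subset_tsupport _ h)
      rw [dist_self] at this
      linarith
    have h2 : ∀ q : ℝ × ℝ, Φ q * (ρ (p.1 - q.1) * ρ (p.2 - q.2)) = 0 := fun q => by
      by_contra h
      have h3 := hq q (subset_tsupport _ (left_ne_zero_of_mul h))
      rw [Prod.dist_eq, lt_max_iff, Real.dist_eq, Real.dist_eq] at h3
      rcases h3 with h3 | h3
      · exact left_ne_zero_of_mul (right_ne_zero_of_mul h) (hz _ h3.le)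
      · exact right_ne_zero_of_mul (right_ne_zero_of_mul h) (hz _ h3.le)
    simp [indicator_of_notMem hp, h1, h2]

lemma IsTest.shift (hρ : IsTest univ ρ) (a : ℝ) : IsTest univ fun x => ρ (x - a) :=
  ⟨hρ.1.comp (contDiff_id.sub contDiff_const),
    hρ.2.1.comp_homeomorph (Homeomorph.subRight a), subset_univ _⟩

lemma IsTest.shift_halfLine (hρ : IsTest univ ρ) {δ d a κ : ℝ} (hz : ∀ x, δ ≤ |x| → ρ x = 0)
    (hδ : δ < d) (hκ : κ * κ = 1) (ha : d ≤ κ * a) : IsTest (halfLine κ) fun x => ρ (x - a) := by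
  refine ⟨(hρ.shift a).1, (hρ.shift a).2.1, ?_⟩
  have hc : IsClosed {x : ℝ | d - δ ≤ κ * x} := isClosed_le continuous_const (by fun_prop)
  refine (closure_minimal (fun x hx => ?_) hc).trans fun x (hx : d - δ ≤ κ * x) => ?_
  · have h1 : |x - a| < δ := by
      by_contra h
      exact hx (hz _ (not_lt.1 h))
    have h2 : |κ| = 1 := by rw [← abs_one, ← sq_eq_sq_iff_abs_eq_abs, sq, hκ, one_pow]
    have h3 : |κ * (x - a)| < δ := by rwa [abs_mul, h2, one_mul]
    have h4 := (abs_lt.1 h3).1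
    change d - δ ≤ κ * x
    linarith
  · change 0 < κ * x
    linarith

/-- A functional of order one off the slip line that vanishes on products is zero. -/
theorem firstOrder_eq_zero {A B S : ℝ × ℝ → ℝ} (hA : LocallyIntegrable A volume)
    (hB : LocallyIntegrable B volume) (hS : LocallyIntegrable S volume)
    (hT : ∀ κ : ℝ, κ * κ = 1 → ∀ φ η : ℝ → ℝ, IsTest univ φ → IsTest (halfLine κ) η →
      pair A (PN.pd 0 fun p => φ p.1 * η p.2) + pair B (PN.pd 1 fun p => φ p.1 * η p.2)
        - pair S (fun p => φ p.1 * η p.2) = 0) (hΦ : IsTest offSlip Φ) :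
    pair A (PN.pd 0 Φ) + pair B (PN.pd 1 Φ) - pair S Φ = 0 := by
  have hΦu : IsTest univ Φ := ⟨hΦ.1, hΦ.2.1, subset_univ _⟩
  have hopen : IsOpen offSlip := isOpen_ne.preimage continuous_snd
  obtain ⟨d, hd, hds⟩ := hΦ.2.1.isCompact.exists_cthickening_subset_open hopen hΦ.2.2
  have hdq : ∀ q ∈ tsupport Φ, d ≤ |q.2| := fun q hq => by
    by_contra h
    have : ((q.1, 0) : ℝ × ℝ) ∈ offSlip := hds (Metric.mem_cthickening_of_dist_le _ q _ _ hq (by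
      rw [Prod.dist_eq, dist_self, Real.dist_eq, zero_sub, abs_neg]
      exact max_le hd.le (not_le.1 h).le))
    exact this rfl
  have hK := hΦ.2.1.isCompact
  set c := (∫ p in Metric.cthickening 1 (tsupport Φ), ‖A p‖)
    + (∫ p in Metric.cthickening 1 (tsupport Φ), ‖B p‖)
    + ∫ p in Metric.cthickening 1 (tsupport Φ), ‖S p‖ with hc
  have main : ∀ ε > 0, |pair A (PN.pd 0 Φ) + pair B (PN.pd 1 Φ) - pair S Φ| ≤ ε * c := by
    intro ε hε
    obtain ⟨a, ha, ha'⟩ := mollify_close (hΦu.pd 0).1.continuous (hΦu.pd 0).2.1 hε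
    obtain ⟨b, hb, hb'⟩ := mollify_close (hΦu.pd 1).1.continuous (hΦu.pd 1).2.1 hε
    obtain ⟨s, hs, hs'⟩ := mollify_close hΦ.1.continuous hΦ.2.1 hε
    set δ := min (min a b) (min s (min 1 (d / 2)))
    have hδ : 0 < δ := by positivity
    obtain ⟨ρ, hρ, h0, h1, hz'⟩ := exists_mollifier (half_pos hδ)
    have hz : ∀ x, δ ≤ |x| → ρ x = 0 := fun x hx => hz' x (by linarith)
    have hδ1 : δ ≤ 1 := (min_le_right _ _).trans ((min_le_right _ _).trans (min_le_left _ _))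
    have hδd : δ < d := lt_of_le_of_lt
      ((min_le_right _ _).trans ((min_le_right _ _).trans (min_le_right _ _))) (by linarith)
    have hz1 : ∀ x, 1 ≤ |x| → ρ x = 0 := fun x hx => hz x (hδ1.trans hx)
    have hdz : ∀ x, δ ≤ |x| → deriv ρ x = 0 := fun x hx => by
      have : ρ =ᶠ[𝓝 x] fun _ => 0 := by
        filter_upwards [(isOpen_lt continuous_const continuous_abs).mem_nhds
          (show δ / 2 < |x| by linarith)] with y hy using hz' y (le_of_lt hy)
      rw [this.deriv_eq, deriv_const]
    have e1 := mollify_pair hA hK (hΦu.pd 0) (tsupport_pd_subset 0) hρ hz1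
      (ha' δ ((min_le_left _ _).trans (min_le_left _ _)) ρ hρ h0 h1 hz)
    have e2 := mollify_pair hB hK (hΦu.pd 1) (tsupport_pd_subset 1) hρ hz1
      (hb' δ ((min_le_left _ _).trans (min_le_right _ _)) ρ hρ h0 h1 hz)
    have e3 := mollify_pair hS hK hΦu subset_rfl hρ hz1
      (hs' δ ((min_le_right _ _).trans (min_le_left _ _)) ρ hρ h0 h1 hz)
    have f1 := mollify_fubini hA hΦu hρ.deriv hρ hdz hz
    have f2 := mollify_fubini hB hΦu hρ hρ.deriv hz hdz
    have f3 := mollify_fubini hS hΦu hρ hρ hz hz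
    have hρd := hρ.1.differentiable (by simp)
    have e4 : (∫ p : ℝ × ℝ, A p * ∫ q : ℝ × ℝ, PN.pd 0 Φ q * (ρ (p.1 - q.1) * ρ (p.2 - q.2)))
        + (∫ p : ℝ × ℝ, B p * ∫ q : ℝ × ℝ, PN.pd 1 Φ q * (ρ (p.1 - q.1) * ρ (p.2 - q.2)))
        - ∫ p : ℝ × ℝ, S p * ∫ q : ℝ × ℝ, Φ q * (ρ (p.1 - q.1) * ρ (p.2 - q.2)) = 0 := by
      simp only [← (integral_mul_shift_parts hΦu hρ _).1, ← (integral_mul_shift_parts hΦu hρ _).2]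
      rw [← f1.2.2, ← f2.2.2, ← f3.2.2, ← integral_add f1.1 f2.1, ← integral_sub]
      rotate_left
      · exact f1.1.add f2.1
      · exact f3.1
      refine integral_eq_zero_of_ae (Eventually.of_forall fun q => ?_)
      simp only [Pi.zero_apply]
      by_cases hq : Φ q = 0
      · simp [hq]
      have hq2 := hdq q (subset_tsupport _ hq)
      have hκ : ∃ κ : ℝ, κ * κ = 1 ∧ d ≤ κ * q.2 := by
        rcases abs_cases q.2 with h | h
        · exact ⟨1, by norm_num, by linarith⟩
        · exact ⟨-1, by norm_num, by linarith⟩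
      obtain ⟨κ, hκ, hdκ⟩ := hκ
      have t := hT κ hκ _ _ (hρ.shift q.1) (hρ.shift_halfLine hz hδd hκ hdκ)
      rw [pd_shift_zero hρd hρd, pd_shift_one hρd hρd] at t
      rw [← mul_add, ← mul_sub]
      exact mul_eq_zero_of_right _ t
    rw [hc, mul_add, mul_add]
    rw [abs_le] at e1 e2 e3 ⊢
    constructor <;> linarith [e1.1, e1.2, e2.1, e2.2, e3.1, e3.2]
  have h0 : |pair A (PN.pd 0 Φ) + pair B (PN.pd 1 Φ) - pair S Φ| ≤ 0 := by
    have l : Tendsto (fun ε : ℝ => ε * c) (𝓝[>] 0) (𝓝 (0 * c)) :=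
      (tendsto_id.mono_left nhdsWithin_le_nhds).mul_const c
    rw [zero_mul] at l
    exact ge_of_tendsto l (by filter_upwards [self_mem_nhdsWithin] with ε hε using main ε hε)
  exact abs_nonpos_iff.1 h0

end moll

/-! ### The stress off the slip line and its divergence -/

lemma TemperedFun.locallyIntegrable {f : ℝ × ℝ → ℝ} (hf : TemperedFun f) :
    LocallyIntegrable f volume := by
  obtain ⟨N, hN⟩ := hf
  have hc : Continuous fun p : ℝ × ℝ => (1 + ‖p‖) ^ N := by fun_prop
  rw [locallyIntegrable_iff]
  intro K hK
  refine (IntegrableOn.mul_continuousOn hN.integrableOn hc.continuousOn hK).congr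
    (Eventually.of_forall fun p => ?_)
  exact div_mul_cancel₀ _ (by positivity)

section

variable {G ν β C : ℝ} {u : Fin 2 → ℝ × ℝ → ℝ} {v w : Fin 2 → ℝ → ℝ} {i j : Fin 2}
  {D : ℝ → ℂ} {Φ : ℝ × ℝ → ℝ}

/-- The stress is the stress field off the slip line. -/
theorem SlipSolution.stress_eq_pair (h : SlipSolution G ν u v w) (hβ : β * (2 - 2 * ν) = 1)
    {dv : ℝ → ℝ} (hdv : HasL2Deriv (v 0) dv) (hs : StressDecays G ν u)
    (hD : FtDual (fun x => (dv x : ℂ)) D) (hΦ : IsTest offSlip Φ) :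
    stress G ν u i j Φ = pair (stressReal (2 * G * β) D i j) Φ := by
  have hu := h.upper.temp
  have hflux : ∀ Ψ : ℝ × ℝ → ℝ, IsTest univ Ψ → stress G ν u i j Ψ
      = pair (fluxX G ν u i j) (pd 0 Ψ) + pair (fluxY G ν u i j) (pd 1 Ψ) := fun Ψ hΨ =>
    stress_eq_flux i j fun a b => (hu a).locallyIntegrable.integrable_smul_right_of_hasCompactSupport
      (hΨ.pd b).1.continuous (hΨ.pd b).2.1
  have e := firstOrder_eq_zero (temperedFun_fluxX (G := G) (ν := ν) hu i j).locallyIntegrable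
    (temperedFun_fluxY (G := G) (ν := ν) hu i j).locallyIntegrable
    (locallyIntegrable_stressReal (C := 2 * G * β) (i := i) (j := j) hD.2.1)
    (fun κ hκ φ η hφ hη => ?_) hΦ
  · rw [hflux Φ ⟨hΦ.1, hΦ.2.1, subset_univ _⟩]
    exact sub_eq_zero.1 e
  · have hT : IsTest univ fun p : ℝ × ℝ => φ p.1 * η p.2 := by
      have := (hφ.ofReal.prodMul hη.ofReal).re
      refine ⟨?_, ?_, subset_univ _⟩
      · simpa [← Complex.ofReal_mul] using this.1
      · simpa [← Complex.ofReal_mul] using this.2.1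
    rw [← hflux _ hT, sub_eq_zero]
    exact h.stress_tensor_eq hβ hκ hdv hs hD hη hφ.schwartz

lemma hasDerivAt_slice_fst (hΦ : Differentiable ℝ Φ) (x y : ℝ) :
    HasDerivAt (fun t => Φ (t, y)) (pd 0 Φ (x, y)) x := by
  have h := (hΦ (x, y)).hasFDerivAt.comp_hasDerivAt x
    ((hasDerivAt_id x).prodMk (hasDerivAt_const x y))
  exact h

lemma hasDerivAt_slice_snd (hΦ : Differentiable ℝ Φ) (x y : ℝ) :
    HasDerivAt (fun t => Φ (x, t)) (pd 1 Φ (x, y)) y := by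
  have h := (hΦ (x, y)).hasFDerivAt.comp_hasDerivAt y
    ((hasDerivAt_const y x).prodMk (hasDerivAt_id y))
  exact h

lemma integral_mul_deriv_of_hasDerivAt_off_zero {m m' g g' : ℝ → ℂ} (hm : Continuous m)
    (hd : ∀ y ≠ 0, HasDerivAt m (m' y) y) (hm' : LocallyIntegrable m' volume)
    (hg : ∀ y, HasDerivAt g (g' y) y) (hg' : Continuous g') (hs : HasCompactSupport g) :
    ∫ y, m y * g' y = -∫ y, m' y * g y := by
  have hgc : Continuous g := continuous_iff_continuousAt.2 fun y => (hg y).continuousAt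
  have hgd : deriv g = g' := funext fun y => (hg y).deriv
  have hs' : HasCompactSupport g' := hgd ▸ hs.deriv
  have i1 : Integrable fun y => m' y * g y :=
    hm'.integrable_smul_right_of_hasCompactSupport hgc hs
  have i2 : Integrable fun y => m y * g' y :=
    (hm.mul hg').integrable_of_hasCompactSupport hs'.mul_left
  rw [eq_neg_iff_add_eq_zero, ← integral_add i2 i1]
  obtain ⟨R, hR0, hR⟩ := hs.isCompact.isBounded.exists_pos_norm_lt
  have hz : ∀ y, R ≤ |y| → g y = 0 := fun y hy => by
    by_contra h
    exact absurd (hR y (subset_tsupport _ h)) (not_lt.2 hy)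
  have hz' : ∀ y, R ≤ |y| → g' y = 0 := fun y hy => by
    by_contra h
    have : y ∈ tsupport g := by
      have h1 : y ∈ tsupport (deriv g) := subset_tsupport _ (by rw [hgd]; exact h)
      exact tsupport_deriv_subset h1
    exact absurd (hR y this) (not_lt.2 hy)
  have e := MeasureTheory.integral_eq_of_hasDerivAt_off_countable (fun y => m y * g y)
    (fun y => m y * g' y + m' y * g y) (a := -R) (b := R) (s := {0}) (countable_singleton 0)
    (hm.mul hgc).continuousOn (fun y hy => by
      have := (hd y hy.2).mul (hg y)
      rw [add_comm]; exact this) (i2.add i1).intervalIntegrable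
  have hR1 : |R| = R := abs_of_pos hR0
  simp only [hz R hR1.ge, hz (-R) (by rw [abs_neg, hR1]), mul_zero, sub_zero] at e
  rw [← e, intervalIntegral.integral_of_le (by linarith), setIntegral_eq_integral_of_forall_compl_eq_zero]
  intro y hy
  have : R ≤ |y| := by
    by_contra h
    have := abs_lt.1 (not_le.1 h)
    exact hy ⟨this.1, this.2.le⟩
  rw [hz y this, hz' y this, mul_zero, mul_zero, add_zero]

lemma hasDerivAt_abs_div {y : ℝ} (hy : y ≠ 0) : HasDerivAt (fun t : ℝ => |t|) (y / |y|) y := by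
  rcases lt_or_gt_of_ne hy with h | h
  · rw [abs_of_neg h, div_neg, div_self hy]
    exact hasDerivAt_abs_neg h
  · rw [abs_of_pos h, div_self hy]
    exact hasDerivAt_abs_pos h

lemma stressSymbol_one_eq (C : ℝ) (i : Fin 2) (y ξ : ℝ) : stressSymbol C i 1 y ξ
    = (if i = 0 then C * (Complex.I * signC ξ) * (1 - absC ξ * ((|y| : ℝ) : ℂ)) else C * absC ξ * y)
      * ((Real.exp (-(|ξ| * |y|)) : ℝ) : ℂ) := by
  have hy : y / |y| * |y| = y := by
    by_cases h : y = 0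
    · simp [h]
    · exact div_mul_cancel₀ _ (abs_ne_zero.2 h)
  have hy' : ((y / |y| : ℝ) : ℂ) * ((|y| : ℝ) : ℂ) = y := by rw [← Complex.ofReal_mul, hy]
  fin_cases i
  · simp [stressSymbol, stressA, stressB, absC]
    ring
  · simp only [stressSymbol, stressA, stressB, absC]
    norm_num
    push_cast at hy' ⊢
    linear_combination (C * ((|ξ| : ℝ) : ℂ)) * hy'

lemma continuous_stressSymbol_one (C : ℝ) (i : Fin 2) (ξ : ℝ) :
    Continuous fun y => stressSymbol C i 1 y ξ := by
  simp only [stressSymbol_one_eq]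
  split_ifs <;> fun_prop

lemma hasDerivAt_stressSymbol_one (C : ℝ) (i : Fin 2) {y : ℝ} (hy : y ≠ 0) (ξ : ℝ) :
    HasDerivAt (fun y => stressSymbol C i 1 y ξ) (-(Complex.I * ξ) * stressSymbol C i 0 y ξ) y := by
  have ha := hasDerivAt_abs_div hy
  have haC : HasDerivAt (fun t : ℝ => ((|t| : ℝ) : ℂ)) ((y / |y| : ℝ) : ℂ) y := ha.ofReal_comp
  have he : HasDerivAt (fun t : ℝ => ((Real.exp (-(|ξ| * |t|)) : ℝ) : ℂ))
      ((Real.exp (-(|ξ| * |y|)) * (-(|ξ| * (y / |y|))) : ℝ) : ℂ) y :=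
    ((ha.const_mul |ξ|).neg.exp).ofReal_comp
  have hI := Complex.I_mul_I
  have s1 := signC_mul_absC ξ
  have s2 := signC_mul_self ξ
  have hy' : ((y / |y| : ℝ) : ℂ) * y = ((|y| : ℝ) : ℂ) := by
    rw [← Complex.ofReal_mul, div_mul_eq_mul_div, ← abs_mul_abs_self y,
      mul_div_assoc, div_self (abs_ne_zero.2 hy), mul_one]
  have hak : ((|ξ| : ℝ) : ℂ) = absC ξ := rfl
  simp only [stressSymbol_one_eq]
  fin_cases i
  · have h : HasDerivAt (fun t : ℝ => C * (Complex.I * signC ξ) * (1 - absC ξ * ((|t| : ℝ) : ℂ))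
        * ((Real.exp (-(|ξ| * |t|)) : ℝ) : ℂ)) _ y :=
      ((((haC.const_mul (absC ξ)).const_sub 1).const_mul (C * (Complex.I * signC ξ)))).mul he
    simp only [Fin.zero_eta, if_true]
    refine h.congr_deriv ?_
    simp only [stressSymbol, stressA, stressB, if_true, Complex.ofReal_mul, Complex.ofReal_neg, hak]
    linear_combination (-C * Complex.I * ((y / |y| : ℝ) : ℂ) * ((Real.exp (-(|ξ| * |y|)) : ℝ) : ℂ)
      * (2 - absC ξ * ((|y| : ℝ) : ℂ))) * s1
  · have h : HasDerivAt (fun t : ℝ => C * absC ξ * (t : ℂ)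
        * ((Real.exp (-(|ξ| * |t|)) : ℝ) : ℂ)) _ y :=
      (((hasDerivAt_id y).ofReal_comp.const_mul (C * absC ξ))).mul he
    simp only [Fin.mk_one, one_ne_zero, if_false]
    refine h.congr_deriv ?_
    simp only [stressSymbol, stressA, stressB, one_ne_zero, if_false, Complex.ofReal_mul,
      Complex.ofReal_neg, Complex.ofReal_one, hak, id]
    linear_combination (-C * absC ξ * absC ξ * ((Real.exp (-(|ξ| * |y|)) : ℝ) : ℂ)) * hy'
      - (C * ((Real.exp (-(|ξ| * |y|)) : ℝ) : ℂ) * (1 - absC ξ * ((|y| : ℝ) : ℂ))) * s2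
      + (ξ * signC ξ * C * (1 - absC ξ * ((|y| : ℝ) : ℂ))
        * ((Real.exp (-(|ξ| * |y|)) : ℝ) : ℂ)) * hI

end

/-! ### The divergence of the stress field -/

section

variable {C : ℝ} {D : ℝ → ℂ} {i j : Fin 2} {Φ Ψ : ℝ × ℝ → ℝ}

lemma IsTest.slice_fst (hΨ : IsTest univ Ψ) (y : ℝ) : HasCompactSupport fun x => (Ψ (x, y) : ℂ) := by
  refine HasCompactSupport.of_support_subset_isCompact (hΨ.2.1.isCompact.image continuous_fst)
    fun x hx => ⟨(x, y), subset_tsupport _ fun h0 => hx (by simp [h0]), rfl⟩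

lemma IsTest.slice_snd (hΨ : IsTest univ Ψ) (x : ℝ) : HasCompactSupport fun y => (Ψ (x, y) : ℂ) := by
  refine HasCompactSupport.of_support_subset_isCompact (hΨ.2.1.isCompact.image continuous_snd)
    fun y hy => ⟨(x, y), subset_tsupport _ fun h0 => hy (by simp [h0]), rfl⟩

lemma integrable_symbol_mul (hc : Continuous Ψ) (hs : HasCompactSupport Ψ) (ξ : ℝ) :
    Integrable fun p : ℝ × ℝ => stressSymbol C i j p.2 ξ
      * Complex.exp (-(Complex.I * ((-p.1 : ℝ) : ℂ) * ξ)) * (Ψ p : ℂ) := by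
  refine ((hc.integrable_of_hasCompactSupport hs).ofReal (𝕜 := ℂ)).bdd_mul (c := 2 * |C|) ?_
    (Eventually.of_forall fun p => ?_)
  · exact ((measurable_stressSymbol C i j).comp
      (measurable_snd.prodMk measurable_const)).aestronglyMeasurable.mul
      (Continuous.aestronglyMeasurable (by fun_prop))
  · rw [norm_mul, norm_cexp_neg_I_mul, mul_one]
    exact norm_stressSymbol_le_const C i j _ ξ

lemma integral_symbol_pd_zero (hΦ : IsTest univ Φ) (ξ : ℝ) :
    ∫ p : ℝ × ℝ, stressSymbol C i 0 p.2 ξ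
      * Complex.exp (-(Complex.I * ((-p.1 : ℝ) : ℂ) * ξ)) * (pd 0 Φ p : ℂ)
      = -(Complex.I * ξ) * ∫ p : ℝ × ℝ, stressSymbol C i 0 p.2 ξ
      * Complex.exp (-(Complex.I * ((-p.1 : ℝ) : ℂ) * ξ)) * (Φ p : ℂ) := by
  have hd := hΦ.1.differentiable (by simp)
  have h0 := (hΦ.pd 0).1.continuous
  have i1 := integrable_symbol_mul (C := C) (i := i) (j := 0) h0 (hΦ.pd 0).2.1 ξ
  have i2 := integrable_symbol_mul (C := C) (i := i) (j := 0) hΦ.1.continuous hΦ.2.1 ξ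
  rw [Measure.volume_eq_prod] at i1 i2 ⊢
  rw [integral_prod_symm _ i1, integral_prod_symm _ i2, ← integral_const_mul]
  refine integral_congr_ae (Eventually.of_forall fun y => ?_)
  simp only [mul_assoc, integral_const_mul]
  have he : ∀ x : ℝ, HasDerivAt (fun x : ℝ => Complex.exp (-(Complex.I * (((-x : ℝ) : ℂ) * ξ))))
      (Complex.I * ξ * Complex.exp (-(Complex.I * (((-x : ℝ) : ℂ) * ξ)))) x := fun x => by
    have := (((((hasDerivAt_id x).neg.ofReal_comp).mul_const (ξ : ℂ)).const_mul
      Complex.I).neg).cexp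
    have h' : HasDerivAt (fun x : ℝ => Complex.exp (-(Complex.I * (((-x : ℝ) : ℂ) * ξ)))) _ x := this
    refine h'.congr_deriv ?_
    simp
    ring
  have e := integral_mul_deriv_of_hasDerivAt_off_zero (g := fun x => (Φ (x, y) : ℂ))
    (g' := fun x => (pd 0 Φ (x, y) : ℂ))
    (m := fun x : ℝ => Complex.exp (-(Complex.I * (((-x : ℝ) : ℂ) * ξ)))) (by fun_prop)
    (fun x _ => he x) (Continuous.locallyIntegrable (by fun_prop))
    (fun x => (hasDerivAt_slice_fst hd x y).ofReal_comp) (by fun_prop) (hΦ.slice_fst y)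
  rw [e]
  simp only [mul_assoc, integral_const_mul]
  ring

lemma integral_symbol_pd_one (hΦ : IsTest univ Φ) (ξ : ℝ) :
    ∫ p : ℝ × ℝ, stressSymbol C i 1 p.2 ξ
      * Complex.exp (-(Complex.I * ((-p.1 : ℝ) : ℂ) * ξ)) * (pd 1 Φ p : ℂ)
      = Complex.I * ξ * ∫ p : ℝ × ℝ, stressSymbol C i 0 p.2 ξ
      * Complex.exp (-(Complex.I * ((-p.1 : ℝ) : ℂ) * ξ)) * (Φ p : ℂ) := by
  have hd := hΦ.1.differentiable (by simp)
  have h0 := (hΦ.pd 1).1.continuous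
  have i1 := integrable_symbol_mul (C := C) (i := i) (j := 1) h0 (hΦ.pd 1).2.1 ξ
  have i2 := integrable_symbol_mul (C := C) (i := i) (j := 0) hΦ.1.continuous hΦ.2.1 ξ
  rw [Measure.volume_eq_prod] at i1 i2 ⊢
  rw [integral_prod _ i1, integral_prod _ i2, ← integral_const_mul]
  refine integral_congr_ae (Eventually.of_forall fun x => ?_)
  simp only
  have hm : LocallyIntegrable (fun y => -(Complex.I * ξ) * stressSymbol C i 0 y ξ) volume := by
    refine (locallyIntegrable_const (|ξ| * (2 * |C|))).mono
      (((measurable_stressSymbol C i 0).comp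
      (measurable_id.prodMk measurable_const)).const_mul _).aestronglyMeasurable
      (Eventually.of_forall fun y => ?_)
    rw [norm_mul, norm_neg, norm_mul, Complex.norm_I, one_mul, Complex.norm_real,
      Real.norm_eq_abs]
    refine le_trans ?_ (le_abs_self _)
    exact mul_le_mul_of_nonneg_left (norm_stressSymbol_le_const C i 0 y ξ) (abs_nonneg _)
  have e := integral_mul_deriv_of_hasDerivAt_off_zero (g := fun y => (Φ (x, y) : ℂ))
    (g' := fun y => (pd 1 Φ (x, y) : ℂ)) (continuous_stressSymbol_one C i ξ)
    (fun y hy => hasDerivAt_stressSymbol_one C i hy ξ) hm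
    (fun y => (hasDerivAt_slice_snd hd x y).ofReal_comp) (by fun_prop) (hΦ.slice_snd x)
  simp only [mul_right_comm _ (Complex.exp _), integral_mul_const]
  rw [e]
  simp only [mul_assoc, integral_const_mul]
  ring

lemma integral_stressField_div (hD : MemLp D 2 volume) (hΦ : IsTest univ Φ) :
    (∫ p, stressField C D i 0 p * (pd 0 Φ p : ℂ)) + ∫ p, stressField C D i 1 p * (pd 1 Φ p : ℂ)
      = 0 := by
  have hc : ∀ j, Continuous fun p => (pd j Φ p : ℂ) := fun j =>
    Complex.continuous_ofReal.comp (hΦ.pd j).1.continuous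
  have hw : ∀ j, Integrable fun p : ℝ × ℝ => heightWeight p.2 * ‖(pd j Φ p : ℂ)‖ := fun j =>
    integrable_heightWeight_mul (hc j) ((hΦ.pd j).ofReal.2.1)
  have hi : ∀ j, Integrable fun ξ => D ξ * ∫ p : ℝ × ℝ, stressSymbol C i j p.2 ξ
      * Complex.exp (-(Complex.I * ((-p.1 : ℝ) : ℂ) * ξ)) * (pd j Φ p : ℂ) := fun j => by
    refine (integrable_exp_mul_stressSymbol (C := C) (i := i) (j := j) hD (hw j)
      (hc j).aestronglyMeasurable).integral_prod_left.congr (Eventually.of_forall fun ξ => ?_)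
    simp only [integral_const_mul]
  rw [integral_stressField_mul hD (hw 0) (hc 0).aestronglyMeasurable,
    integral_stressField_mul hD (hw 1) (hc 1).aestronglyMeasurable, ← mul_add,
    ← integral_add (hi 0) (hi 1)]
  refine mul_eq_zero_of_right _ (integral_eq_zero_of_ae (Eventually.of_forall fun ξ => ?_))
  simp only [Pi.zero_apply]
  rw [integral_symbol_pd_zero hΦ, integral_symbol_pd_one hΦ]
  ring

lemma integrable_stressReal_mul (hD : MemLp D 2 volume) (hc : Continuous Ψ)
    (hs : HasCompactSupport Ψ) : Integrable fun p => stressReal C D i j p * Ψ p :=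
  (locallyIntegrable_stressReal hD).integrable_smul_right_of_hasCompactSupport hc hs

/-- The stress field is divergence free across the slip line. -/
theorem integral_stressReal_div {f : ℝ → ℝ} (h : FtDual (fun x => (f x : ℂ)) D)
    {Φ : Fin 2 → ℝ × ℝ → ℝ} (hΦ : ∀ i, IsTest univ (Φ i)) :
    ∫ p, ∑ i, ∑ j, stressReal C D i j p * pd j (Φ i) p = 0 := by
  have hi : ∀ i j, Integrable fun p => stressReal C D i j p * pd j (Φ i) p := fun i j =>
    integrable_stressReal_mul h.2.1 ((hΦ i).pd j).1.continuous ((hΦ i).pd j).2.1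
  rw [integral_finsetSum _ fun i _ => integrable_finsetSum _ fun j _ => hi i j]
  refine Finset.sum_eq_zero fun i _ => ?_
  rw [integral_finsetSum _ fun j _ => hi i j, Fin.sum_univ_two]
  have e := integral_stressField_div (C := C) (i := i) h.2.1 (hΦ i)
  have e2 : ∀ j, ∫ p, stressField C D i j p * (pd j (Φ i) p : ℂ)
      = ((∫ p, stressReal C D i j p * pd j (Φ i) p : ℝ) : ℂ) := fun j => by
    rw [← integral_complex_ofReal]
    refine integral_congr_ae ?_
    filter_upwards [ae_snd_ne_zero] with p hp
    rw [Complex.ofReal_mul, ofReal_stressReal h hp]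
  rw [e2, e2] at e
  exact_mod_cast e

end

/-! ### Boundary values of the stress -/

section

variable {G ν β κ C : ℝ} {u : Fin 2 → ℝ × ℝ → ℝ} {v w : Fin 2 → ℝ → ℝ} {i : Fin 2}
  {D : ℝ → ℂ} {ρ : ℝ → ℝ}

lemma memLp_mul_stressSymbol (hD : MemLp D 2 volume) (C : ℝ) (i j : Fin 2) (y : ℝ) :
    MemLp (fun ξ => D ξ * stressSymbol C i j y ξ) 2 volume :=
  MemLp.of_le_mul (c := 2 * |C|) hD (hD.1.mul (aestronglyMeasurable_stressSymbol y))
    (Eventually.of_forall fun ξ => by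
      rw [norm_mul, mul_comm]
      exact mul_le_mul_of_nonneg_right (norm_stressSymbol_le_const C i j y ξ) (norm_nonneg _))

lemma isTest_scale_halfLine (hκ : κ * κ = 1) (hρ : IsTest (Ioi 0) ρ) {ε : ℝ} (hε : 0 < ε) :
    IsTest (halfLine κ) fun y => ε⁻¹ * ρ (κ * y / ε) := by
  have h := ((isTest_scaled hρ hε).comp_mul_halfLine hκ).re
  exact h

/-- The average of the symbol over heights of order `ε`. -/
def symbolAverage (C κ : ℝ) (i : Fin 2) (ρ : ℝ → ℝ) (ε ξ : ℝ) : ℂ :=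
  ∫ t, stressSymbol C i 1 (κ * (ε * t)) ξ * (ρ t : ℂ)

lemma integral_symbol_mul_scale (hκ : κ * κ = 1) {ε : ℝ} (hε : 0 < ε) (ξ : ℝ) :
    ∫ y, stressSymbol C i 1 y ξ * ((ε⁻¹ * ρ (κ * y / ε) : ℝ) : ℂ)
      = symbolAverage C κ i ρ ε ξ := by
  rw [← integral_comp_sign_mul hκ]
  have e := Measure.integral_comp_mul_left
    (fun y => stressSymbol C i 1 (κ * y) ξ * (ρ (κ * (κ * y) / ε) : ℂ)) ε
  simp only [← mul_assoc, hκ, one_mul] at e ⊢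
  have e2 : symbolAverage C κ i ρ ε ξ
      = ∫ t, stressSymbol C i 1 (κ * ε * t) ξ * ((ρ (ε * t / ε) : ℝ) : ℂ) := by
    simp only [symbolAverage, mul_div_cancel_left₀ _ hε.ne', mul_assoc]
  rw [e2, e, abs_inv, abs_of_pos hε, Complex.real_smul, ← integral_const_mul]
  congr 1; ext y
  push_cast
  ring

lemma norm_symbolAverage_le (hρ : IsTest (Ioi 0) ρ) (ε ξ : ℝ) :
    ‖symbolAverage C κ i ρ ε ξ‖ ≤ ∫ t, 2 * |C| * ‖ρ t‖ := by
  refine norm_integral_le_of_norm_le (hρ.integrable.norm.const_mul _)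
    (Eventually.of_forall fun t => ?_)
  rw [norm_mul, Complex.norm_real]
  exact mul_le_mul_of_nonneg_right (norm_stressSymbol_le_const _ _ _ _ _) (norm_nonneg _)

lemma tendsto_symbolAverage (hρ : IsTest (Ioi 0) ρ) (ξ : ℝ) :
    Tendsto (fun ε => symbolAverage C κ i ρ ε ξ) (𝓝[>] 0)
      (𝓝 (stressSymbol C i 1 0 ξ * ((∫ t, ρ t : ℝ) : ℂ))) := by
  have e : stressSymbol C i 1 0 ξ * ((∫ t, ρ t : ℝ) : ℂ) = ∫ t, stressSymbol C i 1 0 ξ * (ρ t : ℂ) := by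
    rw [integral_const_mul, integral_complex_ofReal]
  have hc := continuous_stressSymbol_one C i ξ
  have hρc := hρ.1.continuous
  rw [e]
  refine tendsto_integral_filter_of_dominated_convergence (fun t => 2 * |C| * ‖ρ t‖)
    (Eventually.of_forall fun ε => ?_) (Eventually.of_forall fun ε => Eventually.of_forall fun t => ?_)
    (hρ.integrable.norm.const_mul _) (Eventually.of_forall fun t => ?_)
  · exact ((hc.comp (by fun_prop : Continuous fun t => κ * (ε * t))).mul
      (Complex.continuous_ofReal.comp hρc)).aestronglyMeasurable
  · rw [norm_mul, Complex.norm_real]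
    exact mul_le_mul_of_nonneg_right (norm_stressSymbol_le_const _ _ _ _ _) (norm_nonneg _)
  · refine Tendsto.mul_const _ (Tendsto.mono_left ?_ nhdsWithin_le_nhds)
    exact (hc.comp (by fun_prop : Continuous fun ε => κ * (ε * t))).tendsto' _ _ (by simp)

lemma tendsto_integral_symbolAverage (hD : MemLp D 2 volume) (ψ : 𝓢(ℝ, ℂ))
    (hρ : IsTest (Ioi 0) ρ) :
    Tendsto (fun ε => ∫ ξ, D ξ * (ψ ξ * symbolAverage C κ i ρ ε ξ)) (𝓝[>] 0)
      (𝓝 (∫ ξ, D ξ * (ψ ξ * (stressSymbol C i 1 0 ξ * ((∫ t, ρ t : ℝ) : ℂ))))) := by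
  have hi : Integrable fun ξ => D ξ * ψ ξ := hD.integrable_mul (ψ.memLp 2)
  refine tendsto_integral_filter_of_dominated_convergence
    (fun ξ => ‖D ξ * ψ ξ‖ * ∫ t, 2 * |C| * ‖ρ t‖)
    (Eventually.of_forall fun ε => ?_) (Eventually.of_forall fun ε => Eventually.of_forall fun ξ => ?_)
    (hi.norm.mul_const _) (Eventually.of_forall fun ξ => ?_)
  · refine hD.1.mul (ψ.continuous.aestronglyMeasurable.mul ?_)
    have hm : AEStronglyMeasurable (fun q : ℝ × ℝ => stressSymbol C i 1 (κ * (ε * q.2)) q.1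
        * (ρ q.2 : ℂ)) ((volume : Measure ℝ).prod (volume : Measure ℝ)) := by
      refine AEStronglyMeasurable.mul ?_ (Complex.continuous_ofReal.comp
        (hρ.1.continuous.comp continuous_snd)).aestronglyMeasurable
      exact ((measurable_stressSymbol C i 1).comp
        ((by fun_prop : Measurable fun q : ℝ × ℝ => κ * (ε * q.2)).prodMk
          measurable_fst)).aestronglyMeasurable
    exact hm.integral_prod_right'
  · rw [← mul_assoc, norm_mul]
    exact mul_le_mul_of_nonneg_left (norm_symbolAverage_le hρ ε ξ) (norm_nonneg _)
  · exact ((tendsto_symbolAverage hρ ξ).const_mul _).const_mul _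

lemma SlipSolution.hasBoundaryValue_stress (h : SlipSolution G ν u v w) (hβ : β * (2 - 2 * ν) = 1)
    (hκ : κ * κ = 1) {dv : ℝ → ℝ} (hdv : HasL2Deriv (v 0) dv) (hs : StressDecays G ν u)
    (hD : FtDual (fun x => (dv x : ℂ)) D) {τ : ℝ → ℂ}
    (hτ : FtDual τ fun ξ => D ξ * stressSymbol (2 * G * β) i 1 0 ξ) :
    HasBoundaryValue κ (stress G ν u i 1) (linePair fun x => (τ x).re) := by
  intro φ ρ hρ
  set φ' : 𝓢(ℝ, ℂ) := SchwartzMap.postcompCLM (𝕜 := ℝ) Complex.ofRealCLM φ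
  obtain ⟨ψ, hψ⟩ := exists_ft_eq φ'
  have hφ' : ∀ x, φ' x = (φ x : ℂ) := fun x => rfl
  have l := (Complex.continuous_re.tendsto _).comp
    (tendsto_integral_symbolAverage (C := 2 * G * β) (κ := κ) (i := i) hD.2.1 ψ hρ)
  have e : (∫ ξ, D ξ * (ψ ξ * (stressSymbol (2 * G * β) i 1 0 ξ * ((∫ t, ρ t : ℝ) : ℂ)))).re
      = (∫ t, ρ t) * linePair (fun x => (τ x).re) φ := by
    have e1 : ∫ ξ, D ξ * (ψ ξ * (stressSymbol (2 * G * β) i 1 0 ξ * ((∫ t, ρ t : ℝ) : ℂ)))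
        = ((∫ t, ρ t : ℝ) : ℂ) * ∫ x, τ x * φ' x := by
      simp only [← hψ]
      rw [hτ.2.2 ψ ψ.integrable (ψ.memLp 2), ← integral_const_mul]
      congr 1; ext ξ; ring
    have e2 : (∫ x, τ x * φ' x).re = linePair (fun x => (τ x).re) φ := by
      have hi : Integrable fun x => τ x * φ' x := hτ.1.integrable_mul (φ'.memLp 2)
      have := (integral_re hi).symm
      refine this.trans ?_
      rw [linePair]
      congr 1; ext x
      simp [hφ']
    rw [e1, Complex.re_ofReal_mul, e2]
  rw [e] at l
  refine l.congr' ?_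
  filter_upwards [self_mem_nhdsWithin] with ε hε
  have hη := isTest_scale_halfLine hκ hρ (show 0 < ε from hε)
  rw [h.stress_tensor_eq hβ hκ hdv hs hD hη φ]
  have e3 := integral_stressField_mul_tensor (C := 2 * G * β) (i := i) (j := 1) hD.2.1 ψ
    (hη.ofReal.mono (subset_univ _))
  simp only [hψ, hφ', integral_symbol_mul_scale hκ (show 0 < ε from hε)] at e3
  simp only [Function.comp_apply]
  rw [← e3, ← Complex.ofReal_re (∫ p : ℝ × ℝ, _), ← integral_complex_ofReal]
  congr 1
  refine integral_congr_ae ?_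
  filter_upwards [ae_snd_ne_zero] with p hp
  simp only [Complex.ofReal_mul, ofReal_stressReal hD hp]

end

/-! ### Conjugate Poisson kernels at Lebesgue points -/

/-- The Poisson kernel, up to the factor `π`. -/
def poisson (y s : ℝ) : ℝ := y / (s ^ 2 + y ^ 2)

lemma poisson_nonneg {y : ℝ} (hy : 0 < y) (s : ℝ) : 0 ≤ poisson y s := by
  rw [poisson]; positivity

lemma poisson_le_dyadic {y : ℝ} (hy : 0 < y) (s : ℝ) :
    ∃ n : ℕ, |s| ≤ 2 ^ n * y ∧ poisson y s ≤ 4 / y * (1 / 4) ^ n := by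
  have hex : ∃ n : ℕ, |s| ≤ 2 ^ n * y := by
    obtain ⟨n, hn⟩ := pow_unbounded_of_one_lt (|s| / y) (one_lt_two)
    exact ⟨n, by rw [div_lt_iff₀ hy] at hn; exact hn.le⟩
  classical
  refine ⟨Nat.find hex, Nat.find_spec hex, ?_⟩
  rcases hn : Nat.find hex with _ | m
  · rw [pow_zero, mul_one, poisson, div_le_div_iff₀ (by positivity) hy]
    nlinarith [sq_nonneg s]
  · have h := Nat.find_min hex (m := m) (by omega)
    rw [not_le] at h
    have h2 : (2 ^ m * y) ^ 2 ≤ s ^ 2 := by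
      rw [← sq_abs s]
      exact pow_le_pow_left₀ (by positivity) h.le 2
    have h4 : (2 ^ m * y) ^ 2 = 4 ^ m * y ^ 2 := by
      rw [mul_pow, ← pow_mul, mul_comm m 2, pow_mul]; norm_num
    have h5 : (4 : ℝ) ^ m * y ^ 2 ≤ s ^ 2 := h4 ▸ h2
    have e : 4 / y * (1 / 4) ^ (m + 1) = y / (4 ^ m * y ^ 2) := by
      rw [one_div, inv_pow, pow_succ (4 : ℝ) m]; field_simp
    rw [poisson, e]
    exact div_le_div_of_nonneg_left hy.le (by positivity) (by nlinarith [sq_nonneg y])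

section lebesgue

variable {f : ℝ → ℝ} {x : ℝ}

/-- The mean oscillation at `x`. -/
def oscillation (f : ℝ → ℝ) (x r : ℝ) : ℝ := ⨍ t in Metric.closedBall x r, ‖f t - f x‖

/-- `x` is a Lebesgue point of `f`. -/
def LebesguePoint (f : ℝ → ℝ) (x : ℝ) : Prop := Tendsto (oscillation f x) (𝓝[>] 0) (𝓝 0)

lemma ae_lebesguePoint (hf : LocallyIntegrable f volume) : ∀ᵐ x, LebesguePoint f x := by
  filter_upwards [IsUnifLocDoublingMeasure.ae_tendsto_average_norm_sub volume hf 1] with x hx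
  refine hx (fun _ => x) (fun r => r) tendsto_id ?_
  filter_upwards [self_mem_nhdsWithin] with r hr
  exact Metric.mem_closedBall_self (by simpa using le_of_lt hr)

lemma oscillation_nonneg (f : ℝ → ℝ) (x r : ℝ) : 0 ≤ oscillation f x r := by
  rw [oscillation, setAverage_eq, smul_eq_mul]
  have : 0 ≤ ∫ t in Metric.closedBall x r, ‖f t - f x‖ :=
    integral_nonneg fun t => norm_nonneg _
  positivity

lemma integrableOn_sub_const (hf : LocallyIntegrable f volume) (x r : ℝ) :
    IntegrableOn (fun t => f t - f x) (Metric.closedBall x r) :=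
  (hf.sub (locallyIntegrable_const (f x))).integrableOn_isCompact (isCompact_closedBall x r)

lemma lintegral_closedBall_sub (hf : LocallyIntegrable f volume) {r : ℝ} (hr : 0 < r) :
    ∫⁻ t in Metric.closedBall x r, ENNReal.ofReal ‖f t - f x‖
      = ENNReal.ofReal (2 * r * oscillation f x r) := by
  rw [← ofReal_integral_eq_lintegral_ofReal (IntegrableOn.integrable (integrableOn_sub_const hf x r)).norm
    (Eventually.of_forall fun t => norm_nonneg _), oscillation, setAverage_eq, smul_eq_mul,
    measureReal_def, Real.volume_closedBall, ENNReal.toReal_ofReal (by positivity),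
    mul_inv_cancel_left₀ (by positivity)]

lemma oscillation_le (hf : MemLp f 2 volume) {r : ℝ} (hr : 0 < r) :
    oscillation f x r ≤ 1 + |f x| + (∫ t, f t ^ 2) / r := by
  have hi := (memLp_two_iff_integrable_sq hf.1).1 hf
  have hfl := hf.locallyIntegrable (by norm_num)
  have hc : IntegrableOn (fun _ : ℝ => 1 + |f x|) (Metric.closedBall x r) :=
    integrableOn_const measure_closedBall_lt_top.ne
  have h1 : ∫ t in Metric.closedBall x r, ‖f t - f x‖
      ≤ ∫ t in Metric.closedBall x r, ((1 + |f x|) + f t ^ 2) := by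
    refine setIntegral_mono (IntegrableOn.integrable (integrableOn_sub_const hfl x r)).norm
      (hc.add hi.integrableOn) fun t => ?_
    rw [Real.norm_eq_abs]
    have := abs_sub (f t) (f x)
    nlinarith [sq_nonneg (|f t| - 1), sq_abs (f t), abs_nonneg (f t)]
  have h2 : ∫ t in Metric.closedBall x r, ((1 + |f x|) + f t ^ 2)
      ≤ 2 * r * (1 + |f x|) + ∫ t, f t ^ 2 := by
    rw [integral_add hc hi.integrableOn, setIntegral_const, measureReal_def,
      Real.volume_closedBall, ENNReal.toReal_ofReal (by positivity), smul_eq_mul]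
    exact add_le_add le_rfl
      (setIntegral_le_integral hi (Eventually.of_forall fun t => sq_nonneg _))
  have h3 : 0 ≤ ∫ t, f t ^ 2 := integral_nonneg fun t => sq_nonneg _
  rw [oscillation, setAverage_eq, smul_eq_mul, measureReal_def, Real.volume_closedBall,
    ENNReal.toReal_ofReal (by positivity), inv_mul_le_iff₀ (by positivity)]
  refine (h1.trans h2).trans (le_of_sub_nonneg ?_)
  have : 2 * r * (1 + |f x| + (∫ t, f t ^ 2) / r) - (2 * r * (1 + |f x|) + ∫ t, f t ^ 2)
      = ∫ t, f t ^ 2 := by field_simp; ring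
  rw [this]; exact h3

lemma LebesguePoint.exists_bound (h : LebesguePoint f x) (hf : MemLp f 2 volume) :
    ∃ K, ∀ r > 0, oscillation f x r ≤ K := by
  have h1 : ∀ᶠ r in 𝓝[>] (0 : ℝ), oscillation f x r < 1 := h.eventually (gt_mem_nhds one_pos)
  obtain ⟨r₀, hr₀, hs⟩ := mem_nhdsGT_iff_exists_Ioo_subset.1 h1
  have h3 : 0 ≤ ∫ t, f t ^ 2 := integral_nonneg fun t => sq_nonneg _
  have hr₀' : 0 < r₀ := hr₀
  refine ⟨1 + |f x| + (∫ t, f t ^ 2) / r₀, fun r hr => ?_⟩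
  rcases lt_or_ge r r₀ with hlt | hge
  · have : oscillation f x r < 1 := hs ⟨hr, hlt⟩
    have h4 : 0 ≤ (∫ t, f t ^ 2) / r₀ := by positivity
    linarith [abs_nonneg (f x)]
  · refine (oscillation_le hf hr).trans ?_
    gcongr

lemma lintegral_poisson_le (hf : LocallyIntegrable f volume) {y : ℝ} (hy : 0 < y) :
    ∫⁻ t, ENNReal.ofReal (‖f t - f x‖ * poisson y (x - t))
      ≤ ∑' n : ℕ, ENNReal.ofReal (8 * ((1 / 2) ^ n * oscillation f x (2 ^ n * y))) := by
  calc ∫⁻ t, ENNReal.ofReal (‖f t - f x‖ * poisson y (x - t))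
      ≤ ∫⁻ t, ∑' n : ℕ, (Metric.closedBall x (2 ^ n * y)).indicator
          (fun t => ENNReal.ofReal (4 / y * (1 / 4) ^ n) * ENNReal.ofReal ‖f t - f x‖) t := by
        refine lintegral_mono fun t => ?_
        obtain ⟨n, hn, hp⟩ := poisson_le_dyadic hy (x - t)
        refine le_trans ?_ (ENNReal.le_tsum n)
        rw [indicator_of_mem (by
          rw [Metric.mem_closedBall, dist_comm, Real.dist_eq]; exact hn),
          ← ENNReal.ofReal_mul (by positivity), mul_comm]
        exact ENNReal.ofReal_le_ofReal (mul_le_mul_of_nonneg_right hp (norm_nonneg _))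
    _ = ∑' n : ℕ, ∫⁻ t, (Metric.closedBall x (2 ^ n * y)).indicator
          (fun t => ENNReal.ofReal (4 / y * (1 / 4) ^ n) * ENNReal.ofReal ‖f t - f x‖) t := by
        refine lintegral_tsum fun n => AEMeasurable.indicator ?_ Metric.isClosed_closedBall.measurableSet
        exact ((hf.aestronglyMeasurable.sub aestronglyMeasurable_const).norm.aemeasurable.ennreal_ofReal).const_mul _
    _ = _ := by
        congr 1; ext n
        rw [lintegral_indicator Metric.isClosed_closedBall.measurableSet,
          lintegral_const_mul' _ _ ENNReal.ofReal_ne_top,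
          lintegral_closedBall_sub hf (by positivity), ← ENNReal.ofReal_mul (by positivity)]
        congr 1
        have : (1 / 4 : ℝ) ^ n * 2 ^ n = (1 / 2) ^ n := by rw [← mul_pow]; norm_num
        rw [← this]
        field_simp
        ring

/-- Poisson means of the oscillation tend to zero at Lebesgue points. -/
lemma LebesguePoint.tendsto_poisson (h : LebesguePoint f x) (hf : MemLp f 2 volume) :
    Tendsto (fun y => ∫ t, ‖f t - f x‖ * poisson y (x - t)) (𝓝[>] 0) (𝓝 0) := by
  obtain ⟨K, hK⟩ := h.exists_bound hf
  have hfl := hf.locallyIntegrable (by norm_num)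
  have hsum : Tendsto (fun y => ∑' n : ℕ, 8 * ((1 / 2) ^ n * oscillation f x (2 ^ n * y)))
      (𝓝[>] 0) (𝓝 (∑' _ : ℕ, (0 : ℝ))) := by
    refine tendsto_tsum_of_dominated_convergence (bound := fun n => 8 * ((1 / 2) ^ n * K))
      ((summable_geometric_two.mul_right K).mul_left 8) (fun n => ?_) ?_
    · have l : Tendsto (fun y : ℝ => 2 ^ n * y) (𝓝[>] 0) (𝓝[>] 0) := by
        refine tendsto_nhdsWithin_iff.2 ⟨?_, ?_⟩
        · exact ((continuous_const.mul continuous_id).tendsto' 0 0 (by simp)).mono_left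
            nhdsWithin_le_nhds
        · filter_upwards [self_mem_nhdsWithin] with y hy
          have : 0 < y := hy
          exact mem_Ioi.2 (by positivity)
      simpa using ((h.comp l).const_mul ((1 / 2 : ℝ) ^ n)).const_mul 8
    · filter_upwards [self_mem_nhdsWithin] with y hy n
      have hy' : 0 < y := hy
      have h0 := oscillation_nonneg f x (2 ^ n * y)
      rw [Real.norm_of_nonneg (by positivity)]
      gcongr
      exact hK _ (by positivity)
  rw [tsum_zero] at hsum
  refine tendsto_of_tendsto_of_tendsto_of_le_of_le' tendsto_const_nhds hsum ?_ ?_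
  · filter_upwards [self_mem_nhdsWithin] with y hy
    exact integral_nonneg fun t => mul_nonneg (norm_nonneg _) (poisson_nonneg hy _)
  · filter_upwards [self_mem_nhdsWithin] with y hy
    have hy' : 0 < y := hy
    have hnn : ∀ n : ℕ, 0 ≤ 8 * ((1 / 2) ^ n * oscillation f x (2 ^ n * y)) := fun n => by
      have h0 := oscillation_nonneg f x (2 ^ n * y)
      positivity
    have hs : Summable fun n : ℕ => 8 * ((1 / 2) ^ n * oscillation f x (2 ^ n * y)) := by
      refine Summable.of_nonneg_of_le hnn (fun n => ?_)
        ((summable_geometric_two.mul_right K).mul_left 8)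
      gcongr
      exact hK _ (by positivity)
    have hm : AEStronglyMeasurable (fun t => ‖f t - f x‖ * poisson y (x - t)) volume := by
      refine (hf.1.sub aestronglyMeasurable_const).norm.mul (Continuous.aestronglyMeasurable ?_)
      exact continuous_const.div (by fun_prop) fun t => by positivity
    rw [integral_eq_lintegral_of_nonneg_ae (Eventually.of_forall fun t =>
      mul_nonneg (norm_nonneg _) (poisson_nonneg hy' _)) hm]
    refine ENNReal.toReal_le_of_le_ofReal (tsum_nonneg hnn) ?_
    rw [ENNReal.ofReal_tsum_of_nonneg hnn hs]
    exact lintegral_poisson_le hfl hy'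

end lebesgue

/-- The conjugate Poisson kernel, up to the factor `π`. -/
def conjPoisson (y s : ℝ) : ℝ := s / (s ^ 2 + y ^ 2)

/-- The conjugate Poisson kernel minus the truncated kernel of the Hilbert transform. -/
def kernelDefect (y s : ℝ) : ℝ := conjPoisson y s - {s : ℝ | y < |s|}.indicator (fun s => 1 / s) s

lemma continuous_poisson {y : ℝ} (hy : 0 < y) : Continuous (poisson y) :=
  continuous_const.div (by fun_prop) fun s => by positivity

lemma continuous_conjPoisson {y : ℝ} (hy : 0 < y) : Continuous (conjPoisson y) :=
  continuous_id.div (by fun_prop) fun s => by positivity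

lemma poisson_eq {y : ℝ} (hy : 0 < y) (s : ℝ) : poisson y s = y⁻¹ * (1 + (y⁻¹ * s) ^ 2)⁻¹ := by
  rw [poisson]; field_simp; ring_nf

lemma integrable_poisson {y : ℝ} (hy : 0 < y) : Integrable (poisson y) := by
  have : poisson y = fun s => y⁻¹ * (1 + (y⁻¹ * s) ^ 2)⁻¹ := funext (poisson_eq hy)
  rw [this]
  exact (integrable_inv_one_add_sq.comp_mul_left' (inv_ne_zero hy.ne')).const_mul _

lemma integral_poisson {y : ℝ} (hy : 0 < y) : ∫ s, poisson y s = Real.pi := by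
  simp only [poisson_eq hy]
  rw [integral_const_mul, Measure.integral_comp_mul_left (fun s : ℝ => (1 + s ^ 2)⁻¹),
    integral_univ_inv_one_add_sq, inv_inv, abs_of_pos hy, smul_eq_mul,
    inv_mul_cancel_left₀ hy.ne']

lemma memLp_poisson {y : ℝ} (hy : 0 < y) : MemLp (poisson y) 2 volume := by
  have hm := (continuous_poisson hy).aestronglyMeasurable (μ := (volume : Measure ℝ))
  rw [memLp_two_iff_integrable_sq hm]
  refine ((integrable_poisson hy).const_mul y⁻¹).mono' (hm.pow 2) (Eventually.of_forall fun s => ?_)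
  have h1 : poisson y s ≤ y⁻¹ := by
    rw [poisson, div_le_iff₀ (by positivity), inv_mul_eq_div, le_div_iff₀ hy]
    nlinarith [sq_nonneg s]
  have h0 := poisson_nonneg hy s
  rw [Real.norm_of_nonneg (sq_nonneg _), sq]
  exact mul_le_mul_of_nonneg_right h1 h0

lemma memLp_conjPoisson {y : ℝ} (hy : 0 < y) : MemLp (conjPoisson y) 2 volume := by
  have hm := (continuous_conjPoisson hy).aestronglyMeasurable (μ := (volume : Measure ℝ))
  rw [memLp_two_iff_integrable_sq hm]
  refine ((integrable_poisson hy).const_mul y⁻¹).mono' (hm.pow 2) (Eventually.of_forall fun s => ?_)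
  rw [Real.norm_of_nonneg (sq_nonneg _), conjPoisson, poisson, ← mul_div_assoc,
    inv_mul_cancel₀ hy.ne', div_pow, div_le_div_iff₀ (by positivity) (by positivity)]
  nlinarith [sq_nonneg s, sq_nonneg y, mul_nonneg (sq_nonneg s) (sq_nonneg y), sq_nonneg (y ^ 2)]

lemma abs_kernelDefect_le {y : ℝ} (hy : 0 < y) (s : ℝ) : |kernelDefect y s| ≤ poisson y s := by
  rw [kernelDefect, conjPoisson, poisson]
  by_cases h : y < |s|
  · have hs : s ≠ 0 := abs_pos.1 (hy.trans h)
    rw [indicator_of_mem (by exact h)]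
    have e : s / (s ^ 2 + y ^ 2) - 1 / s = -(y ^ 2 / (s * (s ^ 2 + y ^ 2))) := by
      field_simp; ring
    rw [e, abs_neg, abs_div, abs_mul, abs_of_pos (by positivity : 0 < s ^ 2 + y ^ 2),
      abs_of_pos (by positivity : 0 < y ^ 2), ← div_div]
    refine div_le_div_of_nonneg_right ?_ (by positivity)
    rw [div_le_iff₀ (abs_pos.2 hs)]
    nlinarith
  · rw [indicator_of_notMem (by exact h), sub_zero, abs_div,
      abs_of_pos (by positivity : 0 < s ^ 2 + y ^ 2)]
    exact div_le_div_of_nonneg_right (not_lt.1 h) (by positivity)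

lemma kernelDefect_neg (y s : ℝ) : kernelDefect y (-s) = -kernelDefect y s := by
  simp only [kernelDefect, conjPoisson, indicator, mem_ofPred_eq, abs_neg]
  split_ifs <;> ring

lemma integral_kernelDefect (y x : ℝ) : ∫ t, kernelDefect y (x - t) = 0 := by
  rw [integral_sub_left_eq_self (fun s => kernelDefect y s)]
  have h := integral_neg_eq_self (kernelDefect y) volume
  simp only [kernelDefect_neg, integral_neg] at h
  linarith

lemma measurable_kernelDefect {y : ℝ} (hy : 0 < y) : Measurable (kernelDefect y) :=
  (continuous_conjPoisson hy).measurable.sub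
    ((measurable_const.div measurable_id).indicator
      (measurableSet_lt measurable_const continuous_abs.measurable))

section lebesgue

variable {f : ℝ → ℝ} {x : ℝ}

lemma integrable_mul_comp_sub {k : ℝ → ℝ} (hf : MemLp f 2 volume) (hk : MemLp k 2 volume) (x : ℝ) :
    Integrable fun t => f t * k (x - t) :=
  hf.integrable_mul (hk.comp_measurePreserving (Measure.measurePreserving_sub_left volume x))

lemma LebesguePoint.tendsto_integral_poisson (h : LebesguePoint f x) (hf : MemLp f 2 volume) :
    Tendsto (fun y => ∫ t, f t * poisson y (x - t)) (𝓝[>] 0) (𝓝 (Real.pi * f x)) := by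
  have l : Tendsto (fun y => ∫ t, (f t - f x) * poisson y (x - t)) (𝓝[>] 0) (𝓝 0) := by
    refine squeeze_zero_norm' ?_ (h.tendsto_poisson hf)
    filter_upwards [self_mem_nhdsWithin] with y hy
    refine (norm_integral_le_integral_norm _).trans (le_of_eq ?_)
    congr 1; ext t
    rw [norm_mul, Real.norm_of_nonneg (poisson_nonneg hy _)]
  have l2 := l.add_const (Real.pi * f x)
  rw [zero_add] at l2
  refine l2.congr' ?_
  filter_upwards [self_mem_nhdsWithin] with y hy
  have hp : Integrable fun t => poisson y (x - t) := (integrable_poisson hy).comp_sub_left x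
  simp only [sub_mul]
  rw [integral_sub (integrable_mul_comp_sub hf (memLp_poisson hy) x) (hp.const_mul _),
    integral_const_mul, integral_sub_left_eq_self (poisson y), integral_poisson hy]
  ring

lemma LebesguePoint.tendsto_kernelDefect (h : LebesguePoint f x) (hf : MemLp f 2 volume) :
    Tendsto (fun y => ∫ t, f t * kernelDefect y (x - t)) (𝓝[>] 0) (𝓝 0) := by
  refine squeeze_zero_norm' ?_ (h.tendsto_poisson hf)
  filter_upwards [self_mem_nhdsWithin] with y hy
  have hy' : 0 < y := hy
  have hq : MemLp (kernelDefect y) 2 volume :=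
    (memLp_poisson hy').of_le (measurable_kernelDefect hy').aestronglyMeasurable
      (Eventually.of_forall fun s => by
        rw [Real.norm_eq_abs, Real.norm_eq_abs]
        exact (abs_kernelDefect_le hy' s).trans (le_abs_self _))
  have hq1 : Integrable (kernelDefect y) :=
    (integrable_poisson hy').mono' (measurable_kernelDefect hy').aestronglyMeasurable
      (Eventually.of_forall (abs_kernelDefect_le hy'))
  have hi := integrable_mul_comp_sub hf hq x
  have hc : Integrable fun t => f x * kernelDefect y (x - t) := (hq1.comp_sub_left x).const_mul _
  have e : ∫ t, f t * kernelDefect y (x - t) = ∫ t, (f t - f x) * kernelDefect y (x - t) := by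
    simp only [sub_mul]
    rw [integral_sub hi hc, integral_const_mul, integral_kernelDefect, mul_zero, sub_zero]
  have hfl := hf.locallyIntegrable (by norm_num)
  rw [e]
  refine (norm_integral_le_integral_norm _).trans (integral_mono ?_ ?_ fun t => ?_)
  · exact ((hi.sub hc).congr (Eventually.of_forall fun t => (sub_mul _ _ _).symm)).norm
  · have hp := integrable_mul_comp_sub hf (memLp_poisson hy') x
    have hp2 : Integrable fun t => f x * poisson y (x - t) :=
      ((integrable_poisson hy').comp_sub_left x).const_mul _
    refine ((hp.sub hp2).norm).congr (Eventually.of_forall fun t => ?_)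
    simp only [Pi.sub_apply]
    rw [← sub_mul, norm_mul, Real.norm_of_nonneg (poisson_nonneg hy' _)]
  · simp only [norm_mul]
    exact mul_le_mul_of_nonneg_left (abs_kernelDefect_le hy' _) (norm_nonneg _)

lemma integral_conjPoisson_sub (hf : MemLp f 2 volume) {y : ℝ} (hy : 0 < y) (x : ℝ) :
    ∫ t in {t : ℝ | y < |x - t|}, f t / (x - t)
      = (∫ t, f t * conjPoisson y (x - t)) - ∫ t, f t * kernelDefect y (x - t) := by
  have hq : MemLp (kernelDefect y) 2 volume :=
    (memLp_poisson hy).of_le (measurable_kernelDefect hy).aestronglyMeasurable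
      (Eventually.of_forall fun s => by
        rw [Real.norm_eq_abs, Real.norm_eq_abs]
        exact (abs_kernelDefect_le hy s).trans (le_abs_self _))
  rw [← integral_sub (integrable_mul_comp_sub hf (memLp_conjPoisson hy) x)
    (integrable_mul_comp_sub hf hq x), ← integral_indicator
    (measurableSet_lt measurable_const (by fun_prop))]
  congr 1; ext t
  simp only [kernelDefect, indicator, mem_ofPred_eq]
  split_ifs <;> ring

end lebesgue

/-! ### The Hilbert transform of `L²` functions -/

lemma ft_twoSided (a b : ℂ) {y : ℝ} (hy : 0 < y) (x t : ℝ) {g : ℝ → ℂ}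
    (hp : ∀ ξ > 0, g ξ = a * (Complex.exp (-(Complex.I * ((-x : ℝ) : ℂ) * ξ)) *
      ((Real.exp (-(|ξ| * y)) : ℝ) : ℂ)))
    (hn : ∀ ξ < 0, g ξ = b * (Complex.exp (-(Complex.I * ((-x : ℝ) : ℂ) * ξ)) *
      ((Real.exp (-(|ξ| * y)) : ℝ) : ℂ))) :
    ft g t = a * (1 / (y - Complex.I * ((x - t : ℝ) : ℂ)))
      + b * (1 / (y + Complex.I * ((x - t : ℝ) : ℂ))) := by
  set z : ℂ := Complex.I * ((x - t : ℝ) : ℂ) with hz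
  have hzre : z.re = 0 := by simp [hz]
  have r1 : (z - y).re < 0 := by simp [hzre, hy]
  have r2 : 0 < (z + y).re := by simp [hzre, hy]
  have e1 : EqOn (fun ξ : ℝ => Complex.exp (-(Complex.I * (t : ℂ) * (ξ : ℂ))) * g ξ)
      (fun ξ => a * Complex.exp ((z - y) * ξ)) (Ioi 0) := fun ξ (hξ : 0 < ξ) => by
    simp only [hp ξ hξ, abs_of_pos hξ, Complex.ofReal_exp]
    rw [mul_left_comm, ← Complex.exp_add, ← Complex.exp_add]
    congr 2; rw [hz]; push_cast; ring
  have e2 : EqOn (fun ξ : ℝ => Complex.exp (-(Complex.I * (t : ℂ) * (ξ : ℂ))) * g ξ)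
      (fun ξ => b * Complex.exp ((z + y) * ξ)) (Iio 0) := fun ξ (hξ : ξ < 0) => by
    simp only [hn ξ hξ, abs_of_neg hξ, Complex.ofReal_exp]
    rw [mul_left_comm, ← Complex.exp_add, ← Complex.exp_add]
    congr 2; rw [hz]; push_cast; ring
  have i1 : IntegrableOn (fun ξ : ℝ => a * Complex.exp ((z - y) * ξ)) (Ioi 0) :=
    (integrableOn_exp_mul_complex_Ioi r1 0).const_mul a
  have i2 : IntegrableOn (fun ξ : ℝ => b * Complex.exp ((z + y) * ξ)) (Iio 0) :=
    IntegrableOn.mono_set ((integrableOn_exp_mul_complex_Iic r2 0).const_mul b) Iio_subset_Iic_self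
  rw [ft, ← intervalIntegral.integral_Iio_add_Ici (b := 0) (i2.congr_fun e2.symm measurableSet_Iio)
    ((integrableOn_Ici_iff_integrableOn_Ioi).2 (i1.congr_fun e1.symm measurableSet_Ioi)),
    integral_Ici_eq_integral_Ioi, setIntegral_congr_fun measurableSet_Ioi e1,
    setIntegral_congr_fun measurableSet_Iio e2, integral_const_mul, integral_const_mul,
    integral_exp_mul_complex_Ioi r1, ← integral_Iic_eq_integral_Iio,
    integral_exp_mul_complex_Iic r2]
  have d1 : z - y ≠ 0 := fun h => by rw [h] at r1; simp at r1
  have d1' : (y : ℂ) - z ≠ 0 := fun h => d1 (by rw [← neg_sub, h, neg_zero])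
  have d2 : z + y ≠ 0 := fun h => by rw [h] at r2; simp at r2
  have d2' : (y : ℂ) + z ≠ 0 := by rwa [add_comm]
  rw [Complex.ofReal_zero, mul_zero, mul_zero, Complex.exp_zero, add_comm z, ← neg_sub (y : ℂ) z,
    neg_div_neg_eq]
  ring

lemma signC_of_pos {ξ : ℝ} (h : 0 < ξ) : signC ξ = 1 := by
  rw [signC, abs_of_pos h, div_self h.ne', Complex.ofReal_one]

lemma signC_of_neg {ξ : ℝ} (h : ξ < 0) : signC ξ = -1 := by
  rw [signC, abs_of_neg h, div_neg, div_self h.ne, Complex.ofReal_neg, Complex.ofReal_one]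

lemma FtDual.integral_poisson_eq {f : ℝ → ℝ} {D τ : ℝ → ℂ} {C : ℝ}
    (hD : FtDual (fun x => (f x : ℂ)) D)
    (hτ : FtDual τ fun ξ => D ξ * (C * (Complex.I * signC ξ))) {y : ℝ} (hy : 0 < y) (x : ℝ) :
    ∫ t, (τ t).re * poisson y (x - t) = -C * ∫ t, f t * conjPoisson y (x - t) := by
  set g : ℝ → ℂ := fun ξ => Complex.exp (-(Complex.I * ((-x : ℝ) : ℂ) * ξ)) *
      ((Real.exp (-(|ξ| * y)) : ℝ) : ℂ) with hg
  set k : ℝ → ℂ := fun ξ => C * (Complex.I * signC ξ) * g ξ with hk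
  have hgc : Continuous g := by rw [hg]; fun_prop
  have hgn : ∀ ξ, ‖g ξ‖ = Real.exp (-(|ξ| * y)) := fun ξ => by
    rw [hg]; simp only [norm_mul, norm_cexp_neg_I_mul, one_mul, Complex.norm_real, Real.norm_eq_abs,
      Real.abs_exp]
  have g1 : Integrable g := (integrable_exp_neg_abs hy).mono' hgc.aestronglyMeasurable
    (Eventually.of_forall fun ξ => (hgn ξ).le)
  have g2 : MemLp g 2 volume := (memLp_exp_neg_abs hy).of_le hgc.aestronglyMeasurable
    (Eventually.of_forall fun ξ => by rw [hgn, Real.norm_eq_abs, Real.abs_exp])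
  have hsm : Measurable signC := by unfold signC; fun_prop
  have hkm : AEStronglyMeasurable k volume :=
    (((hsm.const_mul _).const_mul _).mul hgc.measurable).aestronglyMeasurable
  have hkn : ∀ ξ, ‖k ξ‖ ≤ |C| * ‖g ξ‖ := fun ξ => by
    rw [hk]; simp only [norm_mul, Complex.norm_real, Complex.norm_I, one_mul, Real.norm_eq_abs]
    exact mul_le_mul_of_nonneg_right (mul_le_of_le_one_right (abs_nonneg _) (norm_signC_le ξ))
      (norm_nonneg _)
  have k1 : Integrable k := (g1.norm.const_mul |C|).mono' hkm (Eventually.of_forall hkn)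
  have k2 : MemLp k 2 volume := g2.of_le_mul hkm (Eventually.of_forall hkn)
  have e1 := hτ.2.2 g g1 g2
  have e2 := hD.2.2 k k1 k2
  have e3 : ∫ t, τ t * ft g t = ∫ t, (f t : ℂ) * ft k t := by
    rw [e1, e2]; congr 1; ext ξ; rw [hk]; ring
  have hd : ∀ s : ℝ, ((y : ℂ) - Complex.I * s) * (y + Complex.I * s) = ((s ^ 2 + y ^ 2 : ℝ) : ℂ) :=
    fun s => by
      push_cast
      linear_combination (-(s : ℂ) ^ 2) * Complex.I_mul_I
  have hd0 : ∀ s : ℝ, ((s ^ 2 + y ^ 2 : ℝ) : ℂ) ≠ 0 := fun s =>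
    Complex.ofReal_ne_zero.2 (by positivity)
  have hda : ∀ s : ℝ, ((y : ℂ) - Complex.I * s) ≠ 0 := fun s h => hd0 s (by rw [← hd, h, zero_mul])
  have hdb : ∀ s : ℝ, ((y : ℂ) + Complex.I * s) ≠ 0 := fun s h => hd0 s (by rw [← hd, h, mul_zero])
  have fg : ∀ t, ft g t = ((2 * poisson y (x - t) : ℝ) : ℂ) := fun t => by
    rw [ft_twoSided 1 1 hy x t (fun ξ _ => by rw [one_mul]) (fun ξ _ => by rw [one_mul]), poisson,
      Complex.ofReal_mul, Complex.ofReal_div, ← hd, one_mul, one_mul]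
    have := hda (x - t); have := hdb (x - t)
    push_cast at *
    field_simp; ring
  have fk : ∀ t, ft k t = ((-(2 * C * conjPoisson y (x - t)) : ℝ) : ℂ) := fun t => by
    rw [ft_twoSided (C * Complex.I) (-(C * Complex.I)) hy x t
      (fun ξ h => by rw [hk]; simp only [signC_of_pos h, mul_one, hg])
      (fun ξ h => by rw [hk]; simp only [signC_of_neg h, mul_neg, mul_one, hg]), conjPoisson,
      Complex.ofReal_neg, Complex.ofReal_mul, Complex.ofReal_div, ← hd]
    have := hda (x - t); have := hdb (x - t)
    push_cast at *
    field_simp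
    linear_combination (2 * C * ((x : ℂ) - t)) * Complex.I_sq
  have hi : Integrable fun t => τ t * ((2 * poisson y (x - t) : ℝ) : ℂ) :=
    hτ.1.integrable_mul ((((memLp_poisson hy).comp_measurePreserving
      (Measure.measurePreserving_sub_left volume x)).const_mul 2).ofReal)
  have e4 := congrArg Complex.re e3
  simp only [fg, fk] at e4
  rw [← Complex.reCLM_apply, ← Complex.reCLM.integral_comp_comm hi] at e4
  simp only [Complex.reCLM_apply, Complex.re_mul_ofReal, ← Complex.ofReal_mul] at e4
  have a1 : ∫ t, (τ t).re * (2 * poisson y (x - t)) = 2 * ∫ t, (τ t).re * poisson y (x - t) := by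
    rw [← integral_const_mul]; congr 1; ext t; ring
  have a2 : ∫ t, f t * -(2 * C * conjPoisson y (x - t))
      = -(2 * C) * ∫ t, f t * conjPoisson y (x - t) := by
    rw [← integral_const_mul]; congr 1; ext t; ring
  rw [a1, integral_complex_ofReal, Complex.ofReal_re, a2] at e4
  linarith

/-- The multiplier `i C ξ/|ξ|` is the principal value integral `-(C/π) ∫ f(t) / (x - t) dt`. -/
lemma FtDual.ae_tendsto_hilbert {f : ℝ → ℝ} {D τ : ℝ → ℂ} {C : ℝ}
    (hf : MemLp f 2 volume) (hD : FtDual (fun x => (f x : ℂ)) D)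
    (hτ : FtDual τ fun ξ => D ξ * (C * (Complex.I * signC ξ))) :
    ∀ᵐ x : ℝ, Tendsto (fun ε => -(C / Real.pi) * ∫ t in {t : ℝ | ε < |x - t|}, f t / (x - t))
      (𝓝[>] 0) (𝓝 (τ x).re) := by
  have hτ2 : MemLp (fun x => (τ x).re) 2 volume := hτ.1.re
  filter_upwards [ae_lebesguePoint (hf.locallyIntegrable (by norm_num)),
    ae_lebesguePoint (hτ2.locallyIntegrable (by norm_num))] with x h1 h2
  have l := ((h2.tendsto_integral_poisson hτ2).const_mul Real.pi⁻¹).add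
    ((h1.tendsto_kernelDefect hf).const_mul (C / Real.pi))
  rw [inv_mul_cancel_left₀ Real.pi_ne_zero, mul_zero, add_zero] at l
  refine l.congr' ?_
  filter_upwards [self_mem_nhdsWithin] with y hy
  rw [hD.integral_poisson_eq hτ hy, integral_conjPoisson_sub hf hy]
  field_simp
  ring

/-! ### Slices of tempered functions -/

section slices

variable {f : ℝ × ℝ → ℝ} {v : ℝ → ℝ} {κ : ℝ}

lemma TemperedFun.comp_fst (hv : TemperedFun v) : TemperedFun fun p : ℝ × ℝ => v p.1 := by
  obtain ⟨N, hN⟩ := hv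
  have h1 : Integrable fun p : ℝ × ℝ => v p.1 / (1 + ‖p.1‖) ^ N * (1 + p.2 ^ 2)⁻¹ :=
    hN.mul_prod integrable_inv_one_add_sq
  refine ⟨N + 2, (h1.mul_bdd (c := 1) (g := fun p : ℝ × ℝ =>
    (1 + ‖p.1‖) ^ N * (1 + p.2 ^ 2) / (1 + ‖p‖) ^ (N + 2)) (Continuous.aestronglyMeasurable ?_)
    (Eventually.of_forall fun p => ?_)).congr (Eventually.of_forall fun p => ?_)⟩
  · exact (by fun_prop : Continuous fun p : ℝ × ℝ => (1 + ‖p.1‖) ^ N * (1 + p.2 ^ 2)).div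
      (by fun_prop) fun p => by positivity
  · rw [Real.norm_of_nonneg (by positivity), div_le_one (by positivity), pow_add]
    have h2 : 1 + p.2 ^ 2 ≤ (1 + ‖p‖) ^ 2 := by
      have : |p.2| ≤ ‖p‖ := norm_snd_le p
      nlinarith [sq_abs p.2, abs_nonneg p.2]
    gcongr
    exact norm_fst_le p
  · have e1 : (1 + ‖p.1‖) ^ N ≠ 0 := by positivity
    have e2 : 1 + p.2 ^ 2 ≠ 0 := by positivity
    simp only
    field_simp

lemma TemperedFun.ae_slice (hf : TemperedFun f) : ∀ᵐ y : ℝ, TemperedFun fun x => f (x, y) := by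
  obtain ⟨N, hN⟩ := hf
  rw [Measure.volume_eq_prod] at hN
  filter_upwards [hN.prod_left_ae] with y hy
  refine ⟨N, (hy.mul_bdd (c := (1 + |y|) ^ N) (g := fun x : ℝ =>
    (1 + ‖(x, y)‖) ^ N / (1 + ‖x‖) ^ N) (Continuous.aestronglyMeasurable ?_)
    (Eventually.of_forall fun x => ?_)).congr (Eventually.of_forall fun x => ?_)⟩
  · exact (by fun_prop : Continuous fun x : ℝ => (1 + ‖(x, y)‖) ^ N).div (by fun_prop)
      fun x => by positivity
  · rw [Real.norm_of_nonneg (by positivity), div_le_iff₀ (by positivity), ← mul_pow, mul_comm]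
    gcongr
    exact prod_norm_le (x, y)
  · have e1 : (1 + ‖(x, y)‖) ^ N ≠ 0 := by positivity
    simp only
    field_simp

lemma integrable_ftPair_slice (hv : TemperedFun v) {Ω : Set (ℝ × ℝ)} {Θ : ℝ × ℝ → ℂ}
    (hΘ : IsTestC Ω Θ) : Integrable fun y => ftPair v fun ξ => Θ (ξ, y) := by
  have h := pftPair_integrable hv.comp_fst hΘ
  rw [Measure.volume_eq_prod] at h
  exact h.integral_prod_right

lemma integral_ftPair_slice (hv : TemperedFun v) {Ω : Set (ℝ × ℝ)} {Θ : ℝ × ℝ → ℂ}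
    (hΘ : IsTestC Ω Θ) :
    ∫ y, ftPair v (fun ξ => Θ (ξ, y)) = ftPair v fun ξ => ∫ y, Θ (ξ, y) := by
  have h := pftPair_integrable hv.comp_fst hΘ
  rw [Measure.volume_eq_prod] at h
  simp only [ftPair]
  refine (integral_integral_swap (f := fun x y => (v x : ℂ) * pft Θ (x, y)) h).symm.trans ?_
  congr 1; ext x
  rw [integral_const_mul]
  congr 1
  simp only [pft, ft]
  have hi : Integrable (fun q : ℝ × ℝ => Complex.exp (-(Complex.I * (x : ℂ) * (q.1 : ℂ))) * Θ q)
      (volume.prod volume) :=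
    (hΘ.integrable (μ := volume.prod volume)).bdd_mul (c := 1)
      (Continuous.aestronglyMeasurable (by fun_prop))
      (Eventually.of_forall fun q => by rw [norm_cexp_neg_I_mul])
  rw [← integral_integral_swap
    (f := fun ξ y : ℝ => Complex.exp (-(Complex.I * (x : ℂ) * (ξ : ℂ))) * Θ (ξ, y)) hi]
  congr 1; ext ξ
  rw [integral_const_mul]

lemma integral_mul_ftPair_slice (hf : TemperedFun f) {Ω Ω' : Set ℝ} {ψ η : ℝ → ℂ}
    (hψ : IsTestC Ω ψ) (hη : IsTestC Ω' η) :
    Integrable (fun y => η y * ftPair (fun x => f (x, y)) ψ) ∧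
      ∫ y, η y * ftPair (fun x => f (x, y)) ψ = pftPair f (tensor ψ η) := by
  have ht : IsTestC (Ω ×ˢ Ω') (tensor ψ η) := hψ.prodMul hη
  have h := pftPair_integrable hf ht
  rw [Measure.volume_eq_prod] at h
  have e : (fun y => η y * ftPair (fun x => f (x, y)) ψ)
      = fun y => ∫ x, (f (x, y) : ℂ) * pft (tensor ψ η) (x, y) := by
    ext y
    rw [ftPair, ← integral_const_mul]
    congr 1; ext x
    rw [pft_tensor]; ring
  rw [e]
  refine ⟨h.integral_prod_right, ?_⟩
  rw [pftPair, Measure.volume_eq_prod, integral_prod_symm _ h]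

lemma isOpen_halfLine (κ : ℝ) : IsOpen (halfLine κ) :=
  isOpen_lt continuous_const (by fun_prop)

lemma exists_isTest_eq_one {U : Set ℝ} (hU : IsOpen U) {y : ℝ} (hy : y ∈ U) :
    ∃ η : ℝ → ℝ, IsTest U η ∧ ∀ᶠ t in 𝓝 y, η t = 1 := by
  obtain ⟨δ, hδ, hs⟩ := Metric.isOpen_iff.1 hU y hy
  let b : ContDiffBump y := ⟨δ / 3, δ / 2, by positivity, by linarith⟩
  refine ⟨b, ⟨b.contDiff, b.hasCompactSupport, ?_⟩, b.eventuallyEq_one⟩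
  rw [b.tsupport_eq]
  exact (Metric.closedBall_subset_ball (by simp only [b]; linarith)).trans hs

/-- A symbol relation tested in the vertical variable holds on almost every horizontal line. -/
lemma ae_ftPair_slice_eq (hf : TemperedFun f) (hv : TemperedFun v) {K : ℝ × ℝ → ℂ}
    (hK : ContDiffOn ℝ ∞ K offFreq)
    (h : ∀ ψ η, IsTestC {ξ : ℝ | ξ ≠ 0} ψ → IsTestC (halfLine κ) η →
      pftPair f (tensor ψ η) = ftPair v fun ξ => ∫ y, η y * (K (ξ, y) * ψ ξ))
    {ψ : ℝ → ℂ} (hψ : IsTestC {ξ : ℝ | ξ ≠ 0} ψ) :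
    ∀ᵐ y : ℝ, y ∈ halfLine κ →
      ftPair (fun x => f (x, y)) ψ = ftPair v fun ξ => K (ξ, y) * ψ ξ := by
  set g : ℝ → ℂ := fun y => ftPair (fun x => f (x, y)) ψ - ftPair v fun ξ => K (ξ, y) * ψ ξ
    with hg
  have hΘ : ∀ η, IsTestC (halfLine κ) η →
      IsTestC offFreq fun q : ℝ × ℝ => K q * (ψ q.1 * η q.2) := fun η hη =>
    ((hψ.prodMul hη).mono fun q hq => hq.1).mul_left isOpen_offFreq hK
  have e2 : ∀ η : ℝ → ℂ, (fun y => η y * ftPair v fun ξ => K (ξ, y) * ψ ξ)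
      = fun y => ftPair v fun ξ => K (ξ, y) * (ψ ξ * η y) := fun η => by
    ext y
    rw [← ftPair_const_mul]
    congr 1; ext ξ; ring
  have key : ∀ η : ℝ → ℝ, IsTest (halfLine κ) η →
      Integrable (fun y => η y • g y) ∧ ∫ y, η y • g y = 0 := fun η hη => by
    obtain ⟨i1, t1⟩ := integral_mul_ftPair_slice hf hψ hη.ofReal
    have i2 := integrable_ftPair_slice hv (hΘ _ hη.ofReal)
    have t2 := integral_ftPair_slice hv (hΘ _ hη.ofReal)
    simp only at i2 t2
    rw [← e2 fun y => (η y : ℂ)] at i2 t2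
    have e : (fun y => η y • g y) = fun y => (η y : ℂ) * ftPair (fun x => f (x, y)) ψ
        - (η y : ℂ) * ftPair v fun ξ => K (ξ, y) * ψ ξ := by
      ext y; rw [Complex.real_smul, hg, mul_sub]
    rw [e]
    refine ⟨i1.sub i2, ?_⟩
    rw [integral_sub i1 i2, t1, t2, h ψ _ hψ hη.ofReal, sub_eq_zero]
    congr 1; ext ξ; congr 1; ext y; ring
  have hl : LocallyIntegrableOn g (halfLine κ) := fun y hy => by
    obtain ⟨η, hη, h1⟩ := exists_isTest_eq_one (isOpen_halfLine κ) hy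
    obtain ⟨s, hs, hso⟩ := eventually_iff_exists_mem.1 h1
    refine IntegrableAtFilter.filter_mono nhdsWithin_le_nhds ?_
    obtain ⟨t, hts, hto, hyt⟩ := mem_nhds_iff.1 hs
    refine ⟨t, hto.mem_nhds hyt, (key η hη).1.integrableOn.congr_fun (fun z hz => ?_)
      hto.measurableSet⟩
    simp only [hso z (hts hz), one_smul]
  filter_upwards [(isOpen_halfLine κ).ae_eq_zero_of_integral_contDiff_smul_eq_zero hl
    fun η h1 h2 h3 => (key η ⟨h1, h2, h3⟩).2] with y hy hy'
  exact sub_eq_zero.1 (hy hy')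

end slices

/-! ### Extension from a countable family of symbols -/

section modulation

variable {F v : ℝ → ℝ} {Ω : Set ℝ} {h : ℝ → ℂ}

/-- Modulation by the frequency `a`. -/
def modulate (a : ℝ) (h : ℝ → ℂ) (ξ : ℝ) : ℂ := Complex.exp (Complex.I * a * ξ) * h ξ

lemma ft_modulate (a : ℝ) (h : ℝ → ℂ) (x : ℝ) : ft (modulate a h) x = ft h (x - a) := by
  rw [ft, ft]
  congr 1; ext ξ
  rw [modulate, ← mul_assoc, ← Complex.exp_add]
  congr 2
  push_cast; ring

lemma IsTestC.modulate (hh : IsTestC Ω h) (a : ℝ) : IsTestC Ω (modulate a h) :=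
  hh.mul_left' ((contDiff_const.mul Complex.ofRealCLM.contDiff).cexp)

lemma one_add_norm_le_mul (x a : ℝ) : 1 + ‖x‖ ≤ (1 + ‖x - a‖) * (1 + ‖a‖) := by
  have := norm_add_le (x - a) a
  rw [sub_add_cancel] at this
  nlinarith [mul_nonneg (norm_nonneg (x - a)) (norm_nonneg a)]

lemma continuous_ftPair_modulate (hF : TemperedFun F) (hh : IsTestC Ω h) :
    Continuous fun a => ftPair F (modulate a h) := by
  have hc := continuous_ft hh.integrable
  refine continuous_iff_continuousAt.2 fun a₀ => ?_
  simp only [ContinuousAt, ftPair, ft_modulate]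
  refine hF.tendsto_integral (Eventually.of_forall fun a =>
    (hc.comp (continuous_id.sub continuous_const)).aestronglyMeasurable) (fun N => ?_) fun x =>
    (hc.comp (continuous_const.sub continuous_id)).tendsto a₀
  obtain ⟨C, hC⟩ := rapid_ft hh N
  have hC0 : 0 ≤ C := le_trans (by positivity) (hC 0)
  refine ⟨(2 + ‖a₀‖) ^ N * C, ?_⟩
  filter_upwards [Metric.ball_mem_nhds a₀ one_pos] with a ha x
  have ha' : 1 + ‖a‖ ≤ 2 + ‖a₀‖ := by
    have h1 : ‖a - a₀‖ < 1 := by simpa [dist_eq_norm] using ha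
    have h2 := norm_add_le (a - a₀) a₀
    rw [sub_add_cancel] at h2
    linarith
  calc (1 + ‖x‖) ^ N * ‖ft h (x - a)‖
      ≤ ((1 + ‖x - a‖) * (1 + ‖a‖)) ^ N * ‖ft h (x - a)‖ := by
        gcongr; exact one_add_norm_le_mul x a
    _ = (1 + ‖a‖) ^ N * ((1 + ‖x - a‖) ^ N * ‖ft h (x - a)‖) := by rw [mul_pow]; ring
    _ ≤ (2 + ‖a₀‖) ^ N * C := by gcongr; exact hC _

lemma rapid_mul_comp_sub {φ k : ℝ → ℂ} (hφ : Rapid φ) (hk : Rapid k) :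
    Rapid fun p : ℝ × ℝ => φ p.2 * k (p.1 - p.2) := by
  intro N
  obtain ⟨A, hA⟩ := hφ (2 * N)
  obtain ⟨B, hB⟩ := hk N
  refine ⟨A * B, fun p => ?_⟩
  have h1 : 1 + ‖p‖ ≤ (1 + ‖p.1 - p.2‖) * (1 + ‖p.2‖) ^ 2 := by
    refine (prod_norm_le p).trans ?_
    have := one_add_norm_le_mul p.1 p.2
    rw [sq, ← mul_assoc]
    exact mul_le_mul_of_nonneg_right this (by positivity)
  calc (1 + ‖p‖) ^ N * ‖φ p.2 * k (p.1 - p.2)‖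
      ≤ ((1 + ‖p.1 - p.2‖) * (1 + ‖p.2‖) ^ 2) ^ N * (‖φ p.2‖ * ‖k (p.1 - p.2)‖) := by
        rw [norm_mul]; gcongr
    _ = ((1 + ‖p.2‖) ^ (2 * N) * ‖φ p.2‖) * ((1 + ‖p.1 - p.2‖) ^ N * ‖k (p.1 - p.2)‖) := by
        rw [mul_pow, ← pow_mul]; ring
    _ ≤ A * B := mul_le_mul (hA _) (hB _) (by positivity) (le_trans (by positivity) (hA 0))

lemma integral_ft_mul_ft_sub (hh : IsTestC Ω h) (ψ : 𝓢(ℝ, ℂ)) (x : ℝ) :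
    ∫ a, ft ψ a * ft h (x - a) = 2 * Real.pi * ft (fun ξ => h ξ * ψ ξ) x := by
  obtain ⟨φ, hφ⟩ := exists_schwartz_ft ψ
  have hi : Integrable (fun q : ℝ × ℝ => Complex.exp (-(Complex.I * ((x - q.1 : ℝ) : ℂ) * q.2)) *
      (ft ψ q.1 * h q.2)) (volume.prod volume) := by
    have h1 : Integrable fun q : ℝ × ℝ => ft ψ q.1 * h q.2 := by
      have : ft ψ = φ := funext fun a => (hφ a).symm
      rw [this]
      exact φ.integrable.mul_prod hh.integrable
    exact h1.bdd_mul (c := 1) (Continuous.aestronglyMeasurable (by fun_prop))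
      (Eventually.of_forall fun q => by rw [norm_cexp_neg_I_mul])
  calc ∫ a, ft ψ a * ft h (x - a)
      = ∫ a : ℝ, ∫ ξ : ℝ, Complex.exp (-(Complex.I * ((x - a : ℝ) : ℂ) * ξ)) * (ft ψ a * h ξ) := by
        congr 1; ext a
        rw [ft.eq_def h, ← integral_const_mul]
        congr 1; ext ξ; ring
    _ = ∫ ξ : ℝ, ∫ a : ℝ, Complex.exp (-(Complex.I * ((x - a : ℝ) : ℂ) * ξ)) * (ft ψ a * h ξ) :=
        integral_integral_swap (f := fun a ξ : ℝ =>
          Complex.exp (-(Complex.I * ((x - a : ℝ) : ℂ) * ξ)) * (ft ψ a * h ξ)) hi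
    _ = ∫ ξ : ℝ, 2 * Real.pi * (Complex.exp (-(Complex.I * x * ξ)) * (h ξ * ψ ξ)) := by
        congr 1; ext ξ
        have e : ∀ a : ℝ, Complex.exp (-(Complex.I * ((x - a : ℝ) : ℂ) * ξ)) * (ft ψ a * h ξ)
            = Complex.exp (-(Complex.I * x * ξ)) * h ξ * (Complex.exp (Complex.I * a * ξ) * ft ψ a) :=
          fun a => by
            have : Complex.exp (-(Complex.I * ((x - a : ℝ) : ℂ) * ξ))
                = Complex.exp (-(Complex.I * x * ξ)) * Complex.exp (Complex.I * a * ξ) := by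
              rw [← Complex.exp_add]; congr 1; push_cast; ring
            rw [this]; ring
        simp only [e]
        rw [integral_const_mul, ft_inversion]
        ring
    _ = _ := by rw [integral_const_mul, ft]

/-- Fourier inversion for the pairing with a product. -/
lemma integral_ft_mul_ftPair_modulate (hF : TemperedFun F) (hh : IsTestC Ω h) (ψ : 𝓢(ℝ, ℂ)) :
    ∫ a, ft ψ a * ftPair F (modulate a h) = 2 * Real.pi * ftPair F fun ξ => h ξ * ψ ξ := by
  have hi : Integrable (fun q : ℝ × ℝ => (F q.1 : ℂ) * (ft ψ q.2 * ft h (q.1 - q.2)))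
      (volume.prod volume) := by
    refine hF.comp_fst.integrable_mul (h := fun q : ℝ × ℝ => ft ψ q.2 * ft h (q.1 - q.2))
      (Continuous.aestronglyMeasurable ?_) (rapid_mul_comp_sub (rapid_ft_schwartz ψ) (rapid_ft hh))
    exact ((continuous_ft ψ.integrable).comp continuous_snd).mul
      ((continuous_ft hh.integrable).comp (continuous_fst.sub continuous_snd))
  calc ∫ a, ft ψ a * ftPair F (modulate a h)
      = ∫ a, ∫ x, (F x : ℂ) * (ft ψ a * ft h (x - a)) := by
        congr 1; ext a
        rw [ftPair, ← integral_const_mul]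
        congr 1; ext x
        rw [ft_modulate]; ring
    _ = ∫ x, ∫ a, (F x : ℂ) * (ft ψ a * ft h (x - a)) :=
        (integral_integral_swap (f := fun x a => (F x : ℂ) * (ft ψ a * ft h (x - a))) hi).symm
    _ = ∫ x, 2 * Real.pi * ((F x : ℂ) * ft (fun ξ => h ξ * ψ ξ) x) := by
        congr 1; ext x
        rw [integral_const_mul, integral_ft_mul_ft_sub hh]
        ring
    _ = _ := by rw [integral_const_mul, ftPair]

/-- A countable exhaustion of the nonzero frequencies by test functions. -/
lemma exists_exhaustion : ∃ χ : ℕ → ℝ → ℂ, (∀ n, IsTestC {ξ : ℝ | ξ ≠ 0} (χ n)) ∧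
    ∀ ψ, IsTestC {ξ : ℝ | ξ ≠ 0} ψ → ∃ n, ∀ ξ, χ n ξ * ψ ξ = ψ ξ := by
  obtain ⟨χ, hχ, hχ1, -, -⟩ := exists_cutoff
  have hp : ∀ n : ℕ, (0 : ℝ) < n + 1 := fun n => by positivity
  have hc := hχ.ofReal
  refine ⟨fun n ξ => (1 - (χ (((n : ℝ) + 1) * ξ) : ℂ)) * (χ (((n : ℝ) + 1)⁻¹ * ξ) : ℂ), fun n => ?_,
    fun ψ hψ => ?_⟩
  · have h1 : IsTestC univ fun ξ => (χ (((n : ℝ) + 1)⁻¹ * ξ) : ℂ) :=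
      ⟨hc.1.comp (contDiff_const.mul contDiff_id),
        hc.2.1.comp_homeomorph (Homeomorph.mulLeft₀ _ (inv_ne_zero (hp n).ne')), subset_univ _⟩
    have h2 := h1.mul_left' (h := fun ξ => 1 - (χ (((n : ℝ) + 1) * ξ) : ℂ))
      (contDiff_const.sub (hc.1.comp (contDiff_const.mul contDiff_id)))
    refine ⟨h2.1, h2.2.1, fun ξ hξ h0 => ?_⟩
    have h0' : ξ = 0 := h0
    rw [h0', notMem_tsupport_iff_eventuallyEq.2 ?_ |> iff_false_intro] at hξ
    · exact hξ
    · filter_upwards [Metric.ball_mem_nhds (0 : ℝ) (inv_pos.2 (hp n))] with t ht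
      have : |t| < (n + 1 : ℝ)⁻¹ := by simpa using ht
      have h3 : |(n + 1 : ℝ) * t| ≤ 1 := by
        rw [abs_mul, abs_of_pos (hp n)]
        calc (n + 1 : ℝ) * |t| ≤ (n + 1) * (n + 1 : ℝ)⁻¹ := by gcongr
          _ = 1 := mul_inv_cancel₀ (hp n).ne'
      simp [hχ1 _ h3]
  · obtain ⟨δ, hδ, hg⟩ := hψ.exists_gap
    obtain ⟨R, hR⟩ := hχ.2.1.isCompact.isBounded.exists_norm_le
    obtain ⟨B, hB⟩ := hψ.2.1.isCompact.isBounded.exists_norm_le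
    obtain ⟨n, hn⟩ := exists_nat_gt (max (R / δ) B)
    refine ⟨n, fun ξ => ?_⟩
    by_cases hξ : ξ ∈ tsupport ψ
    · have h1 : δ < |ξ| := hg.2.2 hξ
      have h2 : |ξ| ≤ B := hB ξ hξ
      have h3 : χ ((n + 1) * ξ) = 0 := by
        refine image_eq_zero_of_notMem_tsupport fun hm => ?_
        have h4 := hR _ hm
        rw [Real.norm_eq_abs, abs_mul, abs_of_pos (hp n)] at h4
        have h5 : R < n * δ := by
          rw [← div_lt_iff₀ hδ]; exact (le_max_left _ _).trans_lt hn
        nlinarith [hp n, abs_nonneg ξ]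
      have h6 : χ ((n + 1 : ℝ)⁻¹ * ξ) = 1 := by
        refine hχ1 _ ?_
        rw [abs_mul, abs_of_pos (inv_pos.2 (hp n)), inv_mul_le_iff₀ (hp n)]
        have := (le_max_right (R / δ) B).trans_lt hn
        linarith
      simp only [h3, h6]; simp
    · rw [image_eq_zero_of_notMem_tsupport hξ, mul_zero]

lemma ftPair_eq_of_modulate (hF : TemperedFun F) (hv : TemperedFun v) {k : ℝ → ℂ}
    (hk : ContDiffOn ℝ ∞ k {ξ : ℝ | ξ ≠ 0}) {χ : ℕ → ℝ → ℂ}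
    (hχ : ∀ n, IsTestC {ξ : ℝ | ξ ≠ 0} (χ n))
    (hχ1 : ∀ ψ, IsTestC {ξ : ℝ | ξ ≠ 0} ψ → ∃ n, ∀ ξ, χ n ξ * ψ ξ = ψ ξ)
    (hq : ∀ (q : ℚ) n, ftPair F (modulate q (χ n)) = ftPair v fun ξ => k ξ * modulate q (χ n) ξ)
    {ψ : ℝ → ℂ} (hψ : IsTestC {ξ : ℝ | ξ ≠ 0} ψ) :
    ftPair F ψ = ftPair v fun ξ => k ξ * ψ ξ := by
  obtain ⟨n, hn⟩ := hχ1 ψ hψ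
  have hkχ : IsTestC {ξ : ℝ | ξ ≠ 0} fun ξ => k ξ * χ n ξ := (hχ n).mul_left isOpen_ne hk
  have em : ∀ a : ℝ, (fun ξ => k ξ * modulate a (χ n) ξ) = modulate a fun ξ => k ξ * χ n ξ :=
    fun a => by ext ξ; simp only [modulate]; ring
  have ha : ∀ a : ℝ, ftPair F (modulate a (χ n)) = ftPair v (modulate a fun ξ => k ξ * χ n ξ) := by
    refine fun a => congrFun ((continuous_ftPair_modulate hF (hχ n)).ext_on
      Rat.isDenseEmbedding_coe_real.dense (continuous_ftPair_modulate hv hkχ) ?_) a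
    rintro _ ⟨q, rfl⟩
    simp only [hq q n, em]
  have h1 := integral_ft_mul_ftPair_modulate hF (hχ n) (hψ.2.1.toSchwartzMap hψ.1)
  have h2 := integral_ft_mul_ftPair_modulate hv hkχ (hψ.2.1.toSchwartzMap hψ.1)
  simp only [ha] at h1
  have h3 := mul_left_cancel₀ (by simp [Real.pi_ne_zero]) (h1.symm.trans h2)
  have e1 : (fun ξ => χ n ξ * (hψ.2.1.toSchwartzMap hψ.1) ξ) = ψ := funext hn
  have e2 : (fun ξ => k ξ * χ n ξ * (hψ.2.1.toSchwartzMap hψ.1) ξ) = fun ξ => k ξ * ψ ξ := by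
    ext ξ; rw [mul_assoc]; congr 1; exact hn ξ
  rwa [e1, e2] at h3

lemma ftPair_eq_of_schwartz (hF : TemperedFun F) (hv : TemperedFun v) {k : ℝ → ℂ}
    (h : ∀ ψ, IsTestC {ξ : ℝ | ξ ≠ 0} ψ → ftPair F ψ = ftPair v fun ξ => k ξ * ψ ξ)
    {ψ φ : 𝓢(ℝ, ℂ)} (h0 : (0 : ℝ) ∉ tsupport ψ) (hφ : ∀ ξ, φ ξ = k ξ * ψ ξ) :
    ftPair F ψ = ftPair v fun ξ => k ξ * ψ ξ := by
  obtain ⟨χ, hχ, hχ1, -, -⟩ := exists_cutoff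
  have hθ := hχ.ofReal
  have hθ0 : ((χ 0 : ℝ) : ℂ) = 1 := by rw [hχ1 0 (by simp)]; simp
  have l2 := hv.tendsto_ft_cut hθ hθ0 φ
  rw [show (fun ξ => k ξ * ψ ξ) = φ from funext fun ξ => (hφ ξ).symm]
  refine tendsto_nhds_unique (hF.tendsto_ft_cut hθ hθ0 ψ) (l2.congr' ?_)
  filter_upwards [self_mem_nhdsWithin] with s hs
  rw [h _ (isTestC_cutSchwartz hθ (ne_of_gt hs) h0)]
  congr 1; ext ξ
  rw [hφ]; ring

end modulation

/-! ### Fourier representation on horizontal lines -/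

lemma hasTemperateGrowth_exp_neg {a : ℝ → ℝ} (ha : Function.HasTemperateGrowth a) {M : ℝ}
    (hM : ∀ ξ, M < a ξ) : Function.HasTemperateGrowth fun ξ => Real.exp (-1 * a ξ) := by
  refine ha.comp' (g := fun t : ℝ => Real.exp (-1 * t)) (t := Ioi M) ?_ isOpen_Ioi.uniqueDiffOn
    (Real.contDiff_exp.comp (contDiff_const.mul contDiff_id)).contDiffOn fun N =>
      ⟨0, Real.exp (-M), (Real.exp_pos _).le, fun n _ t ht => ?_⟩
  · rintro _ ⟨ξ, rfl⟩
    exact hM ξ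
  · rw [iteratedFDerivWithin_of_isOpen n isOpen_Ioi ht, norm_iteratedFDeriv_eq_norm_iteratedDeriv,
      iteratedDeriv_exp_const_mul, norm_mul, norm_pow, norm_neg, norm_one, one_pow, one_mul,
      pow_zero, mul_one, Real.norm_of_nonneg (Real.exp_pos _).le, Real.exp_le_exp]
    have : M < t := ht
    linarith

/-- A smooth function which is the sign outside `[-δ, δ]`. -/
def smoothSign (δ ξ : ℝ) : ℝ := 2 * Real.smoothTransition ((ξ / δ + 1) / 2) - 1

lemma smoothSign_eq {δ : ℝ} (hδ : 0 < δ) {ξ : ℝ} (h : δ ≤ |ξ|) : smoothSign δ ξ = ξ / |ξ| := by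
  rcases le_abs.1 h with h1 | h1
  · have : 1 ≤ ξ / δ := (one_le_div hδ).2 h1
    rw [smoothSign, Real.smoothTransition.one_of_one_le (by linarith), abs_of_pos (by linarith),
      div_self (by linarith)]
    norm_num
  · have : ξ / δ ≤ -1 := by rw [div_le_iff₀ hδ]; linarith
    rw [smoothSign, Real.smoothTransition.zero_of_nonpos (by linarith), abs_of_neg (by linarith),
      div_neg, div_self (by linarith)]
    norm_num

lemma abs_smoothSign_le (δ ξ : ℝ) : |smoothSign δ ξ| ≤ 1 := by
  rw [smoothSign, abs_le]
  constructor <;> linarith [Real.smoothTransition.nonneg ((ξ / δ + 1) / 2),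
    Real.smoothTransition.le_one ((ξ / δ + 1) / 2)]

lemma hasTemperateGrowth_smoothSign {δ : ℝ} (hδ : 0 < δ) :
    Function.HasTemperateGrowth (smoothSign δ) := by
  have hs : ContDiff ℝ ∞ (smoothSign δ) :=
    (contDiff_const.mul (Real.smoothTransition.contDiff.comp
      (((contDiff_id.div_const δ).add contDiff_const).div_const 2))).sub contDiff_const
  refine Function.HasTemperateGrowth.of_fderiv (k := 0) (C := 1)
    (HasCompactSupport.hasTemperateGrowth (HasCompactSupport.intro
      (isCompact_closedBall 0 δ) fun ξ hξ => ?_) (hs.fderiv_right (by simp)))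
    (hs.differentiable (by simp)) fun ξ => by simpa using abs_smoothSign_le δ ξ
  have h1 : δ < |ξ| := by simpa using hξ
  have h2 : smoothSign δ =ᶠ[𝓝 ξ] fun _ => smoothSign δ ξ := by
    rcases lt_abs.1 h1 with h | h
    · filter_upwards [lt_mem_nhds h] with t ht
      rw [smoothSign_eq hδ (ht.le.trans (le_abs_self t)), smoothSign_eq hδ h1.le,
        abs_of_pos (hδ.trans ht), abs_of_pos (hδ.trans h), div_self (hδ.trans ht).ne',
        div_self (hδ.trans h).ne']
    · have h' : ξ < -δ := by linarith
      filter_upwards [gt_mem_nhds h'] with t ht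
      have ht0 : t < 0 := by linarith
      have hξ0 : ξ < 0 := by linarith
      rw [smoothSign_eq hδ (by rw [abs_of_neg ht0]; linarith), smoothSign_eq hδ h1.le,
        abs_of_neg ht0, abs_of_neg hξ0, div_neg, div_neg, div_self ht0.ne, div_self hξ0.ne]
  rw [h2.fderiv_eq, fderiv_fun_const, Pi.zero_apply]

/-- Symbol of the first displacement component in the half plane `κ y > 0`. -/
def fstSymbol (β κ : ℝ) (q : ℝ × ℝ) : ℂ :=
  κ * (1 - β * absC q.1 * (κ * q.2)) * expC (-κ) q

/-- Symbol of the second displacement component in the half plane `κ y > 0`. -/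
def sndSymbol (β ν κ : ℝ) (q : ℝ × ℝ) : ℂ :=
  -β * (Complex.I * ((1 - 2 * ν) * signC q.1 + q.1 * (κ * q.2))) * expC (-κ) q

lemma contDiffOn_fstSymbol (β κ : ℝ) : ContDiffOn ℝ ∞ (fstSymbol β κ) offFreq := by
  have h2 : ContDiff ℝ ∞ fun q : ℝ × ℝ => (q.2 : ℂ) := Complex.ofRealCLM.contDiff.comp contDiff_snd
  exact (contDiffOn_const.mul (contDiffOn_const.sub ((contDiffOn_const.mul
    contDiffOn_absC_fst).mul (contDiff_const.mul h2).contDiffOn))).mul (contDiffOn_expC _)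

lemma contDiffOn_sndSymbol (β ν κ : ℝ) : ContDiffOn ℝ ∞ (sndSymbol β ν κ) offFreq := by
  have h1 : ContDiff ℝ ∞ fun q : ℝ × ℝ => (q.1 : ℂ) := Complex.ofRealCLM.contDiff.comp contDiff_fst
  have h2 : ContDiff ℝ ∞ fun q : ℝ × ℝ => (q.2 : ℂ) := Complex.ofRealCLM.contDiff.comp contDiff_snd
  have h3 : ContDiffOn ℝ ∞ (fun q : ℝ × ℝ => signC q.1) offFreq :=
    contDiffOn_signC.comp contDiff_fst.contDiffOn fun _ h => h
  exact (contDiffOn_const.mul (contDiffOn_const.mul ((contDiffOn_const.mul h3).add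
    (h1.mul (contDiff_const.mul h2)).contDiffOn))).mul (contDiffOn_expC _)

lemma exists_schwartz_mul {k g : ℝ → ℂ} (hg : Function.HasTemperateGrowth g) {δ : ℝ}
    (hk : ∀ ξ, δ ≤ |ξ| → k ξ = g ξ) {ψ : 𝓢(ℝ, ℂ)} (h0 : ∀ ξ, |ξ| < δ → ψ ξ = 0) :
    ∃ φ : 𝓢(ℝ, ℂ), ∀ ξ, φ ξ = k ξ * ψ ξ := by
  refine ⟨SchwartzMap.smulLeftCLM ℂ g ψ, fun ξ => ?_⟩
  rw [SchwartzMap.smulLeftCLM_apply_apply hg, smul_eq_mul]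
  rcases lt_or_ge |ξ| δ with h | h
  · rw [h0 ξ h, mul_zero, mul_zero]
  · rw [hk ξ h]

section representation

variable {κ G ν β y : ℝ} {u : Fin 2 → ℝ × ℝ → ℝ} {v w : Fin 2 → ℝ → ℝ} {ψ η : ℝ → ℂ}

lemma exists_gap_of_notMem {ψ : ℝ → ℂ} (h0 : (0 : ℝ) ∉ tsupport ψ) :
    ∃ δ > 0, ∀ ξ, |ξ| < δ → ψ ξ = 0 := by
  obtain ⟨δ, hδ, hs⟩ := Metric.eventually_nhds_iff.1 (notMem_tsupport_iff_eventuallyEq.1 h0)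
  exact ⟨δ, hδ, fun ξ hξ => hs (by simpa using hξ)⟩

/-- Smooth version of `e^{-κ y |ξ|}`. -/
lemma hasTemperateGrowth_expC {δ : ℝ} (hδ : 0 < δ) (hy : y ∈ halfLine κ) :
    Function.HasTemperateGrowth
      fun ξ : ℝ => ((Real.exp (-1 * (κ * y * (ξ * smoothSign δ ξ))) : ℝ) : ℂ) := by
  have hy' : 0 < κ * y := hy
  have hb := hasTemperateGrowth_smoothSign hδ
  have ha : Function.HasTemperateGrowth fun ξ : ℝ => κ * y * (ξ * smoothSign δ ξ) :=
    (Function.HasTemperateGrowth.const _).mul (Function.HasTemperateGrowth.id'.mul hb)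
  refine Complex.ofRealCLM.hasTemperateGrowth.comp
    (hasTemperateGrowth_exp_neg ha (M := -(κ * y * δ) - 1) fun ξ => ?_)
  have h1 : -δ ≤ ξ * smoothSign δ ξ := by
    rcases le_or_gt δ |ξ| with h | h
    · have : ξ * smoothSign δ ξ = |ξ| := by
        rw [smoothSign_eq hδ h, ← mul_div_assoc, ← abs_mul_abs_self, mul_self_div_self]
      rw [this]; linarith [abs_nonneg ξ]
    · have h2 := abs_smoothSign_le δ ξ
      have h3 : |ξ * smoothSign δ ξ| ≤ δ := by
        rw [abs_mul]
        nlinarith [abs_nonneg ξ, abs_nonneg (smoothSign δ ξ)]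
      exact (abs_le.1 h3).1
  nlinarith [mul_le_mul_of_nonneg_left h1 hy'.le]

lemma smooth_replacements {δ : ℝ} (hδ : 0 < δ) {ξ : ℝ} (h : δ ≤ |ξ|) :
    signC ξ = (smoothSign δ ξ : ℂ) ∧ absC ξ = ξ * (smoothSign δ ξ : ℂ) ∧
      expC (-κ) (ξ, y) = ((Real.exp (-1 * (κ * y * (ξ * smoothSign δ ξ))) : ℝ) : ℂ) := by
  have e : ξ * smoothSign δ ξ = |ξ| := by
    rw [smoothSign_eq hδ h, ← mul_div_assoc, ← abs_mul_abs_self, mul_self_div_self]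
  refine ⟨by rw [signC, smoothSign_eq hδ h], by rw [absC, ← Complex.ofReal_mul, e], ?_⟩
  rw [expC, e, Complex.ofReal_exp]
  congr 2; ring

lemma exists_schwartz_fstSymbol (β : ℝ) (hy : y ∈ halfLine κ) {ψ : 𝓢(ℝ, ℂ)}
    (h0 : (0 : ℝ) ∉ tsupport ψ) : ∃ φ : 𝓢(ℝ, ℂ), ∀ ξ, φ ξ = fstSymbol β κ (ξ, y) * ψ ξ := by
  obtain ⟨δ, hδ, hs⟩ := exists_gap_of_notMem h0
  have hb := hasTemperateGrowth_smoothSign hδ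
  have hE := hasTemperateGrowth_expC hδ hy
  have hbC : Function.HasTemperateGrowth fun ξ => (smoothSign δ ξ : ℂ) :=
    Complex.ofRealCLM.hasTemperateGrowth.comp hb
  refine exists_schwartz_mul (g := fun ξ => κ * (1 - β * (ξ * (smoothSign δ ξ : ℂ)) * (κ * y)) *
    ((Real.exp (-1 * (κ * y * (ξ * smoothSign δ ξ))) : ℝ) : ℂ)) ?_ (fun ξ hξ => ?_) hs
  · have hx : Function.HasTemperateGrowth fun ξ : ℝ => (ξ : ℂ) := Complex.ofRealCLM.hasTemperateGrowth
    fun_prop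
  · obtain ⟨-, e2, e3⟩ := smooth_replacements (κ := κ) (y := y) hδ hξ
    simp only [fstSymbol, e2, e3]

lemma exists_schwartz_sndSymbol (β ν : ℝ) (hy : y ∈ halfLine κ) {ψ : 𝓢(ℝ, ℂ)}
    (h0 : (0 : ℝ) ∉ tsupport ψ) : ∃ φ : 𝓢(ℝ, ℂ), ∀ ξ, φ ξ = sndSymbol β ν κ (ξ, y) * ψ ξ := by
  obtain ⟨δ, hδ, hs⟩ := exists_gap_of_notMem h0
  have hb := hasTemperateGrowth_smoothSign hδ
  have hE := hasTemperateGrowth_expC hδ hy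
  have hbC : Function.HasTemperateGrowth fun ξ => (smoothSign δ ξ : ℂ) :=
    Complex.ofRealCLM.hasTemperateGrowth.comp hb
  refine exists_schwartz_mul (g := fun ξ => -β * (Complex.I * ((1 - 2 * ν) *
    (smoothSign δ ξ : ℂ) + ξ * (κ * y))) *
    ((Real.exp (-1 * (κ * y * (ξ * smoothSign δ ξ))) : ℝ) : ℂ)) ?_ (fun ξ hξ => ?_) hs
  · have hx : Function.HasTemperateGrowth fun ξ : ℝ => (ξ : ℂ) := Complex.ofRealCLM.hasTemperateGrowth
    fun_prop
  · obtain ⟨e1, -, e3⟩ := smooth_replacements (κ := κ) (y := y) hδ hξ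
    simp only [sndSymbol, e1, e3]

lemma integral_comp_mul_sign (hκ : κ * κ = 1) (g : ℝ → ℂ) : ∫ t, g (κ * t) = ∫ t, g t := by
  rcases mul_self_eq_one_iff.1 hκ with rfl | rfl
  · simp
  · simpa using integral_neg_eq_self g volume

lemma moment₀_eq (hκ : κ * κ = 1) (η : ℝ → ℂ) (ξ : ℝ) :
    moment₀ κ η |ξ| = ∫ y, η y * expC (-κ) (ξ, y) := by
  rw [moment₀, expMoment, ← integral_comp_mul_sign hκ fun y => η y * expC (-κ) (ξ, y)]
  congr 1; ext t
  have : -κ * |ξ| * (κ * t) = -(|ξ| * t) := by linear_combination (-(|ξ| * t)) * hκ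
  rw [expC, this]
  push_cast
  ring

lemma moment₁_eq (hκ : κ * κ = 1) (η : ℝ → ℂ) (ξ : ℝ) :
    moment₁ κ η |ξ| = ∫ y, η y * (κ * y * expC (-κ) (ξ, y)) := by
  rw [moment₁, expMoment,
    ← integral_comp_mul_sign hκ fun y => η y * (κ * y * expC (-κ) (ξ, y))]
  congr 1; ext t
  have : -κ * |ξ| * (κ * t) = -(|ξ| * t) := by linear_combination (-(|ξ| * t)) * hκ
  have h2 : (κ : ℂ) * ((κ * t : ℝ) : ℂ) = t := by
    rw [← Complex.ofReal_mul, ← mul_assoc, hκ, one_mul]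
  simp only [expC, this, h2]
  push_cast
  ring

lemma integral_symbol (hκ : κ * κ = 1) (hη : IsTestC (halfLine κ) η) (a b c : ℂ) (ξ : ℝ) :
    ∫ y, η y * ((a + b * (κ * y)) * expC (-κ) (ξ, y) * c)
      = (a * moment₀ κ η |ξ| + b * moment₁ κ η |ξ|) * c := by
  have hE : Continuous fun y : ℝ => expC (-κ) (ξ, y) := by unfold expC; fun_prop
  have i0 : Integrable fun y => η y * expC (-κ) (ξ, y) :=
    (hη.continuous.mul hE).integrable_of_hasCompactSupport hη.2.1.mul_right
  have i1 : Integrable fun y : ℝ => η y * (κ * y * expC (-κ) (ξ, y)) :=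
    (hη.continuous.mul ((by fun_prop : Continuous fun y : ℝ => (κ * y : ℂ)).mul
      hE)).integrable_of_hasCompactSupport hη.2.1.mul_right
  rw [moment₀_eq hκ, moment₁_eq hκ, ← integral_const_mul, ← integral_const_mul,
    ← integral_add (i0.const_mul a) (i1.const_mul b), ← integral_mul_const]
  congr 1; ext y; ring

lemma SlipSolution.pftPair_fst_eq (h : SlipSolution G ν u v w) (hβ : β * (2 - 2 * ν) = 1)
    (hκ : κ * κ = 1) (hψ : IsTestC {ξ : ℝ | ξ ≠ 0} ψ) (hη : IsTestC (halfLine κ) η) :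
    pftPair (u 0) (tensor ψ η)
      = ftPair (v 0) fun ξ => ∫ y, η y * (fstSymbol β κ (ξ, y) * ψ ξ) := by
  rw [h.pftPair_fst hβ hκ hψ hη]
  congr 1; ext ξ
  have e := integral_symbol hκ hη κ (-(κ * β * absC ξ)) (ψ ξ) ξ
  refine Eq.trans ?_ (e.symm.trans ?_)
  · ring
  · congr 1; ext y; simp only [fstSymbol]; ring

lemma SlipSolution.pftPair_snd_eq (h : SlipSolution G ν u v w) (hβ : β * (2 - 2 * ν) = 1)
    (hκ : κ * κ = 1) (hψ : IsTestC {ξ : ℝ | ξ ≠ 0} ψ) (hη : IsTestC (halfLine κ) η) :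
    pftPair (u 1) (tensor ψ η)
      = ftPair (v 0) fun ξ => ∫ y, η y * (sndSymbol β ν κ (ξ, y) * ψ ξ) := by
  rw [h.pftPair_snd hβ hκ hψ hη]
  congr 1; ext ξ
  have e := integral_symbol hκ hη (-β * (Complex.I * ((1 - 2 * ν) * signC ξ)))
    (-β * (Complex.I * ξ)) (ψ ξ) ξ
  refine Eq.trans ?_ (e.symm.trans ?_)
  · ring
  · congr 1; ext y; simp only [sndSymbol]; ring

/-- Almost every slice of `f` has the Fourier transform `K(ξ, y) v̂(ξ)` off zero. -/
lemma ae_slice_representation {f : ℝ × ℝ → ℝ} {v : ℝ → ℝ} (hf : TemperedFun f) (hv : TemperedFun v)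
    {K : ℝ × ℝ → ℂ} (hK : ContDiffOn ℝ ∞ K offFreq)
    (hS : ∀ y ∈ halfLine κ, ∀ ψ : 𝓢(ℝ, ℂ), (0 : ℝ) ∉ tsupport ψ →
      ∃ φ : 𝓢(ℝ, ℂ), ∀ ξ, φ ξ = K (ξ, y) * ψ ξ)
    (h : ∀ ψ η, IsTestC {ξ : ℝ | ξ ≠ 0} ψ → IsTestC (halfLine κ) η →
      pftPair f (tensor ψ η) = ftPair v fun ξ => ∫ y, η y * (K (ξ, y) * ψ ξ)) :
    ∀ᵐ y : ℝ, y ∈ halfLine κ → ∀ ψ : 𝓢(ℝ, ℂ), (0 : ℝ) ∉ tsupport ψ →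
      ftPair (fun x => f (x, y)) ψ = ftPair v fun ξ => K (ξ, y) * ψ ξ := by
  obtain ⟨χ, hχ, hχ1⟩ := exists_exhaustion
  have h1 : ∀ᵐ y : ℝ, ∀ (q : ℚ) (n : ℕ), y ∈ halfLine κ →
      ftPair (fun x => f (x, y)) (modulate q (χ n))
        = ftPair v fun ξ => K (ξ, y) * modulate q (χ n) ξ := by
    rw [ae_all_iff]; intro q
    rw [ae_all_iff]; intro n
    exact ae_ftPair_slice_eq hf hv hK h ((hχ n).modulate q)
  filter_upwards [h1, hf.ae_slice] with y hy hfy hκy ψ h0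
  obtain ⟨φ, hφ⟩ := hS y hκy ψ h0
  have hKy : ContDiffOn ℝ ∞ (fun ξ => K (ξ, y)) {ξ : ℝ | ξ ≠ 0} :=
    hK.comp (contDiff_id.prodMk contDiff_const).contDiffOn fun _ h => h
  exact ftPair_eq_of_schwartz hfy hv (fun ψ hψ => ftPair_eq_of_modulate hfy hv hKy hχ hχ1
    (fun q n => hy q n hκy) hψ) h0 hφ

lemma fstSymbol_eq (hβ : β * (2 - 2 * ν) = 1) (hy : y ∈ halfLine κ) (hκ : κ * κ = 1) (ξ : ℝ) :
    fstSymbol β κ (ξ, y) = κ * mult1 ν y ξ := by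
  have hy' : 0 < κ * y := hy
  have hκ' : |κ| = 1 := by rcases mul_self_eq_one_iff.1 hκ with rfl | rfl <;> simp
  have ha : |y| = κ * y := by rw [← abs_of_pos hy', abs_mul, hκ', one_mul]
  have hβ' : (2 - 2 * ν)⁻¹ = β := (eq_inv_of_mul_eq_one_left hβ).symm
  have he : -κ * |ξ| * y = -(|ξ| * (κ * y)) := by ring
  simp only [fstSymbol, mult1, expC, absC, abs_mul, ha, he, div_eq_mul_inv, hβ']
  push_cast
  ring

lemma sndSymbol_eq (hβ : β * (2 - 2 * ν) = 1) (hy : y ∈ halfLine κ) (hκ : κ * κ = 1) (ξ : ℝ) :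
    sndSymbol β ν κ (ξ, y) = mult2 ν y ξ := by
  have hy' : 0 < κ * y := hy
  have hκ' : |κ| = 1 := by rcases mul_self_eq_one_iff.1 hκ with rfl | rfl <;> simp
  have ha : |y| = κ * y := by rw [← abs_of_pos hy', abs_mul, hκ', one_mul]
  have hβ' : (2 - 2 * ν : ℂ)⁻¹ = β := by
    refine (eq_inv_of_mul_eq_one_left ?_).symm
    exact_mod_cast hβ
  have he : -κ * |ξ| * y = -(|ξ| * (κ * y)) := by ring
  simp only [sndSymbol, mult2, expC, signC, abs_mul, ha, he, one_div, hβ']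
  push_cast
  ring

lemma ae_mem_halfLine : ∀ᵐ y : ℝ, y ∈ halfLine 1 ∨ y ∈ halfLine (-1) := by
  filter_upwards [Measure.ae_ne volume (0 : ℝ)] with y hy
  rcases lt_or_gt_of_ne hy with h | h
  · exact Or.inr (by show 0 < -1 * y; linarith)
  · exact Or.inl (by show 0 < 1 * y; linarith)

end representation

end PN

end

theorem lemma2p3 (G ν s : ℝ) (hG : 0 < G) (hν : ν < 1 / 2) (hs : 1 / 2 ≤ s)
    (W : ℝ → ℝ) (hW : ContDiff ℝ 1 W)
    (u : Fin 2 → ℝ × ℝ → ℝ) (up um : Fin 2 → ℝ → ℝ)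
    (hu : PN.MemLambda (s + 1 / 2) u up um)
    (hEL : PN.SolvesEulerLagrange G ν W u (up 0)) :
    -- Fourier representation
    (∀ᵐ y : ℝ, (∀ i, PN.TemperedFun (fun x : ℝ => u i (x, y))) ∧
      ∀ ψ : SchwartzMap ℝ ℂ, (0 : ℝ) ∉ tsupport ψ →
        (∫ x, (u 0 (x, y) : ℂ) * PN.ft ψ x
          = ∫ x, ((if 0 < y then up 0 x else um 0 x : ℝ) : ℂ)
              * PN.ft (fun ξ => PN.mult1 ν y ξ * ψ ξ) x) ∧
        (∫ x, (u 1 (x, y) : ℂ) * PN.ft ψ x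
          = ∫ x, (up 0 x : ℂ) * PN.ft (fun ξ => PN.mult2 ν y ξ * ψ ξ) x)) ∧
    (∀ dv : ℝ → ℝ, PN.HasL2Deriv (up 0) dv → PN.StressDecays G ν u →
      -- Dirichlet to Neumann map
      (∃ τ : ℝ → ℝ, MemLp τ 2 volume ∧
        PN.HasBoundaryValue 1 (PN.stress G ν u 0 1) (PN.linePair τ) ∧
        PN.HasBoundaryValue (-1) (PN.stress G ν u 0 1) (PN.linePair τ) ∧
        PN.HasBoundaryValue 1 (PN.stress G ν u 1 1) (fun _ => 0) ∧
        PN.HasBoundaryValue (-1) (PN.stress G ν u 1 1) (fun _ => 0) ∧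
        ∀ᵐ x : ℝ, Tendsto
          (fun ε : ℝ => -(G / ((1 - ν) * Real.pi)) * ∫ t in {t : ℝ | ε < |x - t|}, dv t / (x - t))
          (𝓝[>] 0) (𝓝 (τ x))) ∧
      -- the stress is a locally integrable function on the plane, divergence free across the line
      (∃ S : Fin 2 → Fin 2 → ℝ × ℝ → ℝ, (∀ i j, LocallyIntegrable (S i j) volume) ∧
        (∀ i j, ∀ Φ, PN.IsTest PN.offSlip Φ → PN.stress G ν u i j Φ = PN.pair (S i j) Φ) ∧
        ∀ Φ : Fin 2 → ℝ × ℝ → ℝ, (∀ i, PN.IsTest univ (Φ i)) →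
          ∫ p, ∑ i, ∑ j, S i j p * PN.pd j (Φ i) p = 0)) := by
  have h2ν : 0 < 2 - 2 * ν := by linarith
  obtain ⟨β, hβd⟩ : ∃ β, β = (2 - 2 * ν)⁻¹ := ⟨_, rfl⟩
  have hβ : β * (2 - 2 * ν) = 1 := by rw [hβd, inv_mul_cancel₀ h2ν.ne']
  have hm : ∀ᵐ x, um 0 x = -1 * up 0 x := by
    filter_upwards [hu.symm_fst] with x hx
    rw [hx]; ring
  have h : PN.SlipSolution G ν u up um :=
    { pos := hG
      upper := ⟨by norm_num, hν, hu.tempered, hu.tempered_upper, hu.tempered_upper, hu.trace_upper,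
        Eventually.of_forall fun x => (one_mul _).symm, Eventually.of_forall fun x => rfl, hEL.lame⟩
      lower := ⟨by norm_num, hν, hu.tempered, hu.tempered_upper, hu.tempered_lower, hu.trace_lower,
        hm, hu.symm_snd.mono fun x hx => hx.symm, hEL.lame⟩
      normal := hEL.normal }
  refine ⟨?_, fun dv hdv hs => ?_⟩
  · have hv := hu.tempered_upper 0
    have key : ∀ κ : ℝ, κ * κ = 1 → ∀ᵐ y : ℝ, y ∈ PN.halfLine κ →
        ∀ ψ : SchwartzMap ℝ ℂ, (0 : ℝ) ∉ tsupport ψ →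
          PN.ftPair (fun x => u 0 (x, y)) ψ
            = PN.ftPair (up 0) (fun ξ => κ * PN.mult1 ν y ξ * ψ ξ) ∧
          PN.ftPair (fun x => u 1 (x, y)) ψ
            = PN.ftPair (up 0) (fun ξ => PN.mult2 ν y ξ * ψ ξ) := fun κ hκ => by
      filter_upwards [PN.ae_slice_representation (hu.tempered 0) hv (PN.contDiffOn_fstSymbol β κ)
          (fun y hy ψ h0 => PN.exists_schwartz_fstSymbol β hy h0)
          (fun ψ η hψ hη => h.pftPair_fst_eq hβ hκ hψ hη),
        PN.ae_slice_representation (hu.tempered 1) hv (PN.contDiffOn_sndSymbol β ν κ)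
          (fun y hy ψ h0 => PN.exists_schwartz_sndSymbol β ν hy h0)
          (fun ψ η hψ hη => h.pftPair_snd_eq hβ hκ hψ hη)] with y h0 h1 hy ψ hψ
      simp only [PN.fstSymbol_eq hβ hy hκ] at h0
      simp only [PN.sndSymbol_eq hβ hy hκ] at h1
      exact ⟨h0 hy ψ hψ, h1 hy ψ hψ⟩
    filter_upwards [key 1 (by norm_num), key (-1) (by norm_num), PN.ae_mem_halfLine,
      (hu.tempered 0).ae_slice, (hu.tempered 1).ae_slice] with y hp hn hy h0 h1
    refine ⟨fun i => ?_, fun ψ hψ => ?_⟩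
    · fin_cases i
      exacts [h0, h1]
    rcases hy with hy | hy
    · have hy' : 0 < y := by simpa [PN.halfLine] using hy
      refine ⟨((hp hy ψ hψ).1).trans ?_, (hp hy ψ hψ).2⟩
      simp only [if_pos hy', Complex.ofReal_one, one_mul, PN.ftPair]
    · have hy' : ¬ 0 < y := by
        have : 0 < -1 * y := hy
        linarith
      refine ⟨((hn hy ψ hψ).1).trans ?_, (hn hy ψ hψ).2⟩
      simp only [if_neg hy', mul_assoc]
      rw [PN.ftPair_const_mul]
      exact (PN.ftPair_congr_mul hm _).symm
  · obtain ⟨D, hD⟩ := PN.exists_ftDual hdv.1.ofReal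
    have hC : 2 * G * β = G / (1 - ν) := by
      have : (1 - ν) ≠ 0 := by linarith
      rw [eq_div_iff this]
      linear_combination G * hβ
    have hz : (fun ξ => D ξ * PN.stressSymbol (2 * G * β) 0 1 0 ξ)
        = fun ξ => D ξ * (((2 * G * β : ℝ) : ℂ) * (Complex.I * PN.signC ξ)) := by
      ext ξ; simp [PN.stressSymbol_one_eq]
    obtain ⟨τ, hτ⟩ := PN.exists_ftDual_of_right
      (PN.memLp_mul_stressSymbol hD.2.1 (2 * G * β) 0 1 0)
    have hτ0 : PN.FtDual (fun _ => 0) fun ξ => D ξ * PN.stressSymbol (2 * G * β) 1 1 0 ξ := by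
      have : (fun ξ => D ξ * PN.stressSymbol (2 * G * β) 1 1 0 ξ) = fun _ => 0 := by
        ext ξ; simp [PN.stressSymbol_one_eq]
      rw [this]
      exact ⟨MemLp.zero', MemLp.zero', fun g _ _ => by simp⟩
    have hN : ∀ κ : ℝ, κ * κ = 1 →
        PN.HasBoundaryValue κ (PN.stress G ν u 1 1) (fun _ => 0) := fun κ hκ => by
      have := h.hasBoundaryValue_stress hβ hκ hdv hs hD hτ0
      have e : (PN.linePair fun _ => (0 : ℂ).re) = fun _ => 0 := by
        ext φ; simp [PN.linePair]
      rwa [e] at this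
    refine ⟨⟨fun x => (τ x).re, hτ.1.re,
      h.hasBoundaryValue_stress hβ (by norm_num) hdv hs hD hτ,
      h.hasBoundaryValue_stress hβ (by norm_num) hdv hs hD hτ,
      hN 1 (by norm_num), hN (-1) (by norm_num), ?_⟩,
      fun i j => PN.stressReal (2 * G * β) D i j,
      fun i j => PN.locallyIntegrable_stressReal hD.2.1, fun i j Φ hΦ =>
        h.stress_eq_pair hβ hdv hs hD hΦ, fun Φ hΦ => PN.integral_stressReal_div hD hΦ⟩
    rw [hz] at hτ
    have := PN.FtDual.ae_tendsto_hilbert hdv.1 hD hτ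
    rwa [hC, div_div] at this
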